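/- Let $\varphi\colon R\to S$ be a homomorphism of commutative rings such that $S$ has finite flat dimension as an $R$-module. Write $D(R)$, $D(S)$ for the derived categories of modules, and regard $S$-complexes as $R$-complexes via $\varphi$. An object of the derived category has finite projective (injective, flat, Gorenstein projective, Gorenstein flat) dimension if it is isomorphic there to a bounded complex of projective (injective, flat, Gorenstein projective, Gorenstein flat) modules; it has finite homology if all its homology modules are finitely generated. Here an $R$-module $A$ is Gorenstein projective if $A\cong\operatorname{Coker}(P_1\to P_0)$ for an exact complex $P$ of projective modules, unbounded in both directions, with $\operatorname{Hom}_R(P,Q)$ exact for every projective $Q$; it is Gorenstein flat if $A\cong\operatorname{Coker}(F_1\to F_0)$ for an exact complex $F$ of flat modules, unbounded in both directions, with $J\otimes_R F$ exact for every injective $J$. (1) For $U,V\in D(S)$ and $W\in D(R)$, the tensor evaluation morphism $$\mathbf{R}\mathrm{Hom}_S(U,V)\otimes^{\mathbf L}_R W\longrightarrow \mathbf{R}\mathrm{Hom}_S(U,V\otimes^{\mathbf L}_R W)$$ is an isomorphism in $D(S)$ in each of the following cases: (a) $U$ has finite injective dimension and finite homology, $V$ has finite injective dimension, $W$ has finite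 Gorenstein flat dimension, and $S$ is noetherian; (b) $U$ and $V$ have finite injective dimension, $W$ has finite Gorenstein flat dimension and finite homology, and $R$ is noetherian. (2) For $X\in D(R)$ and $Y,Z\in D(S)$, the tensor evaluation morphism $$\mathbf{R}\mathrm{Hom}_R(X,Y)\otimes^{\mathbf L}_S Z\longrightarrow \mathbf{R}\mathrm{Hom}_R(X,Y\otimes^{\mathbf L}_S Z)$$ is an isomorphism in $D(S)$ in each of the following cases: (c) $X$ has finite Gorenstein projective dimension and finite homology, $Y$ has finite flat dimension, $Z$ has finite injective dimension, and $R$ is noetherian; (d) $X$ has finite Gorenstein projective dimension, $Y$ has finite flat dimension, $Z$ has finite injective dimension and finite homology, $S$ is noetherian, and every $S$-complex of finite flat dimension over $S$ has finite projective dimension over $R$; (d') $X$ has finite Gorenstein projective dimension, $Y$ has finite projective dimension, $Z$ has finite injective dimension and finite homology, $S$ is noetherian, and every $S$-complex of finite projective dimension over $S$ has finite projective dimension over $R$. In both (1) and (2) the morphism is the one induced on projective resolutions by $f\otimes z\mapsto\bigl(x\mapsto(-1)^{|x||z|}f(x)\otimes z\bigr)$. (3) Consequently, if $R$ is noetherian,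 $G$ is a finitely generated Gorenstein projective $R$-module, $\widetilde F$ is a flat $S$-module and $\widetilde I$ is an injective $S$-module, then the homomorphism $$\mathrm{Hom}_R(G,\widetilde F)\otimes_S\widetilde I\longrightarrow\mathrm{Hom}_R(G,\widetilde F\otimes_S\widetilde I),\qquad f\otimes y\mapsto\bigl(x\mapsto f(x)\otimes y\bigr),$$ is an isomorphism of $S$-modules. -/

import Mathlib

universe w w₁ w₂ u

open CategoryTheory CochainComplex.HomComplex Opposite
open scoped TensorProduct

namespace TensorEval

noncomputable section

/-- Restriction of scalars along the structure map of an algebra `A → T`. -/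
abbrev resMod (A T : Type u) [CommRing A] [CommRing T] [Algebra A T] :
    ModuleCat.{u} T ⥤ ModuleCat.{u} A :=
  ModuleCat.restrictScalars (algebraMap A T)

/-- A complex of `T`-modules, considered as a complex of `A`-modules. -/
abbrev resCx (A T : Type u) [CommRing A] [CommRing T] [Algebra A T] :
    CochainComplex (ModuleCat.{u} T) ℤ ⥤ CochainComplex (ModuleCat.{u} A) ℤ :=
  (resMod A T).mapHomologicalComplex (ComplexShape.up ℤ)

section hom
variable {A T : Type u} [CommRing A] [CommRing T] [Algebra A T]
  (X : CochainComplex (ModuleCat.{u} A) ℤ) (Y : CochainComplex (ModuleCat.{u} T) ℤ)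

/-- The action of `T` on the cochains of degree `n` from an `A`-complex `X` to a `T`-complex `Y`,
through the values: `(t • z) x = t • z x`. -/
abbrev cochainModule (n : ℤ) : Module T (Cochain X ((resCx A T).obj Y) n) where
  smul t z := z.comp (Cochain.ofHom ((resCx A T).map (t • 𝟙 Y))) (add_zero n)
  one_smul z := by
    change z.comp (Cochain.ofHom ((resCx A T).map ((1 : T) • 𝟙 Y))) (add_zero n) = z
    rw [one_smul, CategoryTheory.Functor.map_id, Cochain.comp_id]
  mul_smul s t z := by
    change z.comp (Cochain.ofHom ((resCx A T).map ((s * t) • 𝟙 Y))) (add_zero n) =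
      (z.comp (Cochain.ofHom ((resCx A T).map (t • 𝟙 Y))) (add_zero n)).comp
        (Cochain.ofHom ((resCx A T).map (s • 𝟙 Y))) (add_zero n)
    rw [Cochain.comp_assoc_of_third_is_zero_cochain, ← Cochain.ofHom_comp, ← Functor.map_comp,
      Linear.smul_comp, Linear.comp_smul, Category.comp_id, smul_smul, mul_comm]
  smul_zero t := Cochain.zero_comp _ _
  smul_add t z w := Cochain.add_comp _ _ _ _
  zero_smul z := by
    change z.comp (Cochain.ofHom ((resCx A T).map ((0 : T) • 𝟙 Y))) (add_zero n) = 0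
    rw [zero_smul, Functor.map_zero, Cochain.ofHom_zero, Cochain.comp_zero]
  add_smul s t z := by
    change z.comp (Cochain.ofHom ((resCx A T).map ((s + t) • 𝟙 Y))) (add_zero n) =
      z.comp (Cochain.ofHom ((resCx A T).map (s • 𝟙 Y))) (add_zero n) +
      z.comp (Cochain.ofHom ((resCx A T).map (t • 𝟙 Y))) (add_zero n)
    rw [add_smul, Functor.map_add, Cochain.ofHom_add, Cochain.comp_add]

/-- The `T`-module `∏ₚ Hom_A (X^p, Y^(p+n))`. -/
def HomCochain (n : ℤ) : Type u := Cochain X ((resCx A T).obj Y) n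

instance (n : ℤ) : AddCommGroup (HomCochain X Y n) :=
  inferInstanceAs (AddCommGroup (Cochain X ((resCx A T).obj Y) n))

instance (n : ℤ) : Module T (HomCochain X Y n) := cochainModule X Y n

/-- The complex `Hom_A (X, Y)` of `T`-modules, for a complex `X` of `A`-modules and a complex `Y`
of `T`-modules: in degree `n` it is `∏ₚ Hom_A (X^p, Y^(p+n))`, and its differential is
`z ↦ d ∘ z - (-1)^n z ∘ d`. -/
def homCx : CochainComplex (ModuleCat.{u} T) ℤ where
  X n := ModuleCat.of T (HomCochain X Y n)
  d i j := ModuleCat.ofHom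
    { toFun := fun z => δ (F := X) (G := (resCx A T).obj Y) i j z
      map_add' := fun z w => δ_add (F := X) (G := (resCx A T).obj Y) (n := i) (m := j) z w
      map_smul' := fun t z => δ_comp_ofHom (F := X) (G := (resCx A T).obj Y) (n := i) z _ j }
  shape i j hij := by
    refine ModuleCat.hom_ext (LinearMap.ext fun z => ?_)
    exact δ_shape (F := X) (G := (resCx A T).obj Y) i j hij z
  d_comp_d' i j k _ _ := by
    refine ModuleCat.hom_ext (LinearMap.ext fun z => ?_)
    exact δ_δ (F := X) (G := (resCx A T).obj Y) i j k z

end hom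

section tensor
variable (B T : Type u) [CommRing B] [CommRing T] [Algebra B T]

instance (M : ModuleCat.{u} T) : IsScalarTower B T ((resMod B T).obj M) :=
  ⟨fun b t m => by
    change (b • t) • (show M from m) = algebraMap B T b • (t • (show M from m))
    rw [Algebra.smul_def, mul_smul]⟩

lemma tensor_hom_ext {M : ModuleCat.{u} T} {N : ModuleCat.{u} B} {P : ModuleCat.{u} T}
    {h k : ModuleCat.of T ((resMod B T).obj M ⊗[B] N) ⟶ P}
    (H : ∀ (x : (resMod B T).obj M) (y : N), h.hom (x ⊗ₜ[B] y) = k.hom (x ⊗ₜ[B] y)) : h = k := by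
  refine ModuleCat.hom_ext (LinearMap.ext fun w => ?_)
  induction w using TensorProduct.induction_on with
  | zero => simp only [map_zero]
  | tmul x y => exact H x y
  | add a b ha hb => simp only [map_add, ha, hb]

/-- The functor `(M, N) ↦ M ⊗[B] N` from `T`-modules and `B`-modules to `T`-modules,
where `T` acts on the left factor. -/
def tensorBif : ModuleCat.{u} T ⥤ ModuleCat.{u} B ⥤ ModuleCat.{u} T where
  obj M :=
    { obj := fun N => ModuleCat.of T ((resMod B T).obj M ⊗[B] N)
      map := fun h => ModuleCat.ofHom
        (TensorProduct.AlgebraTensorModule.lTensor T ((resMod B T).obj M) h.hom)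
      map_id := fun N => by ext : 1; exact TensorProduct.AlgebraTensorModule.lTensor_id
      map_comp := fun h k => tensor_hom_ext B T fun x y => rfl }
  map {M M'} h :=
    { app := fun N => ModuleCat.ofHom
        (TensorProduct.AlgebraTensorModule.rTensor (A := T) (M := (resMod B T).obj M)
          (P := (resMod B T).obj M') B N h.hom)
      naturality := fun N N' k => tensor_hom_ext B T fun x y => rfl }
  map_id M := by
    ext N : 3
    exact TensorProduct.AlgebraTensorModule.rTensor_id
  map_comp h k := by
    exact NatTrans.ext (funext fun N => tensor_hom_ext B T fun x y => rfl)

instance : (tensorBif B T).Additive where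
  map_add {M M' h k} := by
    refine NatTrans.ext (funext fun N => tensor_hom_ext B T fun x y => ?_)
    exact TensorProduct.add_tmul (R := B) (M := (resMod B T).obj M') (h.hom x) (k.hom x) y

instance (M : ModuleCat.{u} T) : ((tensorBif B T).obj M).Additive where
  map_add {N N' h k} := by
    refine tensor_hom_ext B T fun x y => ?_
    exact TensorProduct.tmul_add (R := B) (M := (resMod B T).obj M) x (h.hom y) (k.hom y)

variable {B T}
/-- The complex `Y ⊗_B Z` of `T`-modules, for a complex `Y` of `T`-modules and a complex `Z`
of `B`-modules: in degree `n` it is `⨁_{i+j=n} Y^i ⊗[B] Z^j`, and its differential is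
`y ⊗ z ↦ d y ⊗ z + (-1)^i y ⊗ d z`. -/
abbrev tensorCx (Y : CochainComplex (ModuleCat.{u} T) ℤ) (Z : CochainComplex (ModuleCat.{u} B) ℤ) :
    CochainComplex (ModuleCat.{u} T) ℤ :=
  HomologicalComplex.mapBifunctor Y Z (tensorBif B T) (ComplexShape.up ℤ)

end tensor

section tev
variable {A B T : Type u} [CommRing A] [CommRing B] [CommRing T] [Algebra A T] [Algebra B T]

/-- The `T`-linear map `m ↦ m ⊗ w` from `M` to `M ⊗[B] N`. -/
def tmulRight (M : ModuleCat.{u} T) {N : ModuleCat.{u} B} (w : N) :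
    M ⟶ ((tensorBif B T).obj M).obj N :=
  ModuleCat.ofHom
    { toFun := fun m => (show (resMod B T).obj M from m) ⊗ₜ[B] w
      map_add' := fun m m' => TensorProduct.add_tmul (R := B) (M := (resMod B T).obj M) m m' w
      map_smul' := fun _ _ => rfl }

lemma tmulRight_add (M : ModuleCat.{u} T) {N : ModuleCat.{u} B} (w w' : N) :
    tmulRight M (w + w') = tmulRight M w + tmulRight M w' :=
  ModuleCat.hom_ext (LinearMap.ext fun m =>
    TensorProduct.tmul_add (R := B) (M := (resMod B T).obj M) m w w')

lemma tmulRight_smul (M : ModuleCat.{u} T) {N : ModuleCat.{u} B} (b : B) (w : N) :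
    tmulRight M (b • w) = algebraMap B T b • tmulRight M w :=
  ModuleCat.hom_ext (LinearMap.ext fun m =>
    (TensorProduct.smul_tmul (R := B) (M := (resMod B T).obj M) b m w).symm)

variable (X : CochainComplex (ModuleCat.{u} A) ℤ) (Y : CochainComplex (ModuleCat.{u} T) ℤ)
  (Z : CochainComplex (ModuleCat.{u} B) ℤ)

/-- The inclusion of `Y^i ⊗[B] Z^j` in degree `n = i + j` of `Y ⊗_B Z`. -/
abbrev ιTensor (i j n : ℤ) (h : i + j = n) :
    ((tensorBif B T).obj (Y.X i)).obj (Z.X j) ⟶ (tensorCx Y Z).X n :=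
  HomologicalComplex.ιMapBifunctor Y Z (tensorBif B T) (ComplexShape.up ℤ) i j n h

variable {X Y} in
/-- The component `X^p → Y^q` of a cochain of degree `n = q - p`. -/
def HomCochain.v {n : ℤ} (z : HomCochain X Y n) (p q : ℤ) (h : p + n = q) :
    X.X p ⟶ (resMod A T).obj (Y.X q) :=
  Cochain.v (G := (resCx A T).obj Y) z p q h

variable {X Y} in
/-- The cochain with given components. -/
def HomCochain.mk {n : ℤ} (c : ∀ p q : ℤ, p + n = q → (X.X p ⟶ (resMod A T).obj (Y.X q))) :
    HomCochain X Y n :=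
  Cochain.mk (G := (resCx A T).obj Y) c

variable {X Y} in
lemma HomCochain.ext {n : ℤ} {z w : HomCochain X Y n} (H : ∀ p q h, z.v p q h = w.v p q h) :
    z = w :=
  Cochain.ext (G := (resCx A T).obj Y) z w H

variable {X Y} in
lemma HomCochain.mk_v {n : ℤ} (c : ∀ p q : ℤ, p + n = q → (X.X p ⟶ (resMod A T).obj (Y.X q)))
    (p q : ℤ) (h : p + n = q) : (HomCochain.mk c).v p q h = c p q h := rfl

variable {X Y} in
lemma HomCochain.add_v {n : ℤ} (z w : HomCochain X Y n) (p q : ℤ) (h : p + n = q) :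
    (z + w).v p q h = z.v p q h + w.v p q h := rfl

variable {X Y} in
lemma HomCochain.units_smul_v {n : ℤ} (e : ℤˣ) (z : HomCochain X Y n) (p q : ℤ)
    (h : p + n = q) : (e • z).v p q h = e • z.v p q h := rfl

variable {X Y} in
lemma HomCochain.smul_v {n : ℤ} (t : T) (z : HomCochain X Y n) (p q : ℤ) (h : p + n = q) :
    (t • z).v p q h = z.v p q h ≫ (resMod A T).map (t • 𝟙 (Y.X q)) :=
  Cochain.comp_zero_cochain_v (G := (resCx A T).obj Y) z _ p q h

/-- The cochain `x ↦ (-1)^(|x||w|) z x ⊗ w`. -/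
def tevCochain {i j n : ℤ} (h : i + j = n) (z : HomCochain X Y i) (w : Z.X j) :
    HomCochain X (tensorCx Y Z) n :=
  HomCochain.mk fun p q hpq => (p * j).negOnePow •
    (z.v p (p + i) rfl ≫ (resMod A T).map
      (tmulRight (Y.X (p + i)) w ≫ ιTensor Y Z (p + i) j q (by lia)))

lemma tevCochain_v {i j n : ℤ} (h : i + j = n) (z : HomCochain X Y i) (w : Z.X j)
    (p r q : ℤ) (hpq : p + n = q) (hr : p + i = r) :
    (tevCochain X Y Z h z w).v p q hpq = (p * j).negOnePow •
      (z.v p r hr ≫ (resMod A T).map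
        (tmulRight (Y.X r) w ≫ ιTensor Y Z r j q (by lia))) := by
  subst hr; rfl

lemma tevCochain_add_right {i j n : ℤ} (h : i + j = n) (z : HomCochain X Y i) (w w' : Z.X j) :
    tevCochain X Y Z h z (w + w') = tevCochain X Y Z h z w + tevCochain X Y Z h z w' :=
  HomCochain.ext fun p q hpq => by
    simp only [HomCochain.add_v, tevCochain_v X Y Z h _ _ p _ q hpq rfl, tmulRight_add, Preadditive.add_comp,
      Functor.map_add, Preadditive.comp_add, smul_add]

lemma tevCochain_smul_right {i j n : ℤ} (h : i + j = n) (z : HomCochain X Y i) (b : B)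
    (w : Z.X j) :
    tevCochain X Y Z h z (b • w) = algebraMap B T b • tevCochain X Y Z h z w :=
  HomCochain.ext fun p q hpq => by
    simp only [HomCochain.smul_v, tevCochain_v X Y Z h _ _ p _ q hpq rfl, tmulRight_smul]
    rw [Linear.units_smul_comp, Category.assoc, ← Functor.map_comp, Linear.comp_smul,
      Category.comp_id, Linear.smul_comp]

lemma tevCochain_add_left {i j n : ℤ} (h : i + j = n) (z z' : HomCochain X Y i) (w : Z.X j) :
    tevCochain X Y Z h (z + z') w = tevCochain X Y Z h z w + tevCochain X Y Z h z' w :=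
  HomCochain.ext fun p q hpq => by
    simp only [HomCochain.add_v, tevCochain_v X Y Z h _ _ p _ q hpq rfl, Preadditive.add_comp, smul_add]

lemma tevCochain_smul_left {i j n : ℤ} (h : i + j = n) (t : T) (z : HomCochain X Y i)
    (w : Z.X j) :
    tevCochain X Y Z h (t • z) w = t • tevCochain X Y Z h z w :=
  HomCochain.ext fun p q hpq => by
    simp only [HomCochain.smul_v, tevCochain_v X Y Z h _ _ p _ q hpq rfl]
    rw [Linear.units_smul_comp, Category.assoc, Category.assoc, ← Functor.map_comp,
      ← Functor.map_comp, Linear.comp_smul, Linear.smul_comp, Category.id_comp, Category.comp_id]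

/-- The bilinear map `(z, w) ↦ (x ↦ (-1)^(|x||w|) z x ⊗ w)`. -/
def tevLin {i j n : ℤ} (h : i + j = n) :
    (resMod B T).obj ((homCx X Y).X i) →ₗ[T] Z.X j →ₗ[B]
      (resMod B T).obj ((homCx X (tensorCx Y Z)).X n) where
  toFun z :=
    { toFun := fun w => tevCochain X Y Z h z w
      map_add' := tevCochain_add_right X Y Z h z
      map_smul' := tevCochain_smul_right X Y Z h z }
  map_add' z z' := LinearMap.ext fun w => tevCochain_add_left X Y Z h z z' w
  map_smul' t z := LinearMap.ext fun w => tevCochain_smul_left X Y Z h t z w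

/-- The tensor evaluation on `Hom_A (X, Y)^i ⊗[B] Z^j`. -/
def tevX (i j n : ℤ) (h : i + j = n) :
    ((tensorBif B T).obj ((homCx X Y).X i)).obj (Z.X j) ⟶ (homCx X (tensorCx Y Z)).X n :=
  ModuleCat.ofHom (TensorProduct.AlgebraTensorModule.lift (A := T)
    (P := (resMod B T).obj ((homCx X (tensorCx Y Z)).X n)) (tevLin X Y Z h))

lemma tevX_tmul {i j n : ℤ} (h : i + j = n) (z : HomCochain X Y i) (w : Z.X j) :
    (tevX X Y Z i j n h).hom
      ((show (resMod B T).obj ((homCx X Y).X i) from z) ⊗ₜ[B] w) = tevCochain X Y Z h z w := rfl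

variable {X Y} in
/-- The differential of a cochain. -/
def HomCochain.d {n : ℤ} (z : HomCochain X Y n) : HomCochain X Y (n + 1) :=
  ((homCx X Y).d n (n + 1)).hom z

lemma d_v {n : ℤ} (z : HomCochain X Y n) (p q : ℤ) (hpq : p + (n + 1) = q) :
    z.d.v p q hpq =
      z.v p (p + n) rfl ≫ (resMod A T).map (Y.d (p + n) q) +
        (n + 1).negOnePow • (X.d p (p + 1) ≫ z.v (p + 1) q (by lia)) :=
  δ_v (F := X) (G := (resCx A T).obj Y) n (n + 1) rfl z p q hpq (p + n) (p + 1) (by lia) rfl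

lemma ιTensor_d (i j n : ℤ) (h : i + j = n) :
    ιTensor Y Z i j n h ≫ (tensorCx Y Z).d n (n + 1) =
      ((tensorBif B T).map (Y.d i (i + 1))).app (Z.X j) ≫
        ιTensor Y Z (i + 1) j (n + 1) (by lia) +
      i.negOnePow • (((tensorBif B T).obj (Y.X i)).map (Z.d j (j + 1)) ≫
        ιTensor Y Z i (j + 1) (n + 1) (by lia)) := by
  rw [HomologicalComplex.mapBifunctor.d_eq, Preadditive.comp_add,
    HomologicalComplex.mapBifunctor.ι_D₁, HomologicalComplex.mapBifunctor.ι_D₂,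
    HomologicalComplex.mapBifunctor.d₁_eq Y Z (tensorBif B T) (ComplexShape.up ℤ)
      (show (ComplexShape.up ℤ).Rel i (i + 1) from rfl) j (n + 1) (by change i + 1 + j = n + 1; lia),
    HomologicalComplex.mapBifunctor.d₂_eq Y Z (tensorBif B T) (ComplexShape.up ℤ) i
      (show (ComplexShape.up ℤ).Rel j (j + 1) from rfl) (n + 1)
      (by change i + (j + 1) = n + 1; lia)]
  have h1 : ComplexShape.ε₁ (ComplexShape.up ℤ) (ComplexShape.up ℤ) (ComplexShape.up ℤ) (i, j) = 1 :=
    rfl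
  have h2 : ComplexShape.ε₂ (ComplexShape.up ℤ) (ComplexShape.up ℤ) (ComplexShape.up ℤ) (i, j) =
    i.negOnePow := rfl
  rw [h1, h2, one_smul]

lemma tmulRight_map_left {M M' : ModuleCat.{u} T} (h : M ⟶ M') {N : ModuleCat.{u} B} (w : N) :
    tmulRight M w ≫ ((tensorBif B T).map h).app N = h ≫ tmulRight M' w := rfl

lemma tmulRight_map_right (M : ModuleCat.{u} T) {N N' : ModuleCat.{u} B} (h : N ⟶ N') (w : N) :
    tmulRight M w ≫ ((tensorBif B T).obj M).map h = tmulRight M (h.hom w) := rfl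

lemma units_smul_eq {M : Type*} [AddCommGroup M] [Module T M] (e : ℤˣ) (m : M) :
    e • m = ((e : ℤ) : T) • m := by
  rw [Units.smul_def, Int.cast_smul_eq_zsmul]

lemma d_tevCochain {i j n : ℤ} (h : i + j = n) (z : HomCochain X Y i) (w : Z.X j) :
    (tevCochain X Y Z h z w).d =
      tevCochain X Y Z (i := i + 1) (j := j) (n := n + 1) (by lia) z.d w +
      i.negOnePow • tevCochain X Y Z (i := i) (j := j + 1) (n := n + 1) (by lia)
        z ((Z.d j (j + 1)).hom w) := by
  subst h
  refine HomCochain.ext fun p q hpq => ?_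
  obtain rfl : q = p + (i + j) + 1 := by lia
  rw [HomCochain.add_v, HomCochain.units_smul_v, d_v,
    tevCochain_v X Y Z rfl z w p (p + i) _ _ rfl,
    tevCochain_v X Y Z rfl z w (p + 1) (p + i + 1) _ _ (by lia),
    tevCochain_v X Y Z _ z.d w p (p + i + 1) _ _ (by lia),
    tevCochain_v X Y Z _ z _ p (p + i) _ _ rfl, d_v]
  rw [Linear.units_smul_comp, Category.assoc, ← Functor.map_comp, Category.assoc,
    ιTensor_d Y Z (p + i) j _ (by lia)]
  simp only [Preadditive.comp_add, Preadditive.add_comp, Functor.map_add, smul_add,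
    Linear.comp_units_smul, Linear.units_smul_comp, smul_smul]
  have e1 : (p * j).negOnePow * (p + i).negOnePow = i.negOnePow * (p * (j + 1)).negOnePow := by
    rw [← Int.negOnePow_add, ← Int.negOnePow_add]; congr 1; ring
  have e2 : (i + j + 1).negOnePow * ((p + 1) * j).negOnePow =
      (p * j).negOnePow * (i + 1).negOnePow := by
    rw [← Int.negOnePow_add, ← Int.negOnePow_add, Int.negOnePow_eq_iff]
    exact ⟨j, by ring⟩
  have e3 : (resMod A T).map ((p + i).negOnePow • (tmulRight (Y.X (p + i)) w ≫
        ((tensorBif B T).obj (Y.X (p + i))).map (Z.d j (j + 1)) ≫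
          ιTensor Y Z (p + i) (j + 1) (p + (i + j) + 1) (by lia))) =
      (p + i).negOnePow • (resMod A T).map (tmulRight (Y.X (p + i)) ((Z.d j (j + 1)).hom w) ≫
          ιTensor Y Z (p + i) (j + 1) (p + (i + j) + 1) (by lia)) := by
    rw [Functor.map_units_smul, ← tmulRight_map_right, Category.assoc]
  rw [e3, e2, ← e1, Linear.comp_units_smul, smul_smul, Category.assoc, Category.assoc,
    ← Functor.map_comp, ← Category.assoc (tmulRight (Y.X (p + i)) w), tmulRight_map_left,
    Category.assoc]
  abel

/-- The tensor evaluation morphism of complexes of `T`-modules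
`Hom_A (X, Y) ⊗_B Z ⟶ Hom_A (X, Y ⊗_B Z)`, `z ⊗ w ↦ (x ↦ (-1)^(|x||w|) z x ⊗ w)`. -/
def tev : tensorCx (homCx X Y) Z ⟶ homCx X (tensorCx Y Z) where
  f n := HomologicalComplex.mapBifunctorDesc fun i j h => tevX X Y Z i j n h
  comm' n m hnm := by
    obtain rfl : n + 1 = m := hnm
    refine HomologicalComplex.mapBifunctor.hom_ext fun i j h => ?_
    rw [HomologicalComplex.ι_mapBifunctorDesc_assoc, ← Category.assoc, ιTensor_d,
      Preadditive.add_comp, Linear.units_smul_comp, Category.assoc, Category.assoc,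
      HomologicalComplex.ι_mapBifunctorDesc, HomologicalComplex.ι_mapBifunctorDesc]
    refine tensor_hom_ext B T fun z w => ?_
    refine (d_tevCochain X Y Z h z w).trans ?_
    rfl

end tev
section
variable {C : Type*} [Category C] [Abelian C]

lemma quasiIso_of_op {K L : CochainComplex C ℤ} (φ : K ⟶ L)
    (h : QuasiIso ((CochainComplex.opEquivalence C).functor.map φ.op)) : QuasiIso φ := by
  refine ⟨fun n => ?_⟩
  obtain ⟨m, rfl⟩ : ∃ m : ℤ, n = -m := ⟨-n, by simp⟩
  have h2 := h.quasiIsoAt m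
  rw [quasiIsoAt_iff' _ (m - 1) m (m + 1) (by simp) (by simp)] at h2
  rw [quasiIsoAt_iff' _ (-(m + 1)) (-m) (-(m - 1)) (by simp; lia) (by simp; lia)]
  exact (ShortComplex.quasiIso_opMap_iff _).1 h2

lemma exists_projective [EnoughProjectives C] (K : CochainComplex C ℤ) (n : ℤ)
    [K.IsStrictlyLE n] : ∃ (P : CochainComplex C ℤ) (π : P ⟶ K), QuasiIso π ∧
      (∀ i, Projective (P.X i)) ∧ P.IsStrictlyLE n := by
  let M := (CochainComplex.opEquivalence C).functor.obj (op K)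
  have : M.IsStrictlyGE (-n) := by
    rw [CochainComplex.isStrictlyGE_iff]
    intro i hi
    exact (K.isZero_of_isStrictlyLE n (-i) (by lia)).op
  obtain ⟨L, i, hi, hL, hL'⟩ := CochainComplex.Plus.modelCategoryQuillen.exists_quasiIso_injective M (-n)
  let P := ((CochainComplex.opEquivalence C).inverse.obj L).unop
  let e := (CochainComplex.opEquivalence C).counitIso.app L
  let j : op K ⟶ op P := (CochainComplex.opEquivalence C).functor.preimage (i ≫ e.inv)
  refine ⟨P, j.unop, quasiIso_of_op _ ?_, fun k => ?_, ?_⟩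
  · rw [Quiver.Hom.op_unop, Functor.map_preimage]
    infer_instance
  · have := hL (-k)
    change Projective (unop (L.X (-k)))
    infer_instance
  · rw [CochainComplex.isStrictlyLE_iff]
    intro k hk
    exact (L.isZero_of_isStrictlyGE (-n) (-k) (by lia)).unop

end

section derived
variable {A B T : Type u} [CommRing A] [CommRing B] [CommRing T] [Algebra A T] [Algebra B T]

/-- A K-projective resolution of a complex of `A`-modules. -/
structure KProjRes (X : CochainComplex (ModuleCat.{u} A) ℤ) where
  /-- the K-projective complex -/
  P : CochainComplex (ModuleCat.{u} A) ℤ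
  /-- the augmentation -/
  π : P ⟶ X
  isKProjective : P.IsKProjective
  quasiIso : QuasiIso π

/-- Every complex whose cohomology is bounded above has a K-projective resolution. -/
lemma KProjRes.nonempty (X : CochainComplex (ModuleCat.{u} A) ℤ) (n : ℤ) [X.IsLE n] :
    Nonempty (KProjRes X) := by
  have : QuasiIso (X.ιTruncLE n) := (X.quasiIso_ιTruncLE_iff n).2 inferInstance
  obtain ⟨P, π, _, _, _⟩ := exists_projective (X.truncLE n) n
  exact ⟨P, π ≫ X.ιTruncLE n, CochainComplex.isKProjective_of_projective P n, inferInstance⟩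

/-- The complex of `T`-modules that represents `RHom_A (X, Y)`, computed by a
K-projective resolution of `X`. -/
abbrev rHom {X : CochainComplex (ModuleCat.{u} A) ℤ} (p : KProjRes X)
    (Y : CochainComplex (ModuleCat.{u} T) ℤ) : CochainComplex (ModuleCat.{u} T) ℤ :=
  homCx p.P Y

/-- The complex of `T`-modules that represents `Y ⊗ᴸ_B Z`, computed by a
K-projective resolution of `Z`. -/
abbrev lTensor (Y : CochainComplex (ModuleCat.{u} T) ℤ)
    {Z : CochainComplex (ModuleCat.{u} B) ℤ} (q : KProjRes Z) :
    CochainComplex (ModuleCat.{u} T) ℤ :=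
  tensorCx Y q.P

/-- The tensor evaluation morphism `RHom_A (X, Y) ⊗ᴸ_B Z ⟶ RHom_A (X, Y ⊗ᴸ_B Z)` in the
derived category of `T`-modules. -/
def derivedTev [HasDerivedCategory.{w} (ModuleCat.{u} T)]
    {X : CochainComplex (ModuleCat.{u} A) ℤ} (p : KProjRes X)
    (Y : CochainComplex (ModuleCat.{u} T) ℤ)
    {Z : CochainComplex (ModuleCat.{u} B) ℤ} (q : KProjRes Z) :
    DerivedCategory.Q.obj (lTensor (rHom p Y) q) ⟶ DerivedCategory.Q.obj (rHom p (lTensor Y q)) :=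
  DerivedCategory.Q.map (tev p.P Y q.P)

end derived

section dimensions
variable {R : Type u} [CommRing R]

/-- A module `M` is Gorenstein projective if there is an exact complex `P` of projective modules
with `M ≅ Coker (P^(-1) ⟶ P^0)` such that `Hom (P, N)` is exact for every projective `N`. -/
def GorensteinProjective (M : ModuleCat.{u} R) : Prop :=
  ∃ P : CochainComplex (ModuleCat.{u} R) ℤ,
    (∀ n, Projective (P.X n)) ∧ P.Acyclic ∧ Nonempty (M ≅ Limits.cokernel (P.d (-1) 0)) ∧
    ∀ (N : ModuleCat.{u} R), Projective N → ∀ (n : ℤ) (h : P.X n ⟶ N),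
      P.d (n - 1) n ≫ h = 0 → ∃ k : P.X (n + 1) ⟶ N, h = P.d n (n + 1) ≫ k

/-- A module `M` is Gorenstein flat if there is an exact complex `F` of flat modules
with `M ≅ Coker (F^(-1) ⟶ F^0)` such that `J ⊗ F` is exact for every injective `J`. -/
def GorensteinFlat (M : ModuleCat.{u} R) : Prop :=
  ∃ F : CochainComplex (ModuleCat.{u} R) ℤ,
    (∀ n, Module.Flat R (F.X n)) ∧ F.Acyclic ∧ Nonempty (M ≅ Limits.cokernel (F.d (-1) 0)) ∧
    ∀ (J : ModuleCat.{u} R), Injective J →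
      (((MonoidalCategory.tensorLeft J).mapHomologicalComplex (ComplexShape.up ℤ)).obj F).Acyclic

/-- `X` is isomorphic in the derived category to a bounded complex of modules with the
property `Φ`. -/
def HasBoundedModel [HasDerivedCategory.{w} (ModuleCat.{u} R)] (Φ : ModuleCat.{u} R → Prop)
    (X : CochainComplex (ModuleCat.{u} R) ℤ) : Prop :=
  ∃ (K : CochainComplex (ModuleCat.{u} R) ℤ) (a b : ℤ), K.IsStrictlyGE a ∧ K.IsStrictlyLE b ∧
    (∀ n, Φ (K.X n)) ∧ Nonempty (DerivedCategory.Q.obj K ≅ DerivedCategory.Q.obj X)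

/-- All homology modules of `X` are finitely generated. -/
def FiniteHomology (X : CochainComplex (ModuleCat.{u} R) ℤ) : Prop :=
  ∀ n, Module.Finite R (X.homology n)

variable [HasDerivedCategory.{w} (ModuleCat.{u} R)] (X : CochainComplex (ModuleCat.{u} R) ℤ)

/-- The complex `X` has finite projective dimension. -/
def FiniteProjDim : Prop := HasBoundedModel (fun M => Projective M) X

/-- The complex `X` has finite injective dimension. -/
def FiniteInjDim : Prop := HasBoundedModel (fun M => Injective M) X

/-- The complex `X` has finite flat dimension. -/
def FiniteFlatDim : Prop := HasBoundedModel (fun M => Module.Flat R M) X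

/-- The complex `X` is bounded in homology and has finite Gorenstein projective dimension. -/
def FiniteGorensteinProjDim : Prop := HasBoundedModel GorensteinProjective X

/-- The complex `X` is bounded in homology and has finite Gorenstein flat dimension. -/
def FiniteGorensteinFlatDim : Prop := HasBoundedModel GorensteinFlat X

end dimensions

section relative
variable (R S : Type u) [CommRing R] [CommRing S] [Algebra R S]

/-- The homomorphism `R → S` has finite flat dimension, i.e. `S` has finite flat dimension as an
`R`-module. -/
def HomFiniteFlatDim [HasDerivedCategory.{w} (ModuleCat.{u} R)] : Prop :=
  FiniteFlatDim ((HomologicalComplex.single (ModuleCat.{u} R) (ComplexShape.up ℤ) 0).obj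
    ((resMod R S).obj (ModuleCat.of S S)))

variable (G F I : Type u) [AddCommGroup G] [Module R G] [AddCommGroup F] [Module R F] [Module S F]
  [IsScalarTower R S F] [AddCommGroup I] [Module S I]

/-- The tensor evaluation homomorphism of `S`-modules
`Hom_R (G, F) ⊗_S I → Hom_R (G, F ⊗_S I)`, `f ⊗ y ↦ (x ↦ f x ⊗ y)`. -/
def moduleTev : (G →ₗ[R] F) ⊗[S] I →ₗ[S] (G →ₗ[R] (F ⊗[S] I)) :=
  TensorProduct.lift
    { toFun := fun f =>
        { toFun := fun y => ((TensorProduct.mk S F I).flip y).restrictScalars R ∘ₗ f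
          map_add' := fun y y' => LinearMap.ext fun x => TensorProduct.tmul_add (f x) y y'
          map_smul' := fun s y => LinearMap.ext fun x => TensorProduct.tmul_smul s (f x) y }
      map_add' := fun f f' => LinearMap.ext fun y => LinearMap.ext fun x =>
        TensorProduct.add_tmul (f x) (f' x) y
      map_smul' := fun _ _ => rfl }

end relative

end

end TensorEval

open TensorEval

namespace TensorEval
noncomputable section

/-! ### Quasi-isomorphisms tested on elements -/

section elementwise
variable {R : Type u} [CommRing R]

/-! On modules, tensor evaluation is bijective as soon as one outer variable is finite projective;
by the five lemma it is also bijective when one outer variable is finitely presented and the other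
is flat (third variable) or projective (first variable). For complexes it splits, up to signs, into
these module maps once only finitely many terms contribute (`isIso_tev_of_bounded`). The derived
statement, however, needs projective resolutions, which are unbounded below, whereas the Gorenstein
and injective models are bounded. The proof therefore moves between a bounded model and its
resolution.

The passage is a naturality square (`quasiIso_tev_of_injective` for (a) and (b),
`quasiIso_tev_of_flat` for (c), (d) and (d')). One side of the square replaces the resolution of the
Gorenstein variable by its bounded model inside a tensor product with `Hom (P, J)`, respectively
inside a Hom complex into `Y ⊗ Q`. These complexes are unbounded, but they can be compared with the
bounded complexes `Hom (I, J)` and `Y ⊗ I`, since `P` and `Q` resolve the bounded injective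
complexes `I`. For bounded complexes the replacement is harmless if the relevant `Ext` and `Tor`
groups vanish term by term.

The vanishing holds because a Gorenstein module `G` is a cosyzygy of arbitrarily high order:
shifting along its coresolution makes `Ext (G, N)` and `Tor (N, G)` vanish when `N` has finite
injective, projective or flat dimension, as appropriate. Finite flat dimension of `S` over `R`
enters here only: it bounds uniformly the injective dimension over `R` of injective `S`-modules and
the flat dimension of flat `S`-modules (`exists_hasInjectiveDimensionLT`,
`exists_hasInjectiveDimensionLT_of_flat`).

All statements about tensor products are reduced to Hom by Pontryagin duality: the characters of `Y
⊗ Z` form `Hom (Y, Z^∨)`, and characters detect exactness. So `Tor` never occurs, and its vanishing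
means vanishing of `Ext` into character modules.

In (b) and (c) the Gorenstein complex must be replaced by one with finite terms. It is the
truncation of a resolution by finite projective modules. Its lowest term stays in the right class
because that class, `Coresolved`, is closed under extensions and kernels of epimorphisms
(`Resolving.exists_truncGE`); over a noetherian ring its finite members have coresolutions by finite
free modules (`Coresolved.exists_isSES_free`). Part (3) then needs no complexes: two steps of such a
coresolution and the five lemma suffice. -/

lemma exactAt_iff_forall (K : CochainComplex (ModuleCat.{u} R) ℤ) {i j k : ℤ} (hi : i + 1 = j)
    (hk : j + 1 = k) :
    K.ExactAt j ↔ ∀ x : K.X j, (K.d j k).hom x = 0 → ∃ y : K.X i, (K.d i j).hom y = x := by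
  rw [K.exactAt_iff' i j k (by simp; lia) (by simp; lia), ShortComplex.moduleCat_exact_iff]
  rfl

variable {C : Type*} [Category C] [Abelian C]

attribute [local instance] HasDerivedCategory.standard in
open scoped ZeroObject in
lemma isZero_Q_obj_iff (K : CochainComplex C ℤ) :
    Limits.IsZero (DerivedCategory.Q.obj K) ↔ K.Acyclic := by
  constructor
  · intro h n
    rw [HomologicalComplex.exactAt_iff_isZero_homology]
    exact ((DerivedCategory.homologyFunctor C n).map_isZero h).of_iso
      ((DerivedCategory.homologyFunctorFactors C n).app K).symm
  · intro h
    have : QuasiIso (0 : K ⟶ 0) := ⟨fun n => by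
      rw [quasiIsoAt_iff_exactAt _ _ (h n)]
      exact HomologicalComplex.ExactAt.of_isZero
        ((HomologicalComplex.eval C (ComplexShape.up ℤ) n).map_isZero (Limits.isZero_zero _))⟩
    have h2 : IsIso (DerivedCategory.Q.map (0 : K ⟶ 0)) := by
      rw [DerivedCategory.isIso_Q_map_iff_quasiIso]; exact this
    exact (DerivedCategory.Q.map_isZero (Limits.isZero_zero _)).of_iso (asIso (DerivedCategory.Q.map (0 : K ⟶ 0)))

attribute [local instance] HasDerivedCategory.standard in
lemma quasiIso_iff_acyclic_mappingCone {A B : CochainComplex C ℤ} (f : A ⟶ B) :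
    QuasiIso f ↔ (CochainComplex.mappingCone f).Acyclic := by
  rw [← DerivedCategory.isIso_Q_map_iff_quasiIso, ← isZero_Q_obj_iff]
  exact (Pretriangulated.Triangle.isZero₃_iff_isIso₁ _
    (DerivedCategory.mappingCone_triangle_distinguished f)).symm

open CochainComplex in
/-- Elementwise form of acyclicity of the mapping cone. -/
lemma quasiIso_iff_rel {A B : CochainComplex (ModuleCat.{u} R) ℤ} (f : A ⟶ B) :
    QuasiIso f ↔ ∀ ⦃i j k l : ℤ⦄, i + 1 = j → j + 1 = k → k + 1 = l →
      ∀ (a : A.X k) (b : B.X j), (A.d k l).hom a = 0 → (f.f k).hom a = (B.d j k).hom b →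
        ∃ (a' : A.X j) (b' : B.X i), (A.d j k).hom a' = a ∧
          b = (f.f j).hom a' + (B.d i j).hom b' := by
  rw [quasiIso_iff_acyclic_mappingCone]
  constructor
  · intro h i j k l hij hjk hkl a b ha hab
    -- The conditions on `(a, b)` say precisely that `inl a - inr b` is a cocycle of the cone; the
    -- sign of `b` comes from the sign in the cone differential.
    obtain ⟨y, hy⟩ := (exactAt_iff_forall _ hij hjk).1 (h j)
      (((mappingCone.inl f).v k j (by lia)).hom a - ((mappingCone.inr f).f j).hom b) (by
        have e1 := congr($(mappingCone.inl_v_d f k j l (by lia) (by lia)).hom a)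
        have e2 := congr($(mappingCone.inr_f_d f j k).hom b)
        simp only [ModuleCat.hom_comp, LinearMap.comp_apply, ModuleCat.hom_sub,
          LinearMap.sub_apply] at e1 e2
        rw [map_sub, e1, e2, ha, map_zero, sub_zero, hab, sub_self])
    have e1 := congr($(mappingCone.d_fst_v f i j k hij hjk).hom y)
    have e2 := congr($(mappingCone.d_snd_v f i j hij).hom y)
    simp only [ModuleCat.hom_comp, LinearMap.comp_apply, ModuleCat.hom_neg, LinearMap.neg_apply,
      ModuleCat.hom_add, LinearMap.add_apply] at e1 e2
    rw [hy, map_sub, ← LinearMap.comp_apply, ← LinearMap.comp_apply, ← ModuleCat.hom_comp,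
      ← ModuleCat.hom_comp] at e1 e2
    rw [mappingCone.inl_v_fst_v, mappingCone.inr_f_fst_v] at e1
    rw [mappingCone.inl_v_snd_v, mappingCone.inr_f_snd_v] at e2
    refine ⟨-((mappingCone.fst f).1.v i j hij).hom y, -((mappingCone.snd f).v i i (by lia)).hom y,
      ?_, ?_⟩
    · rw [map_neg, ← e1]
      simp
    · simp only [ModuleCat.hom_zero, LinearMap.zero_apply, zero_sub, ModuleCat.hom_id,
        LinearMap.id_apply] at e2
      rw [map_neg, map_neg, ← neg_add, ← e2, neg_neg]
  · intro h j
    rw [exactAt_iff_forall _ (show j - 1 + 1 = j by lia) (rfl : j + 1 = j + 1)]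
    intro x hx
    have e1 := congr($(mappingCone.d_fst_v f j (j + 1) (j + 2) rfl (by lia)).hom x)
    have e2 := congr($(mappingCone.d_snd_v f j (j + 1) rfl).hom x)
    simp only [ModuleCat.hom_comp, LinearMap.comp_apply, ModuleCat.hom_neg, LinearMap.neg_apply,
      ModuleCat.hom_add, LinearMap.add_apply] at e1 e2
    rw [hx, map_zero] at e1 e2
    obtain ⟨a', b', ha', hb'⟩ := h (show j - 1 + 1 = j by lia) (rfl : j + 1 = j + 1)
      (show j + 1 + 1 = j + 2 by lia) (((mappingCone.fst f).1.v j (j + 1) rfl).hom x)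
      (-((mappingCone.snd f).v j j (by lia)).hom x)
      (neg_eq_zero.1 e1.symm) (by rw [map_neg]; exact eq_neg_of_add_eq_zero_left e2.symm)
    have e3 := congr($(mappingCone.id_X f j (j + 1) rfl).hom x)
    simp only [ModuleCat.hom_comp, LinearMap.comp_apply, ModuleCat.hom_add, LinearMap.add_apply,
      ModuleCat.hom_id, LinearMap.id_apply] at e3
    refine ⟨-((mappingCone.inl f).v j (j - 1) (by lia)).hom a' -
      ((mappingCone.inr f).f (j - 1)).hom b', ?_⟩
    have e4 := congr($(mappingCone.inl_v_d f j (j - 1) (j + 1) (by lia) (by lia)).hom a')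
    have e5 := congr($(mappingCone.inr_f_d f (j - 1) j).hom b')
    simp only [ModuleCat.hom_comp, LinearMap.comp_apply, ModuleCat.hom_sub,
      LinearMap.sub_apply] at e4 e5
    rw [neg_eq_iff_eq_neg.1 hb', map_neg, map_add] at e3
    rw [map_sub, map_neg, e4, e5, ha']
    refine Eq.trans ?_ e3
    abel

end elementwise
end
end TensorEval

namespace TensorEval
noncomputable section

/-! ### Functoriality of Hom complexes, and when it yields quasi-isomorphisms -/

section homCxMap
variable {A T : Type u} [CommRing A] [CommRing T] [Algebra A T]

/-- Precomposition with a morphism of complexes of `A`-modules. -/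
def homCxMapLeft {X' X : CochainComplex (ModuleCat.{u} A) ℤ} (f : X' ⟶ X)
    (Y : CochainComplex (ModuleCat.{u} T) ℤ) : homCx X Y ⟶ homCx X' Y where
  f n := ModuleCat.ofHom
    { toFun := fun z => (Cochain.ofHom f).comp (G := X) (K := (resCx A T).obj Y) z (zero_add n)
      map_add' := fun _ _ => Cochain.comp_add _ _ _ _
      map_smul' := fun _ _ => (Cochain.comp_assoc_of_third_is_zero_cochain _ _ _ _).symm }
  comm' i j _ := ModuleCat.hom_ext (LinearMap.ext fun z =>
    δ_ofHom_comp (K := (resCx A T).obj Y) f z j)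

lemma cochain_smul_comp {X : CochainComplex (ModuleCat.{u} A) ℤ}
    {Y Y' : CochainComplex (ModuleCat.{u} T) ℤ} (g : Y ⟶ Y') (n : ℤ) (t : T)
    (z : Cochain X ((resCx A T).obj Y) n) :
    (z.comp (Cochain.ofHom ((resCx A T).map (t • 𝟙 Y))) (add_zero n)).comp
        (Cochain.ofHom ((resCx A T).map g)) (add_zero n) =
      (z.comp (Cochain.ofHom ((resCx A T).map g)) (add_zero n)).comp
        (Cochain.ofHom ((resCx A T).map (t • 𝟙 Y'))) (add_zero n) := by
  rw [Cochain.comp_assoc_of_third_is_zero_cochain,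
    Cochain.comp_assoc_of_third_is_zero_cochain, ← Cochain.ofHom_comp, ← Cochain.ofHom_comp,
    ← Functor.map_comp, ← Functor.map_comp, Linear.smul_comp, Linear.comp_smul,
    Category.id_comp, Category.comp_id]

/-- Postcomposition with a morphism of complexes of `T`-modules. -/
def homCxMapRight (X : CochainComplex (ModuleCat.{u} A) ℤ)
    {Y Y' : CochainComplex (ModuleCat.{u} T) ℤ} (g : Y ⟶ Y') : homCx X Y ⟶ homCx X Y' where
  f n := ModuleCat.ofHom
    { toFun := fun z => Cochain.comp (F := X) (G := (resCx A T).obj Y) z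
        (Cochain.ofHom ((resCx A T).map g)) (add_zero n)
      map_add' := fun _ _ => Cochain.add_comp _ _ _ _
      map_smul' := fun t z => cochain_smul_comp g n t z }
  comm' i j _ := ModuleCat.hom_ext (LinearMap.ext fun z =>
    δ_comp_ofHom (F := X) (G := (resCx A T).obj Y) z ((resCx A T).map g) j)

/-- Every cocycle from `X` to `M` is a coboundary. -/
def HomAcyclic {C : Type*} [Category C] [Preadditive C] (X M : CochainComplex C ℤ) : Prop :=
  ∀ ⦃i j k : ℤ⦄, i + 1 = j → j + 1 = k → ∀ z : Cochain X M j, δ j k z = 0 →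
    ∃ w : Cochain X M i, δ i j w = z

-- The cone of the restriction map is, up to shift and signs, the Hom complex out of the cone of
-- `f`. A relative cocycle `(a, b)` glues to a cocycle on that cone, and the two components of a
-- primitive are the required witnesses.
open CochainComplex in
lemma quasiIso_homCxMapLeft {X' X : CochainComplex (ModuleCat.{u} A) ℤ} (f : X' ⟶ X)
    (Y : CochainComplex (ModuleCat.{u} T) ℤ)
    (h : HomAcyclic (CochainComplex.mappingCone f) ((resCx A T).obj Y)) :
    QuasiIso (homCxMapLeft f Y) := by
  rw [quasiIso_iff_rel]
  intro i j k l hij hjk hkl (a : Cochain X ((resCx A T).obj Y) k)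
    (b : Cochain X' ((resCx A T).obj Y) j) (ha : δ k l a = 0)
    (hab : (Cochain.ofHom f).comp a (zero_add k) = δ j k b)
  have hl : l.negOnePow = -k.negOnePow := by rw [← hkl, Int.negOnePow_succ]
  have hk : k.negOnePow = -j.negOnePow := by rw [← hjk, Int.negOnePow_succ]
  -- The sign `(-1)^k` in front of `b` is what makes the two contributions to the differential of
  -- the glued cochain cancel.
  obtain ⟨w, hw⟩ := h hjk hkl
    (mappingCone.descCochain f (k.negOnePow • b) a hjk) (by
      rw [mappingCone.δ_descCochain _ _ _ _ _ hkl, ha, hab, δ_units_smul, hl, Units.neg_smul, add_neg_cancel]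
      simp)
  have e1 : (mappingCone.inl f).comp (δ j k w) (show -1 + k = j by lia) = k.negOnePow • b := by
    rw [hw, mappingCone.inl_descCochain]
  have e2 : (Cochain.ofHom (mappingCone.inr f)).comp (δ j k w) (zero_add k) = a := by
    rw [hw, mappingCone.inr_descCochain]
  refine ⟨(Cochain.ofHom (mappingCone.inr f)).comp w (zero_add j),
    k.negOnePow • (mappingCone.inl f).comp w (show -1 + j = i by lia), ?_, ?_⟩
  · exact (δ_ofHom_comp (mappingCone.inr f) w k).trans e2
  · change b = (Cochain.ofHom f).comp ((Cochain.ofHom (mappingCone.inr f)).comp w (zero_add j))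
      (zero_add j) + δ i j (k.negOnePow • (mappingCone.inl f).comp w (show -1 + j = i by lia))
    rw [δ_units_smul, δ_comp _ _ _ 0 k j hij (by lia) hjk, e1, mappingCone.δ_inl, smul_add,
      smul_smul, smul_smul, Int.units_mul_self, one_smul, hk, neg_mul, Int.units_mul_self, Units.neg_smul, one_smul, Cochain.ofHom_comp,
      Cochain.comp_assoc_of_first_is_zero_cochain]
    abel

-- Dual gluing: a relative cocycle `(a, b)` is the pair of components `a`, `-b` of a single cocycle
-- with values in the cone of the restricted map.
open CochainComplex in
lemma quasiIso_homCxMapRight (X : CochainComplex (ModuleCat.{u} A) ℤ)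
    {Y Y' : CochainComplex (ModuleCat.{u} T) ℤ} (g : Y ⟶ Y')
    (h : HomAcyclic X (CochainComplex.mappingCone ((resCx A T).map g))) :
    QuasiIso (homCxMapRight X g) := by
  rw [quasiIso_iff_rel]
  intro i j k l hij hjk hkl (a : Cochain X ((resCx A T).obj Y) k)
    (b : Cochain X ((resCx A T).obj Y') j) (ha : δ k l a = 0)
    (hab : a.comp (Cochain.ofHom ((resCx A T).map g)) (add_zero k) = δ j k b)
  set φ := (resCx A T).map g
  obtain ⟨w, hw⟩ := h hij hjk (mappingCone.liftCochain φ a (-b) hjk) (by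
      rw [mappingCone.δ_liftCochain _ _ _ _ _ hkl, ha, hab, δ_neg, neg_add_cancel]
      simp)
  have e1 : (δ i j w).comp (mappingCone.fst φ).1 (show j + 1 = k by lia) = a := by
    rw [hw, mappingCone.liftCochain_fst]
  have e2 : (δ i j w).comp (mappingCone.snd φ) (add_zero j) = -b := by
    rw [hw, mappingCone.liftCochain_snd]
  refine ⟨-w.comp (mappingCone.fst φ).1 hij, -w.comp (mappingCone.snd φ) (add_zero i), ?_, ?_⟩
  · change δ j k (-w.comp (mappingCone.fst φ).1 hij) = a
    rw [δ_neg, δ_comp _ _ _ j 2 k hjk hij (by lia), e1]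
    simp
  · change b = (-w.comp (mappingCone.fst φ).1 hij).comp (Cochain.ofHom φ) (add_zero j) +
      δ i j (-w.comp (mappingCone.snd φ) (add_zero i))
    rw [δ_neg, δ_comp_zero_cochain _ _ _ hij, e2, mappingCone.δ_snd, Cochain.comp_neg,
      Cochain.neg_comp, Cochain.comp_assoc_of_third_is_zero_cochain]
    abel

end homCxMap

/-! ### Acyclicity of Hom complexes -/

section acyclicity
variable {C : Type*} [Category C] [Abelian C] {X M : CochainComplex C ℤ}

lemma HomAcyclic.of_isKInjective [M.IsKInjective] (hX : X.Acyclic) : HomAcyclic X M :=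
  fun i j k hij hjk z hz =>
    CochainComplex.IsKInjective.eq_δ_of_cocycle (Cocycle.mk z k hjk hz) hX i hij

/-- A cocycle of degree `j` is a morphism to the shift `M⟦j⟧`, which is acyclic too, so the morphism
is null-homotopic. -/
lemma HomAcyclic.of_isKProjective [X.IsKProjective] (hM : M.Acyclic) : HomAcyclic X M := by
  intro i j k hij hjk z hz
  have hM' : (M⟦j⟧).Acyclic := by
    intro n
    have := hM (j + n)
    rw [HomologicalComplex.exactAt_iff_isZero_homology] at this ⊢
    exact this.of_iso
      (((CochainComplex.ShiftSequence.shiftIso C j n _ rfl).app M))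
  have e := (CohomologyClass.toHom_mk_eq_zero_iff (Cocycle.mk z k hjk hz)).1 (by
    rw [CohomologyClass.toHom_mk,
      HomotopyCategory.eq_of_homotopy _ _ (CochainComplex.IsKProjective.homotopyZero _ hM'),
      Functor.map_zero])
  exact (mem_coboundaries_iff _ i hij).1 e

/-- Vanishing of the horizontal cohomology in a complex of homomorphisms from a bounded complex. -/
lemma HomAcyclic.of_bounded_left (a b : ℤ) [X.IsStrictlyGE a] [X.IsStrictlyLE b]
    (h : ∀ p q (f : X.X p ⟶ M.X q), f ≫ M.d q (q + 1) = 0 →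
      ∃ g : X.X p ⟶ M.X (q - 1), g ≫ M.d (q - 1) q = f) : HomAcyclic X M := by
  intro i j k hij hjk
  -- Induct on the number `m` of columns `p = a, …, a + m - 1` in which `z` may be nonzero. In the
  -- highest column the cocycle condition reduces to `f ≫ d = 0`, so `h` gives a primitive;
  -- subtracting the coboundary of this single component clears the column and touches only the one
  -- below.
  suffices H : ∀ (m : ℕ) (z : Cochain X M j), δ j k z = 0 →
      (∀ p q hpq, a + m ≤ p → z.v p q hpq = 0) → ∃ w : Cochain X M i, δ i j w = z by
    intro z hz
    refine H (b + 1 - a).toNat z hz fun p q hpq hp => ?_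
    exact (X.isZero_of_isStrictlyLE b p (by lia)).eq_of_src _ _
  intro m
  induction m with
  | zero =>
    intro z _ hz
    refine ⟨0, ?_⟩
    rw [δ_zero]
    ext p q hpq
    by_cases hp : a ≤ p
    · rw [hz p q hpq (by simpa using hp), Cochain.zero_v]
    · exact (X.isZero_of_isStrictlyGE a p (by lia)).eq_of_src _ _
  | succ m ih =>
    intro z hδ hz
    have e := Cochain.congr_v hδ (a + m) (a + m + j + 1) (by lia)
    rw [δ_v j k hjk z _ _ _ (a + m + j) (a + m + 1) (by lia) rfl,
      hz (a + m + 1) _ (by lia) (by push_cast; lia), Limits.comp_zero, smul_zero, add_zero,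
      Cochain.zero_v] at e
    obtain ⟨g, hg⟩ := h (a + m) (a + m + j) (z.v _ _ rfl) e
    have hs : δ i j (Cochain.single g i) = _ :=
      Cochain.δ_single g i j hij (a + m - 1) (a + m + j) (by lia) (by lia)
    obtain ⟨w, hw⟩ := ih (z - δ i j (Cochain.single g i)) (by simp [hδ, δ_δ]) (by
      intro p q hpq hp
      rw [hs, Cochain.sub_v, Cochain.add_v, Cochain.units_smul_v,
        Cochain.single_v_eq_zero (X.d (a + m - 1) (a + m) ≫ g) j p q hpq (by lia), smul_zero,
        add_zero]
      rcases eq_or_lt_of_le hp with rfl | hp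
      · obtain rfl : q = a + m + j := hpq.symm
        rw [Cochain.single_v, hg, sub_self]
      · rw [Cochain.single_v_eq_zero _ _ _ _ _ (by lia), hz _ _ _ (by push_cast; lia), sub_zero])
    exact ⟨w + Cochain.single g i, by rw [δ_add, hw, sub_add_cancel]⟩

/-- Vanishing of the vertical cohomology in a complex of homomorphisms to a bounded complex. -/
lemma HomAcyclic.of_bounded_right (a b : ℤ) [M.IsStrictlyGE a] [M.IsStrictlyLE b]
    (h : ∀ p q (f : X.X p ⟶ M.X q), X.d (p - 1) p ≫ f = 0 →
      ∃ g : X.X (p + 1) ⟶ M.X q, X.d p (p + 1) ≫ g = f) : HomAcyclic X M := by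
  intro i j k hij hjk
  -- The same induction by rows: the possibly nonzero ones are `b - m < q ≤ b`, and the lowest is
  -- cleared each time, at the expense of the row above.
  suffices H : ∀ (m : ℕ) (z : Cochain X M j), δ j k z = 0 →
      (∀ p q hpq, q ≤ b - m → z.v p q hpq = 0) → ∃ w : Cochain X M i, δ i j w = z by
    intro z hz
    refine H (b + 1 - a).toNat z hz fun p q hpq hp => ?_
    exact (M.isZero_of_isStrictlyGE a q (by lia)).eq_of_tgt _ _
  intro m
  induction m with
  | zero =>
    intro z _ hz
    refine ⟨0, ?_⟩
    rw [δ_zero]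
    ext p q hpq
    by_cases hp : q ≤ b
    · rw [hz p q hpq (by simpa using hp), Cochain.zero_v]
    · exact (M.isZero_of_isStrictlyLE b q (by lia)).eq_of_tgt _ _
  | succ m ih =>
    intro z hδ hz
    obtain ⟨q, hq⟩ : ∃ q, q = b - m := ⟨_, rfl⟩
    obtain ⟨p, hp⟩ : ∃ p, p + j = q := ⟨q - j, by lia⟩
    have e := Cochain.congr_v hδ (p - 1) q (by lia)
    rw [δ_v j k hjk z _ _ _ (q - 1) p rfl (by lia),
      hz (p - 1) (q - 1) (by lia) (by push_cast; lia), Limits.zero_comp, zero_add,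
      Cochain.zero_v] at e
    obtain ⟨g, hg⟩ := h p q (z.v _ _ hp) (by
      have e2 := congrArg (fun t => k.negOnePow • t) e
      simp only [smul_smul, Int.units_mul_self, one_smul, smul_zero] at e2
      exact e2)
    have hs : δ i j (Cochain.single g i) = _ :=
      Cochain.δ_single g i j hij p (q + 1) (by lia) (by lia)
    obtain ⟨w, hw⟩ := ih (z - j.negOnePow • δ i j (Cochain.single g i)) (by simp [hδ, δ_δ]) (by
      intro p' q' hpq' hp'
      rw [hs, smul_add, smul_smul, Int.units_mul_self, one_smul, Cochain.sub_v, Cochain.add_v,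
        Cochain.units_smul_v,
        Cochain.single_v_eq_zero' (g ≫ M.d q (q + 1)) j p' q' hpq' (by lia), smul_zero,
        zero_add]
      rcases eq_or_lt_of_le hp' with h' | hp'
      · obtain rfl : q' = q := by lia
        obtain rfl : p' = p := by lia
        rw [Cochain.single_v, hg, sub_self]
      · rw [Cochain.single_v_eq_zero' _ _ _ _ _ (by lia), hz _ _ _ (by push_cast; lia), sub_zero])
    exact ⟨w + j.negOnePow • Cochain.single g i, by
      rw [δ_add, hw, δ_units_smul, sub_add_cancel]⟩

end acyclicity
end
end TensorEval

namespace TensorEval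
noncomputable section

/-! ### Exactness and characters -/

section characters
variable {T : Type*} [CommRing T] {M₁ M₂ M₃ : Type*} [AddCommGroup M₁] [AddCommGroup M₂]
  [AddCommGroup M₃] [Module T M₁] [Module T M₂] [Module T M₃]

/-- `ℚ/ℤ` is an injective cogenerator. A character that kills `ker g` descends to the image of `g`
and extends to `M₃`; conversely, an element of `ker g` outside the image of `f` is detected by a
character of `M₂ / im f`. -/
lemma exact_iff_dual (f : M₁ →ₗ[T] M₂) (g : M₂ →ₗ[T] M₃) :
    (∀ x, g x = 0 → ∃ y, f y = x) ↔
      ∀ ψ : CharacterModule M₂, CharacterModule.dual f ψ = 0 →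
        ∃ χ, CharacterModule.dual g χ = ψ := by
  constructor
  · intro h ψ hψ
    have hk : ∀ x ∈ g.toAddMonoidHom.ker, (show M₂ →+ AddCircle (1 : ℚ) from ψ) x = 0 := by
      intro x hx
      obtain ⟨y, rfl⟩ := h x hx
      exact DFunLike.congr_fun hψ y
    obtain ⟨χ, hχ⟩ := CharacterModule.dual_surjective_of_injective
      (QuotientAddGroup.kerLift g.toAddMonoidHom).toIntLinearMap
      (QuotientAddGroup.kerLift_injective _) (QuotientAddGroup.lift _ _ hk)
    refine ⟨χ, DFunLike.ext _ _ fun x => ?_⟩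
    exact DFunLike.congr_fun hχ (QuotientAddGroup.mk x)
  · intro h x hx
    by_contra hc
    have hne : (LinearMap.range f).mkQ x ≠ 0 := by
      rw [Submodule.mkQ_apply, Ne, Submodule.Quotient.mk_eq_zero]
      exact hc
    obtain ⟨c, hc⟩ := CharacterModule.exists_character_apply_ne_zero_of_ne_zero hne
    obtain ⟨χ, hχ⟩ := h (CharacterModule.dual (LinearMap.range f).mkQ c) (by
      ext y
      have : (LinearMap.range f).mkQ (f y) = 0 := by simp
      exact (congrArg c this).trans (map_zero c))
    apply hc
    have := DFunLike.congr_fun hχ x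
    refine this.symm.trans ?_
    exact (congrArg χ hx).trans (map_zero χ)

variable {A₁ A₂ A₃ B₁ B₂ B₃ : Type*} [AddCommGroup A₁] [AddCommGroup A₂] [AddCommGroup A₃]
  [AddCommGroup B₁] [AddCommGroup B₂] [AddCommGroup B₃] [Module T A₁] [Module T A₂] [Module T A₃]
  [Module T B₁] [Module T B₂] [Module T B₃]

/-- The relative condition is exactness of `A₁ × B₁ → A₂ × B₂ → A₃ × B₃`, a piece of a mapping cone.
Dualizing this sequence gives a condition of the same shape with the two rows and the direction
exchanged, which is how quasi-isomorphisms are compared with their duals. -/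
lemma rel_iff_dual (d₁ : A₁ →ₗ[T] A₂) (d₂ : A₂ →ₗ[T] A₃) (e₁ : B₁ →ₗ[T] B₂) (e₂ : B₂ →ₗ[T] B₃)
    (f : A₁ →ₗ[T] B₂) (g : A₂ →ₗ[T] B₃) :
    (∀ (a : A₂) (b : B₂), d₂ a = 0 → g a = e₂ b → ∃ a' b', d₁ a' = a ∧ b = f a' + e₁ b') ↔
    ∀ (β : CharacterModule B₂) (α : CharacterModule A₂), CharacterModule.dual e₁ β = 0 →
      CharacterModule.dual f β = CharacterModule.dual d₁ α →
      ∃ γ δ, CharacterModule.dual e₂ γ = β ∧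
        α = CharacterModule.dual g γ + CharacterModule.dual d₂ δ := by
  have h := exact_iff_dual
    ((d₁ ∘ₗ LinearMap.fst T A₁ B₁).prod (f.coprod e₁))
    ((d₂ ∘ₗ LinearMap.fst T A₂ B₂).prod (g.coprod (-e₂)))
  constructor
  · intro H β α h1 h2
    obtain ⟨χ, hχ⟩ := h.1 (fun x hx => by
        obtain ⟨a, b⟩ := x
        have hx' := Prod.ext_iff.1 hx
        obtain ⟨a', b', h3, h4⟩ := H a b hx'.1 (by
          have := hx'.2
          change g a + -e₂ b = 0 at this
          rwa [← sub_eq_add_neg, sub_eq_zero] at this)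
        exact ⟨(a', b'), Prod.ext h3 h4.symm⟩)
      (CharacterModule.dual (LinearMap.fst T A₂ B₂) (-α) +
        CharacterModule.dual (LinearMap.snd T A₂ B₂) β) (DFunLike.ext _ _ fun x => by
          have e1 := DFunLike.congr_fun h1 x.2
          have e2 := DFunLike.congr_fun h2 x.1
          change -α (d₁ x.1) + β (f x.1 + e₁ x.2) = 0
          change β (e₁ x.2) = 0 at e1
          change β (f x.1) = α (d₁ x.1) at e2
          rw [map_add, e1, e2]; abel)
    refine ⟨-CharacterModule.dual (LinearMap.inr T A₃ B₃) χ,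
      -CharacterModule.dual (LinearMap.inl T A₃ B₃) χ, ?_, ?_⟩
    · refine DFunLike.ext _ _ fun b => ?_
      have := DFunLike.congr_fun hχ (0, b)
      change χ (d₂ 0, g 0 + -e₂ b) = -α 0 + β b at this
      change -χ (0, e₂ b) = β b
      rw [map_zero, map_zero, map_zero, neg_zero, zero_add, zero_add] at this
      rw [← this, ← map_neg, Prod.neg_mk, neg_zero]
    · refine DFunLike.ext _ _ fun a => ?_
      have := DFunLike.congr_fun hχ (a, 0)
      change χ (d₂ a, g a + -e₂ 0) = -α a + β 0 at this
      change α a = -χ (0, g a) + -χ (d₂ a, 0)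
      rw [map_zero, map_zero, neg_zero, add_zero, add_zero] at this
      rw [← neg_add, ← map_add, Prod.mk_add_mk, zero_add, add_zero, this, neg_neg]
  · intro H a b h1 h2
    obtain ⟨y, hy⟩ := h.2 (fun ψ hψ => by
        obtain ⟨γ, δ, h3, h4⟩ := H (CharacterModule.dual (LinearMap.inr T A₂ B₂) ψ)
          (-CharacterModule.dual (LinearMap.inl T A₂ B₂) ψ)
          (DFunLike.ext _ _ fun x => by
            have := DFunLike.congr_fun hψ (0, x)
            change ψ (d₁ 0, f 0 + e₁ x) = 0 at this
            change ψ (0, e₁ x) = 0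
            rwa [map_zero, map_zero, zero_add] at this)
          (DFunLike.ext _ _ fun x => by
            have := DFunLike.congr_fun hψ (x, 0)
            change ψ (d₁ x, f x + e₁ 0) = 0 at this
            change ψ (0, f x) = -ψ (d₁ x, 0)
            rw [map_zero, add_zero] at this
            rw [eq_neg_iff_add_eq_zero, ← map_add, Prod.mk_add_mk, zero_add, add_zero, this])
        refine ⟨-(CharacterModule.dual (LinearMap.fst T A₃ B₃) δ +
          CharacterModule.dual (LinearMap.snd T A₃ B₃) γ), DFunLike.ext _ _ fun x => ?_⟩
        have e3 := DFunLike.congr_fun h3 x.2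
        have e4 := DFunLike.congr_fun h4 x.1
        change γ (e₂ x.2) = ψ (0, x.2) at e3
        change -ψ (x.1, 0) = γ (g x.1) + δ (d₂ x.1) at e4
        change -(δ (d₂ x.1) + γ (g x.1 + -e₂ x.2)) = ψ x
        have e5 : ψ x = ψ (x.1, 0) + ψ (0, x.2) := by
          rw [← map_add, Prod.mk_add_mk, zero_add, add_zero]
        rw [e5, ← e3, map_add, map_neg, ← neg_eq_iff_eq_neg.2 (neg_neg _).symm, ← neg_neg (ψ (x.1, 0)), e4]
        abel) (a, b) (Prod.ext h1 (by
          change g a + -e₂ b = 0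
          rw [h2, add_neg_cancel]))
    have hy' := Prod.ext_iff.1 hy
    exact ⟨y.1, y.2, hy'.1, hy'.2.symm⟩

end characters

/-! ### Character complexes detect quasi-isomorphisms -/

section dual
variable {B T : Type u} [CommRing B] [CommRing T]

/-- The characters on the terms of a complex. -/
def dualCx (Z : CochainComplex (ModuleCat.{u} B) ℤ) : CochainComplex (ModuleCat.{u} B) ℤ where
  X n := ModuleCat.of B (CharacterModule (Z.X (-n)))
  d i j := ModuleCat.ofHom (j.negOnePow • CharacterModule.dual (Z.d (-j) (-i)).hom)
  shape i j hij := by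
    rw [Z.shape _ _ (fun h => hij (by simp at h ⊢; lia))]
    ext : 1
    simp
  d_comp_d' i j k _ _ := by
    refine ModuleCat.hom_ext (LinearMap.ext fun c => ?_)
    have h0 : CharacterModule.dual (Z.d (-k) (-j)).hom
        (CharacterModule.dual (Z.d (-j) (-i)).hom c) = 0 := DFunLike.ext _ _ fun x =>
      (congrArg c congr($(Z.d_comp_d (-k) (-j) (-i)).hom x)).trans (map_zero c)
    change (k.negOnePow • CharacterModule.dual (Z.d (-k) (-j)).hom
      (j.negOnePow • CharacterModule.dual (Z.d (-j) (-i)).hom c)) = 0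
    rw [Units.smul_def, Units.smul_def, map_zsmul, h0, smul_zero, smul_zero]

/-- The morphism of complexes of characters induced by a morphism of complexes. -/
def dualMap {Z Z' : CochainComplex (ModuleCat.{u} B) ℤ} (g : Z ⟶ Z') : dualCx Z' ⟶ dualCx Z where
  f n := ModuleCat.ofHom (CharacterModule.dual (g.f (-n)).hom)
  comm' i j _ := by
    refine ModuleCat.hom_ext (LinearMap.ext fun (c : CharacterModule (Z'.X (-i))) => ?_)
    change j.negOnePow • CharacterModule.dual (Z.d (-j) (-i)).hom
      (CharacterModule.dual (g.f (-i)).hom c) =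
      CharacterModule.dual (g.f (-j)).hom
        (j.negOnePow • CharacterModule.dual (Z'.d (-j) (-i)).hom c)
    rw [Units.smul_def, Units.smul_def, map_zsmul]
    congr 1
    refine DFunLike.ext _ _ fun x => ?_
    exact congrArg c congr($(g.comm (-j) (-i)).hom x).symm

variable {K L : CochainComplex (ModuleCat.{u} T) ℤ} {K' L' : CochainComplex (ModuleCat.{u} B) ℤ}

/-- Quasi-isomorphisms are detected on character modules. -/
lemma quasiIso_iff_of_dual (φ : K ⟶ L) (φ' : L' ⟶ K')
    (eK : ∀ n m, n + m = 0 → CharacterModule (K.X n) ≃+ K'.X m)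
    (eL : ∀ n m, n + m = 0 → CharacterModule (L.X n) ≃+ L'.X m)
    (v : ℤ → ℤˣ)
    (hK : ∀ n n' m m' (h : n + m = 0) (h' : n' + m' = 0) (_ : n + 1 = n') (ψ : CharacterModule (K.X n')),
      (K'.d m' m).hom (eK n' m' h' ψ) = v n • eK n m h (CharacterModule.dual (K.d n n').hom ψ))
    (hL : ∀ n n' m m' (h : n + m = 0) (h' : n' + m' = 0) (_ : n + 1 = n') (ψ : CharacterModule (L.X n')),
      (L'.d m' m).hom (eL n' m' h' ψ) = v n • eL n m h (CharacterModule.dual (L.d n n').hom ψ))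
    (hφ : ∀ n m (h : n + m = 0) (ψ : CharacterModule (L.X n)),
      (φ'.f m).hom (eL n m h ψ) = eK n m h (CharacterModule.dual (φ.f n).hom ψ)) :
    QuasiIso φ ↔ QuasiIso φ' := by
  -- Duality negates degrees, so a stretch of four degrees of `φ` is matched with the opposite
  -- stretch of `φ'`. The identifications commute with differentials only up to the units `v`; these
  -- are absorbed by rescaling the witnesses, `v j` for one step and `v j * v k` for two.
  have key : ∀ ⦃i j k l i' j' k' l' : ℤ⦄ (_ : i + 1 = j) (_ : j + 1 = k) (_ : k + 1 = l)
      (hi : i + i' = 0) (hj : j + j' = 0) (hk : k + k' = 0) (hl : l + l' = 0),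
      (∀ (a : K.X k) (b : L.X j), (K.d k l).hom a = 0 → (φ.f k).hom a = (L.d j k).hom b →
        ∃ (a' : K.X j) (b' : L.X i), (K.d j k).hom a' = a ∧
          b = (φ.f j).hom a' + (L.d i j).hom b') ↔
      ∀ (a : L'.X j') (b : K'.X k'), (L'.d j' i').hom a = 0 → (φ'.f j').hom a = (K'.d k' j').hom b →
        ∃ (a' : L'.X k') (b' : K'.X l'), (L'.d k' j').hom a' = a ∧
          b = (φ'.f k').hom a' + (K'.d l' k').hom b' := by
    intro i j k l i' j' k' l' hij hjk hkl hi hj hk hl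
    refine (rel_iff_dual (K.d j k).hom (K.d k l).hom (L.d i j).hom (L.d j k).hom (φ.f j).hom
      (φ.f k).hom).trans ?_
    constructor
    · intro H a b h1 h2
      obtain ⟨β, rfl⟩ := (eL j j' hj).surjective a
      obtain ⟨α, rfl⟩ := (eK k k' hk).surjective b
      obtain ⟨γ, δ, h3, h4⟩ := H β (v j • α)
        ((eL i i' hi).injective ((smul_left_cancel_iff (v i)).1 (by
          rw [← hL i j i' j' hi hj hij, h1, map_zero, smul_zero])))
        ((eK j j' hj).injective (by
          rw [← hφ j j' hj, h2, hK j k j' k' hj hk hjk, Units.smul_def, Units.smul_def, map_zsmul,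
            map_zsmul]))
      refine ⟨v j • eL k k' hk γ, (v j * v k) • eK l l' hl δ, ?_, ?_⟩
      · rw [Units.smul_def, map_zsmul, ← Units.smul_def, hL j k j' k' hj hk hjk, smul_smul,
          Int.units_mul_self, one_smul, h3]
      · rw [Units.smul_def, Units.smul_def (v j * v k), map_zsmul, map_zsmul, ← Units.smul_def,
          ← Units.smul_def, hφ, hK k l k' l' hk hl hkl, smul_smul, mul_assoc, Int.units_mul_self,
          mul_one, ← smul_add, ← map_add, ← h4, Units.smul_def (v j) α, map_zsmul,
          ← Units.smul_def, smul_smul, Int.units_mul_self, one_smul]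
    · intro H β α h1 h2
      obtain ⟨a', b', h3, h4⟩ := H (eL j j' hj β) (v j • eK k k' hk α)
        (by rw [hL i j i' j' hi hj hij, h1, map_zero, smul_zero])
        (by rw [hφ, h2, Units.smul_def, map_zsmul, ← Units.smul_def, hK j k j' k' hj hk hjk,
          smul_smul, Int.units_mul_self, one_smul])
      obtain ⟨γ, rfl⟩ := (eL k k' hk).surjective a'
      obtain ⟨δ, rfl⟩ := (eK l l' hl).surjective b'
      refine ⟨v j • γ, (v j * v k) • δ, (eL j j' hj).injective ?_, (eK k k' hk).injective ?_⟩
      · rw [← h3, hL j k j' k' hj hk hjk, Units.smul_def, map_zsmul, map_zsmul, ← Units.smul_def]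
      · have h5 := congrArg (fun t => v j • t) h4
        simp only [smul_smul, Int.units_mul_self, one_smul] at h5
        rw [h5, hφ, hK k l k' l' hk hl hkl, smul_add, smul_smul, map_add]
        simp only [Units.smul_def, map_zsmul]
  rw [quasiIso_iff_rel, quasiIso_iff_rel]
  constructor
  · intro h i j k l hij hjk hkl
    have e₁ : -l + 1 = -k := by lia
    have e₂ : -k + 1 = -j := by lia
    have e₃ : -j + 1 = -i := by lia
    exact (key e₁ e₂ e₃ (neg_add_cancel l) (neg_add_cancel k) (neg_add_cancel j)
      (neg_add_cancel i)).1 (h e₁ e₂ e₃)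
  · intro h i j k l hij hjk hkl
    have e₁ : -l + 1 = -k := by lia
    have e₂ : -k + 1 = -j := by lia
    have e₃ : -j + 1 = -i := by lia
    exact (key hij hjk hkl (add_neg_cancel i) (add_neg_cancel j) (add_neg_cancel k)
      (add_neg_cancel l)).2 (h e₁ e₂ e₃)

end dual

end
end TensorEval

namespace TensorEval
noncomputable section

section dualEquiv
variable {B : Type u} [CommRing B]

/-- The terms of `dualCx Z`, up to reindexing. -/
def dualEquiv (Z : CochainComplex (ModuleCat.{u} B) ℤ) (n m : ℤ) (h : n + m = 0) :
    CharacterModule (Z.X n) ≃+ (dualCx Z).X m :=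
  (CharacterModule.congr
    (Z.XIsoOfEq (neg_eq_of_add_eq_zero_left h).symm).toLinearEquiv).toAddEquiv

lemma dualEquiv_neg (Z : CochainComplex (ModuleCat.{u} B) ℤ) (m : ℤ)
    (c : CharacterModule (Z.X (-m))) :
    dualEquiv Z (-m) m (neg_add_cancel m) c = c := by
  refine DFunLike.ext (F := CharacterModule (Z.X (-m))) _ _ fun x => ?_
  change c ((Z.XIsoOfEq (neg_eq_of_add_eq_zero_left (neg_add_cancel m)).symm).inv.hom x) = c x
  rw [HomologicalComplex.XIsoOfEq_rfl]
  rfl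

lemma quasiIso_dualMap_iff {Z Z' : CochainComplex (ModuleCat.{u} B) ℤ} (g : Z ⟶ Z') :
    QuasiIso (dualMap g) ↔ QuasiIso g := by
  refine (quasiIso_iff_of_dual g (dualMap g) (dualEquiv Z) (dualEquiv Z') Int.negOnePow
    ?_ ?_ ?_).symm
  · intro n n' m m' h h' _ ψ
    obtain rfl : n = -m := by lia
    obtain rfl : n' = -m' := by lia
    rw [dualEquiv_neg, dualEquiv_neg, Int.negOnePow_neg]
    rfl
  · intro n n' m m' h h' _ ψ
    obtain rfl : n = -m := by lia
    obtain rfl : n' = -m' := by lia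
    rw [dualEquiv_neg, dualEquiv_neg, Int.negOnePow_neg]
    rfl
  · intro n m h ψ
    obtain rfl : n = -m := by lia
    rw [dualEquiv_neg, dualEquiv_neg]
    rfl

end dualEquiv

section composition
variable {A T : Type u} [CommRing A] [CommRing T] [Algebra A T]

/-- The value of a cochain. -/
def HomCochain.val {X : CochainComplex (ModuleCat.{u} A) ℤ}
    {Y : CochainComplex (ModuleCat.{u} T) ℤ} {n : ℤ} (z : HomCochain X Y n) {p q : ℤ}
    (h : p + n = q) (x : X.X p) : Y.X q :=
  (z.v p q h).hom x

lemma HomCochain.val_ext {X : CochainComplex (ModuleCat.{u} A) ℤ}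
    {Y : CochainComplex (ModuleCat.{u} T) ℤ} {n : ℤ} {z z' : HomCochain X Y n}
    (H : ∀ p q (h : p + n = q) x, z.val h x = z'.val h x) : z = z' :=
  HomCochain.ext fun p q h => ModuleCat.hom_ext (LinearMap.ext fun x => H p q h x)

/-- Precomposition of a cochain with a morphism of complexes. -/
def HomCochain.precomp {X X' : CochainComplex (ModuleCat.{u} A) ℤ} (f : X' ⟶ X)
    {Y : CochainComplex (ModuleCat.{u} T) ℤ} {n : ℤ} (z : HomCochain X Y n) : HomCochain X' Y n :=
  Cochain.comp (K := (resCx A T).obj Y) (Cochain.ofHom f) z (zero_add n)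

/-- Postcomposition of a cochain with a morphism of complexes. -/
def HomCochain.postcomp {X : CochainComplex (ModuleCat.{u} A) ℤ}
    {Y Y' : CochainComplex (ModuleCat.{u} T) ℤ} (g : Y ⟶ Y') {n : ℤ} (z : HomCochain X Y n) :
    HomCochain X Y' n :=
  Cochain.comp (G := (resCx A T).obj Y) z (Cochain.ofHom ((resCx A T).map g)) (add_zero n)

lemma HomCochain.precomp_val {X X' : CochainComplex (ModuleCat.{u} A) ℤ} (f : X' ⟶ X)
    {Y : CochainComplex (ModuleCat.{u} T) ℤ} {n : ℤ} (z : HomCochain X Y n) {p q : ℤ}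
    (h : p + n = q) (x : X'.X p) : (z.precomp f).val h x = z.val h ((f.f p).hom x) :=
  congr($((Cochain.zero_cochain_comp_v (K := (resCx A T).obj Y) (Cochain.ofHom f) z p q h).trans
    (congrArg (· ≫ _) (Cochain.ofHom_v f p))).hom x)

lemma HomCochain.postcomp_val {X : CochainComplex (ModuleCat.{u} A) ℤ}
    {Y Y' : CochainComplex (ModuleCat.{u} T) ℤ} (g : Y ⟶ Y') {n : ℤ} (z : HomCochain X Y n)
    {p q : ℤ} (h : p + n = q) (x : X.X p) :
    (z.postcomp g).val h x = (g.f q).hom (z.val h x) :=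
  congr($((Cochain.comp_zero_cochain_v (G := (resCx A T).obj Y) z
    (Cochain.ofHom ((resCx A T).map g)) p q h).trans
    (congrArg (_ ≫ ·) (Cochain.ofHom_v ((resCx A T).map g) q))).hom x)

end composition

/-! ### Hom-tensor adjunction into `ℚ/ℤ` for complexes -/

section tensorMap
variable {B T : Type u} [CommRing B] [CommRing T] [Algebra B T]

/-- The tensor product of two morphisms of complexes. -/
abbrev tensorMap {Y Y' : CochainComplex (ModuleCat.{u} T) ℤ}
    {Z Z' : CochainComplex (ModuleCat.{u} B) ℤ} (f : Y ⟶ Y') (g : Z ⟶ Z') :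
    tensorCx Y Z ⟶ tensorCx Y' Z' :=
  HomologicalComplex.mapBifunctorMap f g (tensorBif B T) (ComplexShape.up ℤ)

variable (Y : CochainComplex (ModuleCat.{u} T) ℤ) (Z : CochainComplex (ModuleCat.{u} B) ℤ)

/-- The element `y ⊗ z` of degree `n`. -/
def tmulCx {i j n : ℤ} (h : i + j = n) (y : Y.X i) (z : Z.X j) : (tensorCx Y Z).X n :=
  (ιTensor Y Z i j n h).hom ((show (resMod B T).obj (Y.X i) from y) ⊗ₜ[B] z)

variable {Y Z} in
-- The quotient by the span of the pure tensors receives the zero map from every summand, hence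
-- vanishes.
lemma tensorCx_induction {n : ℤ} {p : (tensorCx Y Z).X n → Prop} (x : (tensorCx Y Z).X n)
    (zero : p 0) (add : ∀ x y, p x → p y → p (x + y))
    (tmul : ∀ i j (h : i + j = n) (y : Y.X i) (z : Z.X j), p (tmulCx Y Z h y z)) : p x := by
  let S : Submodule T ((tensorCx Y Z).X n) :=
    Submodule.span T {x | ∃ i j, ∃ (h : i + j = n) (y : Y.X i) (z : Z.X j), tmulCx Y Z h y z = x}
  have hS : ModuleCat.ofHom S.mkQ = 0 := by
    refine HomologicalComplex.mapBifunctor.hom_ext fun i j h => tensor_hom_ext B T fun y z => ?_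
    exact (Submodule.Quotient.mk_eq_zero _).2 (Submodule.subset_span ⟨i, j, h, y, z, rfl⟩)
  have hx : x ∈ S := (Submodule.Quotient.mk_eq_zero _).1 congr($(hS).hom x)
  induction hx using Submodule.span_induction with
  | mem x hx => obtain ⟨i, j, h, y, z, rfl⟩ := hx; exact tmul i j h y z
  | zero => exact zero
  | add x y _ _ hx hy => exact add x y hx hy
  -- The motive is only assumed additive. Scalars are moved into the left factor of a pure tensor,
  -- and the claim is proved for all multiples of `x` at once.
  | smul t x hx' hx =>
    clear hx
    induction hx' using Submodule.span_induction generalizing t with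
    | mem x hx =>
      obtain ⟨i, j, h, y, z, rfl⟩ := hx
      have : t • tmulCx Y Z h y z = tmulCx Y Z h (t • y) z :=
        ((ιTensor Y Z i j n h).hom.map_smul t _).symm
      rw [this]
      exact tmul i j h _ z
    | zero => rw [smul_zero]; exact zero
    | add x y _ _ hx hy => rw [smul_add]; exact add _ _ (hx t) (hy t)
    | smul s x _ hx => rw [smul_smul]; exact hx _

lemma tensorCx_char_ext {n : ℤ} {c c' : CharacterModule ((tensorCx Y Z).X n)}
    (h : ∀ i j (hij : i + j = n) (y : Y.X i) (z : Z.X j),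
      c (tmulCx Y Z hij y z) = c' (tmulCx Y Z hij y z)) : c = c' := by
  refine DFunLike.ext _ _ fun x => ?_
  induction x using tensorCx_induction with
  | zero => rw [map_zero, map_zero]
  | add x y hx hy => rw [map_add, map_add, hx, hy]
  | tmul i j hij y z => exact h i j hij y z

/-- The `T`-linear map to the characters of `T` that corresponds to a character. -/
def charLin {M : Type u} [AddCommGroup M] [Module T M] (c : CharacterModule M) :
    M →ₗ[T] CharacterModule T where
  toFun x := c.comp (LinearMap.toSpanSingleton T M x).toAddMonoidHom
  map_add' x y := DFunLike.ext _ _ fun t => by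
    change c (t • (x + y)) = c (t • x) + c (t • y)
    rw [smul_add, map_add]
  map_smul' s x := DFunLike.ext _ _ fun t => by
    change c (t • s • x) = c ((s • t) • x)
    rw [smul_smul, smul_eq_mul, mul_comm]

variable {Y Z} in
/-- The character on `Y ⊗ Z` with given restrictions to the summands. -/
def tensorCxChar {n : ℤ} (c : ∀ i j, i + j = n →
    CharacterModule ((resMod B T).obj (Y.X i) ⊗[B] Z.X j)) : CharacterModule ((tensorCx Y Z).X n) :=
  -- The universal property of the direct sum concerns `T`-linear maps, so each character is encoded
  -- as a `T`-linear map to the characters of `T`; evaluation at `1` recovers it.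
  AddMonoidHom.mk' (fun x => show AddCircle (1 : ℚ) from
    (show CharacterModule T from
    (HomologicalComplex.mapBifunctorDesc (K₁ := Y) (K₂ := Z) (F := tensorBif B T)
      (c := ComplexShape.up ℤ) (j := n) (A := ModuleCat.of T (CharacterModule T))
      fun i j h => ModuleCat.ofHom (charLin (c i j h))).hom x) 1) fun x y => by
    rw [map_add]; rfl

lemma tensorCxChar_tmul {n : ℤ} (c : ∀ i j, i + j = n →
    CharacterModule ((resMod B T).obj (Y.X i) ⊗[B] Z.X j)) (i j : ℤ) (h : i + j = n)
    (y : Y.X i) (z : Z.X j) :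
    tensorCxChar c (tmulCx Y Z h y z) =
      c i j h ((show (resMod B T).obj (Y.X i) from y) ⊗ₜ[B] z) := by
  have e := congr($(HomologicalComplex.ι_mapBifunctorDesc (K₁ := Y) (K₂ := Z) (F := tensorBif B T)
      (c := ComplexShape.up ℤ) (j := n) (A := ModuleCat.of T (CharacterModule T))
      (fun i j h => ModuleCat.ofHom (charLin (c i j h))) i j h).hom
        ((show (resMod B T).obj (Y.X i) from y) ⊗ₜ[B] z))
  refine (DFunLike.congr_fun (F := CharacterModule T) e (1 : T)).trans ?_
  change c i j h ((1 : T) • ((show (resMod B T).obj (Y.X i) from y) ⊗ₜ[B] z)) = _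
  rw [one_smul]

lemma tensorCx_d_tmul {i j n i' j' n' : ℤ} (h : i + j = n) (hi : i + 1 = i') (hj : j + 1 = j')
    (hn : n + 1 = n') (y : Y.X i) (z : Z.X j) :
    ((tensorCx Y Z).d n n').hom (tmulCx Y Z h y z) =
      tmulCx Y Z (show i' + j = n' by lia) ((Y.d i i').hom y) z +
      i.negOnePow • tmulCx Y Z (show i + j' = n' by lia) y ((Z.d j j').hom z) := by
  subst hi hj hn
  exact congr($(ιTensor_d Y Z i j n h).hom ((show (resMod B T).obj (Y.X i) from y) ⊗ₜ[B] z))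

variable {Y Z} in
lemma tensorMap_tmul {Y' : CochainComplex (ModuleCat.{u} T) ℤ}
    {Z' : CochainComplex (ModuleCat.{u} B) ℤ} (f : Y ⟶ Y') (g : Z ⟶ Z') {i j n : ℤ}
    (h : i + j = n) (y : Y.X i) (z : Z.X j) :
    ((tensorMap f g).f n).hom (tmulCx Y Z h y z) =
      tmulCx Y' Z' h ((f.f i).hom y) ((g.f j).hom z) :=
  congr($(HomologicalComplex.ι_mapBifunctorMap f g (tensorBif B T) (ComplexShape.up ℤ) i j n h).hom
    ((show (resMod B T).obj (Y.X i) from y) ⊗ₜ[B] z))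

/-- The linear map to a character module that corresponds to a character of a tensor product. -/
def charHom {M : ModuleCat.{u} T} {N : ModuleCat.{u} B}
    (c : CharacterModule ((resMod B T).obj M ⊗[B] N)) :
    (resMod B T).obj M ⟶ (resMod B B).obj (ModuleCat.of B (CharacterModule N)) :=
  (ModuleCat.ofHom (CharacterModule.curry (R := B) (A := (resMod B T).obj M) (B := N) c) :)

/-- The cochain from `Y` to the complex of characters on `Z` given by a character on `Y ⊗ Z`. -/
def tensorDualHom (n m : ℤ) (h : n + m = 0) : CharacterModule ((tensorCx Y Z).X n) →+
    HomCochain ((resCx B T).obj Y) (dualCx Z) m :=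
  AddMonoidHom.mk' (fun c =>
      (HomCochain.mk fun p q hpq => charHom (M := Y.X p) (N := Z.X (-q))
        (c.comp (ιTensor Y Z p (-q) n (by lia)).hom.toAddMonoidHom) :
        HomCochain ((resCx B T).obj Y) (dualCx Z) m)) fun c c' => rfl

/-- A character is determined by pure tensors, and arbitrary characters on the summands glue.
Summandwise this is currying. -/
lemma tensorDualHom_bijective (n m : ℤ) (h : n + m = 0) :
    Function.Bijective (tensorDualHom Y Z n m h) := by
  constructor
  · intro c c' e
    refine tensorCx_char_ext Y Z fun i j hij y z => ?_
    obtain ⟨q, rfl⟩ : ∃ q, j = -q := ⟨-j, (neg_neg j).symm⟩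
    have := congrArg (fun t : HomCochain ((resCx B T).obj Y) (dualCx Z) m =>
      ((t.v i q (by lia)).hom y)) e
    exact DFunLike.congr_fun (F := CharacterModule (Z.X (-q))) this z
  · intro t
    refine ⟨tensorCxChar fun i j hij => CharacterModule.uncurry (R := B)
      ((CharacterModule.dual (Z.XIsoOfEq (neg_neg j).symm).toLinearEquiv.toLinearMap) ∘ₗ
        (t.v i (-j) (by lia)).hom), ?_⟩
    refine HomCochain.ext fun p q hpq => ?_
    refine ModuleCat.hom_ext (LinearMap.ext fun y => ?_)
    refine DFunLike.ext (F := CharacterModule (Z.X (-q))) _ _ fun z => ?_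
    refine (tensorCxChar_tmul Y Z _ _ _ _ y z).trans ?_
    -- The component of `t` that was used has index `- -q`, equal to `q` only propositionally;
    -- generalizing the index removes the transport.
    have key : ∀ (r : ℤ) (_ : r = q) (h1 : p + m = r) (h2 : -q = -r),
      (show CharacterModule (Z.X (-r)) from (t.v p r h1).hom y) ((Z.XIsoOfEq h2).hom.hom z) =
        (show CharacterModule (Z.X (-q)) from (t.v p q hpq).hom y) z := by
      rintro r rfl h1 h2
      rw [HomologicalComplex.XIsoOfEq_rfl]
      rfl
    exact key (- -q) (neg_neg q) (by lia) (by lia)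

/-- Characters on `Y ⊗ Z` are cochains from `Y` to the complex of characters on `Z`. -/
def tensorDualEquiv (n m : ℤ) (h : n + m = 0) : CharacterModule ((tensorCx Y Z).X n) ≃+
    HomCochain ((resCx B T).obj Y) (dualCx Z) m :=
  AddEquiv.ofBijective (tensorDualHom Y Z n m h) (tensorDualHom_bijective Y Z n m h)

variable {Y Z} in
/-- The value of a cochain with values in characters. -/
def charVal {m : ℤ} (t : HomCochain ((resCx B T).obj Y) (dualCx Z) m) {p q : ℤ} (h : p + m = q)
    (y : Y.X p) (z : Z.X (-q)) : AddCircle (1 : ℚ) :=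
  (show CharacterModule (Z.X (-q)) from (t.v p q h).hom y) z

variable {Y Z} in
lemma charVal_ext {m : ℤ} {t t' : HomCochain ((resCx B T).obj Y) (dualCx Z) m}
    (H : ∀ p q (h : p + m = q) y z, charVal t h y z = charVal t' h y z) : t = t' := by
  refine HomCochain.ext fun p q hpq => ?_
  refine ModuleCat.hom_ext (LinearMap.ext fun (y : Y.X p) => ?_)
  exact DFunLike.ext (F := CharacterModule (Z.X (-q))) _ _ fun z => H p q hpq y z

lemma charVal_tensorDualEquiv {n m : ℤ} (h : n + m = 0) (c : CharacterModule ((tensorCx Y Z).X n))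
    (p q : ℤ) (hpq : p + m = q) (y : Y.X p) (z : Z.X (-q)) :
    charVal (tensorDualEquiv Y Z n m h c) hpq y z =
      c (tmulCx Y Z (show p + -q = n by lia) y z) := rfl

variable {Y Z} in
lemma charVal_units_smul {m : ℤ} (e : ℤˣ) (t : HomCochain ((resCx B T).obj Y) (dualCx Z) m)
    {p q : ℤ} (h : p + m = q) (y : Y.X p) (z : Z.X (-q)) :
    charVal (e • t) h y z = e • charVal t h y z := rfl

variable {Y Z} in
lemma charVal_d {m : ℤ} (t : HomCochain ((resCx B T).obj Y) (dualCx Z) m)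
    {p q : ℤ} (h : p + (m + 1) = q) (y : Y.X p) (z : Z.X (-q)) :
    charVal t.d h y z = q.negOnePow • charVal t rfl y ((Z.d (-q) (-(p + m))).hom z) +
      (m + 1).negOnePow • charVal t (show p + 1 + m = q by lia) ((Y.d p (p + 1)).hom y) z := by
  rw [charVal, d_v]
  rfl

/-- The adjunction commutes with the differentials up to the sign `(-1)^n`. This is the reason for
allowing units in `quasiIso_iff_of_dual`. -/
lemma tensorDualEquiv_d (n n' m m' : ℤ) (h : n + m = 0) (h' : n' + m' = 0) (hn : n + 1 = n')
    (c : CharacterModule ((tensorCx Y Z).X n')) :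
    ((homCx ((resCx B T).obj Y) (dualCx Z)).d m' m).hom (tensorDualEquiv Y Z n' m' h' c) =
      n.negOnePow • tensorDualEquiv Y Z n m h
        (CharacterModule.dual ((tensorCx Y Z).d n n').hom c) := by
  obtain rfl : m' + 1 = m := by lia
  refine charVal_ext (t := HomCochain.d (tensorDualEquiv Y Z n' m' h' c)) fun p q hpq y z => ?_
  rw [charVal_d, charVal_units_smul, charVal_tensorDualEquiv, charVal_tensorDualEquiv,
    charVal_tensorDualEquiv]
  change _ = n.negOnePow • c (((tensorCx Y Z).d n n').hom (tmulCx Y Z _ y z))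
  rw [tensorCx_d_tmul Y Z _ rfl (show -q + 1 = -(p + m') by lia) hn, map_add, smul_add,
    Units.smul_def (p.negOnePow), map_zsmul, ← Units.smul_def, smul_smul,
    ← Int.negOnePow_add, add_comm,
    (Int.negOnePow_eq_iff _ _).2 (show Even ((m' + 1) - n) from ⟨-n, by lia⟩),
    (Int.negOnePow_eq_iff _ _).2 (show Even (q - (n + p)) from ⟨-n, by lia⟩)]

variable {Y Z}

/-- A morphism is a quasi-isomorphism after tensoring with `Z` if it induces a quasi-isomorphism
on homomorphisms to the characters of `Z`. -/
lemma quasiIso_tensorMap_left {Y' : CochainComplex (ModuleCat.{u} T) ℤ} (f : Y ⟶ Y')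
    (h : QuasiIso (homCxMapLeft ((resCx B T).map f) (dualCx Z))) :
    QuasiIso (tensorMap f (𝟙 Z)) := by
  refine (quasiIso_iff_of_dual (tensorMap f (𝟙 Z)) _ (tensorDualEquiv Y Z)
    (tensorDualEquiv Y' Z) Int.negOnePow (tensorDualEquiv_d Y Z) (tensorDualEquiv_d Y' Z)
    fun n m h c => ?_).2 h
  refine charVal_ext (t := (tensorDualEquiv Y' Z n m h c).precomp ((resCx B T).map f))
    fun p q hpq y z => ?_
  refine (congrArg (fun t : CharacterModule (Z.X (-q)) => t z)
    (HomCochain.precomp_val ((resCx B T).map f) (tensorDualEquiv Y' Z n m h c) hpq y)).trans ?_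
  exact (congrArg c (tensorMap_tmul f (𝟙 Z) (show p + -q = n by lia) y z)).symm

/-- Under the adjunction the character dual of `Y ⊗ g` is postcomposition with the dual of `g`. -/
lemma quasiIso_tensorMap_right {Z' : CochainComplex (ModuleCat.{u} B) ℤ} (g : Z ⟶ Z')
    (h : QuasiIso (homCxMapRight ((resCx B T).obj Y) (dualMap g))) :
    QuasiIso (tensorMap (𝟙 Y) g) := by
  refine (quasiIso_iff_of_dual (tensorMap (𝟙 Y) g) _ (tensorDualEquiv Y Z)
    (tensorDualEquiv Y Z') Int.negOnePow (tensorDualEquiv_d Y Z) (tensorDualEquiv_d Y Z')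
    fun n m h c => ?_).2 h
  refine charVal_ext (t := (tensorDualEquiv Y Z' n m h c).postcomp (dualMap g))
    fun p q hpq y z => ?_
  refine (congrArg (fun t : CharacterModule (Z.X (-q)) => t z)
    (HomCochain.postcomp_val (dualMap g) (tensorDualEquiv Y Z' n m h c) hpq y)).trans ?_
  exact (congrArg c (tensorMap_tmul (𝟙 Y) g (show p + -q = n by lia) y z)).symm

end tensorMap

/-! ### Naturality of tensor evaluation in its three variables -/

section naturality
variable {A B T : Type u} [CommRing A] [CommRing B] [CommRing T] [Algebra A T] [Algebra B T]

lemma tev_tmul (X : CochainComplex (ModuleCat.{u} A) ℤ) (Y : CochainComplex (ModuleCat.{u} T) ℤ)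
    (Z : CochainComplex (ModuleCat.{u} B) ℤ) {i j n : ℤ} (h : i + j = n) (z : HomCochain X Y i)
    (w : Z.X j) :
    ((tev X Y Z).f n).hom (tmulCx (homCx X Y) Z h z w) = tevCochain X Y Z h z w :=
  congr($(HomologicalComplex.ι_mapBifunctorDesc (K₁ := homCx X Y) (K₂ := Z) (F := tensorBif B T)
      (c := ComplexShape.up ℤ) (j := n) (fun i j h => tevX X Y Z i j n h) i j h).hom
        ((show (resMod B T).obj ((homCx X Y).X i) from z) ⊗ₜ[B] w))

lemma tensorCx_hom_ext {Y : CochainComplex (ModuleCat.{u} T) ℤ}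
    {Z : CochainComplex (ModuleCat.{u} B) ℤ} {K : CochainComplex (ModuleCat.{u} T) ℤ}
    {f g : tensorCx Y Z ⟶ K} (H : ∀ i j n (h : i + j = n) (y : Y.X i) (z : Z.X j),
      (f.f n).hom (tmulCx Y Z h y z) = (g.f n).hom (tmulCx Y Z h y z)) : f = g := by
  refine HomologicalComplex.hom_ext _ _ fun n => ?_
  refine HomologicalComplex.mapBifunctor.hom_ext fun i j h => tensor_hom_ext B T fun y z => ?_
  exact H i j n h y z

lemma tevCochain_val {X : CochainComplex (ModuleCat.{u} A) ℤ}
    {Y : CochainComplex (ModuleCat.{u} T) ℤ}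
    {Z : CochainComplex (ModuleCat.{u} B) ℤ} {i j n : ℤ} (h : i + j = n) (z : HomCochain X Y i)
    (w : Z.X j) {p r q : ℤ} (hpq : p + n = q) (hr : p + i = r) (x : X.X p) :
    (tevCochain X Y Z h z w).val hpq x =
      (p * j).negOnePow • tmulCx Y Z (show r + j = q by lia) (z.val hr x) w := by
  rw [HomCochain.val, tevCochain_v X Y Z h z w p r q hpq hr]
  rfl

lemma tev_naturality_left {X X' : CochainComplex (ModuleCat.{u} A) ℤ} (f : X' ⟶ X)
    (Y : CochainComplex (ModuleCat.{u} T) ℤ) (Z : CochainComplex (ModuleCat.{u} B) ℤ) :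
    tev X Y Z ≫ homCxMapLeft f (tensorCx Y Z) =
      tensorMap (homCxMapLeft f Y) (𝟙 Z) ≫ tev X' Y Z := by
  refine tensorCx_hom_ext fun i j n h (z : HomCochain X Y i) w => ?_
  refine (congrArg ((homCxMapLeft f (tensorCx Y Z)).f n).hom (tev_tmul X Y Z h z w)).trans ?_
  refine Eq.trans ?_ (congrArg ((tev X' Y Z).f n).hom
    (tensorMap_tmul (homCxMapLeft f Y) (𝟙 Z) h z w)).symm
  refine Eq.trans ?_ (tev_tmul X' Y Z h (z.precomp f) w).symm
  refine HomCochain.val_ext (z := (tevCochain X Y Z h z w).precomp f) fun p q hpq x => ?_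
  rw [HomCochain.precomp_val, tevCochain_val h _ _ hpq rfl, tevCochain_val h _ _ hpq rfl,
    HomCochain.precomp_val]

lemma tev_naturality_middle (X : CochainComplex (ModuleCat.{u} A) ℤ)
    {Y Y' : CochainComplex (ModuleCat.{u} T) ℤ} (f : Y ⟶ Y')
    (Z : CochainComplex (ModuleCat.{u} B) ℤ) :
    tev X Y Z ≫ homCxMapRight X (tensorMap f (𝟙 Z)) =
      tensorMap (homCxMapRight X f) (𝟙 Z) ≫ tev X Y' Z := by
  refine tensorCx_hom_ext fun i j n h (z : HomCochain X Y i) w => ?_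
  refine (congrArg ((homCxMapRight X (tensorMap f (𝟙 Z))).f n).hom
    (tev_tmul X Y Z h z w)).trans ?_
  refine Eq.trans ?_ (congrArg ((tev X Y' Z).f n).hom
    (tensorMap_tmul (homCxMapRight X f) (𝟙 Z) h z w)).symm
  refine Eq.trans ?_ (tev_tmul X Y' Z h (z.postcomp f) w).symm
  refine HomCochain.val_ext (z := (tevCochain X Y Z h z w).postcomp (tensorMap f (𝟙 Z)))
    fun p q hpq x => ?_
  rw [HomCochain.postcomp_val, tevCochain_val h _ _ hpq rfl, tevCochain_val h _ _ hpq rfl,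
    HomCochain.postcomp_val, Units.smul_def, Units.smul_def, map_zsmul, tensorMap_tmul]
  rfl

lemma tev_naturality_right (X : CochainComplex (ModuleCat.{u} A) ℤ)
    (Y : CochainComplex (ModuleCat.{u} T) ℤ)
    {Z Z' : CochainComplex (ModuleCat.{u} B) ℤ} (g : Z ⟶ Z') :
    tev X Y Z ≫ homCxMapRight X (tensorMap (𝟙 Y) g) =
      tensorMap (𝟙 (homCx X Y)) g ≫ tev X Y Z' := by
  refine tensorCx_hom_ext fun i j n h (z : HomCochain X Y i) w => ?_
  refine (congrArg ((homCxMapRight X (tensorMap (𝟙 Y) g)).f n).hom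
    (tev_tmul X Y Z h z w)).trans ?_
  refine Eq.trans ?_ (congrArg ((tev X Y Z').f n).hom
    (tensorMap_tmul (𝟙 (homCx X Y)) g h z w)).symm
  refine Eq.trans ?_ (tev_tmul X Y Z' h z ((g.f j).hom w)).symm
  refine HomCochain.val_ext (z := (tevCochain X Y Z h z w).postcomp (tensorMap (𝟙 Y) g))
    fun p q hpq x => ?_
  rw [HomCochain.postcomp_val, tevCochain_val h _ _ hpq rfl, tevCochain_val h _ _ hpq rfl,
    Units.smul_def, Units.smul_def, map_zsmul, tensorMap_tmul]
  rfl

end naturality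



end
end TensorEval

namespace TensorEval
noncomputable section

/-! ### Tensor evaluation of modules -/

section modTev
variable {A B T : Type u} [CommRing A] [CommRing B] [CommRing T] [Algebra A T] [Algebra B T]

/-- The `T`-module `Hom_A (M, N)`. -/
def homMod (M : ModuleCat.{u} A) (N : ModuleCat.{u} T) : ModuleCat.{u} T :=
  ModuleCat.of T (M →ₗ[A] (resMod A T).obj N)

/-- Postcomposition on `Hom_A (M, N)`. -/
def homModMap (M : ModuleCat.{u} A) {N N' : ModuleCat.{u} T} (g : N ⟶ N') :
    homMod M N ⟶ homMod M N' :=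
  ModuleCat.ofHom (X := M →ₗ[A] (resMod A T).obj N) (Y := M →ₗ[A] (resMod A T).obj N')
    { toFun := fun f => ((resMod A T).map g).hom ∘ₗ f
      map_add' := fun f f' => LinearMap.ext fun x => g.hom.map_add (f x) (f' x)
      map_smul' := fun t f => LinearMap.ext fun x => g.hom.map_smul t (f x) }

/-- Precomposition on `Hom_A (M, N)`. -/
def homModPre {M M' : ModuleCat.{u} A} (h : M' ⟶ M) (N : ModuleCat.{u} T) :
    homMod M N ⟶ homMod M' N :=
  ModuleCat.ofHom (X := M →ₗ[A] (resMod A T).obj N) (Y := M' →ₗ[A] (resMod A T).obj N)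
    { toFun := fun f => f ∘ₗ h.hom
      map_add' := fun _ _ => rfl
      map_smul' := fun _ _ => rfl }

variable (M : ModuleCat.{u} A) (N : ModuleCat.{u} T) (L : ModuleCat.{u} B)

/-- The map `x ↦ f x ⊗ l`. -/
def homTmul (f : M →ₗ[A] (resMod A T).obj N) (l : L) :
    M →ₗ[A] (resMod A T).obj (((tensorBif B T).obj N).obj L) :=
  ((resMod A T).map (tmulRight N l)).hom ∘ₗ f

/-- The bilinear map `(f, l) ↦ (x ↦ f x ⊗ l)`. -/
def modTevLin : (resMod B T).obj (homMod M N) →ₗ[T] L →ₗ[B]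
    (resMod B T).obj (homMod M (((tensorBif B T).obj N).obj L)) where
  toFun f :=
    { toFun := fun l => homTmul M N L f l
      map_add' := fun l l' => LinearMap.ext fun x => by
        exact congr($(tmulRight_add N l l').hom ((show M →ₗ[A] (resMod A T).obj N from f) x))
      map_smul' := fun b l => LinearMap.ext fun x => by
        exact congr($(tmulRight_smul N b l).hom ((show M →ₗ[A] (resMod A T).obj N from f) x)) }
  map_add' f f' := LinearMap.ext fun l => LinearMap.ext fun x =>
    (tmulRight N l).hom.map_add ((show M →ₗ[A] (resMod A T).obj N from f) x)
      ((show M →ₗ[A] (resMod A T).obj N from f') x)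
  map_smul' t f := LinearMap.ext fun l => LinearMap.ext fun x =>
    (tmulRight N l).hom.map_smul t ((show M →ₗ[A] (resMod A T).obj N from f) x)

/-- The tensor evaluation homomorphism `Hom_A (M, N) ⊗_B L ⟶ Hom_A (M, N ⊗_B L)`. -/
def modTev : ((tensorBif B T).obj (homMod M N)).obj L ⟶
    homMod M (((tensorBif B T).obj N).obj L) :=
  ModuleCat.ofHom (TensorProduct.AlgebraTensorModule.lift (A := T)
    (P := (resMod B T).obj (homMod M (((tensorBif B T).obj N).obj L))) (modTevLin M N L))

end modTev

/-! ### Components of Hom complexes and tensor complexes -/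

section components
variable {A B T : Type u} [CommRing A] [CommRing B] [CommRing T] [Algebra A T] [Algebra B T]

section
variable (X : CochainComplex (ModuleCat.{u} A) ℤ) (Y : CochainComplex (ModuleCat.{u} T) ℤ)

/-- The component of a cochain. -/
def evalCochain {n p q : ℤ} (h : p + n = q) : (homCx X Y).X n ⟶ homMod (X.X p) (Y.X q) :=
  ModuleCat.ofHom (X := HomCochain X Y n) (Y := X.X p →ₗ[A] (resMod A T).obj (Y.X q))
    { toFun := fun z => (z.v p q h).hom
      map_add' := fun _ _ => rfl
      map_smul' := fun t z => by rw [HomCochain.smul_v]; rfl }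

/-- The cochain with a single component. -/
def singleCochain {n p q : ℤ} (_ : p + n = q) (f : X.X p →ₗ[A] (resMod A T).obj (Y.X q)) :
    HomCochain X Y n :=
  Cochain.single (L := (resCx A T).obj Y) (ModuleCat.ofHom f :) n

variable {X Y}
lemma singleCochain_val {n p q : ℤ} (h : p + n = q) (f : X.X p →ₗ[A] (resMod A T).obj (Y.X q))
    (x : X.X p) : (singleCochain X Y h f).val h x = f x :=
  congr($(Cochain.single_v (L := (resCx A T).obj Y) (ModuleCat.ofHom f :) n h).hom x)

lemma singleCochain_val_of_ne {n p q : ℤ} (h : p + n = q)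
    (f : X.X p →ₗ[A] (resMod A T).obj (Y.X q)) {p' q' : ℤ} (h' : p' + n = q') (hp : p' ≠ p)
    (x : X.X p') : (singleCochain X Y h f).val h' x = 0 :=
  congr($(Cochain.single_v_eq_zero (L := (resCx A T).obj Y) (ModuleCat.ofHom f :) n
    p' q' h' hp).hom x)

lemma HomCochain.val_add {n p q : ℤ} (h : p + n = q) (z z' : HomCochain X Y n) (x : X.X p) :
    (z + z').val h x = z.val h x + z'.val h x := rfl

lemma HomCochain.val_smul {n p q : ℤ} (h : p + n = q) (t : T) (z : HomCochain X Y n) (x : X.X p) :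
    (t • z).val h x = t • z.val h x := by
  rw [HomCochain.val, HomCochain.smul_v]; rfl

lemma HomCochain.val_zero {n p q : ℤ} (h : p + n = q) (x : X.X p) :
    (0 : HomCochain X Y n).val h x = 0 := rfl

lemma HomCochain.val_sum {ι : Type*} (s : Finset ι) {n p q : ℤ} (h : p + n = q)
    (z : ι → HomCochain X Y n) (x : X.X p) :
    (∑ i ∈ s, z i).val h x = ∑ i ∈ s, (z i).val h x :=
  map_sum (AddMonoidHom.mk' (fun z : HomCochain X Y n => z.val h x) fun _ _ => rfl) _ _

variable (X Y) in
/-- The cochains with a single component. -/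
def singleHom {n p q : ℤ} (h : p + n = q) : homMod (X.X p) (Y.X q) ⟶ (homCx X Y).X n :=
  ModuleCat.ofHom (X := X.X p →ₗ[A] (resMod A T).obj (Y.X q)) (Y := HomCochain X Y n)
    { toFun := fun f => singleCochain X Y h f
      map_add' := fun f f' => HomCochain.val_ext fun p' q' h' x => by
        rw [HomCochain.val_add]
        by_cases hp : p' = p
        · obtain rfl := hp
          obtain rfl : q = q' := h.symm.trans h'
          rw [singleCochain_val, singleCochain_val, singleCochain_val]; rfl
        · rw [singleCochain_val_of_ne _ _ _ hp, singleCochain_val_of_ne _ _ _ hp,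
            singleCochain_val_of_ne _ _ _ hp, add_zero]
      map_smul' := fun t f => HomCochain.val_ext fun p' q' h' x => by
        refine Eq.trans ?_ (HomCochain.val_smul h' t (singleCochain X Y h f) x).symm
        by_cases hp : p' = p
        · obtain rfl := hp
          obtain rfl : q = q' := h.symm.trans h'
          rw [singleCochain_val, singleCochain_val]; rfl
        · rw [singleCochain_val_of_ne _ _ _ hp, singleCochain_val_of_ne _ _ _ hp, smul_zero] }

end

section proj
variable (Y : CochainComplex (ModuleCat.{u} T) ℤ) (Z : CochainComplex (ModuleCat.{u} B) ℤ)

/-- The projection of `Y ⊗ Z` to a summand. -/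
def projTensor (i j n : ℤ) (_ : i + j = n) :
    (tensorCx Y Z).X n ⟶ ((tensorBif B T).obj (Y.X i)).obj (Z.X j) :=
  HomologicalComplex.mapBifunctorDesc (K₁ := Y) (K₂ := Z) (F := tensorBif B T)
    (c := ComplexShape.up ℤ) (j := n) fun i' j' _ =>
      if h : i' = i ∧ j' = j then
        ((tensorBif B T).map (Y.XIsoOfEq h.1).hom).app (Z.X j') ≫
          ((tensorBif B T).obj (Y.X i)).map (Z.XIsoOfEq h.2).hom
      else 0

lemma projTensor_tmul {i j n : ℤ} (h : i + j = n) (y : Y.X i) (z : Z.X j) :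
    (projTensor Y Z i j n h).hom (tmulCx Y Z h y z) =
      (show (resMod B T).obj (Y.X i) from y) ⊗ₜ[B] z := by
  refine congr($(HomologicalComplex.ι_mapBifunctorDesc (K₁ := Y) (K₂ := Z) (F := tensorBif B T)
      (c := ComplexShape.up ℤ) (j := n) _ i j h).hom
        ((show (resMod B T).obj (Y.X i) from y) ⊗ₜ[B] z)).trans ?_
  rw [dif_pos ⟨rfl, rfl⟩, HomologicalComplex.XIsoOfEq_rfl, HomologicalComplex.XIsoOfEq_rfl]
  rfl

lemma projTensor_tmul_of_ne {i j n : ℤ} (h : i + j = n) {i' j' : ℤ} (h' : i' + j' = n)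
    (hi : i' ≠ i) (y : Y.X i') (z : Z.X j') :
    (projTensor Y Z i j n h).hom (tmulCx Y Z h' y z) = 0 := by
  refine congr($(HomologicalComplex.ι_mapBifunctorDesc (K₁ := Y) (K₂ := Z) (F := tensorBif B T)
      (c := ComplexShape.up ℤ) (j := n) _ i' j' h').hom
        ((show (resMod B T).obj (Y.X i') from y) ⊗ₜ[B] z)).trans ?_
  rw [dif_neg fun h => hi h.1]
  rfl

variable {Y Z}
lemma tmulCx_add_left {i j n : ℤ} (h : i + j = n) (y y' : Y.X i) (z : Z.X j) :
    tmulCx Y Z h (y + y') z = tmulCx Y Z h y z + tmulCx Y Z h y' z :=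
  (congrArg (ιTensor Y Z i j n h).hom
    (TensorProduct.add_tmul (R := B) (M := (resMod B T).obj (Y.X i)) y y' z)).trans
    (map_add _ _ _)

lemma tmulCx_sum_left {ι : Type*} (s : Finset ι) {i j n : ℤ} (h : i + j = n) (y : ι → Y.X i)
    (z : Z.X j) : tmulCx Y Z h (∑ k ∈ s, y k) z = ∑ k ∈ s, tmulCx Y Z h (y k) z :=
  map_sum (AddMonoidHom.mk' (fun y => tmulCx Y Z h y z) fun y y' => tmulCx_add_left h y y' z) _ _

lemma tmulCx_zero_left {i j n : ℤ} (h : i + j = n) (z : Z.X j) : tmulCx Y Z h 0 z = 0 :=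
  map_zero (AddMonoidHom.mk' (fun y => tmulCx Y Z h y z) fun y y' => tmulCx_add_left h y y' z)

lemma tmulCx_zero_right {i j n : ℤ} (h : i + j = n) (y : Y.X i) : tmulCx Y Z h y 0 = 0 :=
  (congrArg (ιTensor Y Z i j n h).hom
    (TensorProduct.tmul_zero (R := B) (M := (resMod B T).obj (Y.X i)) _ _)).trans (map_zero _)

/-- When `Y` is concentrated in finitely many degrees, a term of `Y ⊗ Z` is a finite biproduct, even
if `Z` is unbounded. -/
lemma sum_projTensor (s : Finset ℤ) (n : ℤ) (hs : ∀ i ∉ s, Limits.IsZero (Y.X i))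
    (x : (tensorCx Y Z).X n) :
    ∑ i ∈ s, (ιTensor Y Z i (n - i) n (by lia)).hom
      ((projTensor Y Z i (n - i) n (by lia)).hom x) = x := by
  induction x using tensorCx_induction with
  | zero => simp only [map_zero, Finset.sum_const_zero]
  | add x y hx hy => simp only [map_add, Finset.sum_add_distrib]; rw [hx, hy]
  | tmul i j h y z =>
    obtain rfl : j = n - i := by lia
    by_cases hi : i ∈ s
    · rw [Finset.sum_eq_single_of_mem i hi, projTensor_tmul]
      · rfl
      · intro i' _ hi'
        rw [projTensor_tmul_of_ne Y Z _ _ hi'.symm, map_zero]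
    · have : Subsingleton (Y.X i) := ModuleCat.isZero_iff_subsingleton.1 (hs i hi)
      rw [Subsingleton.elim y 0, tmulCx_zero_left]
      simp only [map_zero, Finset.sum_const_zero]

end proj
end components
end
end TensorEval

namespace TensorEval
noncomputable section

/-! ### Tensor evaluation of complexes is diagonal -/

section degreewise
variable {A B T : Type u} [CommRing A] [CommRing B] [CommRing T] [Algebra A T] [Algebra B T]
variable (X : CochainComplex (ModuleCat.{u} A) ℤ) (Y : CochainComplex (ModuleCat.{u} T) ℤ)
  (Z : CochainComplex (ModuleCat.{u} B) ℤ)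

/-- The inclusion of `Hom (X^p, Y^q) ⊗ Z^j` in `Hom (X, Y) ⊗ Z`. -/
def inTensorHom (n p q j : ℤ) (h : q + j = p + n) :
    ((tensorBif B T).obj (homMod (X.X p) (Y.X q))).obj (Z.X j) ⟶ (tensorCx (homCx X Y) Z).X n :=
  ((tensorBif B T).map (singleHom X Y (show p + (q - p) = q by lia))).app (Z.X j) ≫
    ιTensor (homCx X Y) Z (q - p) j n (by lia)

/-- The projection of `Hom (X, Y) ⊗ Z` to `Hom (X^p, Y^q) ⊗ Z^j`. -/
def prTensorHom (n p q j : ℤ) (h : q + j = p + n) :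
    (tensorCx (homCx X Y) Z).X n ⟶ ((tensorBif B T).obj (homMod (X.X p) (Y.X q))).obj (Z.X j) :=
  projTensor (homCx X Y) Z (q - p) j n (by lia) ≫
    ((tensorBif B T).map (evalCochain X Y (show p + (q - p) = q by lia))).app (Z.X j)

/-- The inclusion of `Hom (X^p, Y^q ⊗ Z^j)` in `Hom (X, Y ⊗ Z)`. -/
def inHomTensor (n p q j : ℤ) (h : q + j = p + n) :
    homMod (X.X p) (((tensorBif B T).obj (Y.X q)).obj (Z.X j)) ⟶ (homCx X (tensorCx Y Z)).X n :=
  homModMap _ (ιTensor Y Z q j (p + n) h) ≫ singleHom X (tensorCx Y Z) rfl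

/-- The projection of `Hom (X, Y ⊗ Z)` to `Hom (X^p, Y^q ⊗ Z^j)`. -/
def prHomTensor (n p q j : ℤ) (h : q + j = p + n) :
    (homCx X (tensorCx Y Z)).X n ⟶ homMod (X.X p) (((tensorBif B T).obj (Y.X q)).obj (Z.X j)) :=
  evalCochain X (tensorCx Y Z) rfl ≫ homModMap _ (projTensor Y Z q j (p + n) h)

variable {X Y Z}

/-- Together with `prHomTensor_tev` this says that `tev` is diagonal for the decomposition by `(p,
q)`, its entries being the module evaluations up to the Koszul sign `(-1)^(p * j)`. -/
lemma tev_inTensorHom {n p q j : ℤ} (h : q + j = p + n)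
    (x : ((tensorBif B T).obj (homMod (X.X p) (Y.X q))).obj (Z.X j)) :
    ((tev X Y Z).f n).hom ((inTensorHom X Y Z n p q j h).hom x) =
      (p * j).negOnePow • (inHomTensor X Y Z n p q j h).hom ((modTev _ _ _).hom x) := by
  have e : inTensorHom X Y Z n p q j h ≫ (tev X Y Z).f n =
      (p * j).negOnePow • (modTev (X.X p) (Y.X q) (Z.X j) ≫ inHomTensor X Y Z n p q j h) := by
    refine tensor_hom_ext B T fun (f : X.X p →ₗ[A] (resMod A T).obj (Y.X q)) l => ?_
    refine (tev_tmul X Y Z (show (q - p) + j = n by lia) (singleCochain X Y (by lia) f) l).trans ?_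
    refine HomCochain.val_ext (z' := (p * j).negOnePow • singleCochain X (tensorCx Y Z) rfl
      (((resMod A T).map (ιTensor Y Z q j (p + n) h)).hom ∘ₗ homTmul _ _ _ f l))
      fun p' q' h' m => ?_
    refine Eq.trans ?_ (show (p * j).negOnePow • (singleCochain X (tensorCx Y Z) rfl
      (((resMod A T).map (ιTensor Y Z q j (p + n) h)).hom ∘ₗ homTmul _ _ _ f l)).val h' m = _
      from rfl)
    rw [tevCochain_val _ _ _ h' rfl]
    by_cases hp : p' = p
    · obtain rfl := hp
      obtain rfl := h'
      rw [singleCochain_val]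
      congr 1
      -- The degree `p' + (q - p')` produced by the cochain equals `q` only propositionally, so the
      -- index is generalized before evaluating.
      have key : ∀ (r : ℤ) (hr : r = q) (h1 : p' + (q - p') = r) (h2 : r + j = p' + n),
          tmulCx Y Z h2 ((singleCochain X Y (show p' + (q - p') = q by lia) f).val h1 m) l =
          tmulCx Y Z h (f m) l := by
        rintro r rfl h1 h2
        rw [singleCochain_val]
      exact key _ (by lia) rfl _
    · rw [singleCochain_val_of_ne _ _ _ hp, singleCochain_val_of_ne _ _ _ hp, tmulCx_zero_left,
        smul_zero, smul_zero]
  exact congr($(e).hom x)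

lemma prHomTensor_tev {n p q j : ℤ} (h : q + j = p + n) (x : (tensorCx (homCx X Y) Z).X n) :
    (prHomTensor X Y Z n p q j h).hom (((tev X Y Z).f n).hom x) =
      (p * j).negOnePow • (modTev _ _ _).hom ((prTensorHom X Y Z n p q j h).hom x) := by
  induction x using tensorCx_induction with
  | zero => simp only [map_zero, smul_zero]
  | add x y hx hy => simp only [map_add, smul_add, hx, hy]
  | tmul i k hik z w =>
    refine LinearMap.ext (M := X.X p)
      (M₃ := (resMod A T).obj (((tensorBif B T).obj (Y.X q)).obj (Z.X j))) fun x => ?_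
    have e1 : ∀ (z : HomCochain X Y i), (show X.X p →ₗ[A] (resMod A T).obj
        (((tensorBif B T).obj (Y.X q)).obj (Z.X j)) from (prHomTensor X Y Z n p q j h).hom
        (((tev X Y Z).f n).hom (tmulCx (homCx X Y) Z hik z w))) x =
        (projTensor Y Z q j (p + n) h).hom ((p * k).negOnePow •
          tmulCx Y Z (show p + i + k = p + n by lia) (z.val rfl x) w) := by
      intro z
      rw [← tevCochain_val hik z w rfl rfl x]
      exact congrArg (projTensor Y Z q j (p + n) h).hom
        (congrArg (fun t : HomCochain X (tensorCx Y Z) n => t.val rfl x) (tev_tmul X Y Z hik z w))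
    refine (e1 z).trans ?_
    rw [Units.smul_def, map_zsmul, ← Units.smul_def]
    by_cases hi : p + i = q
    · obtain rfl : i = q - p := by lia
      obtain rfl : k = j := by lia
      refine Eq.trans ?_ (congrArg (fun t : X.X p →ₗ[A] (resMod A T).obj
        (((tensorBif B T).obj (Y.X q)).obj (Z.X k)) => (p * k).negOnePow • t x)
        (congrArg (modTev (X.X p) (Y.X q) (Z.X k)).hom
        (congrArg (((tensorBif B T).map (evalCochain X Y (show p + (q - p) = q by lia))).app
          (Z.X k)).hom (projTensor_tmul (homCx X Y) Z hik z w)))).symm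
      have key : ∀ (z : HomCochain X Y (q - p)) (r : ℤ) (hr : r = q) (h1 : p + (q - p) = r)
          (h2 : r + k = p + n),
          (projTensor Y Z q k (p + n) h).hom (tmulCx Y Z h2 (z.val h1 x) w) =
          (show (resMod B T).obj (Y.X q) from z.val hi x) ⊗ₜ[B] w := by
        rintro z r rfl h1 h2
        rw [projTensor_tmul]
      exact congrArg ((p * k).negOnePow • ·) (key z _ hi rfl _)
    · rw [projTensor_tmul_of_ne Y Z _ _ hi, smul_zero]
      symm
      have : (prTensorHom X Y Z n p q j h).hom (tmulCx (homCx X Y) Z hik z w) = 0 := by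
        refine (congrArg (((tensorBif B T).map (evalCochain X Y
          (show p + (q - p) = q by lia))).app (Z.X j)).hom (projTensor_tmul_of_ne (homCx X Y) Z
            (show (q - p) + j = n by lia) hik (by lia) z w)).trans (map_zero _)
      rw [this, map_zero, smul_zero]
      rfl

open Classical in
/-- The component of a cochain, as a cochain. -/
def restrCochain {i : ℤ} (z : HomCochain X Y i) (s : ℤ × ℤ) : HomCochain X Y i :=
  HomCochain.mk fun p q h => if s = (p, q) then z.v p q h else 0

lemma restrCochain_val {i : ℤ} (z : HomCochain X Y i) {p q : ℤ} (h : p + i = q) (x : X.X p) :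
    (restrCochain z (p, q)).val h x = z.val h x := by
  rw [HomCochain.val, restrCochain, HomCochain.mk_v, if_pos rfl]; rfl

lemma restrCochain_val_of_ne {i : ℤ} (z : HomCochain X Y i) {p q : ℤ} (h : p + i = q)
    {s : ℤ × ℤ} (hs : s ≠ (p, q)) (x : X.X p) : (restrCochain z s).val h x = 0 := by
  rw [HomCochain.val, restrCochain, HomCochain.mk_v, if_neg hs]; rfl

lemma in_pr_tensorHom {n i k : ℤ} (hik : i + k = n) (z : HomCochain X Y i) (w : Z.X k)
    (s : ℤ × ℤ) :
    (inTensorHom X Y Z n s.1 s.2 (s.1 + n - s.2) (by lia)).hom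
      ((prTensorHom X Y Z n s.1 s.2 (s.1 + n - s.2) (by lia)).hom
        (tmulCx (homCx X Y) Z hik z w)) =
      tmulCx (homCx X Y) Z hik (restrCochain z s) w := by
  obtain ⟨p, q⟩ := s
  dsimp only
  by_cases hi : p + i = q
  · obtain rfl : i = q - p := by lia
    obtain rfl : k = p + n - q := by lia
    refine (congrArg (fun t => (inTensorHom X Y Z n p q (p + n - q) (by lia)).hom
      ((((tensorBif B T).map (evalCochain X Y (show p + (q - p) = q by lia))).app
        (Z.X (p + n - q))).hom t)) (projTensor_tmul (homCx X Y) Z hik z w)).trans ?_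
    have : restrCochain z (p, q) = singleCochain X Y hi (z.v p q hi).hom := by
      refine HomCochain.val_ext fun p' q' h' m => ?_
      by_cases hp : p' = p
      · subst hp
        obtain rfl : q' = q := by lia
        rw [restrCochain_val, singleCochain_val]; rfl
      · rw [singleCochain_val_of_ne _ _ _ hp, restrCochain_val_of_ne]
        exact fun h => hp (congrArg Prod.fst h).symm
    rw [this]
    rfl
  · have : restrCochain z (p, q) = 0 := by
      refine HomCochain.val_ext fun p' q' h' m => ?_
      rw [restrCochain_val_of_ne, HomCochain.val_zero]
      intro h
      obtain ⟨rfl, rfl⟩ := Prod.ext_iff.1 h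
      exact hi h'
    rw [this]
    refine Eq.trans ?_ (tmulCx_zero_left (Y := homCx X Y) hik w).symm
    refine (congrArg (fun t => (inTensorHom X Y Z n p q (p + n - q) (by lia)).hom
      ((((tensorBif B T).map (evalCochain X Y (show p + (q - p) = q by lia))).app
        (Z.X (p + n - q))).hom t)) (projTensor_tmul_of_ne (homCx X Y) Z
            (show (q - p) + (p + n - q) = n by lia) hik (by lia) z w)).trans ?_
    simp only [map_zero]

/-- Finiteness in degree `n`: the window for `q` comes from `Y`. Outside the window for `p`, either
`X` vanishes or every partner `Z^(p+n-q)` with `q` in range does. The alternative lets one argument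
cover both bounded `X` and bounded `Z`. -/
lemma sum_in_pr_tensorHom {n a b c d : ℤ} (hY : ∀ q, ¬ (a ≤ q ∧ q ≤ b) → Limits.IsZero (Y.X q))
    (hXZ : ∀ p, ¬ (c ≤ p ∧ p ≤ d) → Limits.IsZero (X.X p) ∨
      ∀ q, a ≤ q → q ≤ b → Limits.IsZero (Z.X (p + n - q)))
    (x : (tensorCx (homCx X Y) Z).X n) :
    ∑ s ∈ Finset.Icc c d ×ˢ Finset.Icc a b,
      (inTensorHom X Y Z n s.1 s.2 (s.1 + n - s.2) (by lia)).hom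
        ((prTensorHom X Y Z n s.1 s.2 (s.1 + n - s.2) (by lia)).hom x) = x := by
  induction x using tensorCx_induction with
  | zero => simp only [map_zero, Finset.sum_const_zero]
  | add x y hx hy => simp only [map_add, Finset.sum_add_distrib]; rw [hx, hy]
  | tmul i k hik z w =>
    by_cases hw : Limits.IsZero (Z.X k)
    · have : Subsingleton (Z.X k) := ModuleCat.isZero_iff_subsingleton.1 hw
      rw [Subsingleton.elim w 0, tmulCx_zero_right]
      simp only [map_zero, Finset.sum_const_zero]
    refine (Finset.sum_congr rfl fun s _ => in_pr_tensorHom hik z w s).trans ?_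
    refine (tmulCx_sum_left (Y := homCx X Y) _ hik _ w).symm.trans ?_
    refine congrArg (fun y => tmulCx (homCx X Y) Z hik y w) ?_
    have key : ∀ z : HomCochain X Y i,
        ∑ s ∈ Finset.Icc c d ×ˢ Finset.Icc a b, restrCochain z s = z := by
      intro z
      refine HomCochain.val_ext fun p q h m => ?_
      refine (HomCochain.val_sum _ h _ m).trans ?_
      by_cases hs : (p, q) ∈ Finset.Icc c d ×ˢ Finset.Icc a b
      · rw [Finset.sum_eq_single_of_mem _ hs, restrCochain_val]
        intro s _ hs
        rw [restrCochain_val_of_ne _ _ hs]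
      · have h0 : z.val h m = 0 := by
          rw [Finset.mem_product, Finset.mem_Icc, Finset.mem_Icc, not_and_or] at hs
          by_cases hq : a ≤ q ∧ q ≤ b
          · rcases hXZ p (by tauto) with hX | hZ
            · have : Subsingleton (X.X p) := ModuleCat.isZero_iff_subsingleton.1 hX
              rw [Subsingleton.elim m 0]
              exact map_zero _
            · refine absurd (hZ q hq.1 hq.2) ?_
              obtain rfl : k = p + n - q := by lia
              exact hw
          · have : Subsingleton (Y.X q) := ModuleCat.isZero_iff_subsingleton.1 (hY q hq)
            exact Subsingleton.elim _ _
        rw [h0]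
        refine Finset.sum_eq_zero fun s hs' => ?_
        rw [restrCochain_val_of_ne]
        rintro rfl
        exact hs hs'
    exact key z

lemma sum_in_pr_homTensor {n a b c d : ℤ} (hY : ∀ q, ¬ (a ≤ q ∧ q ≤ b) → Limits.IsZero (Y.X q))
    (hXZ : ∀ p, ¬ (c ≤ p ∧ p ≤ d) → Limits.IsZero (X.X p) ∨
      ∀ q, a ≤ q → q ≤ b → Limits.IsZero (Z.X (p + n - q)))
    (t : HomCochain X (tensorCx Y Z) n) :
    ∑ s ∈ Finset.Icc c d ×ˢ Finset.Icc a b,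
      (show HomCochain X (tensorCx Y Z) n from
        (inHomTensor X Y Z n s.1 s.2 (s.1 + n - s.2) (by lia)).hom
        ((prHomTensor X Y Z n s.1 s.2 (s.1 + n - s.2) (by lia)).hom t)) = t := by
  refine HomCochain.val_ext fun p q h m => ?_
  subst h
  refine (HomCochain.val_sum _ rfl _ m).trans ?_
  have h1 : ∀ q, (HomCochain.val (X := X) (Y := tensorCx Y Z)
      ((inHomTensor X Y Z n p q (p + n - q) (by lia)).hom
        ((prHomTensor X Y Z n p q (p + n - q) (by lia)).hom t)) rfl m) =
      (ιTensor Y Z q (p + n - q) (p + n) (by lia)).hom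
      ((projTensor Y Z q (p + n - q) (p + n) (by lia)).hom (t.val rfl m)) := fun q =>
    singleCochain_val (X := X) (Y := tensorCx Y Z) rfl _ m
  have h2 : ∀ p' q, p ≠ p' → (HomCochain.val (X := X) (Y := tensorCx Y Z)
      ((inHomTensor X Y Z n p' q (p' + n - q) (by lia)).hom
        ((prHomTensor X Y Z n p' q (p' + n - q) (by lia)).hom t)) rfl m) = 0 := fun p' q hp =>
    singleCochain_val_of_ne (X := X) (Y := tensorCx Y Z) rfl _ rfl hp m
  rw [Finset.sum_product]
  by_cases hp : p ∈ Finset.Icc c d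
  · rw [Finset.sum_eq_single_of_mem p hp]
    · refine (Finset.sum_congr rfl fun q _ => h1 q).trans ?_
      exact sum_projTensor _ _ (fun i hi => hY i (by simpa using hi)) _
    · intro p' _ hp'
      exact Finset.sum_eq_zero fun q _ => h2 p' q hp'.symm
  · refine (Finset.sum_eq_zero fun p' hp' => Finset.sum_eq_zero fun q _ => h2 p' q ?_).trans ?_
    · rintro rfl
      exact hp hp'
    · rcases hXZ p (by simpa using hp) with hX | hZ
      · have : Subsingleton (X.X p) := ModuleCat.isZero_iff_subsingleton.1 hX
        rw [Subsingleton.elim m 0]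
        exact (map_zero _).symm
      · refine Eq.trans ?_ (sum_projTensor (Finset.Icc a b) _
          (fun i hi => hY i (by simpa using hi)) (t.val rfl m))
        refine (Finset.sum_eq_zero fun q hq => ?_).symm
        rw [Finset.mem_Icc] at hq
        have : Subsingleton (((tensorBif B T).obj (Y.X q)).obj (Z.X (p + n - q))) :=
          ModuleCat.isZero_iff_subsingleton.1
            (((tensorBif B T).obj (Y.X q)).map_isZero (hZ q hq.1 hq.2))
        rw [Subsingleton.elim ((projTensor Y Z q (p + n - q) (p + n) _).hom _) 0, map_zero]

/-- Both sides are finite sums of their components and `tev` is diagonal, so its kernel and its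
image are computed componentwise. -/
lemma bijective_tev {n a b c d : ℤ} (hY : ∀ q, ¬ (a ≤ q ∧ q ≤ b) → Limits.IsZero (Y.X q))
    (hXZ : ∀ p, ¬ (c ≤ p ∧ p ≤ d) → Limits.IsZero (X.X p) ∨
      ∀ q, a ≤ q → q ≤ b → Limits.IsZero (Z.X (p + n - q)))
    (H : ∀ p q j, Function.Bijective (modTev (X.X p) (Y.X q) (Z.X j)).hom) :
    Function.Bijective ((tev X Y Z).f n).hom := by
  constructor
  · rw [injective_iff_map_eq_zero]
    intro x hx
    rw [← sum_in_pr_tensorHom hY hXZ x]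
    refine Finset.sum_eq_zero fun s _ => ?_
    have h1 := prHomTensor_tev (n := n) (p := s.1) (q := s.2) (j := s.1 + n - s.2) (by lia) x
    rw [hx, map_zero, eq_comm, smul_eq_zero_iff_eq] at h1
    rw [(injective_iff_map_eq_zero _).1 (H _ _ _).1 _ h1, map_zero]
  · intro t
    choose y hy using fun s : ℤ × ℤ => (H s.1 s.2 (s.1 + n - s.2)).2
      ((prHomTensor X Y Z n s.1 s.2 (s.1 + n - s.2) (by lia)).hom t)
    -- Assemble componentwise preimages, each multiplied by the Koszul sign, which squares to one.
    refine ⟨∑ s ∈ Finset.Icc c d ×ˢ Finset.Icc a b, (s.1 * (s.1 + n - s.2)).negOnePow •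
      (inTensorHom X Y Z n s.1 s.2 (s.1 + n - s.2) (by lia)).hom (y s), ?_⟩
    rw [map_sum]
    refine Eq.trans ?_ (sum_in_pr_homTensor hY hXZ t)
    refine Finset.sum_congr rfl fun s _ => ?_
    rw [Units.smul_def, map_zsmul, ← Units.smul_def, tev_inTensorHom, smul_smul,
      Int.units_mul_self, one_smul, hy]

/-- Tensor evaluation is bijective in each degree if it is on all the terms and if only finitely
many terms contribute. -/
lemma isIso_tev_of_bounded (hY : ∃ a b, Y.IsStrictlyGE a ∧ Y.IsStrictlyLE b)
    (hXZ : (∃ a b, X.IsStrictlyGE a ∧ X.IsStrictlyLE b) ∨ ∃ a b, Z.IsStrictlyGE a ∧ Z.IsStrictlyLE b)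
    (H : ∀ p q j, Function.Bijective (modTev (X.X p) (Y.X q) (Z.X j)).hom) :
    IsIso (tev X Y Z) := by
  obtain ⟨a, b, _, _⟩ := hY
  have hY : ∀ q, ¬ (a ≤ q ∧ q ≤ b) → Limits.IsZero (Y.X q) := by
    intro q hq
    by_cases h : a ≤ q
    · exact Y.isZero_of_isStrictlyLE b q (by lia)
    · exact Y.isZero_of_isStrictlyGE a q (by lia)
  have : ∀ n, IsIso ((tev X Y Z).f n) := by
    intro n
    rw [ConcreteCategory.isIso_iff_bijective]
    rcases hXZ with ⟨c, d, _, _⟩ | ⟨c, d, _, _⟩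
    · refine bijective_tev (c := c) (d := d) hY (fun p hp => Or.inl ?_) H
      by_cases h : c ≤ p
      · exact X.isZero_of_isStrictlyLE d p (by lia)
      · exact X.isZero_of_isStrictlyGE c p (by lia)
    -- From `c ≤ p + n - q ≤ d` and `a ≤ q ≤ b` it follows that `c - n + a ≤ p ≤ d - n + b`.
    · refine bijective_tev (c := c - n + a) (d := d - n + b) hY
        (fun p hp => Or.inr fun q h1 h2 => ?_) H
      by_cases h : c ≤ p + n - q
      · exact Z.isZero_of_isStrictlyLE d _ (by lia)
      · exact Z.isZero_of_isStrictlyGE c _ (by lia)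
  exact HomologicalComplex.Hom.isIso_of_components _

end degreewise
end
end TensorEval

namespace TensorEval
noncomputable section

/-! ### Bijectivity of tensor evaluation for modules -/

section modules
variable {A B T : Type u} [CommRing A] [CommRing B] [CommRing T] [Algebra A T] [Algebra B T]

/-- The pure tensor `n ⊗ l`. -/
abbrev tmulBif {N : ModuleCat.{u} T} {L : ModuleCat.{u} B} (n : N) (l : L) :
    ((tensorBif B T).obj N).obj L :=
  (show (resMod B T).obj N from n) ⊗ₜ[B] l

lemma tensorBif_induction {N : ModuleCat.{u} T} {L : ModuleCat.{u} B}
    {p : ((tensorBif B T).obj N).obj L → Prop} (x : ((tensorBif B T).obj N).obj L)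
    (tmul : ∀ (n : N) (l : L), p (tmulBif n l)) (add : ∀ x y, p x → p y → p (x + y)) : p x := by
  refine TensorProduct.induction_on (motive := p) x ?_ tmul add
  have := tmul 0 0
  rwa [tmulBif, TensorProduct.tmul_zero] at this

lemma tmulBif_add_left {N : ModuleCat.{u} T} {L : ModuleCat.{u} B} (n n' : N) (l : L) :
    (tmulBif (n + n') l : ((tensorBif B T).obj N).obj L) = tmulBif n l + tmulBif n' l :=
  TensorProduct.add_tmul (R := B) (M := (resMod B T).obj N) n n' l

lemma tmulBif_add_right {N : ModuleCat.{u} T} {L : ModuleCat.{u} B} (n : N) (l l' : L) :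
    (tmulBif n (l + l') : ((tensorBif B T).obj N).obj L) = tmulBif n l + tmulBif n l' :=
  TensorProduct.tmul_add (R := B) (M := (resMod B T).obj N) n l l'

lemma tmulBif_sum_left {ι : Type*} (s : Finset ι) {N : ModuleCat.{u} T} {L : ModuleCat.{u} B}
    (n : ι → N) (l : L) : (tmulBif (∑ i ∈ s, n i) l : ((tensorBif B T).obj N).obj L) =
      ∑ i ∈ s, tmulBif (n i) l :=
  map_sum (AddMonoidHom.mk' (fun n => (tmulBif n l : ((tensorBif B T).obj N).obj L))
    fun n n' => tmulBif_add_left n n' l) _ _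

lemma tmulBif_sum_right {ι : Type*} (s : Finset ι) {N : ModuleCat.{u} T} {L : ModuleCat.{u} B}
    (n : N) (l : ι → L) : (tmulBif n (∑ i ∈ s, l i) : ((tensorBif B T).obj N).obj L) =
      ∑ i ∈ s, tmulBif n (l i) :=
  map_sum (AddMonoidHom.mk' (fun l => (tmulBif n l : ((tensorBif B T).obj N).obj L))
    fun l l' => tmulBif_add_right n l l') _ _

lemma tmulBif_smul {N : ModuleCat.{u} T} {L : ModuleCat.{u} B} (b : B) (n : N) (l : L) :
    (tmulBif (algebraMap B T b • n) l : ((tensorBif B T).obj N).obj L) = tmulBif n (b • l) :=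
  TensorProduct.smul_tmul (R := B) (M := (resMod B T).obj N) b n l

lemma exists_dual_basis (M : Type u) [AddCommGroup M] [Module A M] [Module.Finite A M]
    [Module.Projective A M] :
    ∃ (n : ℕ) (x : Fin n → M) (φ : Fin n → M →ₗ[A] A), ∀ m, ∑ i, φ i m • x i = m := by
  obtain ⟨n, f, g, _, _, h⟩ := Module.Finite.exists_comp_eq_id_of_projective A M
  refine ⟨n, fun i => f (fun j => if i = j then 1 else 0), fun i => LinearMap.proj i ∘ₗ g, fun m => ?_⟩
  exact (LinearMap.pi_apply_eq_sum_univ f (g m)).symm.trans (LinearMap.congr_fun h m)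

variable (M : ModuleCat.{u} A) (N : ModuleCat.{u} T) (L : ModuleCat.{u} B)

/-- The value of the tensor evaluation. -/
def modTevFun (x : ((tensorBif B T).obj (homMod M N)).obj L) :
    M →ₗ[A] (resMod A T).obj (((tensorBif B T).obj N).obj L) := (modTev M N L).hom x

lemma modTevFun_add (x y : ((tensorBif B T).obj (homMod M N)).obj L) (m : M) :
    modTevFun M N L (x + y) m = modTevFun M N L x m + modTevFun M N L y m := by
  rw [modTevFun, map_add]; rfl

lemma modTevFun_zero (m : M) : modTevFun M N L 0 m = 0 := by
  rw [modTevFun, map_zero]; rfl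

lemma modTevFun_sum {ι : Type*} (s : Finset ι) (x : ι → ((tensorBif B T).obj (homMod M N)).obj L)
    (m : M) : modTevFun M N L (∑ i ∈ s, x i) m = ∑ i ∈ s, modTevFun M N L (x i) m :=
  map_sum (AddMonoidHom.mk' (fun x => modTevFun M N L x m) fun x y => modTevFun_add M N L x y m) _ _

/-- The map `n ↦ (m ↦ φ m • n)`. -/
def smulRightHom (φ : M →ₗ[A] A) : N ⟶ homMod M N :=
  ModuleCat.ofHom (Y := M →ₗ[A] (resMod A T).obj N)
    { toFun := fun n => φ.smulRight (show (resMod A T).obj N from n)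
      map_add' := fun n n' => LinearMap.ext fun m => smul_add (φ m) (show (resMod A T).obj N from n) n'
      map_smul' := fun t n => LinearMap.ext fun m =>
        smul_comm (algebraMap A T (φ m)) t n }

lemma modTevFun_map_smulRightHom (φ : M →ₗ[A] A) (u : ((tensorBif B T).obj N).obj L) (m : M) :
    modTevFun M N L ((((tensorBif B T).map (smulRightHom M N φ)).app L).hom u) m =
      φ m • (show (resMod A T).obj (((tensorBif B T).obj N).obj L) from u) := by
  induction u using tensorBif_induction with
  | tmul n l => rfl
  | add x y hx hy =>
    rw [map_add, modTevFun_add, hx, hy]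
    exact (smul_add (φ m) (show (resMod A T).obj (((tensorBif B T).obj N).obj L) from x) y).symm

/-- With a dual basis `(x i, φ i)` of `M`, the inverse sends `t` to the sum of the images of `t (x
i)` under the maps `N ⊗ L → Hom (M, N) ⊗ L` given by `n ↦ φ i • n`. -/
lemma bijective_modTev_of_finite_projective_left [Module.Finite A M] [Module.Projective A M] :
    Function.Bijective (modTev M N L).hom := by
  obtain ⟨k, x, φ, h⟩ := exists_dual_basis (A := A) M
  let s (t : M →ₗ[A] (resMod A T).obj (((tensorBif B T).obj N).obj L)) :
      ((tensorBif B T).obj (homMod M N)).obj L :=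
    ∑ i, (((tensorBif B T).map (smulRightHom M N (φ i))).app L).hom (t (x i))
  have h0 {K : ModuleCat.{u} A} (f : M →ₗ[A] K) (m : M) : ∑ i, φ i m • f (x i) = f m := by
    rw [← congrArg f (h m), map_sum]
    exact Finset.sum_congr rfl fun i _ => (map_smul f _ _).symm
  have h1 : ∀ y, s (modTevFun M N L y) = y := by
    intro y
    induction y using tensorBif_induction with
    | tmul f l =>
      refine (tmulBif_sum_left (N := homMod M N) _ (fun i => (smulRightHom M N (φ i)).hom
        ((show M →ₗ[A] (resMod A T).obj N from f) (x i))) l).symm.trans ?_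
      refine congrArg (fun t => tmulBif (N := homMod M N) t l) ?_
      refine LinearMap.ext (M := M) (M₃ := (resMod A T).obj N) fun m => ?_
      refine Eq.trans ?_ (h0 (show M →ₗ[A] (resMod A T).obj N from f) m)
      exact LinearMap.sum_apply (M := M) (M₂ := (resMod A T).obj N) _ _ _
    | add y y' hy hy' =>
      refine Eq.trans ?_ (congrArg₂ (· + ·) hy hy')
      refine Eq.trans ?_ Finset.sum_add_distrib
      refine Finset.sum_congr rfl fun i _ => ?_
      exact (congrArg (((tensorBif B T).map (smulRightHom M N (φ i))).app L).hom
        (modTevFun_add M N L y y' (x i))).trans (map_add _ _ _)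
  have h2 : ∀ t, modTevFun M N L (s t) = t := by
    intro t
    refine LinearMap.ext fun m => ?_
    rw [modTevFun_sum]
    refine (Finset.sum_congr rfl fun i _ => modTevFun_map_smulRightHom M N L _ _ m).trans ?_
    exact h0 t m
  exact ⟨fun y y' e => by rw [← h1 y, ← h1 y']; exact congrArg s e, fun t => ⟨s t, h2 t⟩⟩

variable {L} in
/-- The contraction `n ⊗ l ↦ ψ l • n`. -/
def contract (ψ : L →ₗ[B] B) : ((tensorBif B T).obj N).obj L ⟶ N :=
  ModuleCat.ofHom (TensorProduct.AlgebraTensorModule.lift (A := T) (P := (resMod B T).obj N)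
    { toFun := fun n => ψ.smulRight n
      map_add' := fun n n' => LinearMap.ext fun l => smul_add (ψ l) n n'
      map_smul' := fun t n => LinearMap.ext fun l => smul_comm (algebraMap B T (ψ l)) t
        (show N from n) })

/-- With a dual basis `(l i, ψ i)` of `L`, the inverse sends `t` to the sum of `(contract N (ψ i) ∘
t) ⊗ l i`. -/
lemma bijective_modTev_of_finite_projective_right [Module.Finite B L] [Module.Projective B L] :
    Function.Bijective (modTev M N L).hom := by
  obtain ⟨k, l, ψ, h⟩ := exists_dual_basis (A := B) L
  let s (t : M →ₗ[A] (resMod A T).obj (((tensorBif B T).obj N).obj L)) :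
      ((tensorBif B T).obj (homMod M N)).obj L :=
    ∑ i, tmulBif (N := homMod M N) (((resMod A T).map (contract N (ψ i))).hom ∘ₗ t) (l i)
  have h0 (N : ModuleCat.{u} T) (u : ((tensorBif B T).obj N).obj L) :
      ∑ i, tmulBif ((contract N (ψ i)).hom u) (l i) = u := by
    induction u using tensorBif_induction with
    | tmul n l' =>
      refine Eq.trans ?_ (congrArg (tmulBif n) (h l'))
      rw [tmulBif_sum_right]
      exact Finset.sum_congr rfl fun i _ => tmulBif_smul _ _ _
    | add x y hx hy =>
      refine Eq.trans ?_ (congrArg₂ (· + ·) hx hy)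
      refine Eq.trans ?_ Finset.sum_add_distrib
      refine Finset.sum_congr rfl fun i _ => ?_
      rw [map_add, tmulBif_add_left]
  have h1 : ∀ y, s (modTevFun M N L y) = y := by
    intro y
    induction y using tensorBif_induction with
    | tmul f l' =>
      exact h0 (homMod M N) (tmulBif f l')
    | add y y' hy hy' =>
      refine Eq.trans ?_ (congrArg₂ (· + ·) hy hy')
      refine Eq.trans ?_ Finset.sum_add_distrib
      refine Finset.sum_congr rfl fun i _ => ?_
      refine Eq.trans ?_ (tmulBif_add_left (N := homMod M N) _ _ _)
      refine congrArg (fun t => tmulBif (N := homMod M N) t (l i)) ?_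
      refine LinearMap.ext (M := M) (M₃ := (resMod A T).obj N) fun m => ?_
      exact (congrArg (contract N (ψ i)).hom (modTevFun_add M N L y y' m)).trans (map_add _ _ _)
  have h2 : ∀ t, modTevFun M N L (s t) = t := by
    intro t
    refine LinearMap.ext fun m => ?_
    rw [modTevFun_sum]
    exact h0 N (t m)
  exact ⟨fun y y' e => by rw [← h1 y, ← h1 y']; exact congrArg s e, fun t => ⟨s t, h2 t⟩⟩

lemma modTev_naturality_left {M M' : ModuleCat.{u} A} (h : M' ⟶ M) :
    ((tensorBif B T).map (homModPre h N)).app L ≫ modTev M' N L =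
      modTev M N L ≫ homModPre h _ :=
  tensor_hom_ext B T fun _ _ => rfl

lemma modTev_naturality_right {L L' : ModuleCat.{u} B} (h : L ⟶ L') :
    ((tensorBif B T).obj (homMod M N)).map h ≫ modTev M N L' =
      modTev M N L ≫ homModMap M (((tensorBif B T).obj N).map h) :=
  tensor_hom_ext B T fun _ _ => rfl

lemma homModPre_exact {M₁ M₂ M₃ : ModuleCat.{u} A} (f : M₁ ⟶ M₂) (g : M₂ ⟶ M₃)
    (h : Function.Exact f.hom g.hom) (hg : Function.Surjective g.hom) :
    Function.Exact (homModPre g N).hom (homModPre f N).hom :=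
  LinearMap.exact_lcomp_of_exact_of_surjective ((resMod A T).obj N) h hg

lemma homModPre_injective {M₂ M₃ : ModuleCat.{u} A} (g : M₂ ⟶ M₃)
    (hg : Function.Surjective g.hom) : Function.Injective (homModPre g N).hom := fun f f' e =>
  (LinearMap.cancel_right (f := (show M₃ →ₗ[A] (resMod A T).obj N from f))
    (f' := (show M₃ →ₗ[A] (resMod A T).obj N from f')) (g := g.hom) hg).1 e

lemma tensorBif_exact_left [Module.Flat B L] {N₁ N₂ N₃ : ModuleCat.{u} T} (f : N₁ ⟶ N₂)
    (g : N₂ ⟶ N₃) (h : Function.Exact f.hom g.hom) :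
    Function.Exact (((tensorBif B T).map f).app L).hom (((tensorBif B T).map g).app L).hom := by
  have := Module.Flat.rTensor_exact (R := B) L (f := ((resMod B T).map f).hom)
    (g := ((resMod B T).map g).hom) h
  exact this

lemma tensorBif_injective_left [Module.Flat B L] {N₁ N₂ : ModuleCat.{u} T} (f : N₁ ⟶ N₂)
    (h : Function.Injective f.hom) :
    Function.Injective (((tensorBif B T).map f).app L).hom := by
  have := Module.Flat.rTensor_preserves_injective_linearMap (R := B) (M := L)
    ((resMod B T).map f).hom h
  exact this

/-- Five lemma for a finite free presentation of `M`: `Hom` turns it into a left exact sequence, and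
tensoring with the flat `L` keeps it so. -/
lemma bijective_modTev_of_finitePresentation_left [Module.FinitePresentation A M]
    [Module.Flat B L] : Function.Bijective (modTev M N L).hom := by
  obtain ⟨n, m, f, g, hf, hfg⟩ := Module.FinitePresentation.exists_fin' A M
  let F : ModuleCat.{u} A := ModuleCat.of A (Fin n → A)
  let F' : ModuleCat.{u} A := ModuleCat.of A (Fin m → A)
  let f' : F ⟶ M := ModuleCat.ofHom f
  let g' : F' ⟶ F := ModuleCat.ofHom g
  refine LinearMap.bijective_of_bijective_of_injective_of_left_exact
    (((tensorBif B T).map (homModPre f' N)).app L).hom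
    (((tensorBif B T).map (homModPre g' N)).app L).hom
    (homModPre f' _).hom (homModPre g' _).hom (modTev M N L).hom (modTev F N L).hom
    (modTev F' N L).hom ?_ ?_ ?_ ?_ ?_ ?_ ?_ ?_
  · exact congrArg ModuleCat.Hom.hom (modTev_naturality_left N L f').symm
  · exact congrArg ModuleCat.Hom.hom (modTev_naturality_left N L g').symm
  · exact tensorBif_exact_left L _ _ (homModPre_exact N g' f' hfg hf)
  · exact homModPre_exact _ g' f' hfg hf
  · exact bijective_modTev_of_finite_projective_left F N L
  · exact (bijective_modTev_of_finite_projective_left F' N L).1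
  · exact tensorBif_injective_left L _ (homModPre_injective N f' hf)
  · exact homModPre_injective _ f' hf

/-- Five lemma for a finite free presentation of `L`: tensoring is right exact, and `Hom (M, -)`
preserves this because `M` is projective. -/
lemma bijective_modTev_of_finitePresentation_right [Module.FinitePresentation B L]
    [Module.Projective A M] : Function.Bijective (modTev M N L).hom := by
  obtain ⟨n, m, f, g, hf, hfg⟩ := Module.FinitePresentation.exists_fin' B L
  let F : ModuleCat.{u} B := ModuleCat.of B (Fin n → B)
  let F' : ModuleCat.{u} B := ModuleCat.of B (Fin m → B)
  let f' : F ⟶ L := ModuleCat.ofHom f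
  let g' : F' ⟶ F := ModuleCat.ofHom g
  have hs : Function.Surjective (((tensorBif B T).obj N).map f').hom :=
    LinearMap.lTensor_surjective ((resMod B T).obj N) hf
  have he : Function.Exact (((tensorBif B T).obj N).map g').hom
    (((tensorBif B T).obj N).map f').hom := lTensor_exact ((resMod B T).obj N) hfg hf
  refine LinearMap.bijective_of_surjective_of_bijective_of_right_exact
    (((tensorBif B T).obj (homMod M N)).map g').hom
    (((tensorBif B T).obj (homMod M N)).map f').hom
    (homModMap M (((tensorBif B T).obj N).map g')).hom
    (homModMap M (((tensorBif B T).obj N).map f')).hom (modTev M N F').hom (modTev M N F).hom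
    (modTev M N L).hom ?_ ?_ ?_ ?_ ?_ ?_ ?_ ?_
  · exact congrArg ModuleCat.Hom.hom (modTev_naturality_right M N g').symm
  · exact congrArg ModuleCat.Hom.hom (modTev_naturality_right M N f').symm
  · exact lTensor_exact ((resMod B T).obj (homMod M N)) hfg hf
  · intro t
    constructor
    · intro ht
      -- By exactness `t` lands in the range of the first map, so projectivity lifts it along the
      -- corestriction to that range.
      obtain ⟨s, hs⟩ := Module.projective_lifting_property
        ((resMod A T).map (((tensorBif B T).obj N).map g')).hom.rangeRestrict
        (LinearMap.codRestrict _ (show M →ₗ[A] (resMod A T).obj _ from t) fun m => by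
          exact (he _).1 (LinearMap.congr_fun (f := ((resMod A T).map
            (((tensorBif B T).obj N).map f')).hom ∘ₗ t) (g := 0) ht m)) (LinearMap.surjective_rangeRestrict _)
      exact ⟨s, LinearMap.ext fun m => congrArg Subtype.val (LinearMap.congr_fun hs m)⟩
    · rintro ⟨s, rfl⟩
      refine LinearMap.ext (M := M) (M₃ := (resMod A T).obj (((tensorBif B T).obj N).obj L)) fun m => ?_
      exact (he _).2 ⟨_, rfl⟩
  · exact (bijective_modTev_of_finite_projective_right M N F').2
  · exact bijective_modTev_of_finite_projective_right M N F
  · exact LinearMap.lTensor_surjective ((resMod B T).obj (homMod M N)) hf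
  · intro t
    exact Module.projective_lifting_property ((resMod A T).map (((tensorBif B T).obj N).map f')).hom
      (show M →ₗ[A] (resMod A T).obj _ from t) hs

end modules
end
end TensorEval

namespace TensorEval
noncomputable section

/-! ### Vanishing of Ext in short exact sequences -/

section orth
open Abelian
variable {R : Type u} [CommRing R]

/-- A short exact sequence of modules. -/
structure IsSES {M₁ M₂ M₃ : ModuleCat.{u} R} (f : M₁ ⟶ M₂) (g : M₂ ⟶ M₃) : Prop where
  inj : Function.Injective f.hom
  exact : Function.Exact f.hom g.hom
  surj : Function.Surjective g.hom

namespace IsSES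
variable {M₁ M₂ M₃ : ModuleCat.{u} R} {f : M₁ ⟶ M₂} {g : M₂ ⟶ M₃} (h : IsSES f g)
include h

lemma comp_zero : f ≫ g = 0 := by
  ext x
  exact (h.exact _).2 ⟨x, rfl⟩

lemma shortExact : (ShortComplex.mk f g h.comp_zero).ShortExact where
  exact := (ShortComplex.moduleCat_exact_iff _).2 fun x hx => (h.exact x).1 hx
  mono_f := (ModuleCat.mono_iff_injective f).2 h.inj
  epi_g := (ModuleCat.epi_iff_surjective g).2 h.surj

end IsSES

lemma IsSES.of_linearMap {M₁ M₂ M₃ : Type u} [AddCommGroup M₁] [AddCommGroup M₂] [AddCommGroup M₃]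
    [Module R M₁] [Module R M₂] [Module R M₃] {f : M₁ →ₗ[R] M₂} {g : M₂ →ₗ[R] M₃}
    (hf : Function.Injective f) (h : Function.Exact f g) (hg : Function.Surjective g) :
    IsSES (ModuleCat.ofHom f) (ModuleCat.ofHom g) := ⟨hf, h, hg⟩

/-- All the modules `Ext^i (X, B)` with `i > 0` vanish. -/
def Orth (X B : ModuleCat.{u} R) : Prop := ∀ n : ℕ, Subsingleton (Ext X B (n + 1))

lemma Orth.of_projective {X B : ModuleCat.{u} R} [Projective X] : Orth X B := fun n =>
  Ext.subsingleton_of_projective X B n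

lemma Orth.of_injective {X B : ModuleCat.{u} R} [Injective B] : Orth X B := fun n =>
  Ext.subsingleton_of_injective X B n

section ses
variable {M₁ M₂ M₃ : ModuleCat.{u} R} {f : M₁ ⟶ M₂} {g : M₂ ⟶ M₃} (h : IsSES f g)
  (B : ModuleCat.{u} R)
include h

lemma IsSES.subsingleton_left₁ (n : ℕ) (h₂ : Subsingleton (Ext M₂ B n))
    (h₃ : Subsingleton (Ext M₃ B (n + 1))) : Subsingleton (Ext M₁ B n) := by
  refine subsingleton_of_forall_eq 0 fun x => ?_
  obtain ⟨y, rfl⟩ := Ext.contravariant_sequence_exact₁ h.shortExact B x (add_comm 1 n)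
    (Subsingleton.elim _ _)
  rw [Subsingleton.elim y 0, Ext.comp_zero]

lemma IsSES.subsingleton_left₂ (n : ℕ) (h₁ : Subsingleton (Ext M₁ B n))
    (h₃ : Subsingleton (Ext M₃ B n)) : Subsingleton (Ext M₂ B n) := by
  refine subsingleton_of_forall_eq 0 fun x => ?_
  obtain ⟨y, rfl⟩ := Ext.contravariant_sequence_exact₂ h.shortExact B x (Subsingleton.elim _ _)
  rw [Subsingleton.elim y 0, Ext.comp_zero]

lemma IsSES.subsingleton_left₃ (n : ℕ) (h₁ : Subsingleton (Ext M₁ B n))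
    (h₂ : Subsingleton (Ext M₂ B (n + 1))) : Subsingleton (Ext M₃ B (n + 1)) := by
  refine subsingleton_of_forall_eq 0 fun x => ?_
  obtain ⟨y, rfl⟩ := Ext.contravariant_sequence_exact₃ h.shortExact B x (Subsingleton.elim _ _)
    (add_comm 1 n)
  rw [Subsingleton.elim y 0, Ext.comp_zero]

lemma IsSES.subsingleton_right₁ (n : ℕ) (h₂ : Subsingleton (Ext B M₂ (n + 1)))
    (h₃ : Subsingleton (Ext B M₃ n)) : Subsingleton (Ext B M₁ (n + 1)) := by
  refine subsingleton_of_forall_eq 0 fun x => ?_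
  obtain ⟨y, rfl⟩ := Ext.covariant_sequence_exact₁ B h.shortExact x (Subsingleton.elim _ _) rfl
  rw [Subsingleton.elim y 0, Ext.zero_comp]

lemma IsSES.subsingleton_right₂ (n : ℕ) (h₁ : Subsingleton (Ext B M₁ n))
    (h₃ : Subsingleton (Ext B M₃ n)) : Subsingleton (Ext B M₂ n) := by
  refine subsingleton_of_forall_eq 0 fun x => ?_
  obtain ⟨y, rfl⟩ := Ext.covariant_sequence_exact₂ B h.shortExact x (Subsingleton.elim _ _)
  rw [Subsingleton.elim y 0, Ext.zero_comp]

lemma IsSES.subsingleton_right₃ (n : ℕ) (h₂ : Subsingleton (Ext B M₂ n))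
    (h₁ : Subsingleton (Ext B M₁ (n + 1))) : Subsingleton (Ext B M₃ n) := by
  refine subsingleton_of_forall_eq 0 fun x => ?_
  obtain ⟨y, rfl⟩ := Ext.covariant_sequence_exact₃ B h.shortExact x rfl (Subsingleton.elim _ _)
  rw [Subsingleton.elim y 0, Ext.zero_comp]

variable {B}
lemma IsSES.orth_left₁ (h₂ : Orth M₂ B) (h₃ : Orth M₃ B) : Orth M₁ B := fun n =>
  h.subsingleton_left₁ B _ (h₂ n) (h₃ (n + 1))

lemma IsSES.orth_left₂ (h₁ : Orth M₁ B) (h₃ : Orth M₃ B) : Orth M₂ B := fun n =>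
  h.subsingleton_left₂ B _ (h₁ n) (h₃ n)

lemma IsSES.orth_right₂ (h₁ : Orth B M₁) (h₃ : Orth B M₃) : Orth B M₂ := fun n =>
  h.subsingleton_right₂ B _ (h₁ n) (h₃ n)

lemma IsSES.orth_right₃ (h₂ : Orth B M₂) (h₁ : Orth B M₁) : Orth B M₃ := fun n =>
  h.subsingleton_right₃ B _ (h₂ n) (h₁ (n + 1))

/-- A map from the kernel of an epimorphism extends if the obstruction group vanishes. -/
lemma IsSES.exists_extension (h₃ : Subsingleton (Ext M₃ B 1)) (k : M₁ ⟶ B) :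
    ∃ l : M₂ ⟶ B, f ≫ l = k := by
  obtain ⟨y, hy⟩ := Ext.contravariant_sequence_exact₁ h.shortExact B (Ext.mk₀ k) (add_zero 1)
    (Subsingleton.elim _ _)
  obtain ⟨l, rfl⟩ := (Ext.mk₀_bijective _ _).2 y
  refine ⟨l, (Ext.mk₀_bijective _ _).1 ?_⟩
  rw [← hy, Ext.mk₀_comp_mk₀]

/-- A map to the cokernel of a monomorphism lifts if the obstruction group vanishes. -/
lemma IsSES.exists_lift (h₁ : Subsingleton (Ext B M₁ 1)) (k : B ⟶ M₃) :
    ∃ l : B ⟶ M₂, l ≫ g = k := by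
  obtain ⟨y, hy⟩ := Ext.covariant_sequence_exact₃ B h.shortExact (Ext.mk₀ k) (zero_add 1)
    (Subsingleton.elim _ _)
  obtain ⟨l, rfl⟩ := (Ext.mk₀_bijective _ _).2 y
  refine ⟨l, (Ext.mk₀_bijective _ _).1 ?_⟩
  rw [← hy, Ext.mk₀_comp_mk₀]

end ses

lemma Orth.of_iso_left {X X' B : ModuleCat.{u} R} (e : X ≅ X') (h : Orth X B) : Orth X' B := fun n => by
  refine subsingleton_of_forall_eq 0 fun x => ?_
  have := h n
  rw [← Ext.mk₀_id_comp x, ← e.inv_hom_id, ← Ext.mk₀_comp_mk₀_assoc,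
    Subsingleton.elim ((Ext.mk₀ e.hom).comp x (zero_add _)) 0, Ext.comp_zero]

lemma Orth.of_iso_right {X B B' : ModuleCat.{u} R} (e : B ≅ B') (h : Orth X B) : Orth X B' :=
  fun n => by
  refine subsingleton_of_forall_eq 0 fun x => ?_
  have := h n
  rw [← Ext.comp_mk₀_id x, ← e.inv_hom_id, ← Ext.mk₀_comp_mk₀, ← Ext.comp_assoc_of_third_deg_zero,
    Subsingleton.elim (x.comp (Ext.mk₀ e.inv) (add_zero _)) 0, Ext.zero_comp]

end orth

/-! ### Cycles of acyclic complexes -/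

section cycles
variable {R : Type u} [CommRing R] (N : CochainComplex (ModuleCat.{u} R) ℤ)

/-- The module of cycles. -/
def cyc (p : ℤ) : ModuleCat.{u} R := ModuleCat.of R (LinearMap.ker (N.d p (p + 1)).hom)

/-- The inclusion of the cycles. -/
def cycι (p : ℤ) : cyc N p ⟶ N.X p := ModuleCat.ofHom (LinearMap.ker (N.d p (p + 1)).hom).subtype

lemma d_d_apply {i j k : ℤ} (x : N.X i) : (N.d j k).hom ((N.d i j).hom x) = 0 :=
  congr($(N.d_comp_d i j k).hom x)

/-- The differential, as a map to the cycles. -/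
def cycπ (p q : ℤ) : N.X p ⟶ cyc N q :=
  ModuleCat.ofHom ((N.d p q).hom.codRestrict _ fun x => d_d_apply N x)

lemma cycπ_ι (p q : ℤ) : cycπ N p q ≫ cycι N q = N.d p q := rfl

variable {N}
lemma isSES_cyc (hN : N.Acyclic) {p q : ℤ} (h : p + 1 = q) : IsSES (cycι N p) (cycπ N p q) := by
  subst h
  refine ⟨Subtype.val_injective, fun x => ?_, fun x => ?_⟩
  · exact Iff.trans ⟨fun h => congrArg Subtype.val h, fun h => Subtype.ext h⟩
      (show (N.d p (p + 1)).hom x = 0 ↔ _ from ⟨fun h => ⟨⟨x, h⟩, rfl⟩, fun ⟨y, hy⟩ => hy ▸ y.2⟩)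
  · obtain ⟨y, hy⟩ := (exactAt_iff_forall N rfl rfl).1 (hN (p + 1)) x.1 x.2
    exact ⟨y, Subtype.ext hy⟩

lemma cyc_isZero {p : ℤ} (h : Limits.IsZero (N.X p)) : Limits.IsZero (cyc N p) := by
  have : Subsingleton (N.X p) := ModuleCat.isZero_iff_subsingleton.1 h
  exact ModuleCat.isZero_iff_subsingleton.2 (inferInstanceAs (Subsingleton (LinearMap.ker _)))

lemma Orth.of_isZero_left {X B : ModuleCat.{u} R} (h : Limits.IsZero X) : Orth X B := by
  have : Projective X := h.projective
  exact Orth.of_projective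

lemma Orth.of_isZero_right {X B : ModuleCat.{u} R} (h : Limits.IsZero B) : Orth X B := by
  have : Injective B := h.injective
  exact Orth.of_injective

/-- Descending induction along the integers. -/
lemma int_descending {p : ℤ → Prop} (b : ℤ) (h0 : ∀ n, b ≤ n → p n) (h : ∀ n, p (n + 1) → p n)
    (n : ℤ) : p n := by
  obtain ⟨k, hk⟩ : ∃ k : ℕ, b ≤ n + k := ⟨(b - n).toNat, by lia⟩
  induction k generalizing n with
  | zero => exact h0 n (by simpa using hk)
  | succ k ih => exact h n (ih (n + 1) (by push_cast at hk; lia))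

/-- Ascending induction along the integers. -/
lemma int_ascending {p : ℤ → Prop} (b : ℤ) (h0 : ∀ n, n ≤ b → p n) (h : ∀ n, p n → p (n + 1))
    (n : ℤ) : p n := by
  obtain ⟨k, hk⟩ : ∃ k : ℕ, n - k ≤ b := ⟨(n - b).toNat, by lia⟩
  induction k generalizing n with
  | zero => exact h0 n (by simpa using hk)
  | succ k ih =>
    have := h (n - 1) (ih (n - 1) (by push_cast at hk; lia))
    rwa [sub_add_cancel] at this

/-- A map that vanishes on boundaries factors through the cycles in degree `p + 1`; the obstruction
to extending it to `N^(p+1)` lies in `Ext^1` of the next module of cycles. -/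
lemma extends_of_orth_cyc (hN : N.Acyclic) {B : ModuleCat.{u} R} (h : ∀ p, Orth (cyc N p) B)
    (p : ℤ) (f : N.X p ⟶ B) (hf : N.d (p - 1) p ≫ f = 0) :
    ∃ g : N.X (p + 1) ⟶ B, N.d p (p + 1) ≫ g = f := by
  have h1 := isSES_cyc hN (sub_add_cancel p 1)
  have h2 := isSES_cyc hN (p := p) rfl
  have h3 := isSES_cyc hN (p := p + 1) rfl
  have hz : cycι N p ≫ f = 0 := by
    ext x
    obtain ⟨y, rfl⟩ := h1.surj x
    exact congr($(hf).hom y)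
  have : Epi (ShortComplex.mk _ _ h2.comp_zero).g := (ModuleCat.epi_iff_surjective _).2 h2.surj
  let k : cyc N (p + 1) ⟶ B := h2.shortExact.exact.desc f hz
  have hk : cycπ N p (p + 1) ≫ k = f := h2.shortExact.exact.g_desc f hz
  obtain ⟨g, hg⟩ := h3.exists_extension (h _ 0) k
  exact ⟨g, by rw [← cycπ_ι, Category.assoc, hg, hk]⟩

/-- The map lands in the cycles, and the obstruction to lifting it along `N^(p-1) → cyc N p` is in
`Ext^1 (X, cyc N (p-1))`. -/
lemma lifts_of_orth_cyc (hN : N.Acyclic) {X : ModuleCat.{u} R} (h : ∀ p, Orth X (cyc N p))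
    (p : ℤ) (f : X ⟶ N.X p) (hf : f ≫ N.d p (p + 1) = 0) :
    ∃ g : X ⟶ N.X (p - 1), g ≫ N.d (p - 1) p = f := by
  have h1 := isSES_cyc hN (sub_add_cancel p 1)
  let k : X ⟶ cyc N p := ModuleCat.ofHom (f.hom.codRestrict _ fun x => congr($(hf).hom x))
  obtain ⟨g, hg⟩ := h1.exists_lift (h _ 0) k
  exact ⟨g, by rw [← cycπ_ι, ← Category.assoc, hg]; rfl⟩

/-- Orthogonality passes to kernels of epimorphisms, so it descends from the zero modules above `b`.
-/
lemma orth_cyc_of_bounded_above (hN : N.Acyclic) (b : ℤ) [N.IsStrictlyLE b] {B : ModuleCat.{u} R}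
    (h : ∀ p, Orth (N.X p) B) (p : ℤ) : Orth (cyc N p) B := by
  refine int_descending (p := fun n => Orth (cyc N n) B) (b + 1) (fun n hn => ?_) (fun n hn => ?_) p
  · exact Orth.of_isZero_left (cyc_isZero (N.isZero_of_isStrictlyLE b n (by lia)))
  · exact (isSES_cyc hN rfl).orth_left₁ (h n) hn

/-- Going up, orthogonality passes to a cokernel only in `Ext` degrees at least `2`. The missing
degree is recovered by writing `B` as the quotient of an injective module by another member of `Φ`,
which shifts `Ext^1` to `Ext^2`; hence the induction runs over all of `Φ`. -/
lemma orth_cyc_of_bounded_below (hN : N.Acyclic) (a : ℤ) [N.IsStrictlyGE a]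
    {Φ : ModuleCat.{u} R → Prop}
    (hΦ : ∀ B, Φ B → ∃ (B' E : ModuleCat.{u} R) (f : B' ⟶ E) (g : E ⟶ B), IsSES f g ∧
      Injective E ∧ Φ B')
    (h : ∀ p B, Φ B → Orth (N.X p) B) (p : ℤ) : ∀ B, Φ B → Orth (cyc N p) B := by
  refine int_ascending (p := fun n => ∀ B, Φ B → Orth (cyc N n) B) (a - 1) (fun n hn B _ => ?_) (fun n hn B hB => ?_) p
  · exact Orth.of_isZero_left (cyc_isZero (N.isZero_of_isStrictlyGE a n (by lia)))
  · have key : ∀ B, Φ B → ∀ k, Subsingleton (Abelian.Ext (cyc N (n + 1)) B (k + 2)) := fun B hB k =>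
      (isSES_cyc hN rfl).subsingleton_left₃ B (k + 1) (hn B hB k) (h n B hB (k + 1))
    intro k
    obtain ⟨B', E, f, g, hs, hE, hB'⟩ := hΦ B hB
    exact hs.subsingleton_right₃ _ (k + 1) (Orth.of_injective k) (key B' hB' k)

lemma orth_cyc_of_bounded_below' (hN : N.Acyclic) (a : ℤ) [N.IsStrictlyGE a] {X : ModuleCat.{u} R}
    (h : ∀ p, Orth X (N.X p)) (p : ℤ) : Orth X (cyc N p) := by
  refine int_ascending (p := fun n => Orth X (cyc N n)) (a - 1) (fun n hn => ?_) (fun n hn => ?_) p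
  · exact Orth.of_isZero_right (cyc_isZero (N.isZero_of_isStrictlyGE a n (by lia)))
  · exact (isSES_cyc hN rfl).orth_right₃ (h n) hn

/-- Mirror image of `orth_cyc_of_bounded_below`: going down in the second variable loses `Ext^1`,
and an embedding of `X` in a projective module with cokernel in `Φ` restores it. -/
lemma orth_cyc_of_bounded_above' (hN : N.Acyclic) (b : ℤ) [N.IsStrictlyLE b]
    {Φ : ModuleCat.{u} R → Prop}
    (hΦ : ∀ X, Φ X → ∃ (P X' : ModuleCat.{u} R) (f : X ⟶ P) (g : P ⟶ X'), IsSES f g ∧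
      Projective P ∧ Φ X')
    (h : ∀ p X, Φ X → Orth X (N.X p)) (p : ℤ) : ∀ X, Φ X → Orth X (cyc N p) := by
  refine int_descending (p := fun n => ∀ X, Φ X → Orth X (cyc N n)) (b + 1) (fun n hn X _ => ?_) (fun n hn X hX => ?_) p
  · exact Orth.of_isZero_right (cyc_isZero (N.isZero_of_isStrictlyLE b n (by lia)))
  · have key : ∀ X, Φ X → ∀ k, Subsingleton (Abelian.Ext X (cyc N n) (k + 2)) := fun X hX k =>
      (isSES_cyc hN rfl).subsingleton_right₁ X (k + 1) (h n X hX (k + 1)) (hn X hX k)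
    intro k
    obtain ⟨P, X', f, g, hs, hP, hX'⟩ := hΦ X hX
    exact hs.subsingleton_left₁ _ (k + 1) (Orth.of_projective k) (key X' hX' k)

end cycles
end
end TensorEval

namespace TensorEval
noncomputable section

/-! ### Mapping cones -/

section cone
open CochainComplex
variable {R : Type u} [CommRing R] {F G : CochainComplex (ModuleCat.{u} R) ℤ} (f : F ⟶ G)

lemma isSES_mappingCone (p : ℤ) :
    IsSES ((mappingCone.inr f).f p) ((mappingCone.fst f).1.v p (p + 1) rfl) := by
  have hs : (mappingCone.inr f).f p ≫ (mappingCone.snd f).v p p (add_zero p) = 𝟙 _ := by simp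
  have hf : (mappingCone.inl f).v (p + 1) p (by lia) ≫ (mappingCone.fst f).1.v p (p + 1) rfl =
    𝟙 _ := by simp
  have h0 : (mappingCone.inr f).f p ≫ (mappingCone.fst f).1.v p (p + 1) rfl = 0 := by simp
  have hid := mappingCone.id_X f p (p + 1) rfl
  refine ⟨fun x y hxy => ?_, fun x => ⟨fun hx => ?_, ?_⟩, fun x => ?_⟩
  · have := congrArg ((mappingCone.snd f).v p p (add_zero p)).hom hxy
    exact (congr($(hs).hom x)).symm.trans (this.trans congr($(hs).hom y))
  · have h1 := congr($(hid).hom x)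
    refine ⟨((mappingCone.snd f).v p p (add_zero p)).hom x, ?_⟩
    refine Eq.trans ?_ h1
    change _ = ((mappingCone.inl f).v (p + 1) p (by lia)).hom
      (((mappingCone.fst f).1.v p (p + 1) rfl).hom x) + _
    rw [hx, map_zero, zero_add]
    rfl
  · rintro ⟨y, rfl⟩
    exact congr($(h0).hom y)
  · exact ⟨_, congr($(hf).hom x)⟩

lemma isStrictlyLE_mappingCone (b : ℤ) [F.IsStrictlyLE b] [G.IsStrictlyLE b] :
    (mappingCone f).IsStrictlyLE b := by
  rw [isStrictlyLE_iff]
  intro i hi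
  have := mappingCone.id_X f i (i + 1) rfl
  rw [Limits.IsZero.eq_zero_of_tgt (F.isZero_of_isStrictlyLE b (i + 1) (by lia))
    ((mappingCone.fst f).1.v i (i + 1) rfl), Limits.IsZero.eq_zero_of_tgt
    (G.isZero_of_isStrictlyLE b i (by lia)) ((mappingCone.snd f).v i i (add_zero i)),
    Limits.zero_comp, Limits.zero_comp, add_zero] at this
  exact (Limits.IsZero.iff_id_eq_zero _).2 this.symm

lemma isStrictlyGE_mappingCone (a : ℤ) [F.IsStrictlyGE a] [G.IsStrictlyGE a] :
    (mappingCone f).IsStrictlyGE (a - 1) :=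
  have : G.IsStrictlyGE (a - 1) := G.isStrictlyGE_of_ge (a - 1) a (by lia)
  CochainComplex.isStrictlyGE_mappingCone f a (a - 1) (a - 1)

lemma acyclic_mappingCone [QuasiIso f] : (mappingCone f).Acyclic :=
  letI := HasDerivedCategory.standard (ModuleCat.{u} R)
  (quasiIso_iff_acyclic_mappingCone f).1 inferInstance

lemma orth_mappingCone_left {B : ModuleCat.{u} R} (hF : ∀ p, Orth (F.X p) B)
    (hG : ∀ p, Orth (G.X p) B) (p : ℤ) : Orth ((mappingCone f).X p) B :=
  (isSES_mappingCone f p).orth_left₂ (hG p) (hF (p + 1))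

lemma orth_mappingCone_right {B : ModuleCat.{u} R} (hF : ∀ p, Orth B (F.X p))
    (hG : ∀ p, Orth B (G.X p)) (p : ℤ) : Orth B ((mappingCone f).X p) :=
  (isSES_mappingCone f p).orth_right₂ (hG p) (hF (p + 1))

lemma isKProjective_mappingCone [F.IsKProjective] [G.IsKProjective] :
    (mappingCone f).IsKProjective := by
  rw [isKProjective_iff_leftOrthogonal]
  exact (HomotopyCategory.subcategoryAcyclic (ModuleCat.{u} R)).leftOrthogonal.ext_of_isTriangulatedClosed₃ _
    (HomotopyCategory.mappingCone_triangleh_distinguished f) (IsKProjective.leftOrthogonal F)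
      (IsKProjective.leftOrthogonal G)

lemma HomAcyclic.of_contractible {X : CochainComplex (ModuleCat.{u} R) ℤ} [X.IsKProjective]
    (hX : X.Acyclic) (M : CochainComplex (ModuleCat.{u} R) ℤ) : HomAcyclic X M := by
  intro i j k hij hjk z hz
  -- An acyclic K-projective complex is contractible: the identity is the coboundary of some `w` of
  -- degree `-1`. Composing a cocycle with `w` gives a primitive up to sign.
  obtain ⟨w, hw⟩ := HomAcyclic.of_isKProjective hX (show (-1 : ℤ) + 1 = 0 by lia)
    (show (0 : ℤ) + 1 = 1 by lia) (Cochain.ofHom (𝟙 X)) (by simp)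
  refine ⟨j.negOnePow • w.comp z (by lia), ?_⟩
  rw [δ_units_smul, δ_comp w z (show -1 + j = i by lia) 0 k j hij (by lia) hjk, hz,
    Cochain.comp_zero, hw, zero_add, Cochain.id_comp, smul_smul, Int.units_mul_self, one_smul]

end cone

/-! ### Hom complexes that preserve quasi-isomorphisms -/

section homCx
variable {A T : Type u} [CommRing A] [CommRing T] [Algebra A T]

instance (Y Y' : CochainComplex (ModuleCat.{u} T) ℤ) (g : Y ⟶ Y') [QuasiIso g] :
    QuasiIso ((resCx A T).map g) := inferInstance

lemma quasiIso_homCxMapRight_of_isKProjective (X : CochainComplex (ModuleCat.{u} A) ℤ)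
    [X.IsKProjective] {Y Y' : CochainComplex (ModuleCat.{u} T) ℤ} (g : Y ⟶ Y') [QuasiIso g] :
    QuasiIso (homCxMapRight X g) :=
  quasiIso_homCxMapRight X g (HomAcyclic.of_isKProjective (acyclic_mappingCone _))

lemma quasiIso_homCxMapLeft_of_isKProjective {X X' : CochainComplex (ModuleCat.{u} A) ℤ}
    [X.IsKProjective] [X'.IsKProjective] (f : X' ⟶ X) [QuasiIso f]
    (Y : CochainComplex (ModuleCat.{u} T) ℤ) : QuasiIso (homCxMapLeft f Y) :=
  have := isKProjective_mappingCone f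
  quasiIso_homCxMapLeft f Y (HomAcyclic.of_contractible (acyclic_mappingCone _) _)

lemma quasiIso_homCxMapLeft_of_isKInjective {X X' : CochainComplex (ModuleCat.{u} A) ℤ}
    (f : X' ⟶ X) [QuasiIso f] (Y : CochainComplex (ModuleCat.{u} T) ℤ)
    [((resCx A T).obj Y).IsKInjective] : QuasiIso (homCxMapLeft f Y) :=
  quasiIso_homCxMapLeft f Y (HomAcyclic.of_isKInjective (acyclic_mappingCone _))

instance (Y : CochainComplex (ModuleCat.{u} T) ℤ) (b : ℤ) [Y.IsStrictlyLE b] :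
    ((resCx A T).obj Y).IsStrictlyLE b := by
  rw [CochainComplex.isStrictlyLE_iff]
  exact fun i hi => (resMod A T).map_isZero (Y.isZero_of_isStrictlyLE b i hi)

instance (Y : CochainComplex (ModuleCat.{u} T) ℤ) (b : ℤ) [Y.IsStrictlyGE b] :
    ((resCx A T).obj Y).IsStrictlyGE b := by
  rw [CochainComplex.isStrictlyGE_iff]
  exact fun i hi => (resMod A T).map_isZero (Y.isZero_of_isStrictlyGE b i hi)

variable {X X' : CochainComplex (ModuleCat.{u} A) ℤ} (f : X' ⟶ X) [QuasiIso f]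
  {Y Y' : CochainComplex (ModuleCat.{u} T) ℤ} (g : Y ⟶ Y') [QuasiIso g]

variable (Y) in
lemma quasiIso_homCxMapLeft_of_bounded_above (b : ℤ) [X.IsStrictlyLE b] [X'.IsStrictlyLE b]
    (c d : ℤ) [Y.IsStrictlyGE c] [Y.IsStrictlyLE d]
    (hX : ∀ p q, Orth (X.X p) ((resMod A T).obj (Y.X q)))
    (hX' : ∀ p q, Orth (X'.X p) ((resMod A T).obj (Y.X q))) : QuasiIso (homCxMapLeft f Y) := by
  have := isStrictlyLE_mappingCone f b
  have h := acyclic_mappingCone f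
  refine quasiIso_homCxMapLeft f Y (HomAcyclic.of_bounded_right c d fun p q k hk =>
    extends_of_orth_cyc h (orth_cyc_of_bounded_above h b ?_) p k hk)
  exact orth_mappingCone_left f (fun p => hX' p q) (fun p => hX p q)

-- Neither complex need consist of projectives: the cone is bounded below, so
-- `orth_cyc_of_bounded_below` supplies the vanishing if every term of `Y` has arbitrarily long
-- resolutions by injective modules with syzygies in `Φ`. Its use is for duals of Gorenstein flat
-- modules.
variable (Y) in
lemma quasiIso_homCxMapLeft_of_bounded_below (a : ℤ) [X.IsStrictlyGE a] [X'.IsStrictlyGE a]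
    (c d : ℤ) [Y.IsStrictlyGE c] [Y.IsStrictlyLE d] {Φ : ModuleCat.{u} A → Prop}
    (hΦ : ∀ B, Φ B → ∃ (B' E : ModuleCat.{u} A) (f : B' ⟶ E) (g : E ⟶ B), IsSES f g ∧
      Injective E ∧ Φ B') (hY : ∀ q, Φ ((resMod A T).obj (Y.X q)))
    (hX : ∀ p B, Φ B → Orth (X.X p) B)
    (hX' : ∀ p B, Φ B → Orth (X'.X p) B) : QuasiIso (homCxMapLeft f Y) := by
  have := isStrictlyGE_mappingCone f a
  have h := acyclic_mappingCone f
  refine quasiIso_homCxMapLeft f Y (HomAcyclic.of_bounded_right c d fun p q k hk =>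
    extends_of_orth_cyc h (fun p => orth_cyc_of_bounded_below h (a - 1) hΦ ?_ p _ (hY q)) p k hk)
  exact fun p B hB => orth_mappingCone_left f (fun p => hX' p B hB) (fun p => hX p B hB) p

variable (X) in
lemma quasiIso_homCxMapRight_of_bounded_below (a : ℤ) [Y.IsStrictlyGE a] [Y'.IsStrictlyGE a]
    (c d : ℤ) [X.IsStrictlyGE c] [X.IsStrictlyLE d]
    (hY : ∀ p q, Orth (X.X p) ((resMod A T).obj (Y.X q)))
    (hY' : ∀ p q, Orth (X.X p) ((resMod A T).obj (Y'.X q))) : QuasiIso (homCxMapRight X g) := by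
  have := isStrictlyGE_mappingCone ((resCx A T).map g) a
  have h := acyclic_mappingCone ((resCx A T).map g)
  refine quasiIso_homCxMapRight X g (HomAcyclic.of_bounded_left c d fun p q k hk =>
    lifts_of_orth_cyc h (orth_cyc_of_bounded_below' h (a - 1) ?_) q k hk)
  exact orth_mappingCone_right _ (fun q => hY p q) (fun q => hY' p q)

-- Here a term of `X` has a coresolution by projectives inside `Φ`, as Gorenstein projective modules
-- do; this compensates for the target complexes being bounded only above.
variable (X) in
lemma quasiIso_homCxMapRight_of_bounded_above (b : ℤ) [Y.IsStrictlyLE b] [Y'.IsStrictlyLE b]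
    (c d : ℤ) [X.IsStrictlyGE c] [X.IsStrictlyLE d] {Φ : ModuleCat.{u} A → Prop}
    (hΦ : ∀ X, Φ X → ∃ (P X' : ModuleCat.{u} A) (f : X ⟶ P) (g : P ⟶ X'), IsSES f g ∧
      Projective P ∧ Φ X') (hX : ∀ p, Φ (X.X p))
    (hY : ∀ G q, Φ G → Orth G ((resMod A T).obj (Y.X q)))
    (hY' : ∀ G q, Φ G → Orth G ((resMod A T).obj (Y'.X q))) : QuasiIso (homCxMapRight X g) := by
  have := isStrictlyLE_mappingCone ((resCx A T).map g) b
  have h := acyclic_mappingCone ((resCx A T).map g)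
  refine quasiIso_homCxMapRight X g (HomAcyclic.of_bounded_left c d fun p q k hk =>
    lifts_of_orth_cyc h (fun q => orth_cyc_of_bounded_above' h b hΦ ?_ q _ (hX p)) q k hk)
  exact fun q G hG => orth_mappingCone_right _ (fun q => hY G q hG) (fun q => hY' G q hG) q

end homCx
end
end TensorEval

namespace TensorEval
noncomputable section

/-! ### Character modules as a substitute for Tor -/

section charMod
open Abelian
variable {R : Type u} [CommRing R]

/-- The character module `Hom_ℤ (N, ℚ/ℤ)`. -/
def charMod (N : ModuleCat.{u} R) : ModuleCat.{u} R := ModuleCat.of R (CharacterModule N)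

/-- The modules `Tor_i (M, N)` vanish for `i > 0`; stated through characters. -/
def TorOrth (M N : ModuleCat.{u} R) : Prop := Orth M (charMod N)

lemma injective_charMod (N : ModuleCat.{u} R) [Module.Flat R N] : Injective (charMod N) :=
  (Module.injective_iff_injective_object R _).1
    ((Module.Flat.iff_characterModule_injective (R := R) (M := N)).1 inferInstance)

lemma flat_of_injective_charMod (N : ModuleCat.{u} R) (h : Injective (charMod N)) :
    Module.Flat R N :=
  (Module.Flat.iff_characterModule_injective (R := R) (M := N)).2
    ((Module.injective_iff_injective_object R _).2 h)

/-- The map of character modules induced by a linear map. -/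
def charMap {M N : ModuleCat.{u} R} (f : M ⟶ N) : charMod N ⟶ charMod M :=
  ModuleCat.ofHom (CharacterModule.dual f.hom)

lemma IsSES.char {M₁ M₂ M₃ : ModuleCat.{u} R} {f : M₁ ⟶ M₂} {g : M₂ ⟶ M₃} (h : IsSES f g) :
    IsSES (charMap g) (charMap f) := by
  refine ⟨CharacterModule.dual_injective_of_surjective _ h.surj, fun c => ⟨fun hc => ?_, ?_⟩,
    CharacterModule.dual_surjective_of_injective _ h.inj⟩
  · exact (exact_iff_dual f.hom g.hom).1 (fun x hx => (h.exact x).1 hx) c hc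
  · rintro ⟨y, rfl⟩
    exact DFunLike.ext (F := CharacterModule M₁) _ _ fun x =>
      (congrArg (show M₃ →+ _ from y) (congr($(h.comp_zero).hom x))).trans
        (map_zero (show M₃ →+ _ from y))

/-- The identity of `M` is a finite sum of maps through the `N i`, so each `Ext` class of `M` is a
sum of classes that factor through zero groups. -/
lemma Orth.of_sum_left {M B : ModuleCat.{u} R} {ι : Type*} (s : Finset ι)
    (N : ι → ModuleCat.{u} R) (π : ∀ i, M ⟶ N i) (κ : ∀ i, N i ⟶ M)
    (h : ∑ i ∈ s, π i ≫ κ i = 𝟙 M) (H : ∀ i ∈ s, Orth (N i) B) : Orth M B := fun n =>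
  subsingleton_of_forall_eq 0 fun x => by
    rw [← Ext.mk₀_id_comp x, ← h]
    refine (map_sum (AddMonoidHom.mk' (fun f : M ⟶ M => (Ext.mk₀ f).comp x (zero_add _))
      fun f g => by rw [Ext.mk₀_add, Ext.add_comp]) _ s).trans
        (Finset.sum_eq_zero fun i hi => ?_)
    have := H i hi n
    change (Ext.mk₀ (π i ≫ κ i)).comp x (zero_add (n + 1)) = 0
    rw [← Ext.mk₀_comp_mk₀, Ext.comp_assoc_of_second_deg_zero,
      Subsingleton.elim ((Ext.mk₀ (κ i)).comp x (zero_add _)) 0, Ext.comp_zero]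

lemma Orth.of_sum_right {M B : ModuleCat.{u} R} {ι : Type*} (s : Finset ι)
    (N : ι → ModuleCat.{u} R) (π : ∀ i, M ⟶ N i) (κ : ∀ i, N i ⟶ M)
    (h : ∑ i ∈ s, π i ≫ κ i = 𝟙 M) (H : ∀ i ∈ s, Orth B (N i)) : Orth B M := fun n =>
  subsingleton_of_forall_eq 0 fun x => by
    rw [← Ext.comp_mk₀_id x, ← h]
    refine (map_sum (AddMonoidHom.mk' (fun f : M ⟶ M => x.comp (Ext.mk₀ f) (add_zero _))
      fun f g => by rw [Ext.mk₀_add, Ext.comp_add]) _ s).trans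
        (Finset.sum_eq_zero fun i hi => ?_)
    have := H i hi n
    change x.comp (Ext.mk₀ (π i ≫ κ i)) (add_zero (n + 1)) = 0
    rw [← Ext.mk₀_comp_mk₀, ← Ext.comp_assoc_of_second_deg_zero,
      Subsingleton.elim (x.comp (Ext.mk₀ (π i)) (add_zero _)) 0, Ext.zero_comp]

end charMod

/-! ### Boundedness and orthogonality of the terms of Hom and tensor complexes -/

section bounded
variable {A B T : Type u} [CommRing A] [CommRing B] [CommRing T] [Algebra A T] [Algebra B T]

/-- Restriction of scalars along the identity. -/
def resSelfIso (M : ModuleCat.{u} B) : (resMod B B).obj M ≅ M :=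
  LinearEquiv.toModuleIso
    { AddEquiv.refl M with map_smul' := fun _ _ => rfl }

instance (Z : CochainComplex (ModuleCat.{u} B) ℤ) (b : ℤ) [Z.IsStrictlyLE b] :
    (dualCx Z).IsStrictlyGE (-b) := by
  rw [CochainComplex.isStrictlyGE_iff]
  intro i hi
  have := ModuleCat.isZero_iff_subsingleton.1 (Z.isZero_of_isStrictlyLE b (-i) (by lia))
  exact ModuleCat.isZero_iff_subsingleton.2
    ⟨fun f g => DFunLike.ext (F := CharacterModule (Z.X (-i))) _ _ fun x => by
      rw [Subsingleton.elim x 0]; exact (map_zero (show Z.X (-i) →+ _ from f)).trans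
        (map_zero (show Z.X (-i) →+ _ from g)).symm⟩

instance (Z : CochainComplex (ModuleCat.{u} B) ℤ) (a : ℤ) [Z.IsStrictlyGE a] :
    (dualCx Z).IsStrictlyLE (-a) := by
  rw [CochainComplex.isStrictlyLE_iff]
  intro i hi
  have := ModuleCat.isZero_iff_subsingleton.1 (Z.isZero_of_isStrictlyGE a (-i) (by lia))
  exact ModuleCat.isZero_iff_subsingleton.2
    ⟨fun f g => DFunLike.ext (F := CharacterModule (Z.X (-i))) _ _ fun x => by
      rw [Subsingleton.elim x 0]; exact (map_zero (show Z.X (-i) →+ _ from f)).trans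
        (map_zero (show Z.X (-i) →+ _ from g)).symm⟩

lemma isStrictlyGE_homCx (X : CochainComplex (ModuleCat.{u} A) ℤ)
    (Y : CochainComplex (ModuleCat.{u} T) ℤ) (a b : ℤ) [X.IsStrictlyLE b] [Y.IsStrictlyGE a] :
    (homCx X Y).IsStrictlyGE (a - b) := by
  rw [CochainComplex.isStrictlyGE_iff]
  refine fun n hn => ModuleCat.isZero_iff_subsingleton.2
    ⟨fun (z z' : HomCochain X Y n) => HomCochain.ext fun p q hpq => ?_⟩
  by_cases hp : p ≤ b
  · exact (((resCx A T).obj Y).isZero_of_isStrictlyGE a q (by lia)).eq_of_tgt _ _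
  · exact (X.isZero_of_isStrictlyLE b p (by lia)).eq_of_src _ _

lemma isStrictlyLE_homCx (X : CochainComplex (ModuleCat.{u} A) ℤ)
    (Y : CochainComplex (ModuleCat.{u} T) ℤ) (a b : ℤ) [X.IsStrictlyGE a] [Y.IsStrictlyLE b] :
    (homCx X Y).IsStrictlyLE (b - a) := by
  rw [CochainComplex.isStrictlyLE_iff]
  refine fun n hn => ModuleCat.isZero_iff_subsingleton.2
    ⟨fun (z z' : HomCochain X Y n) => HomCochain.ext fun p q hpq => ?_⟩
  by_cases hp : a ≤ p
  · exact (((resCx A T).obj Y).isZero_of_isStrictlyLE b q (by lia)).eq_of_tgt _ _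
  · exact (X.isZero_of_isStrictlyGE a p (by lia)).eq_of_src _ _

lemma isZero_tensorCx_X (Y : CochainComplex (ModuleCat.{u} T) ℤ)
    (Z : CochainComplex (ModuleCat.{u} B) ℤ) (n : ℤ)
    (h : ∀ i j, i + j = n → Limits.IsZero (Y.X i) ∨ Limits.IsZero (Z.X j)) :
    Limits.IsZero ((tensorCx Y Z).X n) := by
  refine ModuleCat.isZero_iff_subsingleton.2 (subsingleton_of_forall_eq 0 fun x => ?_)
  induction x using tensorCx_induction with
  | zero => rfl
  | add x y hx hy => rw [hx, hy, add_zero]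
  | tmul i j hij y z =>
    rcases h i j hij with h | h
    · have := ModuleCat.isZero_iff_subsingleton.1 h
      rw [Subsingleton.elim y 0, tmulCx_zero_left]
    · have := ModuleCat.isZero_iff_subsingleton.1 h
      rw [Subsingleton.elim z 0, tmulCx_zero_right]

lemma isStrictlyLE_tensorCx (Y : CochainComplex (ModuleCat.{u} T) ℤ)
    (Z : CochainComplex (ModuleCat.{u} B) ℤ) (a b : ℤ) [Y.IsStrictlyLE a] [Z.IsStrictlyLE b] :
    (tensorCx Y Z).IsStrictlyLE (a + b) := by
  rw [CochainComplex.isStrictlyLE_iff]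
  refine fun n hn => isZero_tensorCx_X Y Z n fun i j hij => ?_
  by_cases hi : i ≤ a
  · exact Or.inr (Z.isZero_of_isStrictlyLE b j (by lia))
  · exact Or.inl (Y.isZero_of_isStrictlyLE a i (by lia))

lemma isStrictlyGE_tensorCx (Y : CochainComplex (ModuleCat.{u} T) ℤ)
    (Z : CochainComplex (ModuleCat.{u} B) ℤ) (a b : ℤ) [Y.IsStrictlyGE a] [Z.IsStrictlyGE b] :
    (tensorCx Y Z).IsStrictlyGE (a + b) := by
  rw [CochainComplex.isStrictlyGE_iff]
  refine fun n hn => isZero_tensorCx_X Y Z n fun i j hij => ?_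
  by_cases hi : a ≤ i
  · exact Or.inr (Z.isZero_of_isStrictlyGE b j (by lia))
  · exact Or.inl (Y.isZero_of_isStrictlyGE a i (by lia))

lemma sum_single_eval (X : CochainComplex (ModuleCat.{u} A) ℤ)
    (Y : CochainComplex (ModuleCat.{u} T) ℤ) (s : Finset ℤ) (n : ℤ)
    (hs : ∀ p ∉ s, Limits.IsZero (X.X p) ∨ Limits.IsZero (Y.X (p + n))) :
    ∑ p ∈ s, evalCochain X Y (rfl : p + n = p + n) ≫ singleHom X Y rfl = 𝟙 _ := by
  refine ModuleCat.hom_ext (LinearMap.ext fun (z : HomCochain X Y n) => ?_)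
  rw [ModuleCat.hom_sum]
  refine (LinearMap.sum_apply s _ (show (homCx X Y).X n from z)).trans ?_
  refine HomCochain.val_ext (z := ∑ p ∈ s, singleCochain X Y rfl (z.v p (p + n) rfl).hom)
    (z' := z) fun p q hpq x => ?_
  subst hpq
  rw [HomCochain.val_sum]
  by_cases hp : p ∈ s
  · rw [Finset.sum_eq_single p (fun p' _ h => singleCochain_val_of_ne _ _ _ (Ne.symm h) x)
      (fun h => (h hp).elim)]
    exact singleCochain_val _ _ x
  · rw [Finset.sum_eq_zero fun p' h' => singleCochain_val_of_ne _ _ _ (fun h : p = p' => hp (h ▸ h')) x]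
    rcases hs p hp with h | h
    · have := ModuleCat.isZero_iff_subsingleton.1 h
      rw [Subsingleton.elim x 0]
      exact (map_zero (z.v p (p + n) rfl).hom).symm
    · have : Subsingleton (Y.X (p + n)) := ModuleCat.isZero_iff_subsingleton.1 h
      exact Subsingleton.elim (α := Y.X (p + n)) _ _

lemma orth_homCx_X {X : CochainComplex (ModuleCat.{u} A) ℤ}
    {Y : CochainComplex (ModuleCat.{u} T) ℤ} {N : ModuleCat.{u} B} (s : Finset ℤ) (n : ℤ)
    (hs : ∀ p ∉ s, Limits.IsZero (X.X p) ∨ Limits.IsZero (Y.X (p + n)))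
    (H : ∀ p q, Orth ((resMod B T).obj (homMod (X.X p) (Y.X q))) N) :
    Orth ((resMod B T).obj ((homCx X Y).X n)) N := by
  refine Orth.of_sum_left s (fun p => (resMod B T).obj (homMod (X.X p) (Y.X (p + n))))
    (fun p => (resMod B T).map (evalCochain X Y rfl)) (fun p => (resMod B T).map (singleHom X Y rfl))
    ?_ fun p _ => H p _
  simp only [← Functor.map_comp]
  rw [← Functor.map_sum, sum_single_eval X Y s n hs, CategoryTheory.Functor.map_id]

lemma sum_projTensor_comp (Y : CochainComplex (ModuleCat.{u} T) ℤ)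
    (Z : CochainComplex (ModuleCat.{u} B) ℤ) (s : Finset ℤ) (n : ℤ)
    (hs : ∀ i ∉ s, Limits.IsZero (Y.X i)) :
    ∑ i ∈ s, projTensor Y Z i (n - i) n (by lia) ≫ ιTensor Y Z i (n - i) n (by lia) = 𝟙 _ := by
  refine ModuleCat.hom_ext (LinearMap.ext fun z => ?_)
  rw [ModuleCat.hom_sum, LinearMap.sum_apply]
  exact sum_projTensor s n hs z

lemma orth_tensorCx_X {Y : CochainComplex (ModuleCat.{u} T) ℤ}
    {Z : CochainComplex (ModuleCat.{u} B) ℤ} {N : ModuleCat.{u} A} (a b : ℤ)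
    [Y.IsStrictlyGE a] [Y.IsStrictlyLE b] (n : ℤ)
    (H : ∀ i j, Orth N ((resMod A T).obj (((tensorBif B T).obj (Y.X i)).obj (Z.X j)))) :
    Orth N ((resMod A T).obj ((tensorCx Y Z).X n)) := by
  refine Orth.of_sum_right (Finset.Icc a b)
    (fun i => (resMod A T).obj (((tensorBif B T).obj (Y.X i)).obj (Z.X (n - i))))
    (fun i => (resMod A T).map (projTensor Y Z i (n - i) n (by lia)))
    (fun i => (resMod A T).map (ιTensor Y Z i (n - i) n (by lia))) ?_ fun p _ => H p _
  simp only [← Functor.map_comp]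
  rw [← Functor.map_sum, sum_projTensor_comp Y Z _ n fun i hi => ?_, CategoryTheory.Functor.map_id]
  by_cases h : a ≤ i
  · exact Y.isZero_of_isStrictlyLE b i (by rw [Finset.mem_Icc] at hi; lia)
  · exact Y.isZero_of_isStrictlyGE a i (by lia)

end bounded

/-! ### Tensor products that preserve quasi-isomorphisms -/

section tensor
variable {B T : Type u} [CommRing B] [CommRing T] [Algebra B T]
  {Y Y' : CochainComplex (ModuleCat.{u} T) ℤ} (f : Y ⟶ Y')
  {Z Z' : CochainComplex (ModuleCat.{u} B) ℤ} (g : Z ⟶ Z')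

instance [QuasiIso g] : QuasiIso (dualMap g) := (quasiIso_dualMap_iff g).2 inferInstance

-- The character complex of a bounded above complex of flat modules is a bounded below complex of
-- injective modules, hence K-injective.
variable (Z) in
lemma quasiIso_tensorMap_of_flat [QuasiIso f] (b : ℤ) [Z.IsStrictlyLE b]
    (hZ : ∀ n, Module.Flat B (Z.X n)) : QuasiIso (tensorMap f (𝟙 Z)) := by
  have : ∀ n, Injective (((resCx B B).obj (dualCx Z)).X n) := fun n =>
    have := injective_charMod (Z.X (-n))
    Injective.of_iso (resSelfIso (charMod (Z.X (-n)))).symm this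
  have := CochainComplex.isKInjective_of_injective ((resCx B B).obj (dualCx Z)) (-b)
  exact quasiIso_tensorMap_left f (quasiIso_homCxMapLeft_of_isKInjective _ _)

-- Dualizing turns a coresolution of `G` by flat modules into a resolution of its character module
-- by injective modules. The class of these character modules therefore satisfies the requirement of
-- `quasiIso_homCxMapLeft_of_bounded_below`.
variable (Z) in
lemma quasiIso_tensorMap_left_of_torOrth [QuasiIso f] (a : ℤ) [Y.IsStrictlyGE a]
    [Y'.IsStrictlyGE a] (c d : ℤ) [Z.IsStrictlyGE c] [Z.IsStrictlyLE d]
    {Φ : ModuleCat.{u} B → Prop}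
    (hΦ : ∀ G, Φ G → ∃ (F G' : ModuleCat.{u} B) (f : G ⟶ F) (g : F ⟶ G'), IsSES f g ∧
      Module.Flat B F ∧ Φ G') (hZ : ∀ q, Φ (Z.X q))
    (hY : ∀ p G, Φ G → TorOrth ((resMod B T).obj (Y.X p)) G)
    (hY' : ∀ p G, Φ G → TorOrth ((resMod B T).obj (Y'.X p)) G) :
    QuasiIso (tensorMap f (𝟙 Z)) := by
  refine quasiIso_tensorMap_left f (quasiIso_homCxMapLeft_of_bounded_below
    ((resCx B T).map f) (dualCx Z) a (-d) (-c)
    (Φ := fun M => ∃ G, Φ G ∧ Nonempty (charMod G ≅ M)) ?_ ?_ ?_ ?_)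
  · rintro M ⟨G, hG, ⟨e⟩⟩
    obtain ⟨F, G', i, j, h, hF, hG'⟩ := hΦ G hG
    refine ⟨charMod G', charMod F, charMap j, charMap i ≫ e.hom, ?_, injective_charMod F,
      G', hG', ⟨Iso.refl _⟩⟩
    have he : Function.Bijective e.hom.hom := e.toLinearEquiv.bijective
    refine ⟨h.char.inj, fun x => ?_, he.surjective.comp h.char.surj⟩
    refine Iff.trans ?_ (h.char.exact x)
    exact map_eq_zero_iff e.hom.hom he.injective
  · exact fun q => ⟨_, hZ (-q), ⟨(resSelfIso (charMod (Z.X (-q)))).symm⟩⟩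
  · rintro p M ⟨G, hG, ⟨e⟩⟩
    exact Orth.of_iso_right e (hY' p G hG)
  · rintro p M ⟨G, hG, ⟨e⟩⟩
    exact Orth.of_iso_right e (hY p G hG)

variable (Y) in
lemma quasiIso_tensorMap_right_of_torOrth [QuasiIso g] (b : ℤ) [Z.IsStrictlyLE b]
    [Z'.IsStrictlyLE b] (c d : ℤ) [Y.IsStrictlyGE c] [Y.IsStrictlyLE d]
    (hZ : ∀ p q, TorOrth ((resMod B T).obj (Y.X p)) (Z.X q))
    (hZ' : ∀ p q, TorOrth ((resMod B T).obj (Y.X p)) (Z'.X q)) :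
    QuasiIso (tensorMap (𝟙 Y) g) :=
  quasiIso_tensorMap_right g (quasiIso_homCxMapRight_of_bounded_below
    ((resCx B T).obj Y) (dualMap g) (-b) c d
    (fun p q => Orth.of_iso_right (resSelfIso (charMod (Z'.X (-q)))).symm (hZ' p (-q)))
    (fun p q => Orth.of_iso_right (resSelfIso (charMod (Z.X (-q)))).symm (hZ p (-q))))

lemma tensorMap_id_comp {Z'' : CochainComplex (ModuleCat.{u} B) ℤ} (g' : Z' ⟶ Z'') :
    tensorMap (𝟙 Y) (g ≫ g') = tensorMap (𝟙 Y) g ≫ tensorMap (𝟙 Y) g' :=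
  tensorCx_hom_ext fun _ _ n h y z => (tensorMap_tmul (𝟙 Y) (g ≫ g') h y z).trans
    ((congrArg ((tensorMap (𝟙 Y) g').f n).hom (tensorMap_tmul (𝟙 Y) g h y z)).trans
      (tensorMap_tmul (𝟙 Y) g' h _ _)).symm

lemma tensorMap_comm :
    tensorMap f (𝟙 Z) ≫ tensorMap (𝟙 Y') g = tensorMap (𝟙 Y) g ≫ tensorMap f (𝟙 Z') :=
  tensorCx_hom_ext fun _ _ n h y z =>
    ((congrArg ((tensorMap (𝟙 Y') g).f n).hom (tensorMap_tmul f (𝟙 Z) h y z)).trans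
      (tensorMap_tmul (𝟙 Y') g h _ _)).trans
    ((congrArg ((tensorMap f (𝟙 Z')).f n).hom (tensorMap_tmul (𝟙 Y) g h y z)).trans
      (tensorMap_tmul f (𝟙 Z') h _ _)).symm

lemma tensorMap_id_id : tensorMap (𝟙 Y) (𝟙 Z) = 𝟙 _ :=
  tensorCx_hom_ext fun _ _ _ h y z => tensorMap_tmul (𝟙 Y) (𝟙 Z) h y z

-- A quasi-isomorphism between K-projective complexes is a homotopy equivalence, and tensoring with
-- any `Y` preserves those.
variable (Y) in
lemma quasiIso_tensorMap_of_isKProjective [QuasiIso g] [Z.IsKProjective] [Z'.IsKProjective] :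
    QuasiIso (tensorMap (𝟙 Y) g) := by
  obtain ⟨e, rfl⟩ := (CochainComplex.IsKProjective.quasiIso_iff g).1 inferInstance
  let e' : HomotopyEquiv (tensorCx Y Z) (tensorCx Y Z') :=
    { hom := tensorMap (𝟙 Y) e.hom
      inv := tensorMap (𝟙 Y) e.inv
      homotopyHomInvId := (Homotopy.ofEq (tensorMap_id_comp e.hom e.inv).symm).trans
        ((HomologicalComplex.mapBifunctorMapHomotopy₂ (𝟙 Y) e.homotopyHomInvId _ _).trans
          (Homotopy.ofEq tensorMap_id_id))
      homotopyInvHomId := (Homotopy.ofEq (tensorMap_id_comp e.inv e.hom).symm).trans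
        ((HomologicalComplex.mapBifunctorMapHomotopy₂ (𝟙 Y) e.homotopyInvHomId _ _).trans
          (Homotopy.ofEq tensorMap_id_id)) }
  exact homotopyEquivalences_le_quasiIso _ _ _ ⟨e', rfl⟩

end tensor
end
end TensorEval

namespace TensorEval
noncomputable section

/-! ### The two diagram arguments for tensor evaluation -/

section main
variable {A B T : Type u} [CommRing A] [CommRing B] [CommRing T] [Algebra A T] [Algebra B T]

lemma homCxMap_comm {X X' : CochainComplex (ModuleCat.{u} A) ℤ} (f : X' ⟶ X)
    {Y Y' : CochainComplex (ModuleCat.{u} T) ℤ} (g : Y ⟶ Y') :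
    homCxMapRight X g ≫ homCxMapLeft f Y' = homCxMapLeft f Y ≫ homCxMapRight X' g := by
  refine HomologicalComplex.hom_ext _ _ fun n => ModuleCat.hom_ext (LinearMap.ext fun z => ?_)
  exact Cochain.comp_assoc_of_first_is_zero_cochain (n₂ := n) (n₃ := 0) (n₂₃ := n) (Cochain.ofHom f)
    (show Cochain X ((resCx A T).obj Y) n from z) (Cochain.ofHom ((resCx A T).map g))
      (add_zero n) |>.symm

/-- By `H` and boundedness of `J` and `K`, evaluation at `(P, J, K)` is an isomorphism. Naturality
along `g : Q ⟶ K` reduces the claim to `Hom (P, J) ⊗ g`. That Hom complex may be unbounded above, so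
it is compared through `f` with the bounded complex `Hom (I, J)`, whose terms are Tor-orthogonal to
`K`. -/
theorem quasiIso_tev_of_injective {P I : CochainComplex (ModuleCat.{u} A) ℤ} (f : P ⟶ I)
    [QuasiIso f] (J : CochainComplex (ModuleCat.{u} T) ℤ)
    {Q K : CochainComplex (ModuleCat.{u} B) ℤ} (g : Q ⟶ K) [QuasiIso g]
    (a b : ℤ) [P.IsKProjective] [P.IsStrictlyLE b] [I.IsStrictlyGE a] [I.IsStrictlyLE b]
    (a' b' : ℤ) [J.IsStrictlyGE a'] [J.IsStrictlyLE b']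
    (c d : ℤ) [Q.IsStrictlyLE d] [K.IsStrictlyGE c] [K.IsStrictlyLE d]
    (hQ : ∀ j, Module.Flat B (Q.X j)) {Φ : ModuleCat.{u} B → Prop}
    (hΦ : ∀ G, Φ G → ∃ (F G' : ModuleCat.{u} B) (f : G ⟶ F) (g : F ⟶ G'), IsSES f g ∧
      Module.Flat B F ∧ Φ G') (hK : ∀ q, Φ (K.X q))
    (hJ : ∀ q, Injective ((resMod A T).obj (J.X q)))
    (hJΦ : ∀ q G, Φ G → TorOrth ((resMod B T).obj (J.X q)) G)
    (hIJ : ∀ p q G, Φ G → TorOrth ((resMod B T).obj (homMod (I.X p) (J.X q))) G)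
    (hPJ : ∀ p q G, Φ G → TorOrth ((resMod B T).obj (homMod (P.X p) (J.X q))) G)
    (H : ∀ p q j, Function.Bijective (modTev (P.X p) (J.X q) (K.X j)).hom) :
    QuasiIso (tev P J Q) := by
  have hflat : ∀ (M : ModuleCat.{u} B) j, TorOrth M (Q.X j) := fun M j =>
    have := hQ j
    have := injective_charMod (Q.X j)
    Orth.of_injective
  have : ∀ q, Injective (((resCx A T).obj J).X q) := hJ
  have := CochainComplex.isKInjective_of_injective ((resCx A T).obj J) a'
  have : IsIso (tev P J K) :=
    isIso_tev_of_bounded ⟨a', b', inferInstance, inferInstance⟩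
      (Or.inr ⟨c, d, inferInstance, inferInstance⟩) H
  have h1 : QuasiIso (tensorMap (𝟙 J) g) :=
    quasiIso_tensorMap_right_of_torOrth J g d a' b' (fun p q => hflat _ q)
      (fun p q => hJΦ p _ (hK q))
  have h2 := quasiIso_homCxMapRight_of_isKProjective P (tensorMap (𝟙 J) g)
  have h3 := quasiIso_homCxMapLeft_of_isKInjective f J
  have h4 := quasiIso_tensorMap_of_flat (homCxMapLeft f J) Q d hQ
  have := isStrictlyGE_homCx P J a' b
  have := isStrictlyGE_homCx I J a' b
  have := isStrictlyLE_homCx I J a b'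
  have hI : ∀ n G, Φ G → TorOrth ((resMod B T).obj ((homCx I J).X n)) G := fun n G hG =>
    orth_homCx_X (Finset.Icc a b) n (fun p hp => Or.inl (by
      by_cases h : a ≤ p
      · exact I.isZero_of_isStrictlyLE b p (by rw [Finset.mem_Icc] at hp; lia)
      · exact I.isZero_of_isStrictlyGE a p (by lia))) fun p q => hIJ p q G hG
  have hP : ∀ n G, Φ G → TorOrth ((resMod B T).obj ((homCx P J).X n)) G := fun n G hG =>
    -- Only columns with `p ≤ b` and `a' ≤ p + n` contribute, so each term is a finite sum although
    -- `P` is unbounded below.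
    orth_homCx_X (Finset.Icc (a' - n) b) n (fun p hp => by
      by_cases h : p ≤ b
      · exact Or.inr (J.isZero_of_isStrictlyGE a' _ (by rw [Finset.mem_Icc] at hp; lia))
      · exact Or.inl (P.isZero_of_isStrictlyLE b p (by lia))) fun p q => hPJ p q G hG
  have h5 := quasiIso_tensorMap_left_of_torOrth (homCxMapLeft f J) K (a' - b) c d hΦ hK hI hP
  have h6 := quasiIso_tensorMap_right_of_torOrth (homCx I J) g d (a' - b) (b' - a)
    (fun p q => hflat _ q) (fun p q => hI p _ (hK q))
  -- In the square formed by `Hom (f, J)` and `g`, the other three sides are quasi-isomorphisms by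
  -- `h4`, `h5` and `h6`.
  have h7 : QuasiIso (tensorMap (𝟙 (homCx P J)) g) := by
    have : QuasiIso (tensorMap (homCxMapLeft f J) (𝟙 Q) ≫ tensorMap (𝟙 (homCx P J)) g) := by
      rw [tensorMap_comm]; infer_instance
    exact quasiIso_of_comp_left (tensorMap (homCxMapLeft f J) (𝟙 Q)) _
  have : QuasiIso (tev P J Q ≫ homCxMapRight P (tensorMap (𝟙 J) g)) := by
    rw [tev_naturality_right]; infer_instance
  exact quasiIso_of_comp_right _ (homCxMapRight P (tensorMap (𝟙 J) g))

/-- Evaluation at `(K, Y, Q)` is an isomorphism, now because `K` and `Y` are bounded. Naturality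
along `f : P ⟶ K` reduces the claim to restriction along `f` into `Y ⊗ Q`. This target need not be
bounded below, so it is replaced through `g` by the bounded complex `Y ⊗ I`. -/
theorem quasiIso_tev_of_flat {P K : CochainComplex (ModuleCat.{u} A) ℤ} (f : P ⟶ K)
    [QuasiIso f] (Y : CochainComplex (ModuleCat.{u} T) ℤ)
    {Q I : CochainComplex (ModuleCat.{u} B) ℤ} (g : Q ⟶ I) [QuasiIso g]
    (a b : ℤ) [P.IsStrictlyLE b] [K.IsStrictlyGE a] [K.IsStrictlyLE b]
    (a' b' : ℤ) [Y.IsStrictlyGE a'] [Y.IsStrictlyLE b']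
    (c d : ℤ) [Q.IsStrictlyLE d] [I.IsStrictlyGE c] [I.IsStrictlyLE d]
    (hP : ∀ p, Projective (P.X p)) (hQ : ∀ j, Module.Flat B (Q.X j)) {Φ : ModuleCat.{u} A → Prop}
    (hΦ : ∀ X, Φ X → ∃ (P X' : ModuleCat.{u} A) (f : X ⟶ P) (g : P ⟶ X'), IsSES f g ∧
      Projective P ∧ Φ X') (hK : ∀ q, Φ (K.X q))
    (hYI : ∀ i j, TorOrth ((resMod B T).obj (Y.X i)) (I.X j))
    (hΦY : ∀ G i, Φ G → Orth G ((resMod A T).obj (Y.X i)))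
    (hΦQ : ∀ G i j, Φ G → Orth G ((resMod A T).obj (((tensorBif B T).obj (Y.X i)).obj (Q.X j))))
    (hΦI : ∀ G i j, Φ G → Orth G ((resMod A T).obj (((tensorBif B T).obj (Y.X i)).obj (I.X j))))
    (H : ∀ p q j, Function.Bijective (modTev (K.X p) (Y.X q) (Q.X j)).hom) :
    QuasiIso (tev P Y Q) := by
  have hflat : ∀ (M : ModuleCat.{u} B) j, TorOrth M (Q.X j) := fun M j =>
    have := hQ j
    have := injective_charMod (Q.X j)
    Orth.of_injective
  have := CochainComplex.isKProjective_of_projective P b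
  have : IsIso (tev K Y Q) :=
    isIso_tev_of_bounded ⟨a', b', inferInstance, inferInstance⟩
      (Or.inl ⟨a, b, inferInstance, inferInstance⟩) H
  have h1 : QuasiIso (homCxMapLeft f Y) :=
    quasiIso_homCxMapLeft_of_bounded_above f Y b a' b' (fun p q => hΦY _ q (hK p))
      (fun p q => Orth.of_projective)
  have h2 := quasiIso_tensorMap_of_flat (homCxMapLeft f Y) Q d hQ
  have h3 : QuasiIso (tensorMap (𝟙 Y) g) :=
    quasiIso_tensorMap_right_of_torOrth Y g d a' b' (fun p q => hflat _ q) hYI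
  have h4 := quasiIso_homCxMapRight_of_isKProjective P (tensorMap (𝟙 Y) g)
  have := isStrictlyLE_tensorCx Y Q b' d
  have := isStrictlyLE_tensorCx Y I b' d
  have := isStrictlyGE_tensorCx Y I a' c
  have hQ' : ∀ G n, Φ G → Orth G ((resMod A T).obj ((tensorCx Y Q).X n)) := fun G n hG =>
    orth_tensorCx_X a' b' n fun i j => hΦQ G i j hG
  have hI' : ∀ G n, Φ G → Orth G ((resMod A T).obj ((tensorCx Y I).X n)) := fun G n hG =>
    orth_tensorCx_X a' b' n fun i j => hΦI G i j hG
  have h5 : QuasiIso (homCxMapRight K (tensorMap (𝟙 Y) g)) :=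
    quasiIso_homCxMapRight_of_bounded_above K (tensorMap (𝟙 Y) g) (b' + d) a b hΦ hK hQ' hI'
  have h6 : QuasiIso (homCxMapLeft f (tensorCx Y I)) :=
    quasiIso_homCxMapLeft_of_bounded_above f (tensorCx Y I) b (a' + c) (b' + d)
      (fun p q => hI' _ q (hK p)) (fun p q => Orth.of_projective)
  -- The square formed by `f` and `Y ⊗ g` has quasi-isomorphisms on its other three sides, by `h4`,
  -- `h5` and `h6`.
  have h7 : QuasiIso (homCxMapLeft f (tensorCx Y Q)) := by
    have : QuasiIso (homCxMapLeft f (tensorCx Y Q) ≫ homCxMapRight P (tensorMap (𝟙 Y) g)) := by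
      rw [← homCxMap_comm]; infer_instance
    exact quasiIso_of_comp_right _ (homCxMapRight P (tensorMap (𝟙 Y) g))
  have : QuasiIso (tensorMap (homCxMapLeft f Y) (𝟙 Q) ≫ tev P Y Q) := by
    rw [← tev_naturality_left]; infer_instance
  exact quasiIso_of_comp_left (tensorMap (homCxMapLeft f Y) (𝟙 Q)) _

end main
end
end TensorEval

namespace TensorEval
noncomputable section

/-! ### Independence of the chosen models and resolutions -/

section reduction

lemma exists_quasiIso_of_isKProjective {C : Type*} [Category C] [Abelian C]
    [HasDerivedCategory.{w} C] {K L : CochainComplex C ℤ} [K.IsKProjective]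
    (e : DerivedCategory.Q.obj K ≅ DerivedCategory.Q.obj L) : ∃ f : K ⟶ L, QuasiIso f := by
  obtain ⟨k, hk⟩ := (CochainComplex.IsKProjective.Qh_map_bijective (C := C) K
      ((HomotopyCategory.quotient _ _).obj L)).surjective e.hom
  obtain ⟨k, rfl⟩ := (HomotopyCategory.quotient _ _).map_surjective k
  refine ⟨k, (DerivedCategory.isIso_Q_map_iff_quasiIso _ k).1 ?_⟩
  rw [show DerivedCategory.Q.map k = e.hom from hk]
  infer_instance

/-- Quasi-isomorphisms induce isomorphisms in the derived category. -/
def isoOfQuasiIso {C : Type*} [Category C] [Abelian C] [HasDerivedCategory.{w} C]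
    {K L : CochainComplex C ℤ} (f : K ⟶ L) [QuasiIso f] :
    DerivedCategory.Q.obj K ≅ DerivedCategory.Q.obj L :=
  have := (DerivedCategory.isIso_Q_map_iff_quasiIso _ f).2 inferInstance
  asIso (DerivedCategory.Q.map f)

variable {A B T : Type u} [CommRing A] [CommRing B] [CommRing T] [Algebra A T] [Algebra B T]

/-- With `P` K-projective and `Q` bounded above and flat, both sides of the evaluation respect
quasi-isomorphisms in the middle variable. -/
lemma quasiIso_tev_iff_middle (P : CochainComplex (ModuleCat.{u} A) ℤ) [P.IsKProjective]
    {Y Y' : CochainComplex (ModuleCat.{u} T) ℤ} (t : Y ⟶ Y') [QuasiIso t]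
    (Q : CochainComplex (ModuleCat.{u} B) ℤ) (d : ℤ) [Q.IsStrictlyLE d]
    (hQ : ∀ j, Module.Flat B (Q.X j)) : QuasiIso (tev P Y Q) ↔ QuasiIso (tev P Y' Q) := by
  have h1 := quasiIso_tensorMap_of_flat t Q d hQ
  have h2 := quasiIso_homCxMapRight_of_isKProjective P t
  have h3 := quasiIso_homCxMapRight_of_isKProjective P (tensorMap t (𝟙 Q))
  have h4 := quasiIso_tensorMap_of_flat (homCxMapRight P t) Q d hQ
  have h := tev_naturality_middle P t Q
  constructor
  · intro _
    have : QuasiIso (tensorMap (homCxMapRight P t) (𝟙 Q) ≫ tev P Y' Q) := by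
      rw [← h]; infer_instance
    exact quasiIso_of_comp_left (tensorMap (homCxMapRight P t) (𝟙 Q)) _
  · intro _
    have : QuasiIso (tev P Y Q ≫ homCxMapRight P (tensorMap t (𝟙 Q))) := by
      rw [h]; infer_instance
    exact quasiIso_of_comp_right _ (homCxMapRight P (tensorMap t (𝟙 Q)))

/-- All later cases use this reduction: it suffices to find convenient representatives `P`, `Y₀`,
`Q`. The outer variables are compared by maps out of K-projective complexes, the middle one by a
roof. -/
theorem isIso_derivedTev [HasDerivedCategory.{w₁} (ModuleCat.{u} A)]
    [HasDerivedCategory.{w₂} (ModuleCat.{u} B)] [HasDerivedCategory.{w} (ModuleCat.{u} T)]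
    {X P : CochainComplex (ModuleCat.{u} A) ℤ} {Y Y₀ : CochainComplex (ModuleCat.{u} T) ℤ}
    {Z Q : CochainComplex (ModuleCat.{u} B) ℤ} (p : KProjRes X) (q : KProjRes Z)
    [P.IsKProjective] (eP : DerivedCategory.Q.obj P ≅ DerivedCategory.Q.obj X)
    (eY : DerivedCategory.Q.obj Y₀ ≅ DerivedCategory.Q.obj Y)
    (d : ℤ) [Q.IsStrictlyLE d] (hQ : ∀ j, Projective (Q.X j))
    (eQ : DerivedCategory.Q.obj Q ≅ DerivedCategory.Q.obj Z) (h : QuasiIso (tev P Y₀ Q)) :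
    IsIso (derivedTev p Y q) := by
  have := p.isKProjective
  have := p.quasiIso
  have := q.isKProjective
  have := q.quasiIso
  have := CochainComplex.isKProjective_of_projective Q d
  obtain ⟨s, _⟩ := exists_quasiIso_of_isKProjective (eP ≪≫ (isoOfQuasiIso p.π).symm)
  obtain ⟨t, _⟩ := exists_quasiIso_of_isKProjective (eQ ≪≫ (isoOfQuasiIso q.π).symm)
  have hQ' : ∀ j, Module.Flat B (Q.X j) := fun j =>
    have := (IsProjective.iff_projective (R := B) (Q.X j)).2 (hQ j)
    inferInstance
  have h1 : QuasiIso (tev P Y Q) := by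
    -- The middle complex has no lifting property, so the isomorphism is written as a roof `Y₀ ⟵ Y₁
    -- ⟶ Y` of quasi-isomorphisms.
    obtain ⟨Y₁, r, hr, k, hk⟩ := DerivedCategory.right_fac eY.hom
    have hr' := (DerivedCategory.isIso_Q_map_iff_quasiIso _ r).1 hr
    have hk' : QuasiIso k := by
      rw [← DerivedCategory.isIso_Q_map_iff_quasiIso]
      have : IsIso (inv (DerivedCategory.Q.map r) ≫ DerivedCategory.Q.map k) := by
        rw [← hk]; infer_instance
      exact IsIso.of_isIso_comp_left (inv (DerivedCategory.Q.map r)) _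
    rw [← quasiIso_tev_iff_middle P k Q d hQ', quasiIso_tev_iff_middle P r Q d hQ']
    exact h
  have h2 : QuasiIso (tev p.P Y Q) := by
    have h3 := quasiIso_homCxMapLeft_of_isKProjective s Y
    have h4 := quasiIso_homCxMapLeft_of_isKProjective s (tensorCx Y Q)
    have h5 := quasiIso_tensorMap_of_flat (homCxMapLeft s Y) Q d hQ'
    have : QuasiIso (tev p.P Y Q ≫ homCxMapLeft s (tensorCx Y Q)) := by
      rw [tev_naturality_left]; infer_instance
    exact quasiIso_of_comp_right _ (homCxMapLeft s (tensorCx Y Q))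
  have h3 : QuasiIso (tev p.P Y q.P) := by
    have h4 := quasiIso_tensorMap_of_isKProjective Y t
    have h5 := quasiIso_tensorMap_of_isKProjective (homCx p.P Y) t
    have h6 := quasiIso_homCxMapRight_of_isKProjective p.P (tensorMap (𝟙 Y) t)
    have : QuasiIso (tensorMap (𝟙 (homCx p.P Y)) t ≫ tev p.P Y q.P) := by
      rw [← tev_naturality_right]; infer_instance
    exact quasiIso_of_comp_left (tensorMap (𝟙 (homCx p.P Y)) t) _
  exact (DerivedCategory.isIso_Q_map_iff_quasiIso _ _).2 h3

end reduction
end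
end TensorEval

namespace TensorEval
noncomputable section

/-! ### Symmetry of Tor-vanishing and dimension shifting -/

section orthogonality
open Abelian
variable {R : Type u} [CommRing R]

lemma IsSES.exists_desc {M₁ M₂ M₃ B : ModuleCat.{u} R} {f : M₁ ⟶ M₂} {g : M₂ ⟶ M₃}
    (h : IsSES f g) (k : M₂ ⟶ B) (hk : f ≫ k = 0) : ∃ k' : M₃ ⟶ B, g ≫ k' = k := by
  have : Epi (ShortComplex.mk _ _ h.comp_zero).g := (ModuleCat.epi_iff_surjective _).2 h.surj
  exact ⟨h.shortExact.exact.desc k hk, h.shortExact.exact.g_desc k hk⟩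

lemma IsSES.exists_fac {M₁ M₂ M₃ B : ModuleCat.{u} R} {f : M₁ ⟶ M₂} {g : M₂ ⟶ M₃}
    (h : IsSES f g) (k : B ⟶ M₂) (hk : k ≫ g = 0) : ∃ k' : B ⟶ M₁, k' ≫ f = k := by
  have : Mono (ShortComplex.mk _ _ h.comp_zero).f := (ModuleCat.mono_iff_injective _).2 h.inj
  exact ⟨h.shortExact.exact.lift k hk, h.shortExact.exact.lift_f k hk⟩

lemma IsSES.mono {M₁ M₂ M₃ : ModuleCat.{u} R} {f : M₁ ⟶ M₂} {g : M₂ ⟶ M₃}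
    (h : IsSES f g) : Mono f := (ModuleCat.mono_iff_injective _).2 h.inj

lemma IsSES.epi {M₁ M₂ M₃ : ModuleCat.{u} R} {f : M₁ ⟶ M₂} {g : M₂ ⟶ M₃}
    (h : IsSES f g) : Epi g := (ModuleCat.epi_iff_surjective _).2 h.surj

/-- Partial converse of `IsSES.exists_extension`: every class in `Ext^1 (M₃, B)` is the connecting
image of a map `M₁ ⟶ B`, and it vanishes once that map extends. -/
lemma IsSES.subsingleton_ext_one {M₁ M₂ M₃ B : ModuleCat.{u} R} {f : M₁ ⟶ M₂} {g : M₂ ⟶ M₃}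
    (h : IsSES f g) (h₂ : Subsingleton (Ext M₂ B 1))
    (H : ∀ k : M₁ ⟶ B, ∃ k' : M₂ ⟶ B, f ≫ k' = k) : Subsingleton (Ext M₃ B 1) := by
  refine subsingleton_of_forall_eq 0 fun x => ?_
  obtain ⟨y, rfl⟩ := Ext.contravariant_sequence_exact₃ h.shortExact B x (Subsingleton.elim _ _)
    (n₀ := 0) (add_zero 1)
  obtain ⟨k, rfl⟩ := Ext.homEquiv₀.symm.surjective y
  obtain ⟨k', rfl⟩ := H k
  rw [Ext.homEquiv₀_symm_apply, ← Ext.mk₀_comp_mk₀]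
  exact h.shortExact.extClass_comp_assoc _

/-- The free module on the elements of `M`, with its projection to `M`, and the kernel. -/
lemma exists_isSES_projective (M : ModuleCat.{u} R) : ∃ (K P : ModuleCat.{u} R) (f : K ⟶ P)
    (g : P ⟶ M), IsSES f g ∧ Projective P := by
  let g : (M →₀ R) →ₗ[R] M := Finsupp.linearCombination R id
  refine ⟨ModuleCat.of R (LinearMap.ker g), ModuleCat.of R (M →₀ R), _, _, IsSES.of_linearMap
    (f := (LinearMap.ker g).subtype) (g := g) Subtype.val_injective
    (LinearMap.exact_subtype_ker_map g) (Finsupp.linearCombination_id_surjective R M), ?_⟩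
  exact (IsProjective.iff_projective (R := R) (M →₀ R)).1 inferInstance

lemma exists_isSES_injective (M : ModuleCat.{u} R) : ∃ (E C : ModuleCat.{u} R) (f : M ⟶ E)
    (g : E ⟶ C), IsSES f g ∧ Injective E := by
  let f := Injective.ι M
  exact ⟨Injective.under M, ModuleCat.of R (_ ⧸ LinearMap.range f.hom), f,
    ModuleCat.ofHom (LinearMap.range f.hom).mkQ,
    ⟨(ModuleCat.mono_iff_injective f).1 inferInstance, LinearMap.exact_map_mkQ_range f.hom,
      Submodule.mkQ_surjective _⟩, inferInstance⟩

/-- Interchange the two variables of a bilinear form with values in `ℚ/ℤ`. -/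
def charFlip {M N : ModuleCat.{u} R} (f : M ⟶ charMod N) : N ⟶ charMod M :=
  ModuleCat.ofHom
    { toFun := fun n => (AddMonoidHom.mk' (fun m => (show CharacterModule N from f.hom m) n)
        fun m m' => by rw [map_add]; rfl : M →+ _)
      map_add' := fun n n' => DFunLike.ext (F := CharacterModule M) _ _ fun m =>
        map_add (show CharacterModule N from f.hom m) n n'
      map_smul' := fun r n => DFunLike.ext (F := CharacterModule M) _ _ fun m => by
        change (show CharacterModule N from f.hom m) (r • n) =
          (show CharacterModule N from f.hom (r • m)) n
        exact congrArg (fun c : CharacterModule N => c n) (f.hom.map_smul r m).symm }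

lemma charFlip_charFlip {M N : ModuleCat.{u} R} (f : M ⟶ charMod N) : charFlip (charFlip f) = f :=
  rfl

lemma charFlip_comp {M M' N : ModuleCat.{u} R} (g : M' ⟶ M) (f : M ⟶ charMod N) :
    charFlip (g ≫ f) = charFlip f ≫ charMap g := rfl

lemma charMap_comp {M M' M'' : ModuleCat.{u} R} (f : M ⟶ M') (g : M' ⟶ M'') :
    charMap (f ≫ g) = charMap g ≫ charMap f := rfl

/-- This is the symmetry of `Tor_1`, proved with bilinear forms: a map `M ⟶ N^∨` is a form on `M ×
N`, and `charFlip` exchanges the variables. -/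
lemma subsingleton_ext_one_charMod {M N : ModuleCat.{u} R}
    (h : Subsingleton (Ext M (charMod N) 1)) : Subsingleton (Ext N (charMod M) 1) := by
  obtain ⟨K, P, κ, π, hM, _⟩ := exists_isSES_projective M
  obtain ⟨L, F, i, ν, hN, _⟩ := exists_isSES_projective N
  have := (IsProjective.iff_projective (R := R) P).2 inferInstance
  have := injective_charMod P
  refine hN.subsingleton_ext_one (Ext.subsingleton_of_projective F _ 0) fun φ => ?_
  have := hN.mono
  have := hN.epi
  have := hM.char.mono
  -- First extend `φ` with values in the injective module `P^∨`, which contains `M^∨`. The failure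
  -- of `ψ` to take values in `M^∨` is a map `χ : N ⟶ K^∨`; its flip extends from `K` to `P` by
  -- hypothesis, and subtracting the flipped extension corrects `ψ` without changing it on `L`.
  let ψ : F ⟶ charMod P := Injective.factorThru (φ ≫ charMap π) i
  have hψ : i ≫ ψ = φ ≫ charMap π := Injective.comp_factorThru _ _
  obtain ⟨χ, hχ⟩ := hN.exists_desc (ψ ≫ charMap κ) (by
    rw [reassoc_of% hψ, ← charMap_comp, hM.comp_zero]
    refine ModuleCat.hom_ext (LinearMap.ext fun x => ?_)
    exact DFunLike.ext (F := CharacterModule K) _ _ fun y =>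
      map_zero (show M →+ _ from φ.hom x))
  obtain ⟨ξ, hξ⟩ := hM.exists_extension h (charFlip χ)
  have hξ' : charFlip ξ ≫ charMap κ = χ := by rw [← charFlip_comp, hξ, charFlip_charFlip]
  obtain ⟨θ, hθ⟩ := hM.char.exists_fac (ψ - ν ≫ charFlip ξ) (by
    rw [Preadditive.sub_comp, Category.assoc, hξ', hχ, sub_self])
  refine ⟨θ, ?_⟩
  rw [← cancel_mono (charMap π), Category.assoc, hθ, Preadditive.comp_sub, hψ, ← Category.assoc,
    hN.comp_zero, Limits.zero_comp, sub_zero]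

lemma subsingleton_ext_charMod (n : ℕ) {M N : ModuleCat.{u} R}
    (h : Subsingleton (Ext M (charMod N) (n + 1))) : Subsingleton (Ext N (charMod M) (n + 1)) := by
  induction n generalizing M N with
  | zero => exact subsingleton_ext_one_charMod h
  | succ n ih =>
    obtain ⟨K, P, κ, π, hM, _⟩ := exists_isSES_projective M
    have := (IsProjective.iff_projective (R := R) P).2 inferInstance
    have := injective_charMod P
    have h1 : Subsingleton (Ext K (charMod N) (n + 1)) :=
      hM.subsingleton_left₁ _ _ (Ext.subsingleton_of_projective P _ n) h
    exact hM.char.subsingleton_right₁ _ _ (Ext.subsingleton_of_injective _ _ (n + 1)) (ih h1)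

lemma TorOrth.symm {M N : ModuleCat.{u} R} (h : TorOrth M N) : TorOrth N M :=
  fun n => subsingleton_ext_charMod n (h n)

lemma TorOrth.of_flat_right {M N : ModuleCat.{u} R} [Module.Flat R N] : TorOrth M N :=
  have := injective_charMod N
  Orth.of_injective

lemma TorOrth.of_flat_left {M N : ModuleCat.{u} R} [Module.Flat R M] : TorOrth M N :=
  TorOrth.of_flat_right.symm

lemma IsSES.ext_left_shift {M₁ M₂ M₃ B : ModuleCat.{u} R} {f : M₁ ⟶ M₂} {g : M₂ ⟶ M₃}
    (h : IsSES f g) (h₂ : Orth M₂ B) (n : ℕ) :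
    Subsingleton (Ext M₁ B (n + 1)) ↔ Subsingleton (Ext M₃ B (n + 2)) :=
  ⟨fun h₁ => h.subsingleton_left₃ _ _ h₁ (h₂ (n + 1)),
    fun h₃ => h.subsingleton_left₁ _ _ (h₂ n) h₃⟩

lemma IsSES.ext_right_shift {M₁ M₂ M₃ B : ModuleCat.{u} R} {f : M₁ ⟶ M₂} {g : M₂ ⟶ M₃}
    (h : IsSES f g) (h₂ : Orth B M₂) (n : ℕ) :
    Subsingleton (Ext B M₃ (n + 1)) ↔ Subsingleton (Ext B M₁ (n + 2)) :=
  ⟨fun h₃ => h.subsingleton_right₁ _ _ (h₂ (n + 1)) h₃,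
    fun h₁ => h.subsingleton_right₃ _ _ (h₂ n) h₁⟩

/-- A module in a class with coresolutions by modules that are orthogonal to `B` is orthogonal
to `B` if `B` has finite injective dimension. -/
lemma orth_of_hasInjectiveDimensionLT {Φ : ModuleCat.{u} R → Prop} {B : ModuleCat.{u} R} (d : ℕ)
    [HasInjectiveDimensionLT B d]
    (hΦ : ∀ X, Φ X → ∃ (P X' : ModuleCat.{u} R) (f : X ⟶ P) (g : P ⟶ X'), IsSES f g ∧
      Orth P B ∧ Φ X') {X : ModuleCat.{u} R} (hX : Φ X) : Orth X B := by
  -- Replacing `X` by its cosyzygy raises the `Ext` degree by one; `k` counts the steps still needed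
  -- to reach the injective dimension.
  have key : ∀ (k n : ℕ), d ≤ n + 1 + k → ∀ X, Φ X → Subsingleton (Ext X B (n + 1)) := by
    intro k
    induction k with
    | zero => exact fun n hn X _ => HasInjectiveDimensionLT.subsingleton B d (n + 1) hn X
    | succ k ih =>
      intro n hn X hX
      obtain ⟨P, X', f, g, h, hP, hX'⟩ := hΦ X hX
      exact (h.ext_left_shift hP n).2 (ih (n + 1) (by lia) X' hX')
  exact fun n => key d n (by lia) X hX

/-- If `X` is orthogonal to injective modules after dualizing, then to modules of finite
injective dimension. -/
lemma torOrth_of_hasInjectiveDimensionLT {G : ModuleCat.{u} R}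
    (hG : ∀ E : ModuleCat.{u} R, Injective E → TorOrth E G) (d : ℕ) :
    ∀ (J : ModuleCat.{u} R), HasInjectiveDimensionLT J d → TorOrth J G := by
  induction d with
  | zero => exact fun J hJ => Orth.of_isZero_left (isZero_of_hasInjectiveDimensionLT_zero J)
  | succ d ih =>
    intro J hJ
    obtain ⟨E, C, f, g, h, hE⟩ := exists_isSES_injective J
    -- Dimension below `1` means that `J` itself is injective; it is separated because the shift
    -- below works only in positive `Ext` degrees.
    rcases d with _ | d
    · exact hG J (injective_iff_hasInjectiveDimensionLT_one.2 hJ)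
    · refine h.orth_left₁ (hG E hE) (ih C ?_)
      rw [hasInjectiveDimensionLT_iff]
      intro i hi X e
      obtain ⟨i, rfl⟩ : ∃ j, i = j + 1 := ⟨i - 1, by lia⟩
      have := (h.ext_right_shift (B := X) Orth.of_injective i).2
        (HasInjectiveDimensionLT.subsingleton J (d + 1 + 1) (i + 2) (by lia) X)
      exact Subsingleton.elim _ _

/-- If `X` is orthogonal to projective modules, then to modules of finite projective dimension. -/
lemma orth_of_hasProjectiveDimensionLT {X : ModuleCat.{u} R}
    (hX : ∀ P : ModuleCat.{u} R, Projective P → Orth X P) (d : ℕ) :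
    ∀ (N : ModuleCat.{u} R), HasProjectiveDimensionLT N d → Orth X N := by
  induction d with
  | zero => exact fun N hN => Orth.of_isZero_right (isZero_of_hasProjectiveDimensionLT_zero N)
  | succ d ih =>
    intro N hN
    obtain ⟨K, P, f, g, h, hP⟩ := exists_isSES_projective N
    rcases d with _ | d
    · exact hX N (projective_iff_hasProjectiveDimensionLT_one.2 hN)
    · refine h.orth_right₃ (hX P hP) (ih K ?_)
      rw [hasProjectiveDimensionLT_iff]
      intro i hi Y e
      obtain ⟨i, rfl⟩ : ∃ j, i = j + 1 := ⟨i - 1, by lia⟩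
      have := (h.ext_left_shift (B := Y) Orth.of_projective i).2
        (HasProjectiveDimensionLT.subsingleton N (d + 1 + 1) (i + 2) (by lia) Y)
      exact Subsingleton.elim _ _

end orthogonality
end
end TensorEval

namespace TensorEval
noncomputable section

/-! ### Modules with orthogonal cosyzygies -/

section coresolving
open Abelian
variable {R : Type u} [CommRing R] {A B C T A' C' X : ModuleCat.{u} R}

/-- The third isomorphism theorem. -/
lemma IsSES.exists_comp {f : B ⟶ X} {g : X ⟶ A'} (h : IsSES f g) {i : X ⟶ T} {p : T ⟶ C'}
    (h' : IsSES i p) : ∃ (B' : ModuleCat.{u} R) (p' : T ⟶ B') (j : A' ⟶ B') (q : B' ⟶ C'),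
      IsSES (f ≫ i) p' ∧ IsSES j q := by
  let p' : T ⟶ ModuleCat.of R (T ⧸ LinearMap.range (f ≫ i).hom) :=
    ModuleCat.ofHom (LinearMap.range (f ≫ i).hom).mkQ
  have hp : IsSES (f ≫ i) p' := ⟨h'.inj.comp h.inj, LinearMap.exact_map_mkQ_range (f ≫ i).hom,
    Submodule.mkQ_surjective _⟩
  obtain ⟨j, hj⟩ := h.exists_desc (i ≫ p') (by rw [← Category.assoc, hp.comp_zero])
  obtain ⟨q, hq⟩ := hp.exists_desc p (by rw [Category.assoc, h'.comp_zero, Limits.comp_zero])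
  have hj' : ∀ x, j.hom (g.hom x) = p'.hom (i.hom x) := fun x => congr($(hj).hom x)
  have hq' : ∀ x, q.hom (p'.hom x) = p.hom x := fun x => congr($(hq).hom x)
  refine ⟨_, p', j, q, hp, (injective_iff_map_eq_zero _).2 fun a ha => ?_, fun b => ?_,
    fun c => ?_⟩
  · obtain ⟨x, rfl⟩ := h.surj a
    rw [hj'] at ha
    obtain ⟨b, hb⟩ := (hp.exact _).1 ha
    obtain rfl : f.hom b = x := h'.inj hb
    exact (h.exact _).2 ⟨b, rfl⟩
  · obtain ⟨t, rfl⟩ := hp.surj b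
    rw [hq', h'.exact]
    constructor
    · rintro ⟨x, rfl⟩
      exact ⟨g.hom x, hj' x⟩
    · rintro ⟨a, ha⟩
      obtain ⟨x, rfl⟩ := h.surj a
      rw [hj', ← sub_eq_zero, ← map_sub] at ha
      obtain ⟨b, hb⟩ := (hp.exact _).1 ha
      refine ⟨x - f.hom b, ?_⟩
      rw [map_sub, show i.hom (f.hom b) = _ from hb]
      abel
  · obtain ⟨t, rfl⟩ := h'.surj c
    exact ⟨_, hq' t⟩

/-- The pushout of a short exact sequence along a monomorphism. -/
lemma IsSES.exists_pushout {f : A ⟶ B} {g : B ⟶ C} (h : IsSES f g) {i : A ⟶ T} {p : T ⟶ A'}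
    (h' : IsSES i p) : ∃ (X : ModuleCat.{u} R) (t : T ⟶ X) (c : X ⟶ C) (b : B ⟶ X) (a : X ⟶ A'),
      IsSES t c ∧ IsSES b a ∧ ∀ (Z : ModuleCat.{u} R) (β : B ⟶ Z) (τ : T ⟶ Z), f ≫ β = i ≫ τ →
        ∃ r : X ⟶ Z, b ≫ r = β ∧ t ≫ r = τ := by
  let k : A ⟶ ModuleCat.of R (B × T) := ModuleCat.ofHom (f.hom.prod (-i.hom))
  let q : ModuleCat.of R (B × T) ⟶ ModuleCat.of R ((B × T) ⧸ LinearMap.range k.hom) :=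
    ModuleCat.ofHom (LinearMap.range k.hom).mkQ
  have hq : IsSES k q := ⟨fun x y hxy => h.inj (congrArg Prod.fst hxy),
    LinearMap.exact_map_mkQ_range k.hom, Submodule.mkQ_surjective _⟩
  obtain ⟨c, hc⟩ := hq.exists_desc (ModuleCat.ofHom (g.hom ∘ₗ LinearMap.fst R B T)) (by
    ext x; exact congr($(h.comp_zero).hom x))
  obtain ⟨a, ha⟩ := hq.exists_desc (ModuleCat.ofHom (p.hom ∘ₗ LinearMap.snd R B T)) (by
    ext x; exact (map_neg p.hom (i.hom x)).trans
      (neg_eq_zero.2 congr($(h'.comp_zero).hom x)))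
  have hc' : ∀ x y, c.hom (q.hom (x, y)) = g.hom x := fun x y => congr($(hc).hom (x, y))
  have ha' : ∀ x y, a.hom (q.hom (x, y)) = p.hom y := fun x y => congr($(ha).hom (x, y))
  have hsurj : ∀ z, ∃ x y, q.hom (x, y) = z := fun z => by
    obtain ⟨⟨x, y⟩, rfl⟩ := hq.surj z
    exact ⟨x, y, rfl⟩
  have hzero : ∀ x y, q.hom (x, y) = 0 → ∃ z, f.hom z = x ∧ i.hom z = -y := fun x y hxy => by
    obtain ⟨z, hz⟩ := (hq.exact _).1 hxy
    exact ⟨z, congrArg Prod.fst hz, neg_eq_iff_eq_neg.1 (congrArg Prod.snd hz)⟩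
  have hfi : ∀ z, q.hom (f.hom z, 0) = q.hom (0, i.hom z) := fun z => by
    rw [← sub_eq_zero, ← map_sub]
    refine Eq.trans (congrArg q.hom ?_) ((hq.exact (k.hom z)).2 ⟨z, rfl⟩)
    exact Prod.ext (sub_zero _) (zero_sub _)
  have hadd : ∀ x y, q.hom (x, y) = q.hom (x, 0) + q.hom (0, y) := fun x y => by
    rw [← map_add]
    exact congrArg q.hom (Prod.ext (add_zero _).symm (zero_add _).symm)
  let t : T ⟶ _ := ModuleCat.ofHom (q.hom ∘ₗ LinearMap.inr R B T)
  let b : B ⟶ _ := ModuleCat.ofHom (q.hom ∘ₗ LinearMap.inl R B T)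
  have ht : ∀ y, t.hom y = q.hom (0, y) := fun y => rfl
  have hb : ∀ x, b.hom x = q.hom (x, 0) := fun x => rfl
  refine ⟨_, t, c, b, a, ⟨(injective_iff_map_eq_zero _).2 fun y hy => ?_, fun z => ?_, fun z => ?_⟩,
    ⟨(injective_iff_map_eq_zero _).2 fun y hy => ?_, fun z => ?_, fun z => ?_⟩, fun Z β τ hβ => ?_⟩
  · obtain ⟨z, hz, hz'⟩ := hzero 0 y hy
    obtain rfl : z = 0 := h.inj (hz.trans (map_zero _).symm)
    rwa [map_zero, eq_comm, neg_eq_zero] at hz'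
  · obtain ⟨x, y, rfl⟩ := hsurj z
    rw [hc', h.exact]
    constructor
    · rintro ⟨z, rfl⟩
      refine ⟨i.hom z + y, ?_⟩
      rw [map_add, ht, ht, hadd (f.hom z) y, hfi]
    · rintro ⟨y', hy⟩
      rw [ht, ← sub_eq_zero, ← map_sub] at hy
      obtain ⟨z, hz, -⟩ := hzero (0 - x) (y' - y) hy
      exact ⟨-z, by rw [map_neg, hz]; abel⟩
  · obtain ⟨x, rfl⟩ := h.surj z
    exact ⟨_, hc' x 0⟩
  · obtain ⟨z, hz, hz'⟩ := hzero y 0 hy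
    obtain rfl : z = 0 := h'.inj (by rw [hz', neg_zero, map_zero])
    rw [← hz, map_zero]
  · obtain ⟨x, y, rfl⟩ := hsurj z
    rw [ha', h'.exact]
    constructor
    · rintro ⟨z, rfl⟩
      refine ⟨f.hom z + x, ?_⟩
      rw [map_add, hb, hb, hadd x (i.hom z), hfi, add_comm]
    · rintro ⟨x', hx⟩
      rw [hb, ← sub_eq_zero, ← map_sub] at hx
      obtain ⟨z, -, hz⟩ := hzero (x' - x) (0 - y) hx
      exact ⟨z, by rw [hz]; abel⟩
  · obtain ⟨y, rfl⟩ := h'.surj z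
    exact ⟨_, ha' 0 y⟩
  · obtain ⟨r, hr⟩ := hq.exists_desc (ModuleCat.ofHom (β.hom.coprod τ.hom)) (by
      ext z
      change β.hom (f.hom z) + τ.hom (-i.hom z) = 0
      rw [map_neg, ← sub_eq_add_neg, sub_eq_zero]
      exact congr($(hβ).hom z))
    have hr' : ∀ x y, r.hom (q.hom (x, y)) = β.hom x + τ.hom y := fun x y =>
      congr($(hr).hom (x, y))
    refine ⟨r, ?_, ?_⟩
    · ext x; exact (hr' x 0).trans (by rw [map_zero, add_zero])
    · ext y; exact (hr' 0 y).trans (by rw [map_zero, zero_add])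

/-- A retraction makes the sequence split. Reading the splitting backwards presents `C` as the
kernel of the epimorphism `r`, the form required by `Coresolved.kernel`. -/
lemma IsSES.exists_section {f : A ⟶ B} {g : B ⟶ C} (h : IsSES f g) {r : B ⟶ A}
    (hr : f ≫ r = 𝟙 A) : ∃ s : C ⟶ B, IsSES s r := by
  obtain ⟨s, hs⟩ := h.exists_desc (𝟙 B - r ≫ f) (by
    rw [Preadditive.comp_sub, reassoc_of% hr, Category.comp_id, sub_self])
  have hs' : ∀ x, s.hom (g.hom x) = x - f.hom (r.hom x) := fun x => congr($(hs).hom x)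
  have hr' : ∀ x, r.hom (f.hom x) = x := fun x => congr($(hr).hom x)
  refine ⟨s, (injective_iff_map_eq_zero _).2 fun c hc => ?_, fun x => ⟨fun hx => ?_, ?_⟩,
    fun x => ⟨_, hr' x⟩⟩
  · obtain ⟨x, rfl⟩ := h.surj c
    rw [hs', sub_eq_zero] at hc
    rw [hc]
    exact (h.exact _).2 ⟨_, rfl⟩
  · exact ⟨g.hom x, by rw [hs', hx, map_zero, sub_zero]⟩
  · rintro ⟨c, rfl⟩
    obtain ⟨x, rfl⟩ := h.surj c
    rw [hs', map_sub, hr', sub_self]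

/-- The embedding of the middle term of a split extension of `C` by `T`, followed by an
embedding of `C`. -/
lemma IsSES.exists_prod {t : T ⟶ X} {c : X ⟶ C} (h : IsSES t c) {r : X ⟶ T} (hr : t ≫ r = 𝟙 T)
    {T' : ModuleCat.{u} R} {i : C ⟶ T'} {p : T' ⟶ C'} (h' : IsSES i p) :
    ∃ (j : X ⟶ ModuleCat.of R (T × T')) (q : ModuleCat.of R (T × T') ⟶ C'), IsSES j q := by
  have hr' : ∀ x, r.hom (t.hom x) = x := fun x => congr($(hr).hom x)
  have htc : ∀ x, c.hom (t.hom x) = 0 := fun x => congr($(h.comp_zero).hom x)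
  refine ⟨ModuleCat.ofHom (r.hom.prod (c ≫ i).hom), ModuleCat.ofHom (p.hom ∘ₗ LinearMap.snd R T T'),
    (injective_iff_map_eq_zero _).2 fun x hx => ?_, fun ⟨y, y'⟩ => ⟨fun hy => ?_, ?_⟩, fun z => ?_⟩
  · have h1 : r.hom x = 0 := congrArg Prod.fst hx
    have h2 : i.hom (c.hom x) = 0 := congrArg Prod.snd hx
    rw [← map_zero i.hom] at h2
    obtain ⟨y, rfl⟩ := (h.exact _).1 (h'.inj h2)
    rw [hr'] at h1
    rw [h1, map_zero]
  · obtain ⟨z, rfl⟩ := (h'.exact y').1 hy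
    obtain ⟨x, rfl⟩ := h.surj z
    refine ⟨x + t.hom (y - r.hom x), Prod.ext ?_ ?_⟩
    · change r.hom (x + t.hom (y - r.hom x)) = y
      rw [map_add, hr']
      abel
    · change i.hom (c.hom (x + t.hom (y - r.hom x))) = i.hom (c.hom x)
      rw [map_add, htc, add_zero]
  · rintro ⟨x, hx⟩
    have : y' = i.hom (c.hom x) := (congrArg Prod.snd hx).symm
    exact (h'.exact y').2 ⟨_, this.symm⟩
  · obtain ⟨y, rfl⟩ := h'.surj z
    exact ⟨(0, y), rfl⟩

/-- The modules that have a coresolution by modules in `𝒯` whose cosyzygies are orthogonal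
to `𝒯`. -/
def Coresolved (𝒯 : ModuleCat.{u} R → Prop) (M : ModuleCat.{u} R) : Prop :=
  ∃ 𝒟 : ModuleCat.{u} R → Prop, 𝒟 M ∧ ∀ D, 𝒟 D → (∀ T, 𝒯 T → Orth D T) ∧
    ∃ (T D' : ModuleCat.{u} R) (f : D ⟶ T) (g : T ⟶ D'), IsSES f g ∧ 𝒯 T ∧ 𝒟 D'

namespace Coresolved
variable {𝒯 : ModuleCat.{u} R → Prop}

lemma orth (h : Coresolved 𝒯 A) (hT : 𝒯 T) : Orth A T := by
  obtain ⟨𝒟, hA, h𝒟⟩ := h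
  exact (h𝒟 A hA).1 T hT

lemma exists_isSES (h : Coresolved 𝒯 A) : ∃ (T A' : ModuleCat.{u} R) (f : A ⟶ T) (g : T ⟶ A'),
    IsSES f g ∧ 𝒯 T ∧ Coresolved 𝒯 A' := by
  obtain ⟨𝒟, hA, h𝒟⟩ := h
  obtain ⟨T, A', f, g, hs, hT, hA'⟩ := (h𝒟 A hA).2
  exact ⟨T, A', f, g, hs, hT, 𝒟, hA', h𝒟⟩

lemma of_isSES {f : A ⟶ T} {g : T ⟶ A'} (h : IsSES f g) (hT : 𝒯 T) (hA' : Coresolved 𝒯 A')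
    (hA : ∀ T, 𝒯 T → Orth A T) : Coresolved 𝒯 A := by
  refine ⟨fun M => M = A ∨ Coresolved 𝒯 M, Or.inl rfl, fun D hD => ?_⟩
  rcases hD with rfl | hD
  · exact ⟨hA, T, A', f, g, h, hT, Or.inr hA'⟩
  · obtain ⟨T, A', f, g, h, hT, hA'⟩ := hD.exists_isSES
    exact ⟨fun T hT => hD.orth hT, T, A', f, g, h, hT, Or.inr hA'⟩

/-- Horseshoe argument: the pushout of the extension along `A ⟶ T` splits since `Ext^1 (C, T) = 0`,
so it embeds in `T × T'`. The cokernel of `B` there is again an extension, of `C'` by `A'`, hence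
the class of all such extensions is a witness. -/
lemma extension (hprod : ∀ T T', 𝒯 T → 𝒯 T' → 𝒯 (ModuleCat.of R (T × T'))) {f : A ⟶ B} {g : B ⟶ C}
    (h : IsSES f g) (hA : Coresolved 𝒯 A) (hC : Coresolved 𝒯 C) : Coresolved 𝒯 B := by
  refine ⟨fun B => ∃ (A C : ModuleCat.{u} R) (f : A ⟶ B) (g : B ⟶ C), IsSES f g ∧
    Coresolved 𝒯 A ∧ Coresolved 𝒯 C, ⟨A, C, f, g, h, hA, hC⟩, ?_⟩
  rintro B ⟨A, C, f, g, h, hA, hC⟩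
  refine ⟨fun T hT => h.orth_left₂ (hA.orth hT) (hC.orth hT), ?_⟩
  obtain ⟨T, A', i, p, hi, hT, hA'⟩ := hA.exists_isSES
  obtain ⟨T', C', i', p', hi', hT', hC'⟩ := hC.exists_isSES
  obtain ⟨X, t, c, b, a, h1, h2, -⟩ := h.exists_pushout hi
  obtain ⟨r, hr⟩ := h1.exists_extension (hC.orth hT 0) (𝟙 T)
  obtain ⟨j, q, h3⟩ := h1.exists_prod hr hi'
  obtain ⟨B', k, j', q', h4, h5⟩ := h2.exists_comp h3
  exact ⟨_, B', _, k, h4, hprod T T' hT hT', A', C', j', q', h5, hA', hC'⟩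

/-- Embed `A` through `B` into `T`. The cokernel is an extension of the cosyzygy of `B` by `C`, to
which `extension` applies. -/
lemma kernel (hprod : ∀ T T', 𝒯 T → 𝒯 T' → 𝒯 (ModuleCat.of R (T × T'))) {f : A ⟶ B} {g : B ⟶ C}
    (h : IsSES f g) (hB : Coresolved 𝒯 B) (hC : Coresolved 𝒯 C) : Coresolved 𝒯 A := by
  obtain ⟨T, B', i, p, hi, hT, hB'⟩ := hB.exists_isSES
  obtain ⟨A', p', j, q, h1, h2⟩ := h.exists_comp hi
  exact of_isSES h1 hT (extension hprod h2 hC hB')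
    fun T hT => h.orth_left₁ (hB.orth hT) (hC.orth hT)

end Coresolved
end coresolving
end
end TensorEval

namespace TensorEval
noncomputable section

/-! ### Ext of finite modules over noetherian rings -/

section noetherian
open Abelian
variable {R : Type u} [CommRing R]

lemma projective_of_free (P : Type u) [AddCommGroup P] [Module R P] [Module.Projective R P] :
    Projective (ModuleCat.of R P) :=
  (IsProjective.iff_projective (R := R) P).1 inferInstance

lemma exists_isSES_finite [IsNoetherianRing R] (M : ModuleCat.{u} R) [Module.Finite R M] :
    ∃ (k : ℕ) (K : ModuleCat.{u} R) (f : K ⟶ ModuleCat.of R (Fin k → R))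
      (g : ModuleCat.of R (Fin k → R) ⟶ M), IsSES f g ∧ Module.Finite R K := by
  obtain ⟨k, g, hg⟩ := Module.Finite.exists_fin' R M
  exact ⟨k, ModuleCat.of R (LinearMap.ker g), _, _, IsSES.of_linearMap
    (f := (LinearMap.ker g).subtype) (g := g) Subtype.val_injective
    (LinearMap.exact_subtype_ker_map g) hg, inferInstanceAs (Module.Finite R (LinearMap.ker g))⟩

/-- Vanishing of `Ext^1` implies vanishing of the higher `Ext` for a class of modules that is
closed under syzygies. -/
lemma orth_of_syzygies {Φ : ModuleCat.{u} R → Prop} {B : ModuleCat.{u} R}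
    (hΦ : ∀ X, Φ X → Subsingleton (Ext X B 1) ∧ ∃ (K P : ModuleCat.{u} R) (f : K ⟶ P)
      (g : P ⟶ X), IsSES f g ∧ Projective P ∧ Φ K) {X : ModuleCat.{u} R} (hX : Φ X) :
    Orth X B := by
  intro n
  induction n generalizing X with
  | zero => exact (hΦ X hX).1
  | succ n ih =>
    obtain ⟨K, P, f, g, h, hP, hK⟩ := (hΦ X hX).2
    exact (h.ext_left_shift Orth.of_projective n).1 (ih hK)

/-- A map from the finitely presented syzygy to a flat module factors through a finite free one,
whose coordinate maps extend because `Ext^1 (M, R) = 0`. -/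
lemma subsingleton_ext_one_flat [IsNoetherianRing R] (M : ModuleCat.{u} R) [Module.Finite R M]
    (h : Subsingleton (Ext M (ModuleCat.of R R) 1)) (F : ModuleCat.{u} R) [Module.Flat R F] :
    Subsingleton (Ext M F 1) := by
  obtain ⟨k, K, i, p, hs, _⟩ := exists_isSES_finite M
  have := projective_of_free (R := R) (Fin k → R)
  have := Module.finitePresentation_of_finite R K
  refine hs.subsingleton_ext_one (Ext.subsingleton_of_projective _ _ 0) fun φ => ?_
  obtain ⟨n, a, b, hab⟩ := Module.Flat.exists_factorization_of_finitePresentation φ.hom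
  have hext := fun j : Fin n => hs.exists_extension h (ModuleCat.ofHom (Finsupp.lapply j ∘ₗ a))
  choose c hc using hext
  refine ⟨ModuleCat.ofHom (b ∘ₗ (Finsupp.linearEquivFunOnFinite R R (Fin n)).symm.toLinearMap ∘ₗ
    LinearMap.pi fun j => (c j).hom), ?_⟩
  ext x
  rw [hab]
  exact congrArg b (Finsupp.ext fun j => congr($(hc j).hom x))

/-- Finite free presentations by matrices. -/
lemma exists_matrix_presentation [IsNoetherianRing R] (M : ModuleCat.{u} R) [Module.Finite R M] :
    ∃ (k m n : ℕ) (U : Matrix (Fin m) (Fin k) R) (V : Matrix (Fin n) (Fin m) R),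
      ∀ N : ModuleCat.{u} R, Subsingleton (Ext M N 1) ↔ ∀ x : Fin m → N,
        (∀ j, ∑ i, V j i • x i = 0) → ∃ y : Fin k → N, ∀ i, x i = ∑ l, U i l • y l := by
  obtain ⟨k, K, f, p, hs, _⟩ := exists_isSES_finite M
  obtain ⟨m, L, f', p', hs', _⟩ := exists_isSES_finite K
  obtain ⟨n, r, hr⟩ := Module.Finite.exists_fin' R L
  have := projective_of_free (R := R) (Fin k → R)
  -- `U` and `V` are the matrices of `R^m → R^k` and `R^n → R^m` in a free resolution of `M`; the
  -- condition is exactness of `N^k → N^m → N^n`. In this form it is defined over `R` and can be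
  -- dualized directly.
  refine ⟨k, m, n, fun i l => f.hom (p'.hom (Pi.single i 1)) l,
    fun j i => f'.hom (r (Pi.single j 1)) i, fun N => ?_⟩
  have hsum : ∀ {a : ℕ} (φ : (Fin a → R) →ₗ[R] N) (v : Fin a → R),
      φ v = ∑ i, v i • φ (Pi.single i 1) := fun φ v => by
    conv_lhs => rw [pi_eq_sum_univ' v, map_sum]
    simp only [map_smul]
  constructor
  · intro h x hx
    let φ : ModuleCat.of R (Fin m → R) ⟶ N := ModuleCat.ofHom (Fintype.linearCombination R x)
    have hφ : ∀ i, φ.hom (Pi.single i 1) = x i := fun i => by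
      change Fintype.linearCombination R x (Pi.single i 1) = x i
      rw [Fintype.linearCombination_apply_single, one_smul]
    have hφf : (f' ≫ φ).hom ∘ₗ r = 0 := by
      refine LinearMap.pi_ext' fun j => LinearMap.ext_ring ?_
      change φ.hom (f'.hom (r (Pi.single j 1))) = 0
      exact (hsum φ.hom _).trans ((Finset.sum_congr rfl fun i _ => by rw [hφ]).trans (hx j))
    obtain ⟨ψ, hψ⟩ := hs'.exists_desc φ (by
      ext y
      obtain ⟨z, rfl⟩ := hr y
      exact congr($hφf z))
    obtain ⟨χ, hχ⟩ := hs.exists_extension h ψ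
    refine ⟨fun l => χ.hom (Pi.single l 1), fun i => ?_⟩
    rw [← hφ, ← hψ]
    change ψ.hom (p'.hom (Pi.single i 1)) = _
    rw [← hχ]
    exact hsum χ.hom _
  · intro H
    refine hs.subsingleton_ext_one (Ext.subsingleton_of_projective _ _ 0) fun φ => ?_
    obtain ⟨y, hy⟩ := H (fun i => φ.hom (p'.hom (Pi.single i 1))) fun j => by
      refine (hsum (p' ≫ φ).hom (f'.hom (r (Pi.single j 1)))).symm.trans ?_
      change φ.hom (p'.hom (f'.hom _)) = 0
      rw [(hs'.exact _).2 ⟨_, rfl⟩, map_zero]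
    refine ⟨ModuleCat.ofHom (Fintype.linearCombination R y), ?_⟩
    have := hs'.epi
    rw [← cancel_epi p']
    refine ModuleCat.hom_ext (LinearMap.pi_ext' fun i => LinearMap.ext_ring ?_)
    exact (hy i).symm

end noetherian

/-! ### Hom and tensor products with injective modules over noetherian rings -/

section hom_injective
open Abelian

lemma exists_fac_of_ker_le {S : Type u} [CommRing S] {M N J : Type u} [AddCommGroup M]
    [AddCommGroup N] [AddCommGroup J] [Module S M] [Module S N] [Module S J] [Module.Injective S J]
    (v : M →ₗ[S] N) (w : M →ₗ[S] J) (h : LinearMap.ker v ≤ LinearMap.ker w) :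
    ∃ t : N →ₗ[S] J, ∀ x, t (v x) = w x := by
  obtain ⟨t, ht⟩ := Module.Injective.out ((LinearMap.ker v).liftQ v le_rfl)
    (LinearMap.ker_eq_bot.1 (Submodule.ker_liftQ_eq_bot' _ v rfl)) ((LinearMap.ker v).liftQ w h)
  exact ⟨t, fun x => ht (Submodule.Quotient.mk x)⟩

/-- `Hom (-, J)` with `J` injective turns the exact sequence `I^k → I^m → I^n` into an exact
sequence of powers of `Hom (I, J)` with the matrices transposed. -/
lemma exists_matrix_fac {S : Type u} [CommRing S] {I J : Type u} [AddCommGroup I]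
    [AddCommGroup J] [Module S I] [Module S J] [Module.Injective S J] {k m n : ℕ}
    (U : Fin m → Fin k → S) (V : Fin n → Fin m → S)
    (h : ∀ x : Fin m → I, (∀ j, ∑ i, V j i • x i = 0) → ∃ y : Fin k → I, ∀ i, x i = ∑ l, U i l • y l)
    (z : Fin m → (I →ₗ[S] J)) (hz : ∀ l, ∑ i, U i l • z i = 0) :
    ∃ t : Fin n → (I →ₗ[S] J), ∀ i, z i = ∑ j, V j i • t j := by
  let w : (Fin m → I) →ₗ[S] J := ∑ i, z i ∘ₗ LinearMap.proj i
  let v : (Fin m → I) →ₗ[S] (Fin n → I) := LinearMap.pi fun j => ∑ i, V j i • LinearMap.proj i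
  have hw : ∀ x, w x = ∑ i, z i (x i) := fun x => by simp [w]
  have hv : ∀ x j, v x j = ∑ i, V j i • x i := fun x j => by simp [v]
  obtain ⟨t, ht⟩ := exists_fac_of_ker_le v w fun x hx => by
    obtain ⟨y, hy⟩ := h x fun j => (hv x j).symm.trans (congrFun hx j)
    rw [LinearMap.mem_ker, hw]
    simp only [hy, map_sum]
    rw [Finset.sum_comm]
    refine Finset.sum_eq_zero fun l _ => ?_
    have := congr($(hz l) (y l))
    simpa only [LinearMap.sum_apply, LinearMap.smul_apply, LinearMap.zero_apply, map_smul]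
      using this
  refine ⟨fun j => t ∘ₗ LinearMap.single S (fun _ => I) j, fun i => LinearMap.ext fun x => ?_⟩
  have h1 : z i x = w (Pi.single i x) := by
    rw [hw, Finset.sum_eq_single i (fun j _ hj => by rw [Pi.single_eq_of_ne hj, map_zero])
      (fun h => (h (Finset.mem_univ i)).elim), Pi.single_eq_same]
  have h2 : v (Pi.single i x) = ∑ j, V j i • LinearMap.single S (fun _ => I) j x := by
    funext j
    rw [hv, Finset.sum_eq_single i (fun j _ hj => by rw [Pi.single_eq_of_ne hj, smul_zero])
      (fun h => (h (Finset.mem_univ i)).elim), Pi.single_eq_same, Finset.sum_apply,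
      Finset.sum_eq_single j (fun j' _ hj => by
        rw [Pi.smul_apply, LinearMap.single_apply, Pi.single_eq_of_ne hj.symm, smul_zero])
      (fun h => (h (Finset.mem_univ j)).elim), Pi.smul_apply, LinearMap.single_apply,
      Pi.single_eq_same]
  rw [h1, ← ht, h2, map_sum, LinearMap.sum_apply]
  simp only [map_smul, LinearMap.smul_apply, LinearMap.comp_apply]

lemma exists_matrix_char {R : Type u} [CommRing R] {H : Type u} [AddCommGroup H] [Module R H]
    {k m n : ℕ} (U : Fin m → Fin k → R) (V : Fin n → Fin m → R)
    (h : ∀ z : Fin m → H, (∀ l, ∑ i, U i l • z i = 0) → ∃ t : Fin n → H, ∀ i, z i = ∑ j, V j i • t j)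
    (x : Fin m → CharacterModule H) (hx : ∀ j, ∑ i, V j i • x i = 0) :
    ∃ y : Fin k → CharacterModule H, ∀ i, x i = ∑ l, U i l • y l := by
  let f : (Fin n → H) →ₗ[R] (Fin m → H) := LinearMap.pi fun i => ∑ j, V j i • LinearMap.proj j
  let g : (Fin m → H) →ₗ[R] (Fin k → H) := LinearMap.pi fun l => ∑ i, U i l • LinearMap.proj i
  have hf : ∀ z i, f z i = ∑ j, V j i • z j := fun z i => by simp [f]
  have hg : ∀ z l, g z l = ∑ i, U i l • z i := fun z l => by simp [g]
  have hsum : ∀ {a : ℕ} (c : Fin a → CharacterModule H) (z : H),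
      (∑ i, c i) z = ∑ i, c i z := fun c z =>
    map_sum (AddMonoidHom.mk' (fun c : CharacterModule H => c z) fun _ _ => rfl) _ _
  let ψ : CharacterModule (Fin m → H) := ∑ i, (x i : H →+ AddCircle (1 : ℚ)).comp (Pi.evalAddMonoidHom (fun _ => H) i)
  have hψ : ∀ z, ψ z = ∑ i, x i (z i) := fun z =>
    map_sum (AddMonoidHom.mk' (fun c : CharacterModule (Fin m → H) => c z) fun _ _ => rfl) _ _
  obtain ⟨χ, hχ⟩ := (exact_iff_dual f g).1
    (fun z hz => by
      obtain ⟨t, ht⟩ := h z fun l => (hg z l).symm.trans (congrFun hz l)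
      exact ⟨t, funext fun i => (hf t i).trans (ht i).symm⟩) ψ
    (DFunLike.ext (F := CharacterModule (Fin n → H)) _ _ fun t => by
      change ψ (f t) = 0
      rw [hψ]
      simp only [hf, map_sum]
      rw [Finset.sum_comm]
      refine Finset.sum_eq_zero fun j _ => ?_
      exact (hsum (fun i => V j i • x i) (t j)).symm.trans
        (congrArg (fun c : CharacterModule H => c (t j)) (hx j)))
  refine ⟨fun l => (χ : (Fin k → H) →+ AddCircle (1 : ℚ)).comp (AddMonoidHom.single (fun _ => H) l),
    fun i => DFunLike.ext (F := CharacterModule H) _ _ fun z => ?_⟩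
  rw [hsum]
  have h1 : x i z = ψ (Pi.single i z) := by
    rw [hψ, Finset.sum_eq_single i (fun j _ hj => by rw [Pi.single_eq_of_ne hj, map_zero])
      (fun h => (h (Finset.mem_univ i)).elim), Pi.single_eq_same]
  have h2 : g (Pi.single i z) = ∑ l, Pi.single l (U i l • z) := by
    funext l
    rw [hg, Finset.sum_eq_single i (fun j _ hj => by rw [Pi.single_eq_of_ne hj, smul_zero])
      (fun h => (h (Finset.mem_univ i)).elim), Pi.single_eq_same, Finset.sum_apply,
      Finset.sum_eq_single l (fun j' _ hj => Pi.single_eq_of_ne hj.symm _)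
      (fun h => (h (Finset.mem_univ l)).elim), Pi.single_eq_same]
  rw [h1, ← hχ]
  change χ (g (Pi.single i z)) = _
  rw [h2, map_sum]
  rfl

variable {R S : Type u} [CommRing R] [CommRing S] [Algebra R S]

lemma injective_resSelf (J : ModuleCat.{u} S) [Injective J] :
    Injective ((resMod S S).obj J) :=
  Injective.of_iso (resSelfIso J).symm inferInstance

/-- In classical terms `Tor_1 (M, Hom (I, J)) = Hom (Ext^1 (M, I), J)` for `M` finite and `J`
injective. Concretely, the matrix form of `Ext^1 (M, I) = 0` is dualized twice, first into `J` and
then into `ℚ/ℤ`. -/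
lemma subsingleton_ext_one_charMod_homMod [IsNoetherianRing R] (M : ModuleCat.{u} R)
    [Module.Finite R M] (I J : ModuleCat.{u} S) [Injective J]
    (h : Subsingleton (Ext M ((resMod R S).obj I) 1)) :
    Subsingleton (Ext M (charMod ((resMod R S).obj (homMod (A := S) (T := S) I J))) 1) := by
  obtain ⟨k, m, n, U, V, H⟩ := exists_matrix_presentation M
  have := injective_resSelf J
  have : Module.Injective S ((resMod S S).obj J) :=
    (Module.injective_iff_injective_object S ((resMod S S).obj J)).2 this
  rw [H] at h ⊢
  exact exists_matrix_char (H := (resMod R S).obj (homMod (A := S) (T := S) I J)) U V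
    (exists_matrix_fac (I := I) (J := (resMod S S).obj J) (fun i l => algebraMap R S (U i l))
      (fun j i => algebraMap R S (V j i)) h)

lemma injective_of_ext_one {N : ModuleCat.{u} R}
    (h : ∀ a : Ideal R, Subsingleton (Ext (ModuleCat.of R (R ⧸ a)) N 1)) : Injective N := by
  rw [← Module.injective_iff_injective_object R N, ← Module.Baer.iff_injective]
  intro a f
  have hs : IsSES (ModuleCat.ofHom a.subtype) (ModuleCat.ofHom a.mkQ) :=
    IsSES.of_linearMap Subtype.val_injective (LinearMap.exact_subtype_mkQ a)
      (Submodule.mkQ_surjective a)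
  obtain ⟨g, hg⟩ := hs.exists_extension (h a) (ModuleCat.ofHom f)
  exact ⟨g.hom, fun x hx => congr($(hg).hom ⟨x, hx⟩)⟩

/-- Baer's criterion for the character module, tested on the finite modules `S / a`. -/
lemma flat_homMod [IsNoetherianRing S] (I J : ModuleCat.{u} S) [Injective I] [Injective J] :
    Module.Flat S (homMod (A := S) (T := S) I J) := by
  have h := injective_of_ext_one fun a : Ideal S =>
    subsingleton_ext_one_charMod_homMod (R := S) (S := S) (ModuleCat.of S (S ⧸ a)) I J
      (have := injective_resSelf I; Ext.subsingleton_of_injective _ _ 0)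
  have := flat_of_injective_charMod _ h
  exact Module.Flat.of_linearEquiv (resSelfIso (homMod (A := S) (T := S) I J)).symm.toLinearEquiv

/-- By adjunction the character module of `E` is `Hom_S (E, S^∨)`, and `S^∨` is injective. -/
lemma flat_charMod [IsNoetherianRing S] (E : ModuleCat.{u} S) [Injective E] :
    Module.Flat S (charMod E) := by
  have := injective_charMod (ModuleCat.of S S)
  have := flat_homMod E (charMod (ModuleCat.of S S))
  refine Module.Flat.of_linearEquiv (M := homMod (A := S) (T := S) E (charMod (ModuleCat.of S S))) ?_
  exact {
    toFun := fun c => show E →ₗ[S] (resMod S S).obj (charMod (ModuleCat.of S S)) from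
      { toFun := fun x => (show E →+ _ from c).comp (LinearMap.toSpanSingleton S E x).toAddMonoidHom
        map_add' := fun x y => DFunLike.ext (F := CharacterModule S) _ _ fun s => by
          change (show CharacterModule E from c) (s • (x + y)) =
            (show CharacterModule E from c) (s • x) + (show CharacterModule E from c) (s • y)
          rw [smul_add, map_add]
        map_smul' := fun r x => DFunLike.ext (F := CharacterModule S) _ _ fun s => by
          change (show CharacterModule E from c) (s • r • x) =
            (show CharacterModule E from c) ((r • s) • x)
          rw [smul_eq_mul, mul_comm, mul_smul] }
    map_add' := fun c c' => rfl
    map_smul' := fun s c => LinearMap.ext fun x => DFunLike.ext (F := CharacterModule S) _ _ fun t => by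
      change (show CharacterModule E from c) (s • t • x) =
        (show CharacterModule E from c) ((s • t) • x)
      rw [smul_assoc]
    invFun := fun f => show CharacterModule E from
      (AddMonoidHom.mk' (fun x => (show CharacterModule S from
        (show E →ₗ[S] (resMod S S).obj (charMod (ModuleCat.of S S)) from f) x) 1)
        fun x y => by rw [map_add]; rfl)
    left_inv := fun c => DFunLike.ext (F := CharacterModule E) _ _ fun x =>
      congrArg (show CharacterModule E from c) (one_smul S x)
    right_inv := fun f => LinearMap.ext fun x => DFunLike.ext (F := CharacterModule S) _ _ fun t => by
      change (show CharacterModule S from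
        (show E →ₗ[S] (resMod S S).obj (charMod (ModuleCat.of S S)) from f) (t • x)) 1 = 
        (show CharacterModule S from
        (show E →ₗ[S] (resMod S S).obj (charMod (ModuleCat.of S S)) from f) x) t
      rw [map_smul]
      change (show CharacterModule S from
        (show E →ₗ[S] (resMod S S).obj (charMod (ModuleCat.of S S)) from f) x) (t • 1) = _
      rw [smul_eq_mul, mul_one] }

/-- Vanishing of `Ext^1 (M, I)` passes to `I ⊗ Y`, for `M` finite over a noetherian ring and `Y`
flat. -/
lemma subsingleton_ext_one_tensor [IsNoetherianRing R] (M : ModuleCat.{u} R)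
    [Module.Finite R M] (I Y : ModuleCat.{u} S) [Module.Flat S Y]
    (h : Subsingleton (Ext M ((resMod R S).obj I) 1)) :
    Subsingleton (Ext M ((resMod R S).obj (((tensorBif S S).obj I).obj Y)) 1) := by
  obtain ⟨k, K, i, p, hs, _⟩ := exists_isSES_finite M
  have := projective_of_free (R := R) (Fin k → R)
  have := Module.finitePresentation_of_finite R K
  refine hs.subsingleton_ext_one (Ext.subsingleton_of_projective _ _ 0) fun φ => ?_
  -- As `K` is finitely presented and `Y` flat, every map `K → I ⊗ Y` is a sum of maps `f (-) ⊗ l`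
  -- with `f : K → I`, and each such `f` extends by hypothesis.
  obtain ⟨x, hx⟩ := (bijective_modTev_of_finitePresentation_left K I Y).2 φ.hom
  suffices H : ∀ x : ((tensorBif S S).obj (homMod K I)).obj Y,
      ∃ ψ : ModuleCat.of R (Fin k → R) →ₗ[R] (resMod R S).obj (((tensorBif S S).obj I).obj Y),
        ψ ∘ₗ i.hom = (modTev K I Y).hom x by
    obtain ⟨ψ, hψ⟩ := H x
    exact ⟨(ModuleCat.ofHom ψ :), ModuleCat.hom_ext (hψ.trans hx)⟩
  intro x
  induction x using tensorBif_induction with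
  | add a b ha hb =>
    obtain ⟨ψ, hψ⟩ := ha
    obtain ⟨ψ', hψ'⟩ := hb
    exact ⟨ψ + ψ', by rw [map_add, LinearMap.add_comp, hψ, hψ']; rfl⟩
  | tmul f l =>
    obtain ⟨g, hg⟩ := hs.exists_extension h
      (ModuleCat.ofHom (show K →ₗ[R] (resMod R S).obj I from f) :)
    refine ⟨homTmul _ I Y g.hom l, ?_⟩
    exact congrArg (fun a => homTmul K I Y a l) congr($(hg).hom)

end hom_injective
end
end TensorEval

namespace TensorEval
noncomputable section

/-! ### Gorenstein projective and Gorenstein flat modules as cycles -/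

section gorenstein
open Abelian
variable {R : Type u} [CommRing R]

lemma exists_iso_cyc {N : CochainComplex (ModuleCat.{u} R) ℤ} (hN : N.Acyclic) :
    Nonempty (Limits.cokernel (N.d (-1) 0) ≅ cyc N 1) := by
  have hs := isSES_cyc hN (show (0 : ℤ) + 1 = 1 by lia)
  have h0 : N.d (-1) 0 ≫ cycπ N 0 1 = 0 := by
    ext x
    exact Subtype.ext (d_d_apply N x)
  let φ := Limits.cokernel.desc (N.d (-1) 0) (cycπ N 0 1) h0
  have hφ : ∀ x, φ.hom ((Limits.cokernel.π (N.d (-1) 0)).hom x) = (cycπ N 0 1).hom x := fun x =>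
    congr($(Limits.cokernel.π_desc _ _ h0).hom x)
  have hπ := (ModuleCat.epi_iff_surjective (Limits.cokernel.π (N.d (-1) 0))).1 inferInstance
  have h1 : Function.Injective φ.hom := (injective_iff_map_eq_zero _).2 fun y hy => by
    obtain ⟨x, rfl⟩ := hπ y
    have hx : (cycπ N 0 1).hom x = 0 := (hφ x).symm.trans hy
    obtain ⟨z, rfl⟩ := (exactAt_iff_forall N (show (-1 : ℤ) + 1 = 0 by lia)
      (show (0 : ℤ) + 1 = 1 by lia)).1 (hN 0) x (congrArg Subtype.val hx)
    exact congr($(Limits.cokernel.condition (N.d (-1) 0)).hom z)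
  have h2 : Function.Surjective φ.hom := fun y => by
    obtain ⟨x, rfl⟩ := hs.surj y
    exact ⟨_, hφ x⟩
  exact ⟨(LinearEquiv.ofBijective φ.hom ⟨h1, h2⟩).toModuleIso⟩

/-- The modules of cycles of totally acyclic complexes of projective modules. -/
def IsProjCycle (M : ModuleCat.{u} R) : Prop :=
  ∃ P : CochainComplex (ModuleCat.{u} R) ℤ,
    (∀ n, Projective (P.X n)) ∧ P.Acyclic ∧ (∃ p, Nonempty (cyc P p ≅ M)) ∧
    ∀ (N : ModuleCat.{u} R), Projective N → ∀ (n : ℤ) (h : P.X n ⟶ N),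
      P.d (n - 1) n ≫ h = 0 → ∃ k : P.X (n + 1) ⟶ N, h = P.d n (n + 1) ≫ k

lemma GorensteinProjective.isProjCycle {M : ModuleCat.{u} R} (h : GorensteinProjective M) :
    IsProjCycle M := by
  obtain ⟨P, hP, hac, ⟨e⟩, hex⟩ := h
  obtain ⟨e'⟩ := exists_iso_cyc hac
  exact ⟨P, hP, hac, ⟨1, ⟨e'.symm ≪≫ e.symm⟩⟩, hex⟩

lemma IsSES.congr_left {M₁ M₁' M₂ M₃ : ModuleCat.{u} R} {f : M₁ ⟶ M₂} {g : M₂ ⟶ M₃}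
    (h : IsSES f g) (e : M₁ ≅ M₁') : IsSES (e.inv ≫ f) g := by
  have he : Function.Bijective e.inv.hom := e.symm.toLinearEquiv.bijective
  refine ⟨h.inj.comp he.injective, fun x => (h.exact x).trans ⟨?_, ?_⟩, h.surj⟩
  · rintro ⟨y, rfl⟩
    obtain ⟨z, rfl⟩ := he.surjective y
    exact ⟨z, rfl⟩
  · rintro ⟨z, rfl⟩
    exact ⟨_, rfl⟩

/-- The cycles of an acyclic complex `P` are orthogonal to `B` if the terms are and `Hom (P, B)`
is exact. -/
lemma orth_cyc_of_exact {P : CochainComplex (ModuleCat.{u} R) ℤ} (hP : P.Acyclic)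
    {B : ModuleCat.{u} R} (hB : ∀ n, Orth (P.X n) B) (hex : ∀ (n : ℤ) (h : P.X n ⟶ B),
      P.d (n - 1) n ≫ h = 0 → ∃ k : P.X (n + 1) ⟶ B, h = P.d n (n + 1) ≫ k) (p : ℤ) :
    Orth (cyc P p) B := by
  intro m
  induction m generalizing p with
  | zero =>
    -- The cycles in degree `n + 2` are the quotient of `P^(n+1)` by those in degree `n + 1`. A map
    -- from the latter, pulled back to `P^n`, kills boundaries, so `hex` extends it.
    obtain ⟨n, rfl⟩ : ∃ n, p = n + 1 + 1 := ⟨p - 2, by lia⟩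
    have hs := isSES_cyc hP (p := n) rfl
    have := hs.epi
    refine (isSES_cyc hP (p := n + 1) rfl).subsingleton_ext_one (hB _ 0) fun k => ?_
    obtain ⟨l, hl⟩ := hex n (cycπ P n (n + 1) ≫ k) (by
      rw [← Category.assoc]
      convert Limits.zero_comp
      ext x
      exact Subtype.ext (d_d_apply P x))
    refine ⟨l, ?_⟩
    rw [← cancel_epi (cycπ P n (n + 1)), hl, ← cycπ_ι, Category.assoc]
  | succ m ih =>
    obtain ⟨n, rfl⟩ : ∃ n, p = n + 1 := ⟨p - 1, by lia⟩
    exact ((isSES_cyc hP (p := n) rfl).ext_left_shift (hB n) m).1 (ih n)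

lemma IsProjCycle.orth {M N : ModuleCat.{u} R} (h : IsProjCycle M) (hN : Projective N) :
    Orth M N := by
  obtain ⟨P, hP, hac, ⟨p, ⟨e⟩⟩, hex⟩ := h
  exact Orth.of_iso_left e (orth_cyc_of_exact hac (fun n => Orth.of_projective) (hex N hN) p)

lemma IsProjCycle.exists_isSES {M : ModuleCat.{u} R} (h : IsProjCycle M) :
    ∃ (P M' : ModuleCat.{u} R) (f : M ⟶ P) (g : P ⟶ M'), IsSES f g ∧ Projective P ∧
      IsProjCycle M' := by
  obtain ⟨P, hP, hac, ⟨p, ⟨e⟩⟩, hex⟩ := h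
  exact ⟨_, _, _, _, (isSES_cyc hac (p := p) rfl).congr_left e, hP p, P, hP, hac,
    ⟨p + 1, ⟨Iso.refl _⟩⟩, hex⟩

lemma IsProjCycle.coresolved {M : ModuleCat.{u} R} (h : IsProjCycle M) :
    Coresolved (fun P => Projective P) M :=
  ⟨IsProjCycle, h, fun _ hD => ⟨fun _ hT => hD.orth hT, hD.exists_isSES⟩⟩

/-- The modules of cycles of acyclic complexes `F` of flat modules with `J ⊗ F` acyclic for
injective `J`. -/
def IsFlatCycle (M : ModuleCat.{u} R) : Prop :=
  ∃ F : CochainComplex (ModuleCat.{u} R) ℤ,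
    (∀ n, Module.Flat R (F.X n)) ∧ F.Acyclic ∧ (∃ p, Nonempty (cyc F p ≅ M)) ∧
    ∀ (J : ModuleCat.{u} R), Injective J →
      (((MonoidalCategory.tensorLeft J).mapHomologicalComplex (ComplexShape.up ℤ)).obj F).Acyclic

lemma GorensteinFlat.isFlatCycle {M : ModuleCat.{u} R} (h : GorensteinFlat M) :
    IsFlatCycle M := by
  obtain ⟨P, hP, hac, ⟨e⟩, hex⟩ := h
  obtain ⟨e'⟩ := exists_iso_cyc hac
  exact ⟨P, hP, hac, ⟨1, ⟨e'.symm ≪≫ e.symm⟩⟩, hex⟩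

/-- `Hom (F, E^∨)` is the character dual of the exact complex `E ⊗ F`. -/
lemma exists_fac_charMod {F : CochainComplex (ModuleCat.{u} R) ℤ} {E : ModuleCat.{u} R}
    (hE : (((MonoidalCategory.tensorLeft E).mapHomologicalComplex
      (ComplexShape.up ℤ)).obj F).Acyclic) (n : ℤ) (h : F.X n ⟶ charMod E)
    (hh : F.d (n - 1) n ≫ h = 0) : ∃ k : F.X (n + 1) ⟶ charMod E, h = F.d n (n + 1) ≫ k := by
  have h1 := (exactAt_iff_forall _ (sub_add_cancel n 1) rfl).1 (hE n)
  obtain ⟨χ, hχ⟩ := (exact_iff_dual ((F.d (n - 1) n).hom.lTensor E)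
    ((F.d n (n + 1)).hom.lTensor E)).1 h1
    (CharacterModule.uncurry (R := R) (A := E) (B := F.X n) (charFlip h).hom) (by
      refine DFunLike.ext (F := CharacterModule (E ⊗[R] F.X (n - 1))) _ _ fun x => ?_
      induction x using TensorProduct.induction_on with
      | zero => exact map_zero (show E ⊗[R] F.X (n - 1) →+ _ from _)
      | add a b ha hb =>
        refine (map_add (show E ⊗[R] F.X (n - 1) →+ _ from _) a b).trans ?_
        exact (congr_arg₂ (· + ·) ha hb).trans (add_zero 0)
      | tmul e x =>
        exact congrArg (fun c : CharacterModule E => c e) congr($(hh).hom x))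
  refine ⟨charFlip (ModuleCat.ofHom (CharacterModule.curry (R := R) (A := E)
    (B := F.X (n + 1)) χ)), ModuleCat.hom_ext (LinearMap.ext fun x => ?_)⟩
  refine DFunLike.ext (F := CharacterModule E) _ _ fun e => ?_
  exact (congrArg (fun c : CharacterModule (E ⊗[R] F.X n) => c (e ⊗ₜ x)) hχ).symm

lemma IsFlatCycle.orth {M E : ModuleCat.{u} R} (h : IsFlatCycle M) (hE : Injective E) :
    Orth M (charMod E) := by
  obtain ⟨P, hP, hac, ⟨p, ⟨e⟩⟩, hex⟩ := h
  exact Orth.of_iso_left e (orth_cyc_of_exact hac (fun n => TorOrth.of_flat_left)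
    (exists_fac_charMod (hex E hE)) p)

lemma IsFlatCycle.exists_isSES {M : ModuleCat.{u} R} (h : IsFlatCycle M) :
    ∃ (P M' : ModuleCat.{u} R) (f : M ⟶ P) (g : P ⟶ M'), IsSES f g ∧ Module.Flat R P ∧
      IsFlatCycle M' := by
  obtain ⟨P, hP, hac, ⟨p, ⟨e⟩⟩, hex⟩ := h
  exact ⟨_, _, _, _, (isSES_cyc hac (p := p) rfl).congr_left e, hP p, P, hP, hac,
    ⟨p + 1, ⟨Iso.refl _⟩⟩, hex⟩

/-- The character modules of injective modules. -/
def IsCharInj (T : ModuleCat.{u} R) : Prop :=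
  ∃ E : ModuleCat.{u} R, Injective E ∧ Nonempty (charMod E ≅ T)

lemma IsCharInj.flat [IsNoetherianRing R] {T : ModuleCat.{u} R} (h : IsCharInj T) :
    Module.Flat R T := by
  obtain ⟨E, hE, ⟨e⟩⟩ := h
  have := flat_charMod E
  exact Module.Flat.of_linearEquiv e.symm.toLinearEquiv

lemma IsCharInj.prod (T T' : ModuleCat.{u} R) (h : IsCharInj T) (h' : IsCharInj T') :
    IsCharInj (ModuleCat.of R (T × T')) := by
  obtain ⟨E, hE, ⟨e⟩⟩ := h
  obtain ⟨E', hE', ⟨e'⟩⟩ := h'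
  have h1 : Module.Injective R E := (Module.injective_iff_injective_object R E).2 hE
  have h2 : Module.Injective R E' := (Module.injective_iff_injective_object R E').2 hE'
  have h3 : Module.Injective R (E × E') := by
    refine ⟨fun X Y _ _ _ _ f hf g => ?_⟩
    obtain ⟨a, ha⟩ := h1.out f hf (LinearMap.fst R E E' ∘ₗ g)
    obtain ⟨b, hb⟩ := h2.out f hf (LinearMap.snd R E E' ∘ₗ g)
    exact ⟨a.prod b, fun x => Prod.ext (ha x) (hb x)⟩
  refine ⟨ModuleCat.of R (E × E'), (Module.injective_iff_injective_object R (E × E')).1 h3,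
    ⟨?_ ≪≫ (LinearEquiv.prodCongr e.toLinearEquiv e'.toLinearEquiv).toModuleIso⟩⟩
  refine LinearEquiv.toModuleIso (X₁ := CharacterModule (E × E'))
    (X₂ := CharacterModule E × CharacterModule E') <| LinearEquiv.ofBijective
      ((CharacterModule.dual (LinearMap.inl R E E')).prod
        (CharacterModule.dual (LinearMap.inr R E E'))) ⟨?_, ?_⟩
  · refine fun c c' hc => DFunLike.ext (F := CharacterModule (E × E')) _ _ fun x => ?_
    have hx : ∀ c : CharacterModule (E × E'), c x = c (x.1, 0) + c (0, x.2) := fun c =>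
      (congrArg c (Prod.fst_add_snd x).symm).trans (map_add (show E × E' →+ _ from c) _ _)
    rw [hx, hx]
    exact congr_arg₂ (· + ·) (congrArg (fun t : CharacterModule E × CharacterModule E' => t.1 x.1) hc)
      (congrArg (fun t : CharacterModule E × CharacterModule E' => t.2 x.2) hc)
  · rintro ⟨c, c'⟩
    refine ⟨((show E →+ AddCircle (1 : ℚ) from c).coprod (show E' →+ AddCircle (1 : ℚ) from c') :), Prod.ext
      (DFunLike.ext (F := CharacterModule E) _ _ fun x => ?_)
      (DFunLike.ext (F := CharacterModule E') _ _ fun x => ?_)⟩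
    · exact (congrArg (c x + ·) (map_zero (show E' →+ _ from c'))).trans (add_zero _)
    · exact (congrArg (· + c' x) (map_zero (show E →+ _ from c))).trans (zero_add _)

/-- The evaluation map to the double character module. -/
def charEval (M : ModuleCat.{u} R) : M ⟶ charMod (charMod M) := charFlip (𝟙 _)

lemma charEval_injective (M : ModuleCat.{u} R) : Function.Injective (charEval M).hom :=
  (injective_iff_map_eq_zero _).2 fun _ hx =>
    CharacterModule.eq_zero_of_character_apply fun c =>
      congrArg (fun t : CharacterModule (CharacterModule M) => t c) hx

lemma charEval_charMap (M : ModuleCat.{u} R) :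
    charEval (charMod M) ≫ charMap (charEval M) = 𝟙 (charMod M) := rfl

/-- A flat module embeds into the character module of an injective module, with flat cokernel. -/
lemma exists_isSES_charMod (F : ModuleCat.{u} R) [Module.Flat R F] :
    ∃ (H : ModuleCat.{u} R) (g : charMod (charMod F) ⟶ H), IsSES (charEval F) g ∧
      IsCharInj (charMod (charMod F)) ∧ ((IsNoetherianRing R) → Module.Flat R H) := by
  let g : charMod (charMod F) ⟶ ModuleCat.of R (_ ⧸ LinearMap.range (charEval F).hom) :=
    ModuleCat.ofHom (LinearMap.range (charEval F).hom).mkQ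
  have hs : IsSES (charEval F) g := ⟨charEval_injective F,
    LinearMap.exact_map_mkQ_range (charEval F).hom, Submodule.mkQ_surjective _⟩
  have := injective_charMod F
  refine ⟨_, g, hs, ⟨_, this, ⟨Iso.refl _⟩⟩, fun _ => flat_of_injective_charMod _ ?_⟩
  have := flat_charMod (charMod F)
  have := injective_charMod (charMod (charMod F))
  -- The dual of the evaluation map is split by the evaluation of `F^∨`. So the dual of the cokernel
  -- is a retract of the triple dual of `F`, which is injective since the double dual is flat.
  obtain ⟨r, hr⟩ := hs.char.exists_fac
    (𝟙 _ - charMap (charEval F) ≫ charEval (charMod F)) (by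
      rw [Preadditive.sub_comp, Category.assoc, charEval_charMap, Category.id_comp,
        Category.comp_id, sub_self])
  have := hs.char.mono
  refine (show Retract (charMod _) (charMod (charMod (charMod F))) from ⟨charMap g, r, ?_⟩).injective
  rw [← cancel_mono (charMap g), Category.assoc, hr, Preadditive.comp_sub, ← Category.assoc,
    hs.char.comp_zero, Limits.zero_comp, sub_zero, Category.comp_id, Category.id_comp]

lemma IsSES.flat {M₁ M₂ M₃ : ModuleCat.{u} R} {f : M₁ ⟶ M₂} {g : M₂ ⟶ M₃} (h : IsSES f g)
    [Module.Flat R M₁] [Module.Flat R M₃] : Module.Flat R M₂ := by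
  have := injective_charMod M₁
  have := injective_charMod M₃
  exact flat_of_injective_charMod _ (injective_of_ext_one fun a =>
    h.char.subsingleton_right₂ _ _ (Ext.subsingleton_of_injective _ _ 0)
      (Ext.subsingleton_of_injective _ _ 0))

lemma coresolved_of_flat [IsNoetherianRing R] (F : ModuleCat.{u} R) [Module.Flat R F] :
    Coresolved IsCharInj F := by
  refine ⟨fun F => Module.Flat R F, inferInstance, fun F hF => ⟨fun T hT => ?_, ?_⟩⟩
  · obtain ⟨E, hE, ⟨e⟩⟩ := hT
    exact Orth.of_iso_right e TorOrth.of_flat_left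
  · obtain ⟨H, g, hs, hT, hH⟩ := exists_isSES_charMod F
    exact ⟨_, H, _, g, hs, hT, hH inferInstance⟩

/-- Arbitrary flat modules need not be `Ext`-orthogonal to Gorenstein flat ones, so flat
coresolutions are replaced by coresolutions by duals of injective modules, which are. The witnessing
class consists of extensions of flat modules by flat cycles: pushing out along `M ⟶ F` embeds such a
`D` in a flat module, and that one in its double dual. -/
lemma IsFlatCycle.coresolved [IsNoetherianRing R] {M : ModuleCat.{u} R} (h : IsFlatCycle M) :
    Coresolved IsCharInj M := by
  refine ⟨fun D => ∃ (M H : ModuleCat.{u} R) (f : M ⟶ D) (g : D ⟶ H), IsSES f g ∧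
    IsFlatCycle M ∧ Module.Flat R H, ?_, ?_⟩
  · exact ⟨M, ModuleCat.of R PUnit, 𝟙 M, 0, ⟨Function.injective_id, fun x =>
      ⟨fun _ => ⟨x, rfl⟩, fun _ => rfl⟩, fun _ => ⟨0, Subsingleton.elim _ _⟩⟩, h, inferInstance⟩
  · rintro D ⟨M, H, f, g, hs, hM, hH⟩
    refine ⟨fun T ⟨E, hE, ⟨e⟩⟩ => Orth.of_iso_right e
      (hs.orth_left₂ (hM.orth hE) TorOrth.of_flat_left), ?_⟩
    obtain ⟨F, M', i, p, hi, hF, hM'⟩ := hM.exists_isSES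
    obtain ⟨X, t, c, b, a, h1, h2, -⟩ := hs.exists_pushout hi
    have := h1.flat
    obtain ⟨H', g', h3, hT, hH'⟩ := exists_isSES_charMod X
    obtain ⟨B', p', j, q, h4, h5⟩ := h2.exists_comp h3
    exact ⟨_, B', _, p', h4, hT, M', H', j, q, h5, hM', hH' inferInstance⟩

lemma coresolved_of_projective (P : ModuleCat.{u} R) [Projective P] :
    Coresolved (fun P : ModuleCat.{u} R => Projective P) P :=
  ⟨fun P => Projective P, inferInstance, fun D _ => ⟨fun _ _ => Orth.of_projective, D,
    ModuleCat.of R PUnit, 𝟙 D, 0, ⟨Function.injective_id, fun x =>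
      ⟨fun _ => ⟨x, rfl⟩, fun _ => rfl⟩, fun _ => ⟨0, Subsingleton.elim _ _⟩⟩, inferInstance,
    projective_of_free PUnit⟩⟩

/-- A finite module with coresolutions by flat modules embeds into a finite free module such that
the cokernel has such coresolutions, too. -/
lemma Coresolved.exists_isSES_free [IsNoetherianRing R] {𝒯 : ModuleCat.{u} R → Prop}
    (hprod : ∀ T T', 𝒯 T → 𝒯 T' → 𝒯 (ModuleCat.of R (T × T'))) (hflat : ∀ T, 𝒯 T → Module.Flat R T)
    (hT : ∀ F : ModuleCat.{u} R, (Module.Free R F ∨ 𝒯 F) → Coresolved 𝒯 F)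
    {M : ModuleCat.{u} R} [Module.Finite R M] (hM : Coresolved 𝒯 M) :
    ∃ (n : ℕ) (M' : ModuleCat.{u} R) (f : M ⟶ ModuleCat.of R (Fin n → R))
      (g : ModuleCat.of R (Fin n → R) ⟶ M'), IsSES f g ∧ Module.Finite R M' ∧
      Coresolved 𝒯 M' := by
  obtain ⟨T, A', i, p, hi, hT', hA'⟩ := hM.exists_isSES
  have := hflat T hT'
  have := Module.finitePresentation_of_finite R M
  have : Module.Finite R (M →ₗ[R] R) := by
    obtain ⟨k, q, hq⟩ := Module.Finite.exists_fin' R M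
    have : IsNoetherian R ((Fin k → R) →ₗ[R] R) := isNoetherian_of_isNoetherianRing_of_finite R _
    exact Module.Finite.of_injective (LinearMap.lcomp R R q) fun a b hab => LinearMap.ext fun x => by
      obtain ⟨y, rfl⟩ := hq x
      exact congr($hab y)
  -- Generators of the dual of `M` give a map `f : M ⟶ R^n` through which every map to a finite free
  -- module factors. The embedding `i` into a flat module factors through a finite free one, hence
  -- through `f`, so `f` is injective.
  obtain ⟨n, s, hs⟩ := Module.Finite.exists_fin (R := R) (M := M →ₗ[R] R)
  obtain ⟨k, a, b, hab⟩ := Module.Flat.exists_factorization_of_finitePresentation i.hom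
  let f : M ⟶ ModuleCat.of R (Fin n → R) := ModuleCat.ofHom (LinearMap.pi s)
  have hc : ∀ j : Fin k, ∃ c : Fin n → R, ∑ l, c l • s l = Finsupp.lapply j ∘ₗ a := fun j =>
    (Submodule.mem_span_range_iff_exists_fun R).1 (hs ▸ Submodule.mem_top)
  choose c hc using hc
  let α : ModuleCat.of R (Fin n → R) ⟶ T := ModuleCat.ofHom
    (b ∘ₗ (Finsupp.linearEquivFunOnFinite R R (Fin k)).symm.toLinearMap ∘ₗ
      LinearMap.pi fun j => ∑ l, c j l • LinearMap.proj l)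
  have hα : f ≫ α = i := by
    ext x
    rw [hab]
    refine congrArg b (Finsupp.ext fun j => ?_)
    have := congr($(hc j) x)
    simp only [LinearMap.sum_apply, LinearMap.smul_apply] at this
    refine Eq.trans ?_ this
    change (∑ l, c j l • LinearMap.proj l : (Fin n → R) →ₗ[R] R) (f.hom x) = _
    simp only [LinearMap.sum_apply, LinearMap.smul_apply]
    rfl
  let g : ModuleCat.of R (Fin n → R) ⟶ ModuleCat.of R (_ ⧸ LinearMap.range f.hom) :=
    ModuleCat.ofHom (LinearMap.range f.hom).mkQ
  have hfg : IsSES f g := ⟨fun x y hxy => hi.inj (by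
      rw [← hα]
      exact congrArg α.hom hxy), LinearMap.exact_map_mkQ_range f.hom, Submodule.mkQ_surjective _⟩
  -- The pushout `X` is an extension of `A'` by `R^n`, hence coresolved. Since `i` factors through
  -- `f`, the copy of `T` in `X` splits off, so the cokernel of `f` is the kernel of an epimorphism
  -- `X ⟶ T`.
  obtain ⟨X, t, c, b, a, h1, h2, hX⟩ := hfg.exists_pushout hi
  obtain ⟨r, -, hr⟩ := hX T α (𝟙 T) (hα.trans (Category.comp_id i).symm)
  obtain ⟨σ, hσ⟩ := h1.exists_section hr
  refine ⟨n, _, f, g, hfg, inferInstanceAs (Module.Finite R ((Fin n → R) ⧸ _)),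
    Coresolved.kernel hprod hσ (extension hprod h2 (hT _ (Or.inl ?_)) hA') (hT T (Or.inr hT'))⟩
  infer_instance

end gorenstein
end
end TensorEval

namespace TensorEval
noncomputable section
open CochainComplex

/-! ### Truncation within classes of modules -/

section resolving
open Abelian
variable {R : Type u} [CommRing R]

/-- A class of modules that is closed under extensions and kernels of epimorphisms. -/
structure Resolving (𝒞 : ModuleCat.{u} R → Prop) : Prop where
  zero : ∀ X, Limits.IsZero X → 𝒞 X
  iso : ∀ {X Y}, (X ≅ Y) → 𝒞 X → 𝒞 Y
  ext : ∀ {M₁ M₂ M₃ : ModuleCat.{u} R} {f : M₁ ⟶ M₂} {g : M₂ ⟶ M₃}, IsSES f g →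
    𝒞 M₁ → 𝒞 M₃ → 𝒞 M₂
  ker : ∀ {M₁ M₂ M₃ : ModuleCat.{u} R} {f : M₁ ⟶ M₂} {g : M₂ ⟶ M₃}, IsSES f g →
    𝒞 M₂ → 𝒞 M₃ → 𝒞 M₁

/-- A class of modules with the two-out-of-three property in short exact sequences. -/
structure TwoOfThree (𝒞 : ModuleCat.{u} R → Prop) : Prop extends Resolving 𝒞 where
  coker : ∀ {M₁ M₂ M₃ : ModuleCat.{u} R} {f : M₁ ⟶ M₂} {g : M₂ ⟶ M₃}, IsSES f g →
    𝒞 M₁ → 𝒞 M₂ → 𝒞 M₃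

lemma IsSES.nonempty_iso_of_isZero {M₁ M₂ M₃ : ModuleCat.{u} R} {f : M₁ ⟶ M₂} {g : M₂ ⟶ M₃}
    (h : IsSES f g) (h₁ : Limits.IsZero M₁) : Nonempty (M₂ ≅ M₃) := by
  refine ⟨(LinearEquiv.ofBijective g.hom ⟨(injective_iff_map_eq_zero _).2 fun x hx => ?_,
    h.surj⟩).toModuleIso⟩
  obtain ⟨y, rfl⟩ := (h.exact x).1 hx
  have := ModuleCat.isZero_iff_subsingleton.1 h₁
  rw [Subsingleton.elim y 0, map_zero]

lemma IsSES.isZero_right {M₁ M₂ M₃ : ModuleCat.{u} R} {f : M₁ ⟶ M₂} {g : M₂ ⟶ M₃}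
    (h : IsSES f g) (h₂ : Limits.IsZero M₂) : Limits.IsZero M₃ := by
  have := ModuleCat.isZero_iff_subsingleton.1 h₂
  exact ModuleCat.isZero_iff_subsingleton.2 h.surj.subsingleton

lemma IsSES.isZero_middle {M₁ M₂ M₃ : ModuleCat.{u} R} {f : M₁ ⟶ M₂} {g : M₂ ⟶ M₃}
    (h : IsSES f g) (h₁ : Limits.IsZero M₁) (h₃ : Limits.IsZero M₃) : Limits.IsZero M₂ := by
  obtain ⟨e⟩ := h.nonempty_iso_of_isZero h₁
  exact h₃.of_iso e

variable {K L : CochainComplex (ModuleCat.{u} R) ℤ}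

lemma exists_isSES_mappingCone (f : K ⟶ L) {p q : ℤ} (h : p + 1 = q) :
    ∃ (i : L.X p ⟶ (mappingCone f).X p) (π : (mappingCone f).X p ⟶ K.X q), IsSES i π := by
  subst h
  exact ⟨_, _, isSES_mappingCone f p⟩

lemma Resolving.mappingCone {𝒞 : ModuleCat.{u} R → Prop} (h𝒞 : Resolving 𝒞) (f : K ⟶ L) (p q : ℤ)
    (h : p + 1 = q) (hK : 𝒞 (K.X q)) (hL : 𝒞 (L.X p)) : 𝒞 ((mappingCone f).X p) := by
  obtain ⟨i, π, hs⟩ := exists_isSES_mappingCone f h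
  exact h𝒞.ext hs hL hK

lemma Resolving.cyc_of_above {𝒞 : ModuleCat.{u} R → Prop} (h𝒞 : Resolving 𝒞) (hK : K.Acyclic)
    (b n : ℤ) [K.IsStrictlyLE b] (h : ∀ p, n ≤ p → 𝒞 (K.X p)) : ∀ p, n ≤ p → 𝒞 (cyc K p) :=
  int_descending (p := fun p => n ≤ p → 𝒞 (cyc K p)) (b + 1)
    (fun p hp _ => h𝒞.zero _ (cyc_isZero (K.isZero_of_isStrictlyLE b p (by lia))))
    fun p hp hnp => h𝒞.ker (isSES_cyc hK rfl) (h p hnp) (hp (by lia))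

lemma TwoOfThree.cyc_of_below {𝒞 : ModuleCat.{u} R → Prop} (h𝒞 : TwoOfThree 𝒞) (hK : K.Acyclic)
    (a n : ℤ) [K.IsStrictlyGE a] (h : ∀ p, p < n → 𝒞 (K.X p)) : ∀ p, p ≤ n → 𝒞 (cyc K p) :=
  int_ascending (p := fun p => p ≤ n → 𝒞 (cyc K p)) (a - 1)
    (fun p hp _ => h𝒞.zero _ (cyc_isZero (K.isZero_of_isStrictlyGE a p (by lia))))
    fun p hp hnp => h𝒞.coker (isSES_cyc hK rfl) (hp (by lia)) (h p (by lia))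

/-- Below the range of `L` the acyclic cone starts with `K^n`, which it identifies with its cycles
in degree `n`. These lie in `𝒞` by descent from above, which involves only `K^p` with `p > n` and
the terms of `L`. -/
lemma Resolving.lowest_term {𝒞 : ModuleCat.{u} R → Prop} (h𝒞 : Resolving 𝒞) (f : K ⟶ L)
    [QuasiIso f] (a b n : ℤ) (hn : n < a) [K.IsStrictlyGE n] [K.IsStrictlyLE b]
    [L.IsStrictlyGE a] [L.IsStrictlyLE b] (hK : ∀ p ≠ n, 𝒞 (K.X p)) (hL : ∀ p, 𝒞 (L.X p)) :
    𝒞 (K.X n) := by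
  have hN := acyclic_mappingCone f
  have := isStrictlyLE_mappingCone f b
  have h1 := h𝒞.cyc_of_above hN b n fun p hp => h𝒞.mappingCone f p _ rfl (hK _ (by lia)) (hL p)
  obtain ⟨i, π, h2⟩ := exists_isSES_mappingCone f (show n - 2 + 1 = n - 1 by lia)
  have h3 := h2.isZero_middle (L.isZero_of_isStrictlyGE a _ (by lia))
    (K.isZero_of_isStrictlyGE n _ (by lia))
  have h4 := (isSES_cyc hN (show n - 2 + 1 = n - 1 by lia)).isZero_right h3
  obtain ⟨e⟩ := (isSES_cyc hN (show n - 1 + 1 = n by lia)).nonempty_iso_of_isZero h4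
  obtain ⟨j, ρ, h5⟩ := exists_isSES_mappingCone f (show n - 1 + 1 = n by lia)
  obtain ⟨e'⟩ := h5.nonempty_iso_of_isZero (L.isZero_of_isStrictlyGE a _ (by lia))
  exact h𝒞.iso (e.symm ≪≫ e') (h1 n le_rfl)

/-- Cycles of the cone in degree `m` are reached from below and those in degree `m + 1` from above;
together they control the cone in degree `m`, of which `L^m` is the kernel onto a term of `K`. -/
lemma TwoOfThree.target_term {𝒞 : ModuleCat.{u} R → Prop} (h𝒞 : TwoOfThree 𝒞) (f : K ⟶ L)
    [QuasiIso f] (a b m : ℤ) [K.IsStrictlyGE a] [K.IsStrictlyLE b]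
    [L.IsStrictlyGE a] [L.IsStrictlyLE b] (hK : ∀ p, 𝒞 (K.X p)) (hL : ∀ p ≠ m, 𝒞 (L.X p)) :
    𝒞 (L.X m) := by
  have hN := acyclic_mappingCone f
  have := isStrictlyLE_mappingCone f b
  have := isStrictlyGE_mappingCone f a
  have h1 := h𝒞.cyc_of_above hN b (m + 1)
    fun p hp => h𝒞.mappingCone f p _ rfl (hK _) (hL p (by lia))
  have h2 := h𝒞.cyc_of_below hN (a - 1) m
    fun p hp => h𝒞.mappingCone f p _ rfl (hK _) (hL p (by lia))
  exact h𝒞.ker (isSES_mappingCone f m) (h𝒞.ext (isSES_cyc hN rfl) (h2 m le_rfl) (h1 _ le_rfl))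
    (hK _)

/-- The truncation of a resolution of a bounded complex. -/
lemma Resolving.exists_truncGE {𝒞 : ModuleCat.{u} R → Prop} (h𝒞 : Resolving 𝒞) (f : K ⟶ L)
    [QuasiIso f] (a b n : ℤ) (hn : n < a) [K.IsStrictlyLE b]
    [L.IsStrictlyGE a] [L.IsStrictlyLE b] (hK : ∀ p, 𝒞 (K.X p)) (hL : ∀ p, 𝒞 (L.X p)) :
    QuasiIso (K.πTruncGE n) ∧ ∀ p, 𝒞 ((K.truncGE n).X p) := by
  have := L.isStrictlyGE_of_ge n a hn.le
  have : K.IsGE n := by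
    rw [isGE_iff]
    intro i hi
    exact (exactAt_iff_of_quasiIsoAt f i).2 (L.exactAt_of_isGE n i hi)
  have hq : QuasiIso (K.πTruncGE n) := (K.quasiIso_πTruncGE_iff n).2 this
  let g : K.truncGE n ⟶ L := truncGEMap f n ≫ inv (L.πTruncGE n)
  have hg : K.πTruncGE n ≫ g = f := by
    rw [← Category.assoc, πTruncGE_naturality, Category.assoc, IsIso.hom_inv_id, Category.comp_id]
  have hg' : QuasiIso g := by
    have : QuasiIso (K.πTruncGE n ≫ g) := by rwa [hg]
    exact quasiIso_of_comp_left (K.πTruncGE n) g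
  have h1 : ∀ p ≠ n, 𝒞 ((K.truncGE n).X p) := fun p hp => by
    rcases lt_or_gt_of_ne hp with h | h
    · exact h𝒞.zero _ ((K.truncGE n).isZero_of_isStrictlyGE n p h)
    · exact h𝒞.iso (K.truncGEXIso n p h).symm (hK p)
  refine ⟨hq, fun p => ?_⟩
  by_cases hp : p = n
  · rw [hp]
    exact h𝒞.lowest_term g a b n hn h1 hL
  · exact h1 p hp

/-- Converts the derived notion of finite dimension of a module into the module-theoretic one: a
truncated projective resolution of `K` maps quasi-isomorphically to the module `L^m`. -/
lemma TwoOfThree.of_isoQ [HasDerivedCategory.{w} (ModuleCat.{u} R)] {𝒞 : ModuleCat.{u} R → Prop}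
    (h𝒞 : TwoOfThree 𝒞) (hproj : ∀ P, Projective P → 𝒞 P) (a b m : ℤ) [K.IsStrictlyGE a]
    [K.IsStrictlyLE b] [L.IsStrictlyGE m] [L.IsStrictlyLE m] (hK : ∀ p, 𝒞 (K.X p))
    (e : DerivedCategory.Q.obj K ≅ DerivedCategory.Q.obj L) : 𝒞 (L.X m) := by
  obtain ⟨P, f, _, hP, _⟩ := exists_projective K b
  have := isKProjective_of_projective P b
  obtain ⟨g, _⟩ := exists_quasiIso_of_isKProjective (isoOfQuasiIso f ≪≫ e)
  -- The truncation degree must be strictly below `a`, for the lowest-term argument, and at most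
  -- `m`, so that truncation does not alter `L`.
  have := L.isStrictlyGE_of_ge (min (a - 1) m) m (min_le_right _ _)
  have := L.isStrictlyLE_of_le m (max b m) (le_max_right _ _)
  have := P.isStrictlyLE_of_le b (max b m) (le_max_left _ _)
  obtain ⟨_, h1⟩ := h𝒞.exists_truncGE f a b (min (a - 1) m) (by lia) (fun p => hproj _ (hP p)) hK
  let k : P.truncGE (min (a - 1) m) ⟶ L :=
    truncGEMap g (min (a - 1) m) ≫ inv (L.πTruncGE (min (a - 1) m))
  have hk : P.πTruncGE (min (a - 1) m) ≫ k = g := by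
    rw [← Category.assoc, πTruncGE_naturality, Category.assoc, IsIso.hom_inv_id, Category.comp_id]
  have : QuasiIso k := by
    have : QuasiIso (P.πTruncGE (min (a - 1) m) ≫ k) := by rwa [hk]
    exact quasiIso_of_comp_left (P.πTruncGE (min (a - 1) m)) k
  refine h𝒞.target_term k (min (a - 1) m) (max b m) m h1 fun p hp => ?_
  rcases lt_or_gt_of_ne hp with h | h
  · exact h𝒞.zero _ (L.isZero_of_isStrictlyGE m p h)
  · exact h𝒞.zero _ (L.isZero_of_isStrictlyLE m p h)

end resolving
end
end TensorEval

namespace TensorEval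
noncomputable section
open CochainComplex

/-! ### Dimensions and restriction of scalars -/

section dimension
open Abelian
variable {R S : Type u} [CommRing R] [CommRing S] [Algebra R S]

lemma twoOfThree_projectiveDimension :
    TwoOfThree fun X : ModuleCat.{u} R => ∃ d, HasProjectiveDimensionLT X d where
  zero X hX := ⟨0, hX.hasProjectiveDimensionLT_zero⟩
  iso := fun e ⟨d, hd⟩ => ⟨d, hasProjectiveDimensionLT_of_iso e d⟩
  ext := fun h ⟨d, hd⟩ ⟨d', hd'⟩ =>
    ⟨max d d', h.shortExact.hasProjectiveDimensionLT_X₂ (max d d')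
      (hasProjectiveDimensionLT_of_ge _ d _ (le_max_left _ _))
      (hasProjectiveDimensionLT_of_ge _ d' _ (le_max_right _ _))⟩
  ker := fun h ⟨d, hd⟩ ⟨d', hd'⟩ =>
    ⟨max d d', h.shortExact.hasProjectiveDimensionLT_X₁ (max d d')
      (hasProjectiveDimensionLT_of_ge _ d _ (le_max_left _ _))
      (hasProjectiveDimensionLT_of_ge _ d' _ (by lia))⟩
  coker := fun h ⟨d, hd⟩ ⟨d', hd'⟩ =>
    ⟨max d d' + 1, h.shortExact.hasProjectiveDimensionLT_X₃ (max d d')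
      (hasProjectiveDimensionLT_of_ge _ d _ (le_max_left _ _))
      (hasProjectiveDimensionLT_of_ge _ d' _ (by lia))⟩

lemma twoOfThree_injectiveDimension :
    TwoOfThree fun X : ModuleCat.{u} R => ∃ d, HasInjectiveDimensionLT X d where
  zero X hX := ⟨0, hX.hasInjectiveDimensionLT_zero⟩
  iso := fun e ⟨d, hd⟩ => ⟨d, hasInjectiveDimensionLT_of_iso e d⟩
  ext := fun h ⟨d, hd⟩ ⟨d', hd'⟩ =>
    ⟨max d d', h.shortExact.hasInjectiveDimensionLT_X₂ (max d d')
      (hasInjectiveDimensionLT_of_ge _ d _ (le_max_left _ _))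
      (hasInjectiveDimensionLT_of_ge _ d' _ (le_max_right _ _))⟩
  ker := fun h ⟨d, hd⟩ ⟨d', hd'⟩ =>
    ⟨max d d' + 1, h.shortExact.hasInjectiveDimensionLT_X₁ (max d d')
      (hasInjectiveDimensionLT_of_ge _ d' _ (le_max_right _ _))
      (hasInjectiveDimensionLT_of_ge _ d _ (by lia))⟩
  coker := fun h ⟨d, hd⟩ ⟨d', hd'⟩ =>
    ⟨max d d', h.shortExact.hasInjectiveDimensionLT_X₃ (max d d')
      (hasInjectiveDimensionLT_of_ge _ d' _ (le_max_right _ _))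
      (hasInjectiveDimensionLT_of_ge _ d _ (by lia))⟩

lemma isZero_charMod {X : ModuleCat.{u} R} (h : Limits.IsZero X) : Limits.IsZero (charMod X) := by
  have := ModuleCat.isZero_iff_subsingleton.1 h
  exact ModuleCat.isZero_iff_subsingleton.2
    ⟨fun f g => DFunLike.ext (F := CharacterModule X) _ _ fun x => by
      rw [Subsingleton.elim x 0]
      exact (map_zero (show X →+ _ from f)).trans (map_zero (show X →+ _ from g)).symm⟩

/-- Isomorphic modules have isomorphic character modules. -/
def charIso {X Y : ModuleCat.{u} R} (e : X ≅ Y) : charMod X ≅ charMod Y where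
  hom := charMap e.inv
  inv := charMap e.hom
  hom_inv_id := by rw [← charMap_comp, e.hom_inv_id]; rfl
  inv_hom_id := by rw [← charMap_comp, e.inv_hom_id]; rfl

lemma twoOfThree_flatDimension :
    TwoOfThree fun X : ModuleCat.{u} R => ∃ d, HasInjectiveDimensionLT (charMod X) d where
  zero _ hX := twoOfThree_injectiveDimension.zero _ (isZero_charMod hX)
  iso e h := twoOfThree_injectiveDimension.iso (charIso e) h
  ext h h₁ h₃ := twoOfThree_injectiveDimension.ext h.char h₃ h₁
  ker h h₂ h₃ := twoOfThree_injectiveDimension.coker h.char h₃ h₂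
  coker h h₁ h₂ := twoOfThree_injectiveDimension.ker h.char h₂ h₁

lemma exists_hasInjectiveDimensionLT_charMod (F : ModuleCat.{u} R) [Module.Flat R F] :
    ∃ d, HasInjectiveDimensionLT (charMod F) d :=
  have := injective_charMod F
  ⟨1, inferInstance⟩

/-- By base change, `R`-linear maps to an `S`-module are `S`-linear maps from `S ⊗ -`; there
injectivity of `J` applies. -/
lemma exists_extension_of_rTensor_injective {K P J : Type u} [AddCommGroup K] [AddCommGroup P]
    [AddCommGroup J] [Module R K] [Module R P] [Module R J] [Module S J] [IsScalarTower R S J]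
    [hJ : Module.Injective S J] (i : K →ₗ[R] P) (hi : Function.Injective (i.rTensor S))
    (φ : K →ₗ[R] J) : ∃ t : P →ₗ[R] J, t ∘ₗ i = φ := by
  have hi' : Function.Injective (i.baseChange S) := by
    have : Function.Injective (i.lTensor S) := by
      rwa [← LinearMap.comm_comp_rTensor_comp_comm_eq, LinearMap.coe_comp, LinearMap.coe_comp,
        LinearEquiv.coe_coe, LinearEquiv.coe_coe, EquivLike.comp_injective,
        EquivLike.injective_comp]
    exact this
  obtain ⟨t, ht⟩ := hJ.out (i.baseChange S) hi' (LinearMap.liftBaseChange S φ)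
  refine ⟨t.restrictScalars R ∘ₗ TensorProduct.mk R S P 1, LinearMap.ext fun x => ?_⟩
  exact (ht (1 ⊗ₜ x)).trans
    ((LinearMap.liftBaseChange_tmul S φ 1 x).trans (one_smul S _))

/-- The hypothesis is `Tor_1 (M, S) = 0` in dual form, so a syzygy embedding of `M` stays injective
after tensoring with `S`. -/
lemma subsingleton_ext_one_restrict (M : ModuleCat.{u} R) (J : ModuleCat.{u} S) [Injective J]
    (h : Subsingleton (Ext M (charMod ((resMod R S).obj (ModuleCat.of S S))) 1)) :
    Subsingleton (Ext M ((resMod R S).obj J) 1) := by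
  obtain ⟨K, P, i, p, hs, hP⟩ := exists_isSES_projective M
  refine hs.subsingleton_ext_one (Ext.subsingleton_of_projective _ _ 0) fun φ => ?_
  have hJ : Module.Injective S ((resMod R S).obj J) :=
    (Module.injective_iff_injective_object S J).2 inferInstance
  have hinj : Function.Injective (i.hom.rTensor S) := by
    rw [rTensor_injective_iff_lcomp_surjective]
    intro χ
    let e : charMod (ModuleCat.of R S) ≅ charMod ((resMod R S).obj (ModuleCat.of S S)) :=
      charIso (LinearEquiv.toModuleIso
        (show S ≃ₗ[R] (resMod R S).obj (ModuleCat.of S S) from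
          { toFun := fun s => s
            map_add' := fun _ _ => rfl
            map_smul' := fun r s => Algebra.smul_def r s
            invFun := fun s => s
            left_inv := fun _ => rfl
            right_inv := fun _ => rfl }))
    obtain ⟨ψ, hψ⟩ := hs.exists_extension h
      ((show K ⟶ charMod (ModuleCat.of R S) from ModuleCat.ofHom χ) ≫ e.hom)
    refine ⟨(ψ ≫ e.inv).hom, congrArg ModuleCat.Hom.hom (?_ : i ≫ ψ ≫ e.inv = _)⟩
    rw [← Category.assoc, hψ, Category.assoc, e.hom_inv_id, Category.comp_id]
    rfl
  obtain ⟨t, ht⟩ := exists_extension_of_rTensor_injective (J := (resMod R S).obj J) i.hom hinj φ.hom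
  exact ⟨(ModuleCat.ofHom t :), ModuleCat.hom_ext ht⟩

/-- Shifting along syzygies of `M` extends `subsingleton_ext_one_restrict` to all positive degrees.
Hence the injective dimension of `S^∨` over `R`, finite by hypothesis, bounds that of all injective
`S`-modules. -/
lemma exists_hasInjectiveDimensionLT [HasDerivedCategory.{w} (ModuleCat.{u} R)]
    (hφ : HomFiniteFlatDim R S) :
    ∃ d, ∀ J : ModuleCat.{u} S, Injective J → HasInjectiveDimensionLT ((resMod R S).obj J) d := by
  obtain ⟨K, a, b, _, _, hK, ⟨e⟩⟩ := hφ
  obtain ⟨d, hd⟩ := twoOfThree_flatDimension.iso (HomologicalComplex.singleObjXSelf _ _ _)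
    (twoOfThree_flatDimension.of_isoQ (fun P hP =>
      have := (IsProjective.iff_projective (R := R) P).2 hP
      exists_hasInjectiveDimensionLT_charMod P) a b 0
      (fun p => have := hK p; exists_hasInjectiveDimensionLT_charMod (K.X p)) e)
  have key : ∀ (n : ℕ) (M : ModuleCat.{u} R) (J : ModuleCat.{u} S), Injective J →
      Subsingleton (Ext M (charMod ((resMod R S).obj (ModuleCat.of S S))) (n + 1)) →
      Subsingleton (Ext M ((resMod R S).obj J) (n + 1)) := by
    intro n
    induction n with
    | zero => exact fun M J _ h => subsingleton_ext_one_restrict M J h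
    | succ n ih =>
      intro M J hJ h
      obtain ⟨N, P, i, p, hs, hP⟩ := exists_isSES_projective M
      rw [← hs.ext_left_shift Orth.of_projective] at h ⊢
      exact ih N J hJ h
  -- Only positive `Ext` degrees are controlled, so degree zero has to be excluded in case `d = 0`.
  refine ⟨d + 1, fun J hJ => ?_⟩
  rw [hasInjectiveDimensionLT_iff]
  rintro (_ | i) hi M e
  · lia
  · have := key i M J hJ (HasInjectiveDimensionLT.subsingleton _ d (i + 1) (by lia) M)
    exact Subsingleton.elim _ _

/-- The character module of a flat module over `S` has finite injective dimension over `R`. -/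
lemma exists_hasInjectiveDimensionLT_of_flat [HasDerivedCategory.{w} (ModuleCat.{u} R)]
    (hφ : HomFiniteFlatDim R S) :
    ∃ d, ∀ F : ModuleCat.{u} S, Module.Flat S F →
      HasInjectiveDimensionLT (charMod ((resMod R S).obj F)) d := by
  obtain ⟨d, hd⟩ := exists_hasInjectiveDimensionLT hφ
  refine ⟨d, fun F hF => ?_⟩
  have := hd _ (injective_charMod F)
  refine hasInjectiveDimensionLT_of_iso (X := (resMod R S).obj (charMod F)) ?_ d
  exact LinearEquiv.toModuleIso
    (show (resMod R S).obj (charMod F) ≃ₗ[R] CharacterModule ((resMod R S).obj F) from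
      { toFun := fun c => c
        map_add' := fun _ _ => rfl
        map_smul' := fun r s => rfl
        invFun := fun c => c
        left_inv := fun _ => rfl
        right_inv := fun _ => rfl })

/-- A finite module in a class that is closed under syzygies and orthogonal to `R` is orthogonal to
the modules of finite flat dimension. -/
lemma orth_of_finite_flatDimension [IsNoetherianRing R] {Φ : ModuleCat.{u} R → Prop}
    (hΦ : ∀ M, Φ M → Module.Finite R M ∧ Orth M (ModuleCat.of R R)) 
    (hΦ' : ∀ X, Φ X → ∃ (K P : ModuleCat.{u} R) (f : K ⟶ P)
      (g : P ⟶ X), IsSES f g ∧ Projective P ∧ Φ K) (d : ℕ) :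
    ∀ (N : ModuleCat.{u} R), HasInjectiveDimensionLT (charMod N) d → ∀ M, Φ M → Orth M N := by
  have hflat : ∀ (F : ModuleCat.{u} R), Module.Flat R F → ∀ M, Φ M → Orth M F :=
    fun F _ M hM => orth_of_syzygies (Φ := Φ) (fun X hX =>
      have := (hΦ X hX).1
      ⟨subsingleton_ext_one_flat X ((hΦ X hX).2 0) F, hΦ' X hX⟩) hM
  have hinj : ∀ N : ModuleCat.{u} R, HasInjectiveDimensionLT (charMod N) 1 → Module.Flat R N :=
    fun N hN => flat_of_injective_charMod N (injective_iff_hasInjectiveDimensionLT_one.2 hN)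
  induction d with
  | zero => exact fun N hN => hflat N (hinj N (hasInjectiveDimensionLT_of_ge _ 0 1 (by lia)))
  | succ d ih =>
    intro N hN M hM
    rcases d with _ | d
    · exact hflat N (hinj N hN) M hM
    obtain ⟨K, P, f, g, h, hP⟩ := exists_isSES_projective N
    have := (IsProjective.iff_projective (R := R) P).2 hP
    have := injective_charMod P
    exact h.orth_right₃ (hflat P inferInstance M hM)
      (ih K (h.char.shortExact.hasInjectiveDimensionLT_X₃ (d + 1) inferInstance hN) M hM)

end dimension
end
end TensorEval

namespace TensorEval
noncomputable section
open CochainComplex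

/-! ### Resolutions by finite projective modules -/

section finite
open Pretriangulated
variable {R : Type u} [CommRing R]

lemma IsSES.projective {M₁ M₂ M₃ : ModuleCat.{u} R} {f : M₁ ⟶ M₂} {g : M₂ ⟶ M₃} (h : IsSES f g)
    (h₁ : Projective M₁) (h₃ : Projective M₃) : Projective M₂ := by
  rw [projective_iff_hasProjectiveDimensionLT_one] at *
  exact h.shortExact.hasProjectiveDimensionLT_X₂ 1 h₁ h₃

section
variable [HasDerivedCategory.{w} (ModuleCat.{u} R)]

/-- Resolutions by bounded above complexes of finite projective modules. -/
def HasFiniteRes (Z : DerivedCategory (ModuleCat.{u} R)) : Prop :=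
  ∃ (L : CochainComplex (ModuleCat.{u} R) ℤ) (b : ℤ), L.IsStrictlyLE b ∧
    (∀ i, Projective (L.X i)) ∧ (∀ i, Module.Finite R (L.X i)) ∧
    Nonempty (DerivedCategory.Q.obj L ≅ Z)

lemma HasFiniteRes.of_iso {Z Z' : DerivedCategory (ModuleCat.{u} R)} (h : HasFiniteRes Z)
    (e : Z ≅ Z') : HasFiniteRes Z' := by
  obtain ⟨L, b, h1, h2, h3, ⟨e'⟩⟩ := h
  exact ⟨L, b, h1, h2, h3, ⟨e' ≪≫ e⟩⟩

lemma HasFiniteRes.shift {Z : DerivedCategory (ModuleCat.{u} R)} (h : HasFiniteRes Z) (n : ℤ) :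
    HasFiniteRes (Z⟦n⟧) := by
  obtain ⟨L, b, _, h2, h3, ⟨e⟩⟩ := h
  exact ⟨L⟦n⟧, b - n, L.isStrictlyLE_shift b n (b - n) (by lia), fun i => h2 _, fun i => h3 _,
    ⟨(DerivedCategory.Q.commShiftIso n).app L ≪≫ (CategoryTheory.shiftFunctor _ n).mapIso e⟩⟩

lemma FiniteHomology.of_isoQ {K L : CochainComplex (ModuleCat.{u} R) ℤ} (h : FiniteHomology K)
    (e : DerivedCategory.Q.obj K ≅ DerivedCategory.Q.obj L) : FiniteHomology L := fun n =>
  have : Module.Finite R ((HomologicalComplex.homologyFunctor (ModuleCat.{u} R) (ComplexShape.up ℤ) n).obj K) := h n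
  Module.Finite.equiv (((DerivedCategory.homologyFunctorFactors _ n).app K).symm ≪≫
    (DerivedCategory.homologyFunctor _ n).mapIso e ≪≫
      ((DerivedCategory.homologyFunctorFactors _ n).app L)).toLinearEquiv

end

variable [IsNoetherianRing R]


instance : EnoughProjectives (FGModuleCat.{u} R) where
  presentation M := by
    obtain ⟨k, g, hg⟩ := Module.Finite.exists_fin' R M
    let π : FGModuleCat.of R (Fin k → R) ⟶ M := FGModuleCat.ofHom g
    have hπ : Epi ((forget₂ (FGModuleCat R) (ModuleCat R)).map π) :=
      (ModuleCat.epi_iff_surjective _).2 hg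
    have := projective_of_free (R := R) (Fin k → R)
    exact ⟨{
      p := FGModuleCat.of R (Fin k → R)
      f := π
      projective := ⟨fun {E X} f e he => by
        have : Epi ((forget₂ (FGModuleCat R) (ModuleCat R)).map e) := inferInstance
        have : Projective ((forget₂ (FGModuleCat R) (ModuleCat R)).obj
          (FGModuleCat.of R (Fin k → R))) := projective_of_free (R := R) (Fin k → R)
        refine ⟨(forget₂ (FGModuleCat R) (ModuleCat R)).preimage (Projective.factorThru
          ((forget₂ (FGModuleCat R) (ModuleCat R)).map f)
          ((forget₂ (FGModuleCat R) (ModuleCat R)).map e)), ?_⟩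
        apply (forget₂ (FGModuleCat R) (ModuleCat R)).map_injective
        rw [CategoryTheory.Functor.map_comp, Functor.map_preimage, Projective.factorThru_comp]⟩
      epi := (forget₂ (FGModuleCat R) (ModuleCat R)).epi_of_epi_map hπ }⟩

lemma projective_of_projective_fgModuleCat (P : FGModuleCat.{u} R) [Projective P] :
    Projective ((forget₂ (FGModuleCat R) (ModuleCat R)).obj P) := by
  obtain ⟨k, g, hg⟩ := Module.Finite.exists_fin' R P
  let π : FGModuleCat.of R (Fin k → R) ⟶ P := FGModuleCat.ofHom g
  have : Epi ((forget₂ (FGModuleCat R) (ModuleCat R)).map π) :=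
    (ModuleCat.epi_iff_surjective _).2 hg
  have : Epi π := (forget₂ (FGModuleCat R) (ModuleCat R)).epi_of_epi_map this
  have : Projective ((forget₂ (FGModuleCat R) (ModuleCat R)).obj
    (FGModuleCat.of R (Fin k → R))) := projective_of_free (R := R) (Fin k → R)
  exact ((show Retract P _ from ⟨Projective.factorThru (𝟙 P) π, π,
    Projective.factorThru_comp _ _⟩).map (forget₂ (FGModuleCat R) (ModuleCat R))).projective

lemma IsSES.finite {M₁ M₂ M₃ : ModuleCat.{u} R} {f : M₁ ⟶ M₂} {g : M₂ ⟶ M₃} (h : IsSES f g)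
    (h₁ : Module.Finite R M₁) (h₃ : Module.Finite R M₃) : Module.Finite R M₂ :=
  have := isNoetherian_of_range_eq_ker f.hom g.hom (LinearMap.exact_iff.1 h.exact).symm
  inferInstance

variable [HasDerivedCategory.{w} (ModuleCat.{u} R)]

/-- Resolve in the abelian category of finite modules, which has enough projectives, and transport
along the exact forgetful functor. -/
lemma HasFiniteRes.single (M : ModuleCat.{u} R) [Module.Finite R M] (n : ℤ) :
    HasFiniteRes (DerivedCategory.Q.obj
      ((HomologicalComplex.single (ModuleCat.{u} R) (ComplexShape.up ℤ) n).obj M)) := by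
  let F := forget₂ (FGModuleCat R) (ModuleCat R)
  let M' : FGModuleCat R := FGModuleCat.of R M
  obtain ⟨P, π, _, hP, _⟩ := exists_projective
    ((HomologicalComplex.single (FGModuleCat.{u} R) (ComplexShape.up ℤ) n).obj M') n
  have : F.PreservesHomology := inferInstance
  have : QuasiIso ((F.mapHomologicalComplex (ComplexShape.up ℤ)).map π) := inferInstance
  refine ⟨(F.mapHomologicalComplex _).obj P, n, ?_, fun i => ?_, fun i => ?_,
    ⟨isoOfQuasiIso ((F.mapHomologicalComplex _).map π) ≪≫ DerivedCategory.Q.mapIso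
      ((HomologicalComplex.singleMapHomologicalComplex F (ComplexShape.up ℤ) n).app M')⟩⟩
  · rw [isStrictlyLE_iff]
    intro i hi
    exact F.map_isZero (P.isZero_of_isStrictlyLE n i hi)
  · have := hP i
    exact projective_of_projective_fgModuleCat (P.X i)
  · exact inferInstanceAs (Module.Finite R (P.X i))

/-- K-projectivity realizes the first map of the triangle by a map of resolutions, and its cone
resolves the third object. -/
lemma HasFiniteRes.of_distinguished₃ {T : Triangle (DerivedCategory (ModuleCat.{u} R))}
    (hT : T ∈ distTriang _) (h₁ : HasFiniteRes T.obj₁) (h₂ : HasFiniteRes T.obj₂) :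
    HasFiniteRes T.obj₃ := by
  obtain ⟨L, b, _, hL, hL', ⟨e⟩⟩ := h₁
  obtain ⟨K, c, _, hK, hK', ⟨e'⟩⟩ := h₂
  have := isKProjective_of_projective L b
  obtain ⟨k, hk⟩ := (IsKProjective.Qh_map_bijective L
    ((HomotopyCategory.quotient _ _).obj K)).surjective (e.hom ≫ T.mor₁ ≫ e'.inv)
  obtain ⟨k, rfl⟩ := (HomotopyCategory.quotient _ _).map_surjective k
  have hk' : DerivedCategory.Q.map k = e.hom ≫ T.mor₁ ≫ e'.inv := hk
  have := L.isStrictlyLE_of_le b (max b c) (le_max_left _ _)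
  have := K.isStrictlyLE_of_le c (max b c) (le_max_right _ _)
  refine ⟨mappingCone k, max b c, isStrictlyLE_mappingCone k _, fun i => ?_, fun i => ?_,
    ⟨(Triangle.π₃.mapIso (isoTriangleOfIso₁₂ _ _
      (DerivedCategory.mappingCone_triangle_distinguished k) hT e e' ?_))⟩⟩
  · exact (isSES_mappingCone k i).projective (hK i) (hL _)
  · exact (isSES_mappingCone k i).finite (hK' i) (hL' _)
  · change DerivedCategory.Q.map k ≫ e'.hom = e.hom ≫ T.mor₁
    rw [hk', Category.assoc, Category.assoc, e'.inv_hom_id, Category.comp_id]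

/-- Induction on the amplitude: canonical truncation splits off the top homology module, leaving a
shorter complex with finite homology. -/
lemma HasFiniteRes.of_bounded (a : ℤ) (k : ℕ) (Z : CochainComplex (ModuleCat.{u} R) ℤ)
    [Z.IsStrictlyGE a] [Z.IsStrictlyLE (a + k)] (hZ : FiniteHomology Z) :
    HasFiniteRes (DerivedCategory.Q.obj Z) := by
  induction k generalizing Z with
  | zero =>
    have : Z.IsStrictlyLE a := Z.isStrictlyLE_of_le (a + (0 : ℕ)) a (by simp)
    obtain ⟨M, ⟨e⟩⟩ := Z.exists_iso_single a
    have : Module.Finite R M := by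
      have : Module.Finite R
        ((HomologicalComplex.homologyFunctor (ModuleCat.{u} R) (ComplexShape.up ℤ) a).obj Z) := hZ a
      exact Module.Finite.equiv (((HomologicalComplex.homologyFunctor _ _ a).mapIso e ≪≫
        (HomologicalComplex.homologyFunctorSingleIso _ _ a).app M).toLinearEquiv)
    exact (HasFiniteRes.single M a).of_iso (DerivedCategory.Q.mapIso e.symm)
  | succ k ih =>
    have hs := Z.shortComplexTruncLE_shortExact (a + k)
    have h1 : HasFiniteRes (DerivedCategory.Q.obj (Z.truncLE (a + k))) := by
      refine ih _ fun n => ?_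
      by_cases hn : n ≤ a + k
      · have := Z.quasiIsoAt_ιTruncLE (a + k) n hn
        have := hZ n
        exact Module.Finite.equiv
          (asIso (HomologicalComplex.homologyMap (Z.ιTruncLE (a + k)) n)).symm.toLinearEquiv
      · have := ModuleCat.isZero_iff_subsingleton.1
          ((Z.truncLE (a + k)).isZero_of_isLE (a + k) n (by lia))
        infer_instance
    have h3 : HasFiniteRes (DerivedCategory.Q.obj (Z.truncGE (a + k + 1))) := by
      have : (Z.truncGE (a + k + 1)).IsStrictlyLE (a + k + 1) := by
        have : (Z.truncGE (a + k + 1)).IsStrictlyLE (a + (k + 1 : ℕ)) := inferInstance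
        exact (Z.truncGE (a + k + 1)).isStrictlyLE_of_le (a + (k + 1 : ℕ)) (a + k + 1)
          (by push_cast; lia)
      obtain ⟨M, ⟨e⟩⟩ := (Z.truncGE (a + k + 1)).exists_iso_single (a + k + 1)
      have : Module.Finite R M := by
        have := hZ (a + k + 1)
        exact Module.Finite.equiv ((asIso (HomologicalComplex.homologyMap
          (Z.πTruncGE (a + k + 1)) (a + k + 1)) ≪≫
            (HomologicalComplex.homologyFunctor _ _ (a + k + 1)).mapIso e ≪≫
          (HomologicalComplex.homologyFunctorSingleIso _ _ (a + k + 1)).app M).toLinearEquiv)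
      exact (HasFiniteRes.single M _).of_iso (DerivedCategory.Q.mapIso e.symm)
    have hT := DerivedCategory.triangleOfSES_distinguished hs
    -- The inverse rotation places `Z` third, as the cone of a map from the shifted top part to the
    -- lower truncation.
    refine HasFiniteRes.of_distinguished₃ (inv_rot_of_distTriang _ hT) ?_ h1
    exact (h3.of_iso (isoOfQuasiIso (Z.shortComplexTruncLEX₃ToTruncGE (a + k) (a + k + 1))).symm).shift
      (-1)

/-- A bounded complex with finite homology over a noetherian ring has a resolution by a bounded
above complex of finite projective modules. -/
lemma exists_finite_projective (K : CochainComplex (ModuleCat.{u} R) ℤ) (a b : ℤ)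
    [K.IsStrictlyGE a] [K.IsStrictlyLE b] (hK : FiniteHomology K) :
    ∃ (L : CochainComplex (ModuleCat.{u} R) ℤ) (c : ℤ) (f : L ⟶ K), QuasiIso f ∧
      L.IsStrictlyLE c ∧ (∀ i, Projective (L.X i)) ∧ (∀ i, Module.Finite R (L.X i)) := by
  have := K.isStrictlyLE_of_le b (a + (b - a).toNat) (by lia)
  obtain ⟨L, c, _, h2, h3, ⟨e⟩⟩ := HasFiniteRes.of_bounded a (b - a).toNat K hK
  have := isKProjective_of_projective L c
  obtain ⟨f, hf⟩ := exists_quasiIso_of_isKProjective e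
  exact ⟨L, c, f, hf, inferInstance, h2, h3⟩

end finite
end
end TensorEval

namespace TensorEval
noncomputable section
open CochainComplex

/-! ### Cases (a) and (b) -/

section cases
variable {R S : Type u} [CommRing R] [CommRing S] [Algebra R S]

lemma injective_homMod (P J : ModuleCat.{u} S) [Projective P] [Injective J] :
    Injective (homMod (A := S) (T := S) P J) := by
  have := (IsProjective.iff_projective (R := S) P).2 inferInstance
  have hJ : Module.Injective S ((resMod S S).obj J) :=
    (Module.injective_iff_injective_object S J).2 inferInstance
  have h : Module.Injective S (P →ₗ[S] (resMod S S).obj J) := by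
    refine ⟨fun X Y _ _ _ _ f hf g => ?_⟩
    obtain ⟨t, ht⟩ := hJ.out (f.rTensor P) (Module.Flat.rTensor_preserves_injective_linearMap f hf)
      (TensorProduct.lift g)
    exact ⟨TensorProduct.curry t, fun x => LinearMap.ext fun y => ht (x ⊗ₜ y)⟩
  exact (Module.injective_iff_injective_object S (P →ₗ[S] (resMod S S).obj J)).1 h

lemma IsFlatCycle.torOrth {G E : ModuleCat.{u} R} (h : IsFlatCycle G) (hE : Injective E) :
    TorOrth E G := TorOrth.symm (h.orth hE)

lemma resolving_coresolved {𝒯 : ModuleCat.{u} R → Prop}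
    (hprod : ∀ T T', 𝒯 T → 𝒯 T' → 𝒯 (ModuleCat.of R (T × T')))
    (h : Coresolved 𝒯 (ModuleCat.of R R)) : Resolving (Coresolved 𝒯) where
  zero X hX := by
    have := ModuleCat.isZero_iff_subsingleton.1 hX
    -- A zero module is the kernel of the identity of `R`.
    refine Coresolved.kernel hprod (f := (0 : X ⟶ ModuleCat.of R R)) (g := 𝟙 _)
      ⟨Function.injective_of_subsingleton _, fun x => ⟨fun hx => ⟨0, ?_⟩, ?_⟩,
        Function.surjective_id⟩ h h
    · exact hx.symm
    · rintro ⟨y, rfl⟩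
      rfl
  iso e hX := by
    obtain ⟨T, A', f, g, hs, hT, hA'⟩ := hX.exists_isSES
    exact Coresolved.of_isSES (hs.congr_left e) hT hA' fun T hT => Orth.of_iso_left e (hX.orth hT)
  ext h h₁ h₃ := Coresolved.extension hprod h h₁ h₃
  ker h h₂ h₃ := Coresolved.kernel hprod h h₂ h₃

lemma Coresolved.syzygy [IsNoetherianRing R] {𝒯 : ModuleCat.{u} R → Prop}
    (hprod : ∀ T T', 𝒯 T → 𝒯 T' → 𝒯 (ModuleCat.of R (T × T')))
    (hfree : ∀ F : ModuleCat.{u} R, Module.Free R F → Coresolved 𝒯 F) {M : ModuleCat.{u} R}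
    (h : Module.Finite R M ∧ Coresolved 𝒯 M) : ∃ (K P : ModuleCat.{u} R) (f : K ⟶ P)
      (g : P ⟶ M), IsSES f g ∧ Projective P ∧ Module.Finite R K ∧ Coresolved 𝒯 K := by
  obtain ⟨hM, hM'⟩ := h
  obtain ⟨k, K, f, g, hs, hK⟩ := exists_isSES_finite M
  exact ⟨K, _, f, g, hs, projective_of_free (R := R) (Fin k → R), hK,
    Coresolved.kernel hprod hs (hfree _ (inferInstanceAs (Module.Free R (Fin k → R)))) hM'⟩

section truncation
variable [IsNoetherianRing R] [HasDerivedCategory.{w} (ModuleCat.{u} R)]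

/-- A bounded complex with finite homology and terms in a resolving class that contains the
projective modules has a model with finite terms in that class. -/
lemma exists_finite_model {𝒞 : ModuleCat.{u} R → Prop} (h𝒞 : Resolving 𝒞)
    (hproj : ∀ P, Projective P → 𝒞 P) (K : CochainComplex (ModuleCat.{u} R) ℤ) (a b : ℤ)
    [K.IsStrictlyGE a] [K.IsStrictlyLE b] (hK : ∀ p, 𝒞 (K.X p)) (hK' : FiniteHomology K) :
    ∃ (L K' : CochainComplex (ModuleCat.{u} R) ℤ) (f : L ⟶ K') (c d : ℤ), QuasiIso f ∧
      L.IsStrictlyLE d ∧ K'.IsStrictlyGE c ∧ K'.IsStrictlyLE d ∧ (∀ i, Projective (L.X i)) ∧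
      (∀ i, Module.Finite R (L.X i)) ∧ (∀ i, Module.Finite R (K'.X i) ∧ 𝒞 (K'.X i)) ∧
      Nonempty (DerivedCategory.Q.obj L ≅ DerivedCategory.Q.obj K) := by
  obtain ⟨L, d, f, _, _, h1, h2⟩ := exists_finite_projective K a b hK'
  have := K.isStrictlyLE_of_le b (max b d) (le_max_left _ _)
  have := L.isStrictlyLE_of_le d (max b d) (le_max_right _ _)
  -- Truncating strictly below `a` puts the cokernel term in `𝒞`; it is finite as a quotient of a
  -- term of `L`.
  obtain ⟨h3, h4⟩ := h𝒞.exists_truncGE f a (max b d) (a - 1) (by lia) (fun p => hproj _ (h1 p)) hK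
  refine ⟨L, L.truncGE (a - 1), L.πTruncGE (a - 1), a - 1, max b d, h3, inferInstance,
    inferInstance, inferInstance, h1, h2, fun i => ⟨?_, h4 i⟩, ⟨isoOfQuasiIso f⟩⟩
  have := h2 i
  have : Epi ((L.πTruncGE (a - 1)).f i) := by dsimp [CochainComplex.πTruncGE]; infer_instance
  exact Module.Finite.of_surjective ((L.πTruncGE (a - 1)).f i).hom
    ((ModuleCat.epi_iff_surjective _).1 this)

end truncation

section
variable [HasDerivedCategory.{w₁} (ModuleCat.{u} R)] [HasDerivedCategory.{w₂} (ModuleCat.{u} S)]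

/-- Over the noetherian ring `S` the modules `Hom (I, J)` are flat, so they have finite flat
dimension over `R` and are Tor-orthogonal to Gorenstein flat modules. The resolution `P` has finite
projective terms, which makes evaluation bijective termwise. -/
theorem isIso_derivedTev_of_finiteInjDim_left (hφ : HomFiniteFlatDim R S) [IsNoetherianRing S]
    {U V : CochainComplex (ModuleCat.{u} S) ℤ} {W : CochainComplex (ModuleCat.{u} R) ℤ}
    (hU : FiniteInjDim U) (hU' : FiniteHomology U) (hV : FiniteInjDim V)
    (hW : FiniteGorensteinFlatDim W) (p : KProjRes U) (q : KProjRes W) :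
    IsIso (derivedTev p V q) := by
  obtain ⟨I, a, b, _, _, hI, ⟨eI⟩⟩ := hU
  obtain ⟨J, a', b', _, _, hJ, ⟨eJ⟩⟩ := hV
  obtain ⟨K, c, d, _, _, hK, ⟨eK⟩⟩ := hW
  obtain ⟨P, e, f, _, _, hP, hP'⟩ := exists_finite_projective I a b (hU'.of_isoQ eI.symm)
  obtain ⟨Q, g, _, hQ, _⟩ := exists_projective K d
  obtain ⟨n, hn⟩ := exists_hasInjectiveDimensionLT hφ
  obtain ⟨m, hm⟩ := exists_hasInjectiveDimensionLT_of_flat hφ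
  have := P.isStrictlyLE_of_le e (max b e) (le_max_right _ _)
  have := I.isStrictlyLE_of_le b (max b e) (le_max_left _ _)
  have := isKProjective_of_projective P (max b e)
  have hinj : ∀ E : ModuleCat.{u} S, Injective E → ∀ G, IsFlatCycle G →
      TorOrth ((resMod R S).obj E) G := fun E hE G hG =>
    torOrth_of_hasInjectiveDimensionLT (fun _ => hG.torOrth) n _ (hn E hE)
  refine isIso_derivedTev p q (isoOfQuasiIso f ≪≫ eI) eJ d hQ (isoOfQuasiIso g ≪≫ eK)
    (quasiIso_tev_of_injective f J g a (max b e) a' b' c d (fun j => ?_) (Φ := IsFlatCycle)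
      (fun G hG => hG.exists_isSES) (fun q => (hK q).isFlatCycle)
      (fun q => have := hJ q; injective_resSelf _) (fun q => hinj _ (hJ q))
      (fun p q G hG => ?_) (fun p q => hinj _ ?_) fun p q j => ?_)
  · have := (IsProjective.iff_projective (R := R) (Q.X j)).2 (hQ j)
    infer_instance
  · have := hI p
    have := hJ q
    have := hm _ (flat_homMod (I.X p) (J.X q))
    exact TorOrth.symm (orth_of_hasInjectiveDimensionLT m (Φ := IsFlatCycle) (fun X hX => by
      obtain ⟨P, X', f, g, h, _, hX'⟩ := hX.exists_isSES
      exact ⟨P, X', f, g, h, TorOrth.of_flat_left, hX'⟩) hG)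
  · have := hP p
    have := hJ q
    exact injective_homMod _ _
  · have := (IsProjective.iff_projective (R := S) (P.X p)).2 (hP p)
    have := hP' p
    exact bijective_modTev_of_finite_projective_left _ _ _

/-- `Hom (I, J)` need not be flat now. Instead `W` gets a model with finite terms `G`; these satisfy
`Ext^1_R (G, I) = 0`, which dualizes to Tor-orthogonality with `Hom (I, J)`. Termwise, evaluation is
bijective since `P` is projective and `K'` has finitely presented terms. -/
theorem isIso_derivedTev_of_finiteGorensteinFlatDim (hφ : HomFiniteFlatDim R S) [IsNoetherianRing R]
    {U V : CochainComplex (ModuleCat.{u} S) ℤ} {W : CochainComplex (ModuleCat.{u} R) ℤ}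
    (hU : FiniteInjDim U) (hV : FiniteInjDim V)
    (hW : FiniteGorensteinFlatDim W) (hW' : FiniteHomology W) (p : KProjRes U) (q : KProjRes W) :
    IsIso (derivedTev p V q) := by
  obtain ⟨I, a, b, _, _, hI, ⟨eI⟩⟩ := hU
  obtain ⟨J, a', b', _, _, hJ, ⟨eJ⟩⟩ := hV
  obtain ⟨K, c, d, _, _, hK, ⟨eK⟩⟩ := hW
  have hflat : ∀ F : ModuleCat.{u} R, Projective F → Coresolved IsCharInj F := fun F hF =>
    have := (IsProjective.iff_projective (R := R) F).2 hF
    coresolved_of_flat F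
  obtain ⟨Q, K', g, c', d', _, _, _, _, hQ, hQ', hK', ⟨eQ⟩⟩ := exists_finite_model
    (resolving_coresolved IsCharInj.prod (hflat _ (projective_of_free R))) hflat K c d
    (fun p => (hK p).isFlatCycle.coresolved) (hW'.of_isoQ eK.symm)
  obtain ⟨P, f, _, hP, _⟩ := exists_projective I b
  obtain ⟨n, hn⟩ := exists_hasInjectiveDimensionLT hφ
  have := isKProjective_of_projective P b
  have hfree : ∀ F : ModuleCat.{u} R, Module.Free R F → Coresolved IsCharInj F := fun F _ =>
    coresolved_of_flat F
  have hΦ : ∀ G : ModuleCat.{u} R, (Module.Finite R G ∧ Coresolved IsCharInj G) →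
      ∃ (P G' : ModuleCat.{u} R) (f : G ⟶ P) (g : P ⟶ G'), IsSES f g ∧ Module.Free R P ∧
        Module.Finite R G' ∧ Coresolved IsCharInj G' := by
    rintro G ⟨_, hG⟩
    obtain ⟨n, G', f, g, h, h'⟩ := hG.exists_isSES_free IsCharInj.prod (fun T hT => hT.flat)
      (fun F hF => hF.elim (hfree F) fun hF => have := hF.flat; coresolved_of_flat F)
    exact ⟨_, G', f, g, h, inferInstanceAs (Module.Free R (Fin n → R)), h'⟩
  have hinj : ∀ E : ModuleCat.{u} S, Injective E → ∀ G : ModuleCat.{u} R,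
      (Module.Finite R G ∧ Coresolved IsCharInj G) → TorOrth ((resMod R S).obj E) G :=
    fun E hE G hG => torOrth_of_hasInjectiveDimensionLT
      (fun E hE => TorOrth.symm (hG.2.orth ⟨E, hE, ⟨Iso.refl _⟩⟩)) n _ (hn E hE)
  refine isIso_derivedTev p q (isoOfQuasiIso f ≪≫ eI) eJ d' hQ (eQ ≪≫ eK)
    (quasiIso_tev_of_injective f J g a b a' b' c' d' (fun j => ?_)
      (fun G hG => ?_) hK'
      (fun q => have := hJ q; injective_resSelf _) (fun q => hinj _ (hJ q))
      (fun p q G hG => ?_) (fun p q => hinj _ ?_) fun p q j => ?_)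
  · have := (IsProjective.iff_projective (R := R) (Q.X j)).2 (hQ j)
    infer_instance
  · obtain ⟨P, G', f, g, h, _, h'⟩ := hΦ G hG
    exact ⟨P, G', f, g, h, inferInstance, h'⟩
  · have := hJ q
    have := hn _ (hI p)
    refine TorOrth.symm (orth_of_syzygies (Φ := fun G => Module.Finite R G ∧ Coresolved IsCharInj G)
      (fun X hX => ⟨?_, Coresolved.syzygy IsCharInj.prod hfree hX⟩) hG)
    have := hX.1
    refine subsingleton_ext_one_charMod_homMod X (I.X p) (J.X q) (orth_of_hasInjectiveDimensionLT n
      (Φ := fun G => Module.Finite R G ∧ Coresolved IsCharInj G) (fun X hX => ?_) hX 0)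
    obtain ⟨P, G', f, g, h, _, h'⟩ := hΦ X hX
    have := projective_of_free (R := R) P
    exact ⟨P, G', f, g, h, Orth.of_projective (X := P), h'⟩
  · have := hP p
    have := hJ q
    exact injective_homMod _ _
  · have := (IsProjective.iff_projective (R := S) (P.X p)).2 (hP p)
    have := (hK' j).1
    have := Module.finitePresentation_of_finite R (K'.X j)
    exact bijective_modTev_of_finitePresentation_right _ _ _

end
end cases
end
end TensorEval

namespace TensorEval
noncomputable section
open CochainComplex

/-! ### Cases (c), (d) and (d') -/

section cases
variable {R S : Type u} [CommRing R] [CommRing S] [Algebra R S]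

lemma flat_resSelf (F : ModuleCat.{u} S) [Module.Flat S F] :
    Module.Flat S ((resMod S S).obj F) :=
  Module.Flat.of_linearEquiv (resSelfIso F).toLinearEquiv

lemma flat_tensorBif (F F' : ModuleCat.{u} S) [Module.Flat S F] [Module.Flat S F'] :
    Module.Flat S (((tensorBif S S).obj F).obj F') := by
  have := flat_resSelf F
  exact inferInstanceAs (Module.Flat S ((resMod S S).obj F ⊗[S] F'))

lemma projective_tensorBif (F F' : ModuleCat.{u} S) [Projective F] [Projective F'] :
    Projective (((tensorBif S S).obj F).obj F') := by
  have := (IsProjective.iff_projective (R := S) F).2 inferInstance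
  have := (IsProjective.iff_projective (R := S) F').2 inferInstance
  have : Module.Projective S ((resMod S S).obj F) :=
    Module.Projective.of_equiv (resSelfIso F).symm.toLinearEquiv
  exact projective_of_free (R := S) ((resMod S S).obj F ⊗[S] F')

/-- The tensor product over `S` is commutative. -/
def tensorBifComm (M N : ModuleCat.{u} S) :
    ((tensorBif S S).obj M).obj N ≅ ((tensorBif S S).obj N).obj M :=
  LinearEquiv.toModuleIso (X₁ := (resMod S S).obj M ⊗[S] N) (X₂ := (resMod S S).obj N ⊗[S] M)
    ((TensorProduct.congr (resSelfIso M).toLinearEquiv (resSelfIso N).toLinearEquiv.symm).trans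
      (TensorProduct.comm S M ((resMod S S).obj N)))

/-- For `Ext^1` this is `subsingleton_ext_one_tensor` with the factors exchanged; closure under
syzygies gives the higher degrees. It is needed when `S` is not noetherian, where `Y ⊗ I` may fail
to be injective. -/
lemma orth_tensorBif [IsNoetherianRing R] {Φ : ModuleCat.{u} R → Prop}
    (hΦ : ∀ X, Φ X → Module.Finite R X ∧ ∃ (K P : ModuleCat.{u} R) (f : K ⟶ P)
      (g : P ⟶ X), IsSES f g ∧ Projective P ∧ Φ K) (Y I : ModuleCat.{u} S) [Module.Flat S Y]
    (hI : ∀ X, Φ X → Orth X ((resMod R S).obj I)) {X : ModuleCat.{u} R} (hX : Φ X) :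
    Orth X ((resMod R S).obj (((tensorBif S S).obj Y).obj I)) := by
  refine Orth.of_iso_right ((resMod R S).mapIso (tensorBifComm I Y))
    (orth_of_syzygies (Φ := Φ) (fun X hX => ⟨?_, (hΦ X hX).2⟩) hX)
  have := (hΦ X hX).1
  exact subsingleton_ext_one_tensor X I Y (hI X hX 0)

/-- The tensor product of a flat and an injective module over a noetherian ring is injective. -/
lemma injective_tensorBif [IsNoetherianRing S] (Y I : ModuleCat.{u} S) [Module.Flat S Y]
    [Injective I] : Injective (((tensorBif S S).obj Y).obj I) := by
  have := injective_resSelf I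
  have h : Injective ((resMod S S).obj (((tensorBif S S).obj I).obj Y)) :=
    injective_of_ext_one fun a => subsingleton_ext_one_tensor (R := S) _ I Y
      (Abelian.Ext.subsingleton_of_injective _ _ 0)
  exact Injective.of_iso (resSelfIso _ ≪≫ tensorBifComm I Y) h

lemma projective_prod (P P' : ModuleCat.{u} R) (h : Projective P) (h' : Projective P') :
    Projective (ModuleCat.of R (P × P')) := by
  have := (IsProjective.iff_projective (R := R) P).2 h
  have := (IsProjective.iff_projective (R := R) P').2 h'
  exact projective_of_free (P × P')

/-- Finite modules that have a coresolution by projective modules with cosyzygies orthogonal to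
the projective modules; over a noetherian ring these are the finite Gorenstein projective modules. -/
def IsFiniteProjCoresolved (M : ModuleCat.{u} R) : Prop :=
  Module.Finite R M ∧ Coresolved (fun P : ModuleCat.{u} R => Projective P) M

namespace IsFiniteProjCoresolved
variable [IsNoetherianRing R] {M : ModuleCat.{u} R}

lemma exists_isSES (h : IsFiniteProjCoresolved M) :
    ∃ (n : ℕ) (M' : ModuleCat.{u} R) (f : M ⟶ ModuleCat.of R (Fin n → R))
      (g : ModuleCat.of R (Fin n → R) ⟶ M'), IsSES f g ∧ IsFiniteProjCoresolved M' := by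
  have := h.1
  refine h.2.exists_isSES_free projective_prod
    (fun T hT => have := (IsProjective.iff_projective (R := R) T).2 hT; inferInstance)
    (fun F hF => ?_)
  rcases hF with hF | hF
  · have := projective_of_free (R := R) F
    exact coresolved_of_projective F
  · exact coresolved_of_projective F

lemma syzygy (h : IsFiniteProjCoresolved M) : ∃ (K P : ModuleCat.{u} R) (f : K ⟶ P)
      (g : P ⟶ M), IsSES f g ∧ Projective P ∧ IsFiniteProjCoresolved K :=
  Coresolved.syzygy projective_prod (fun F _ =>
    have := projective_of_free (R := R) F
    coresolved_of_projective F) h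

lemma orth_of_flatDimension (h : IsFiniteProjCoresolved M) (d : ℕ) (N : ModuleCat.{u} R)
    [hN : HasInjectiveDimensionLT (charMod N) d] : Orth M N :=
  orth_of_finite_flatDimension (Φ := IsFiniteProjCoresolved)
    (fun _ hX => ⟨hX.1, hX.2.orth (projective_of_free (R := R) R)⟩) (fun _ hX => hX.syzygy) d N hN M h

lemma orth_of_injectiveDimension (h : IsFiniteProjCoresolved M) (d : ℕ) (N : ModuleCat.{u} R)
    [HasInjectiveDimensionLT N d] : Orth M N :=
  orth_of_hasInjectiveDimensionLT d (Φ := IsFiniteProjCoresolved) (fun X hX => by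
    obtain ⟨n, X', f, g, h, hX'⟩ := hX.exists_isSES
    have := projective_of_free (R := R) (Fin n → R)
    exact ⟨_, X', f, g, h, Orth.of_projective, hX'⟩) h

end IsFiniteProjCoresolved

section
variable [HasDerivedCategory.{w₁} (ModuleCat.{u} R)] [HasDerivedCategory.{w₂} (ModuleCat.{u} S)]

/-- `X` gets a model with finite terms that have coresolutions by finite free modules. These are
orthogonal to modules of finite flat dimension, which covers `Y` and `Y ⊗ Q`, and by
`orth_tensorBif` also to `Y ⊗ I`. -/
theorem isIso_derivedTev_of_finiteGorensteinProjDim (hφ : HomFiniteFlatDim R S) [IsNoetherianRing R]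
    {X : CochainComplex (ModuleCat.{u} R) ℤ} {Y Z : CochainComplex (ModuleCat.{u} S) ℤ}
    (hX : FiniteGorensteinProjDim X) (hX' : FiniteHomology X) (hY : FiniteFlatDim Y)
    (hZ : FiniteInjDim Z) (p : KProjRes X) (q : KProjRes Z) :
    IsIso (derivedTev p Y q) := by
  obtain ⟨K, a, b, _, _, hK, ⟨eK⟩⟩ := hX
  obtain ⟨J, a', b', _, _, hJ, ⟨eJ⟩⟩ := hY
  obtain ⟨I, c, d, _, _, hI, ⟨eI⟩⟩ := hZ
  obtain ⟨P, K', f, a₁, b₁, _, _, _, _, hP, hP', hK', ⟨eP⟩⟩ := exists_finite_model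
    (resolving_coresolved (𝒯 := fun P : ModuleCat.{u} R => Projective P) projective_prod
      (have := projective_of_free (R := R) R; coresolved_of_projective _))
    (fun P _ => coresolved_of_projective P) K a b
    (fun p => (hK p).isProjCycle.coresolved) (hX'.of_isoQ eK.symm)
  obtain ⟨Q, g, _, hQ, _⟩ := exists_projective I d
  have := isKProjective_of_projective P b₁
  obtain ⟨n, hn⟩ := exists_hasInjectiveDimensionLT hφ
  obtain ⟨m, hm⟩ := exists_hasInjectiveDimensionLT_of_flat hφ
  have hQ' : ∀ j, Module.Flat S (Q.X j) := fun j =>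
    have := (IsProjective.iff_projective (R := S) (Q.X j)).2 (hQ j)
    inferInstance
  refine isIso_derivedTev p q (eP ≪≫ eK) eJ d hQ (isoOfQuasiIso g ≪≫ eI)
    (quasiIso_tev_of_flat f J g a₁ b₁ a' b' c d hP hQ' (Φ := IsFiniteProjCoresolved)
      (fun G hG => ?_) hK' (fun i j => ?_) (fun G i hG => ?_) (fun G i j hG => ?_)
      (fun G i j hG => ?_) fun p i j => ?_)
  · obtain ⟨n, G', f, g, h, hG'⟩ := hG.exists_isSES
    exact ⟨_, G', f, g, h, projective_of_free (R := R) (Fin n → R), hG'⟩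
  · have := hJ i
    have := flat_resSelf (J.X i)
    exact TorOrth.of_flat_left
  · have := hm _ (hJ i)
    exact hG.orth_of_flatDimension m _
  · have := hJ i
    have := hQ' j
    have := hm _ (flat_tensorBif (J.X i) (Q.X j))
    exact hG.orth_of_flatDimension m _
  · have := hJ i
    have := hn _ (hI j)
    exact orth_tensorBif (Φ := IsFiniteProjCoresolved) (fun X hX => ⟨hX.1, hX.syzygy⟩) _ _
      (fun X hX => hX.orth_of_injectiveDimension n _) hG
  · have := (hK' p).1
    have := hQ' j
    have := Module.finitePresentation_of_finite R (K'.X p)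
    exact bijective_modTev_of_finitePresentation_left _ _ _

/-- The tensor evaluation for a class `𝒴` of flat modules that have finite projective dimension
over `R`. -/
theorem isIso_derivedTev_of_class (hφ : HomFiniteFlatDim R S) [IsNoetherianRing S]
    {𝒴 : ModuleCat.{u} S → Prop} (h𝒴 : ∀ F, 𝒴 F → Module.Flat S F)
    (h𝒴' : ∀ F, 𝒴 F → ∃ d, HasProjectiveDimensionLT ((resMod R S).obj F) d)
    (htensor : ∀ F P, 𝒴 F → Projective P → 𝒴 (((tensorBif S S).obj F).obj P))
    {X : CochainComplex (ModuleCat.{u} R) ℤ} {Y Z : CochainComplex (ModuleCat.{u} S) ℤ}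
    (hX : FiniteGorensteinProjDim X) (hY : HasBoundedModel 𝒴 Y)
    (hZ : FiniteInjDim Z) (hZ' : FiniteHomology Z) (p : KProjRes X) (q : KProjRes Z) :
    IsIso (derivedTev p Y q) := by
  obtain ⟨K, a, b, _, _, hK, ⟨eK⟩⟩ := hX
  obtain ⟨J, a', b', _, _, hJ, ⟨eJ⟩⟩ := hY
  obtain ⟨I, c, d, _, _, hI, ⟨eI⟩⟩ := hZ
  obtain ⟨P, f, _, hP, _⟩ := exists_projective K b
  obtain ⟨Q, e, g, _, _, hQ, hQ'⟩ := exists_finite_projective I c d (hZ'.of_isoQ eI.symm)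
  have := Q.isStrictlyLE_of_le e (max d e) (le_max_right _ _)
  have := I.isStrictlyLE_of_le d (max d e) (le_max_left _ _)
  have := isKProjective_of_projective P b
  obtain ⟨n, hn⟩ := exists_hasInjectiveDimensionLT hφ
  have horth : ∀ G F, IsProjCycle G → 𝒴 F → Orth G ((resMod R S).obj F) := fun G F hG hF => by
    obtain ⟨m, hm⟩ := h𝒴' F hF
    exact orth_of_hasProjectiveDimensionLT (fun _ => hG.orth) m _ hm
  refine isIso_derivedTev p q (isoOfQuasiIso f ≪≫ eK) eJ (max d e) hQ (isoOfQuasiIso g ≪≫ eI)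
    (quasiIso_tev_of_flat f J g a b a' b' c (max d e) hP (fun j => ?_) (Φ := IsProjCycle)
      (fun G hG => hG.exists_isSES) (fun p => (hK p).isProjCycle) (fun i j => ?_)
      (fun G i hG => horth G _ hG (hJ i)) (fun G i j hG => horth G _ hG (htensor _ _ (hJ i) (hQ j)))
      (fun G i j hG => ?_) fun p i j => ?_)
  · have := (IsProjective.iff_projective (R := S) (Q.X j)).2 (hQ j)
    infer_instance
  · have := h𝒴 _ (hJ i)
    have := flat_resSelf (J.X i)
    exact TorOrth.of_flat_left
  · have := h𝒴 _ (hJ i)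
    have := hI j
    -- Here `S` is noetherian, so `Y ⊗ I` has injective terms and hence bounded injective dimension
    -- over `R`; no finiteness of the Gorenstein projective modules is needed.
    have := hn _ (injective_tensorBif (J.X i) (I.X j))
    refine orth_of_hasInjectiveDimensionLT n (Φ := IsProjCycle) (fun X hX => ?_) hG
    obtain ⟨P, X', f, g, h, _, hX'⟩ := hX.exists_isSES
    exact ⟨P, X', f, g, h, Orth.of_projective, hX'⟩
  · have := (IsProjective.iff_projective (R := S) (Q.X j)).2 (hQ j)
    have := hQ' j
    exact bijective_modTev_of_finite_projective_right _ _ _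

lemma exists_hasProjectiveDimensionLT_of_single (F : ModuleCat.{u} R) (h : FiniteProjDim
      ((HomologicalComplex.single (ModuleCat.{u} R) (ComplexShape.up ℤ) 0).obj F)) :
    ∃ d, HasProjectiveDimensionLT F d := by
  obtain ⟨K, a, b, _, _, hK, ⟨e⟩⟩ := h
  have h1 : ∀ P : ModuleCat.{u} R, Projective P → ∃ d, HasProjectiveDimensionLT P d := fun P _ =>
    ⟨1, inferInstance⟩
  exact twoOfThree_projectiveDimension.iso (HomologicalComplex.singleObjXSelf _ _ _)
    (twoOfThree_projectiveDimension.of_isoQ h1 a b 0 (fun p => h1 _ (hK p)) e)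

/-- The hypothesis of (d) and (d') concerns complexes; applied to a module in degree zero it gives
an ordinary projective dimension over `R`. -/
lemma exists_hasProjectiveDimensionLT_of_finiteProjDim {𝒴 : ModuleCat.{u} S → Prop}
    (h0 : ∀ X, Limits.IsZero X → 𝒴 X) (hiso : ∀ {X Y}, (X ≅ Y) → 𝒴 X → 𝒴 Y)
    (h : ∀ K : CochainComplex (ModuleCat.{u} S) ℤ, HasBoundedModel 𝒴 K →
      FiniteProjDim ((resCx R S).obj K)) (F : ModuleCat.{u} S) (hF : 𝒴 F) :
    ∃ d, HasProjectiveDimensionLT ((resMod R S).obj F) d := by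
  let K := (HomologicalComplex.single (ModuleCat.{u} S) (ComplexShape.up ℤ) 0).obj F
  have hK : HasBoundedModel 𝒴 K := ⟨K, 0, 0, inferInstance, inferInstance, fun n => by
    by_cases hn : n = 0
    · subst hn
      exact hiso (HomologicalComplex.singleObjXSelf (ComplexShape.up ℤ) 0 F).symm hF
    · exact h0 _ (HomologicalComplex.isZero_single_obj_X _ _ _ _ hn), ⟨Iso.refl _⟩⟩
  obtain ⟨L, a, b, h1, h2, hL, ⟨e⟩⟩ := h K hK
  exact exists_hasProjectiveDimensionLT_of_single _ ⟨L, a, b, h1, h2, hL, ⟨e ≪≫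
    DerivedCategory.Q.mapIso ((HomologicalComplex.singleMapHomologicalComplex (resMod R S)
      (ComplexShape.up ℤ) 0).app F)⟩⟩

end
end cases
end
end TensorEval

namespace TensorEval
noncomputable section
open CochainComplex

/-! ### Tensor evaluation for finite Gorenstein projective modules -/

section coresolution
open Abelian
variable {A B T : Type u} [CommRing A] [CommRing B] [CommRing T] [Algebra A T] [Algebra B T]
  {M F M' F' M'' : ModuleCat.{u} A}

lemma homModPre_surjective {f : M ⟶ F} {g : F ⟶ M'} (h : IsSES f g) (N : ModuleCat.{u} T)
    (hN : Orth M' ((resMod A T).obj N)) : Function.Surjective (homModPre f N).hom := by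
  intro φ
  obtain ⟨ψ, hψ⟩ := h.exists_extension (hN 0)
    (ModuleCat.ofHom (show M →ₗ[A] (resMod A T).obj N from φ) :)
  exact ⟨(ψ.hom :), congrArg ModuleCat.Hom.hom hψ⟩

lemma homModPre_exact_of_orth {f : M ⟶ F} {g : F ⟶ M'} (h : IsSES f g) {f' : M' ⟶ F'}
    {g' : F' ⟶ M''} (h' : IsSES f' g') (N : ModuleCat.{u} T)
    (hN : Orth M'' ((resMod A T).obj N)) :
    Function.Exact (homModPre (g ≫ f') N).hom (homModPre f N).hom := by
  intro φ
  let φ' : F ⟶ (resMod A T).obj N := (ModuleCat.ofHom (show F →ₗ[A] (resMod A T).obj N from φ) :)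
  constructor
  · intro hφ
    obtain ⟨k, hk⟩ := h.exists_desc φ' (ModuleCat.hom_ext hφ)
    obtain ⟨l, hl⟩ := h'.exists_extension (hN 0) k
    refine ⟨(l.hom :), ?_⟩
    have : (g ≫ f') ≫ l = φ' := by rw [Category.assoc, hl, hk]
    exact congrArg ModuleCat.Hom.hom this
  · rintro ⟨k, rfl⟩
    refine LinearMap.ext (M := M) (M₃ := (resMod A T).obj N) fun x => ?_
    change (show F' →ₗ[A] (resMod A T).obj N from k) (f'.hom (g.hom (f.hom x))) = 0
    rw [(h.exact _).2 ⟨x, rfl⟩, map_zero, map_zero]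

/-- The tensor evaluation is bijective for the modules with a coresolution by finite projective
modules whose cosyzygies are orthogonal to the modules that are involved. -/
lemma bijective_modTev_of_isSES {f : M ⟶ F} {g : F ⟶ M'} (h : IsSES f g) {f' : M' ⟶ F'}
    {g' : F' ⟶ M''} (h' : IsSES f' g') [Module.Finite A F] [Module.Projective A F]
    [Module.Finite A F'] [Module.Projective A F'] (N : ModuleCat.{u} T) (L : ModuleCat.{u} B)
    (h₁ : Orth M' ((resMod A T).obj N)) (h₂ : Orth M'' ((resMod A T).obj N))
    (h₃ : Orth M' ((resMod A T).obj (((tensorBif B T).obj N).obj L)))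
    (h₄ : Orth M'' ((resMod A T).obj (((tensorBif B T).obj N).obj L))) :
    Function.Bijective (modTev M N L).hom := by
  refine LinearMap.bijective_of_surjective_of_bijective_of_right_exact
    (((tensorBif B T).map (homModPre (g ≫ f') N)).app L).hom
    (((tensorBif B T).map (homModPre f N)).app L).hom
    (homModPre (g ≫ f') _).hom (homModPre f _).hom (modTev F' N L).hom (modTev F N L).hom
    (modTev M N L).hom ?_ ?_ ?_ ?_ ?_ ?_ ?_ ?_
  · exact congrArg ModuleCat.Hom.hom (modTev_naturality_left N L (g ≫ f')).symm
  · exact congrArg ModuleCat.Hom.hom (modTev_naturality_left N L f).symm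
  · exact rTensor_exact (f := ((resMod B T).map (homModPre (g ≫ f') N)).hom)
      (g := ((resMod B T).map (homModPre f N)).hom) L (homModPre_exact_of_orth h h' N h₂)
      (homModPre_surjective h N h₁)
  · exact homModPre_exact_of_orth h h' _ h₄
  · exact (bijective_modTev_of_finite_projective_left F' N L).2
  · exact bijective_modTev_of_finite_projective_left F N L
  · exact LinearMap.rTensor_surjective (g := ((resMod B T).map (homModPre f N)).hom) L
      (homModPre_surjective h N h₁)
  · exact homModPre_surjective h _ h₃

end coresolution

section modules
variable {R S : Type u} [CommRing R] [CommRing S] [Algebra R S]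

lemma bijective_moduleTev_of_modTev (G F I : Type u) [AddCommGroup G] [Module R G] [AddCommGroup F]
    [Module R F] [Module S F] [IsScalarTower R S F] [AddCommGroup I] [Module S I]
    (h : Function.Bijective (modTev (A := R) (B := S) (T := S) (ModuleCat.of R G)
      (ModuleCat.of S F) (ModuleCat.of S I)).hom) : Function.Bijective (moduleTev R S G F I) := by
  let e : F ≃ₗ[R] (resMod R S).obj (ModuleCat.of S F) :=
    { toFun := fun x => x
      map_add' := fun _ _ => rfl
      map_smul' := fun r x => (algebraMap_smul S r x).symm
      invFun := fun x => x
      left_inv := fun _ => rfl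
      right_inv := fun _ => rfl }
  let e₁ : (G →ₗ[R] F) ≃ₗ[S] (resMod S S).obj (homMod (ModuleCat.of R G) (ModuleCat.of S F)) :=
    { toFun := fun φ => (e.toLinearMap ∘ₗ φ : G →ₗ[R] _)
      map_add' := fun _ _ => rfl
      map_smul' := fun _ _ => rfl
      invFun := fun φ => e.symm.toLinearMap ∘ₗ (show G →ₗ[R] (resMod R S).obj (ModuleCat.of S F) from φ)
      left_inv := fun _ => rfl
      right_inv := fun _ => rfl }
  let e₂ : (F ⊗[S] I) ≃ₗ[R] (resMod R S).obj
      (((tensorBif S S).obj (ModuleCat.of S F)).obj (ModuleCat.of S I)) :=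
    { toFun := fun x => x
      map_add' := fun _ _ => rfl
      map_smul' := fun r x => (algebraMap_smul S r x).symm
      invFun := fun x => x
      left_inv := fun _ => rfl
      right_inv := fun _ => rfl }
  let e₃ := TensorProduct.congr e₁ (LinearEquiv.refl S I)
  have hsq : ∀ x, e₂.toLinearMap ∘ₗ moduleTev R S G F I x =
      modTevFun (ModuleCat.of R G) (ModuleCat.of S F) (ModuleCat.of S I) (e₃ x) := fun x => by
    refine LinearMap.ext fun m => ?_
    induction x using TensorProduct.induction_on with
    | zero =>
      rw [map_zero, map_zero]
      exact (modTevFun_zero (ModuleCat.of R G) (ModuleCat.of S F) (ModuleCat.of S I) m).symm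
    | tmul φ y => rfl
    | add x y hx hy =>
      rw [map_add, map_add]
      exact (congr_arg₂ (· + ·) hx hy).trans 
        (modTevFun_add (ModuleCat.of R G) (ModuleCat.of S F) (ModuleCat.of S I) (e₃ x) (e₃ y) m).symm
  have h2 : Function.Injective fun φ : G →ₗ[R] (F ⊗[S] I) => e₂.toLinearMap ∘ₗ φ :=
    fun φ ψ hφ => LinearMap.ext fun x => e₂.injective congr($hφ x)
  constructor
  · intro x y hxy
    exact e₃.injective (h.1 ((hsq x).symm.trans ((congrArg (e₂.toLinearMap ∘ₗ ·) hxy).trans (hsq y))))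
  · intro φ
    obtain ⟨x, hx⟩ := h.2 (e₂.toLinearMap ∘ₗ φ : G →ₗ[R] _)
    obtain ⟨x, rfl⟩ := e₃.surjective x
    exact ⟨x, h2 ((hsq x).trans hx)⟩

/-- Two finite free steps `G → F₀ → F₁` of a coresolution suffice: the cosyzygies are orthogonal to
`F` and to `F ⊗ I`, so both sides are cokernels of the corresponding maps on the free modules, where
evaluation is bijective. -/
theorem bijective_moduleTev [HasDerivedCategory.{w} (ModuleCat.{u} R)]
    (hφ : HomFiniteFlatDim R S) [IsNoetherianRing R] (G F I : Type u) [AddCommGroup G] [Module R G]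
    [AddCommGroup F] [Module R F] [Module S F] [IsScalarTower R S F] [AddCommGroup I] [Module S I]
    [Module.Finite R G] (hG : GorensteinProjective (ModuleCat.of R G)) [Module.Flat S F]
    [hI : Module.Injective S I] : Function.Bijective (moduleTev R S G F I) := by
  have hG' : IsFiniteProjCoresolved (ModuleCat.of R G) := ⟨inferInstance, hG.isProjCycle.coresolved⟩
  obtain ⟨n, hn⟩ := exists_hasInjectiveDimensionLT hφ
  obtain ⟨m, hm⟩ := exists_hasInjectiveDimensionLT_of_flat hφ
  obtain ⟨k, G₁, f, g, h, hG₁⟩ := hG'.exists_isSES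
  obtain ⟨k', G₂, f', g', h', hG₂⟩ := hG₁.exists_isSES
  have := hm (ModuleCat.of S F) inferInstance
  have := hn (ModuleCat.of S I) ((Module.injective_iff_injective_object S I).1 hI)
  have : Module.Flat S (ModuleCat.of S F) := inferInstance
  have horth : ∀ X, IsFiniteProjCoresolved X → Orth X ((resMod R S).obj
      (((tensorBif S S).obj (ModuleCat.of S F)).obj (ModuleCat.of S I))) := fun X hX =>
    orth_tensorBif (Φ := IsFiniteProjCoresolved) (fun X hX => ⟨hX.1, hX.syzygy⟩) _ _
      (fun X hX => hX.orth_of_injectiveDimension n _) hX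
  exact bijective_moduleTev_of_modTev G F I (bijective_modTev_of_isSES h h' _ _
    (hG₁.orth_of_flatDimension m _) (hG₂.orth_of_flatDimension m _) (horth _ hG₁) (horth _ hG₂))

end modules
end
end TensorEval

theorem theorem3p2 {R S : Type u} [CommRing R] [CommRing S] [Algebra R S]
    [HasDerivedCategory.{w₁} (ModuleCat.{u} R)] [HasDerivedCategory.{w₂} (ModuleCat.{u} S)]
    (hφ : HomFiniteFlatDim R S) :
    (∀ (U V : CochainComplex (ModuleCat.{u} S) ℤ) (W : CochainComplex (ModuleCat.{u} R) ℤ),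
      ((FiniteInjDim U ∧ FiniteHomology U ∧ FiniteInjDim V ∧ FiniteGorensteinFlatDim W ∧
          IsNoetherianRing S) ∨
        (FiniteInjDim U ∧ FiniteInjDim V ∧ FiniteGorensteinFlatDim W ∧ FiniteHomology W ∧
          IsNoetherianRing R)) →
      ∀ (p : KProjRes U) (q : KProjRes W), IsIso (derivedTev p V q)) ∧
    (∀ (X : CochainComplex (ModuleCat.{u} R) ℤ) (Y Z : CochainComplex (ModuleCat.{u} S) ℤ),
      ((FiniteGorensteinProjDim X ∧ FiniteHomology X ∧ FiniteFlatDim Y ∧ FiniteInjDim Z ∧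
          IsNoetherianRing R) ∨
        (FiniteGorensteinProjDim X ∧ FiniteFlatDim Y ∧ FiniteInjDim Z ∧ FiniteHomology Z ∧
          IsNoetherianRing S ∧
          ∀ K : CochainComplex (ModuleCat.{u} S) ℤ,
            FiniteFlatDim K → FiniteProjDim ((resCx R S).obj K)) ∨
        (FiniteGorensteinProjDim X ∧ FiniteProjDim Y ∧ FiniteInjDim Z ∧ FiniteHomology Z ∧
          IsNoetherianRing S ∧
          ∀ K : CochainComplex (ModuleCat.{u} S) ℤ,
            FiniteProjDim K → FiniteProjDim ((resCx R S).obj K))) →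
      ∀ (p : KProjRes X) (q : KProjRes Z), IsIso (derivedTev p Y q)) ∧
    (IsNoetherianRing R →
      ∀ (G F I : Type u) [AddCommGroup G] [Module R G] [AddCommGroup F] [Module R F] [Module S F]
        [IsScalarTower R S F] [AddCommGroup I] [Module S I],
        Module.Finite R G → GorensteinProjective (ModuleCat.of R G) → Module.Flat S F →
        Module.Injective S I → Function.Bijective (moduleTev R S G F I)) := by
  refine ⟨fun U V W h p q => ?_, fun X Y Z h p q => ?_, fun hR G F I _ _ _ _ _ _ _ _ _ hG hF hI => ?_⟩
  · rcases h with ⟨hU, hU', hV, hW, _⟩ | ⟨hU, hV, hW, hW', _⟩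
    · exact isIso_derivedTev_of_finiteInjDim_left hφ hU hU' hV hW p q
    · exact isIso_derivedTev_of_finiteGorensteinFlatDim hφ hU hV hW hW' p q
  · rcases h with ⟨hX, hX', hY, hZ, _⟩ | ⟨hX, hY, hZ, hZ', _, hpd⟩ | ⟨hX, hY, hZ, hZ', _, hpd⟩
    · exact isIso_derivedTev_of_finiteGorensteinProjDim hφ hX hX' hY hZ p q
    -- Case (d) uses the class of flat modules and case (d') that of projective modules; both are
    -- stable under tensoring with projectives.
    · exact isIso_derivedTev_of_class hφ (fun F hF => hF)
        (exists_hasProjectiveDimensionLT_of_finiteProjDim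
          (fun M hM => by
            have := ModuleCat.isZero_iff_subsingleton.1 hM
            infer_instance)
          (fun e _ => Module.Flat.of_linearEquiv e.symm.toLinearEquiv) hpd)
        (fun F P hF hP => by
          have := (IsProjective.iff_projective (R := S) P).2 hP
          exact flat_tensorBif F P) hX hY hZ hZ' p q
    · exact isIso_derivedTev_of_class hφ
        (fun F hF => by
          have := (IsProjective.iff_projective (R := S) F).2 hF
          infer_instance)
        (exists_hasProjectiveDimensionLT_of_finiteProjDim
          (fun M hM => hM.projective) (fun e hM => Projective.of_iso e hM) hpd)
        (fun F P hF hP => projective_tensorBif F P) hX hY hZ hZ' p q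
  · exact bijective_moduleTev hφ G F I hG
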